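/- **Setting.** Work in four-dimensional Minkowski space, $\eta=\mathrm{diag}(-1,1,1,1)$, $\varepsilon_{0123}=1$. Let $U\subseteq\mathbb R^{n_s}$ be open and non-empty (the range of the scalars $\phi^i$), and let $g_{ij}$, $\mathcal I_{IJ}$, $\mathcal R_{IJ}$ $(1\le I,J\le n_v)$ be smooth functions on $U$ with $\mathcal I(\phi)$ symmetric positive definite and $\mathcal R$ symmetric. Let $\Theta_I{}^\alpha,\Theta^{I\alpha}$ $(1\le\alpha\le \dim G)$ be real constants satisfying the locality constraint $\Theta^{I[\alpha}\Theta_I{}^{\beta]}=0$ (sum over $I$). Put $\mathcal L_S=-\tfrac12 g_{ij}(\phi)\partial_\mu\phi^i\partial^\mu\phi^j$. *The Lagrangian $\mathcal L^\Theta$* has as fields the scalars, vectors $A^I_\mu$, $\tilde A_{I\mu}$ with abelian curvatures $F^I,\tilde F_I$, and two-forms $B_{\alpha\mu\nu}$. With $H^I_{\mu\nu}=F^I_{\mu\nu}+\tfrac12\Theta^{I\alpha}B_{\alpha\mu\nu}$, $$\mathcal L^\Theta=\mathcal L_S-\tfrac14\mathcal I_{IJ}H^I_{\mu\nu}H^{J\mu\nu}+\tfrac18\mathcal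 R_{IJ}\varepsilon^{\mu\nu\rho\sigma}H^I_{\mu\nu}H^J_{\rho\sigma}-\tfrac18\varepsilon^{\mu\nu\rho\sigma}\Theta^{I\alpha}B_{\alpha\mu\nu}\Big(\tilde F_{I\rho\sigma}-\tfrac14\Theta_I{}^\beta B_{\beta\rho\sigma}\Big).$$ *The frame $E(\Theta)$.* Let $r$ be the rank of $(\Theta^{I\alpha})$. Choose invertible real matrices $Y,Z$ such that $Y\Theta^{\rm mag}Z=\begin{pmatrix}\theta&0\\0&0\end{pmatrix}$ with $\theta$ an invertible $r\times r$ matrix, where $\Theta^{\rm mag}=(\Theta^{I\alpha})$; split $I=(\hat I,\hat U)$ and $\alpha=(i,m)$ accordingly, and let $\tilde\theta_{\hat I}{}^i$ be the upper left $r\times r$ block of $Y^{-T}(\Theta_I{}^\alpha)Z$. Let $E(\Theta)=E_1E_2$, where $E_1=\mathrm{diag}(Y^{-1},Y^{T})$ and $E_2$ expresses $(A',\tilde A')$ through the electric potentials $q$ and magnetic potentials $p$ of the new frame by $$A'^{\hat I}=-p^{\hat I},\quad A'^{\hat U}=q^{\hat U},\quad \tilde A'_{\hat I}=q_{\hat I}+(\theta^{-1})_{i\hat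 I}\tilde\theta_{\hat J}{}^i\,p^{\hat J},\quad \tilde A'_{\hat U}=p_{\hat U}.$$ For symmetric $\mathcal I,\mathcal R$ with $\mathcal I$ invertible, put $\mathcal M(\mathcal I,\mathcal R)=\begin{pmatrix}\mathcal I+\mathcal R\mathcal I^{-1}\mathcal R&-\mathcal R\mathcal I^{-1}\\-\mathcal I^{-1}\mathcal R&\mathcal I^{-1}\end{pmatrix}$. The *second-order Lagrangian in the frame $E(\Theta)$*, for $n_v$ vectors $A'^I_\mu$, is $$\mathcal L'=\mathcal L_S-\tfrac14\mathcal I'_{IJ}F'^I_{\mu\nu}F'^{J\mu\nu}+\tfrac18\mathcal R'_{IJ}\varepsilon^{\mu\nu\rho\sigma}F'^I_{\mu\nu}F'^J_{\rho\sigma},\qquad \mathcal M(\mathcal I',\mathcal R')=E(\Theta)^T\mathcal M(\mathcal I,\mathcal R)E(\Theta).$$ *BRST cohomology.* Let $z^a$ be the components of the vectors and two-forms, and let $\delta z^a=R^a{}_\alpha(\partial)\epsilon^\alpha$, $\delta\phi^i=0$, with constant-coefficient differential operators $R^a{}_\alpha$, be gauge transformations of a Lagrangian $\mathcal L$. Introduce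 ghosts $C^\alpha$ (ghost number $1$) and antifields $\phi^*_i,z^*_a$ (ghost number $-1$), $C^*_\alpha$ (ghost number $-2$); the Grassmann parity is the ghost number modulo 2. Local functions are polynomials in the derivatives of all these variables, and in the undifferentiated variables other than the scalars, with coefficients smooth in $(x,\phi)\in\mathbb R^4\times U$. The BRST differential $s$ is the graded derivation commuting with the total derivatives $\partial_\mu$ with $s x^\mu=s\phi^i=sC^\alpha=0$ and $$sz^a=R^a{}_\alpha(\partial)C^\alpha,\quad s\phi^*_i=\frac{\delta\mathcal L}{\delta\phi^i},\quad sz^*_a=\frac{\delta\mathcal L}{\delta z^a},\quad sC^*_\alpha=R^a{}_\alpha(-\partial)z^*_a .$$ For $g\in\mathbb Z$, $H^g(s|d)$ is the space of local functions $a$ of ghost number $g$ with $sa+\partial_\mu m^\mu=0$ for some local functions $m^\mu$ of ghost number $g+1$, modulo those of the form $sb+\partial_\mu n^\mu$ with $b$, $n^\mu$ local functions of ghost number $g-1$, $g$. For $\mathcal L'$ take the gauge transformations $\delta A'^I_\mu=\partial_\mu\lambda^I$. For $\mathcal L^\Theta$ take any irreducible generating set: its elements are gauge symmetries, no nonzero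 operators $c^\alpha$ satisfy $R^a{}_\alpha c^\alpha=0$, and every gauge symmetry $\delta z^a=T^a(\partial)\epsilon$, $\delta\phi^i=0$ with constant-coefficient $T^a$ is of the form $T^a=R^a{}_\alpha c^\alpha$ with constant-coefficient operators $c^\alpha$. **Theorem.** Matrices $Y,Z$ as above and an irreducible generating set of $\mathcal L^\Theta$ exist. For every choice of $Y,Z$ the matrix $E(\Theta)$ is symplectic, and there are smooth symmetric $\mathcal I'$, $\mathcal R'$ on $U$, with $\mathcal I'$ positive definite, such that $\mathcal M(\mathcal I',\mathcal R')=E(\Theta)^T\mathcal M(\mathcal I,\mathcal R)E(\Theta)$. For every irreducible generating set of $\mathcal L^\Theta$, the BRST differentials $s$ of $\mathcal L^\Theta$ and $s'$ of $\mathcal L'$ satisfy $s^2=0$, $s'^2=0$, and $$H^g(s|d)\;\cong\;H^g(s'|d)\qquad\text{for all } g\in\mathbb Z,$$ in particular for $g=0$ (consistent deformations) and $g=1$ (candidate anomalies). The isomorphisms are induced by a single local map: a homomorphism of the algebras of local functions that fixes all functions of $(x,\phi)$, preserves the ghost number, commutes with the $\partial_\mu$, intertwines $s$ and $s'$, and sends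 $(A^I_\mu,\tilde A_{I\mu})$ to $E(\Theta)(A'_\mu,0)$, where $A'_\mu$ stands in the place of the electric potentials $q$ of the new frame. -/

import Mathlib

open scoped ContDiff Matrix
open TopologicalSpace (Opens)

namespace LocalBRST

noncomputable section

/-! ### Smooth functions on an open subset of a normed space -/

section Smooth

variable {E : Type*}

section Extension

variable [TopologicalSpace E]

/-- The extension by zero of a function on `Ω`; only its restriction to the open set `Ω` is used. -/
def extendZero (Ω : Opens E) (f : Ω → ℝ) : E → ℝ := Function.extend Subtype.val f 0

theorem extendZero_apply (Ω : Opens E) (f : Ω → ℝ) (x : Ω) : extendZero Ω f x = f x :=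
  Subtype.val_injective.extend_apply _ _ _

theorem extendZero_eqOn {Ω : Opens E} {f : Ω → ℝ} {h : E → ℝ} (hf : ∀ x : Ω, f x = h x) :
    Set.EqOn (extendZero Ω f) h Ω := by
  intro x hx
  rw [extendZero_apply Ω f ⟨x, hx⟩, hf ⟨x, hx⟩]

end Extension

variable [NormedAddCommGroup E] [NormedSpace ℝ E]

/-- The algebra `C^∞(Ω)` of real-valued smooth functions on the open set `Ω`. -/
def SmoothFn (Ω : Opens E) : Subalgebra ℝ (Ω → ℝ) where
  carrier := {f | ContDiffOn ℝ ∞ (extendZero Ω f) Ω}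
  mul_mem' {f g} hf hg := by
    refine (ContDiffOn.mul hf hg).congr (extendZero_eqOn fun x => ?_)
    simp [extendZero_apply]
  add_mem' {f g} hf hg := by
    refine (ContDiffOn.add hf hg).congr (extendZero_eqOn fun x => ?_)
    simp [extendZero_apply]
  algebraMap_mem' r :=
    (contDiffOn_const (c := r)).congr (extendZero_eqOn fun _ => rfl)

theorem SmoothFn.differentiableAt {Ω : Opens E} (f : SmoothFn Ω) (x : Ω) :
    DifferentiableAt ℝ (extendZero Ω f.1) x :=
  (f.2.contDiffAt (Ω.isOpen.mem_nhds x.2)).differentiableAt (by simp)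

/-- A function that is the restriction of a function smooth on `Ω`. -/
def SmoothFn.ofContDiffOn (Ω : Opens E) (h : E → ℝ) (hh : ContDiffOn ℝ ∞ h Ω) : SmoothFn Ω :=
  ⟨fun x => h x, hh.congr (extendZero_eqOn fun _ => rfl)⟩

theorem fderiv_extendZero {Ω : Opens E} {f : Ω → ℝ} {h : E → ℝ} (hf : ∀ x : Ω, f x = h x)
    (x : Ω) : fderiv ℝ (extendZero Ω f) x = fderiv ℝ h x :=
  Filter.EventuallyEq.fderiv_eq
    ((extendZero_eqOn hf).eventuallyEq_of_mem (Ω.isOpen.mem_nhds x.2))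

/-- The derivative in the constant direction `w`, as a derivation of `C^∞(Ω)`. -/
def SmoothFn.dir (Ω : Opens E) (w : E) : Derivation ℝ (SmoothFn Ω) (SmoothFn Ω) :=
  Derivation.mk'
    { toFun := fun f => SmoothFn.ofContDiffOn Ω (fun x => fderiv ℝ (extendZero Ω f.1) x w)
        ((ContDiffOn.fderiv_of_isOpen f.2 Ω.isOpen (by simp)).clm_apply contDiffOn_const)
      map_add' := fun f g => by
        apply Subtype.ext
        funext x
        change fderiv ℝ (extendZero Ω (f + g).1) x w
          = fderiv ℝ (extendZero Ω f.1) x w + fderiv ℝ (extendZero Ω g.1) x w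
        rw [fderiv_extendZero (h := extendZero Ω f.1 + extendZero Ω g.1)
          (fun y => by simp [extendZero_apply]),
          fderiv_add (SmoothFn.differentiableAt f x) (SmoothFn.differentiableAt g x)]
        rfl
      map_smul' := fun r f => by
        apply Subtype.ext
        funext x
        change fderiv ℝ (extendZero Ω (r • f).1) x w = r * fderiv ℝ (extendZero Ω f.1) x w
        rw [fderiv_extendZero (h := r • extendZero Ω f.1)
          (fun y => by simp [extendZero_apply]),
          fderiv_const_smul (SmoothFn.differentiableAt f x)]
        rfl }
    (fun f g => by
      apply Subtype.ext
      funext x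
      change fderiv ℝ (extendZero Ω (f * g).1) x w
        = f.1 x * fderiv ℝ (extendZero Ω g.1) x w + g.1 x * fderiv ℝ (extendZero Ω f.1) x w
      rw [fderiv_extendZero (h := extendZero Ω f.1 * extendZero Ω g.1)
        (fun y => by simp [extendZero_apply]),
        fderiv_mul (SmoothFn.differentiableAt f x) (SmoothFn.differentiableAt g x)]
      simp [extendZero_apply])

theorem SmoothFn.dir_apply (Ω : Opens E) (w : E) (f : SmoothFn Ω) (x : Ω) :
    (SmoothFn.dir Ω w f).1 x = fderiv ℝ (extendZero Ω f.1) x w := rfl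

end Smooth

/-! ### Coefficients: smooth functions of the spacetime point and of the scalar fields -/

section Coefficients

variable {σ : Type} [Fintype σ]

/-- The points `(x, φ)` with `x` in spacetime `ℝ⁴` and `φ` in the scalar domain `U`. -/
def baseOpen (U : Opens (σ → ℝ)) : Opens ((Fin 4 → ℝ) × (σ → ℝ)) :=
  ⟨{p | p.2 ∈ U}, U.isOpen.preimage continuous_snd⟩

/-- `C^∞(ℝ⁴ × U)`: smooth functions of the undifferentiated scalars and of the coordinates. -/
abbrev Coeff (U : Opens (σ → ℝ)) : Type := SmoothFn (baseOpen U)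

/-- A smooth function of the scalars, regarded as a function of `(x, φ)`. -/
def Coeff.ofScalar {U : Opens (σ → ℝ)} (f : SmoothFn U) : Coeff U :=
  SmoothFn.ofContDiffOn _ (fun p => extendZero U f.1 p.2)
    (ContDiffOn.comp f.2 contDiff_snd.contDiffOn fun _ hp => hp)

/-- The scalar field `φ^i` as a coordinate function. -/
def Coeff.coord (U : Opens (σ → ℝ)) (i : σ) : Coeff U :=
  SmoothFn.ofContDiffOn _ (fun p => p.2 i)
    ((contDiff_apply ℝ ℝ i).comp contDiff_snd).contDiffOn

/-- `∂f/∂x^μ`. -/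
def Coeff.dx (U : Opens (σ → ℝ)) (μ : Fin 4) : Derivation ℝ (Coeff U) (Coeff U) :=
  SmoothFn.dir _ (Pi.single μ 1, 0)

open Classical in
/-- `∂f/∂φ^i`. -/
def Coeff.dphi (U : Opens (σ → ℝ)) (i : σ) : Derivation ℝ (Coeff U) (Coeff U) :=
  SmoothFn.dir _ (0, Pi.single i 1)

theorem Coeff.dir_coord (U : Opens (σ → ℝ)) (i : σ) (w : (Fin 4 → ℝ) × (σ → ℝ)) :
    SmoothFn.dir (baseOpen U) w (Coeff.coord U i) = algebraMap ℝ _ (w.2 i) := by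
  apply Subtype.ext
  funext x
  have e := fderiv_extendZero (Ω := baseOpen U) (f := (Coeff.coord U i).1)
    (h := fun p : (Fin 4 → ℝ) × (σ → ℝ) => p.2 i) (fun _ => rfl) x
  rw [SmoothFn.dir_apply, e]
  have h : HasFDerivAt (fun p : (Fin 4 → ℝ) × (σ → ℝ) => p.2 i)
      ((ContinuousLinearMap.proj (R := ℝ) (φ := fun _ : σ => ℝ) i).comp
        (ContinuousLinearMap.snd ℝ (Fin 4 → ℝ) (σ → ℝ))) x.1 :=
    ((ContinuousLinearMap.proj (R := ℝ) (φ := fun _ : σ => ℝ) i).comp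
      (ContinuousLinearMap.snd ℝ (Fin 4 → ℝ) (σ → ℝ))).hasFDerivAt
  rw [h.fderiv]
  rfl

theorem Coeff.dx_coord (U : Opens (σ → ℝ)) (i : σ) (μ : Fin 4) :
    Coeff.dx U μ (Coeff.coord U i) = 0 := by
  rw [Coeff.dx, Coeff.dir_coord]
  simp

open Classical in
theorem Coeff.dphi_coord (U : Opens (σ → ℝ)) (i j : σ) :
    Coeff.dphi U j (Coeff.coord U i) = if i = j then 1 else 0 := by
  rw [Coeff.dphi, Coeff.dir_coord]
  by_cases h : i = j
  · subst h
    simp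
  · simp [h]

end Coefficients

/-! ### Local functions of fields, ghosts and antifields -/

/-- Generators: scalars `φ^i` (`i : σ`), the components `z^a` (`a : F`) of the other bosonic
fields, ghosts `C^α` (`α : P`), and the conjugate antifields. -/
inductive Gen (σ F P : Type) : Type
  | scalar (i : σ)
  | field (a : F)
  | ghost (α : P)
  | scalarAnti (i : σ)
  | fieldAnti (a : F)
  | ghostAnti (α : P)

/-- The ghost number; the Grassmann parity is its reduction modulo two. -/
def Gen.gh {σ F P : Type} : Gen σ F P → ℤ
  | .scalar _ => 0
  | .field _ => 0
  | .ghost _ => 1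
  | .scalarAnti _ => -1
  | .fieldAnti _ => -1
  | .ghostAnti _ => -2

/-- The jet variable `(z, ν)` stands for the derivative `∂^ν z` of the generator `z`. -/
abbrev Jet (σ F P : Type) : Type := Gen σ F P × (Fin 4 →₀ ℕ)

section LocalFunctions

variable {σ : Type} [Fintype σ] (U : Opens (σ → ℝ)) (F P : Type)

/-- Relations of the algebra of local functions: functions in `C^∞(ℝ⁴ × U)` are added and
multiplied as such and commute with everything, jet variables commute up to the sign given by
their parities, and the undifferentiated scalar `φ^i` is the `i`-th coordinate function. -/
inductive Rel : FreeAlgebra ℝ (Coeff U ⊕ Jet σ F P) → FreeAlgebra ℝ (Coeff U ⊕ Jet σ F P) → Prop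
  | coeff_add (f g : Coeff U) :
      Rel (FreeAlgebra.ι ℝ (.inl (f + g)))
        (FreeAlgebra.ι ℝ (.inl f) + FreeAlgebra.ι ℝ (.inl g))
  | coeff_mul (f g : Coeff U) :
      Rel (FreeAlgebra.ι ℝ (.inl (f * g)))
        (FreeAlgebra.ι ℝ (.inl f) * FreeAlgebra.ι ℝ (.inl g))
  | coeff_const (r : ℝ) :
      Rel (FreeAlgebra.ι ℝ (.inl (algebraMap ℝ (Coeff U) r))) (algebraMap ℝ _ r)
  | coeff_comm (f : Coeff U) (v : Jet σ F P) :
      Rel (FreeAlgebra.ι ℝ (.inl f) * FreeAlgebra.ι ℝ (.inr v))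
        (FreeAlgebra.ι ℝ (.inr v) * FreeAlgebra.ι ℝ (.inl f))
  | jet_comm (v w : Jet σ F P) :
      Rel (FreeAlgebra.ι ℝ (.inr v) * FreeAlgebra.ι ℝ (.inr w))
        ((-1 : ℝ) ^ (v.1.gh * w.1.gh) • (FreeAlgebra.ι ℝ (.inr w) * FreeAlgebra.ι ℝ (.inr v)))
  | scalar_zero (i : σ) :
      Rel (FreeAlgebra.ι ℝ (.inr (.scalar i, 0))) (FreeAlgebra.ι ℝ (.inl (Coeff.coord U i)))

/-- The graded-commutative algebra of local functions: polynomials in all jet variables (the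
derivatives of the scalars, and all the other fields, ghosts and antifields with their
derivatives) whose coefficients are smooth functions of `x` and of the undifferentiated scalars. -/
def LocalFn : Type := RingQuot (Rel U F P)

instance : Ring (LocalFn U F P) := inferInstanceAs (Ring (RingQuot (Rel U F P)))

instance : Algebra ℝ (LocalFn U F P) := inferInstanceAs (Algebra ℝ (RingQuot (Rel U F P)))

variable {U F P}

/-- The quotient map from the free algebra. -/
def LocalFn.mk : FreeAlgebra ℝ (Coeff U ⊕ Jet σ F P) →ₐ[ℝ] LocalFn U F P :=
  RingQuot.mkAlgHom ℝ (Rel U F P)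

theorem LocalFn.mk_rel {x y} (h : Rel U F P x y) : LocalFn.mk x = LocalFn.mk y :=
  RingQuot.mkAlgHom_rel ℝ h

/-- A smooth function of `(x, φ)` as a local function. -/
def coeff : Coeff U →ₐ[ℝ] LocalFn U F P :=
  AlgHom.ofLinearMap
    { toFun := fun f => LocalFn.mk (FreeAlgebra.ι ℝ (.inl f))
      map_add' := fun f g => by rw [LocalFn.mk_rel (Rel.coeff_add f g), map_add]
      map_smul' := fun r f => by
        rw [Algebra.smul_def, LocalFn.mk_rel (Rel.coeff_mul _ f), map_mul,
          LocalFn.mk_rel (Rel.coeff_const r), AlgHom.commutes, ← Algebra.smul_def]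
        rfl }
    (by
      have := LocalFn.mk_rel (Rel.coeff_const (U := U) (F := F) (P := P) 1)
      simpa using this)
    (fun f g => by
      change LocalFn.mk _ = LocalFn.mk _ * LocalFn.mk _
      rw [LocalFn.mk_rel (Rel.coeff_mul f g), map_mul])

/-- The jet variable `∂^ν z` as a local function. -/
def jet (z : Gen σ F P) (ν : Fin 4 →₀ ℕ) : LocalFn U F P :=
  LocalFn.mk (FreeAlgebra.ι ℝ (.inr (z, ν)))

theorem coeff_comm_jet (f : Coeff U) (v : Jet σ F P) :
    (coeff f * jet v.1 v.2 : LocalFn U F P) = jet v.1 v.2 * coeff f := by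
  have := LocalFn.mk_rel (Rel.coeff_comm (F := F) (P := P) f v)
  rwa [map_mul, map_mul] at this

theorem jet_comm (v w : Jet σ F P) :
    (jet v.1 v.2 * jet w.1 w.2 : LocalFn U F P)
      = (-1 : ℝ) ^ (v.1.gh * w.1.gh) • (jet w.1 w.2 * jet v.1 v.2) := by
  have := LocalFn.mk_rel (Rel.jet_comm (U := U) (F := F) (P := P) v w)
  rwa [map_mul, map_smul, map_mul] at this

theorem jet_scalar_zero (i : σ) :
    (jet (.scalar i) 0 : LocalFn U F P) = coeff (Coeff.coord U i) :=
  LocalFn.mk_rel (Rel.scalar_zero i)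

variable (U F P) in
/-- Local functions of ghost number `g`: the span of the products `f(x, φ) ∂^{ν₁}z₁ ⋯ ∂^{νₖ}zₖ`
whose ghost numbers add up to `g`. -/
def ghPart (g : ℤ) : Submodule ℝ (LocalFn U F P) :=
  Submodule.span ℝ {a | ∃ (f : Coeff U) (l : List (Jet σ F P)),
    (l.map fun v => v.1.gh).sum = g ∧ a = coeff f * (l.map fun v => jet v.1 v.2).prod}

theorem coeff_comm_prod (f : Coeff U) (l : List (Jet σ F P)) :
    (coeff f * (l.map fun v => jet v.1 v.2).prod : LocalFn U F P)
      = (l.map fun v => jet v.1 v.2).prod * coeff f := by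
  induction l with
  | nil => simp
  | cons v l ih =>
    rw [List.map_cons, List.prod_cons, ← mul_assoc, coeff_comm_jet, mul_assoc, ih, mul_assoc]

theorem mul_mem_ghPart {g h : ℤ} {a b : LocalFn U F P} (ha : a ∈ ghPart U F P g)
    (hb : b ∈ ghPart U F P h) : a * b ∈ ghPart U F P (g + h) := by
  induction ha using Submodule.span_induction with
  | zero => simp
  | add x y _ _ hx hy => rw [add_mul]; exact Submodule.add_mem _ hx hy
  | smul r x _ hx => rw [smul_mul_assoc]; exact Submodule.smul_mem _ _ hx
  | mem x hx =>
    obtain ⟨f, l, hl, rfl⟩ := hx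
    induction hb using Submodule.span_induction with
    | zero => simp
    | add x y _ _ hx hy => rw [mul_add]; exact Submodule.add_mem _ hx hy
    | smul r x _ hx => rw [mul_smul_comm]; exact Submodule.smul_mem _ _ hx
    | mem y hy =>
      obtain ⟨f', l', hl', rfl⟩ := hy
      refine Submodule.subset_span ⟨f * f', l ++ l', by simp [hl, hl'], ?_⟩
      rw [List.map_append, List.prod_append, map_mul, mul_assoc, mul_assoc, ← mul_assoc _ (coeff f'),
        ← coeff_comm_prod, mul_assoc]

theorem coeff_mem_ghPart (f : Coeff U) : (coeff f : LocalFn U F P) ∈ ghPart U F P 0 :=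
  Submodule.subset_span ⟨f, [], by simp, by simp⟩

theorem jet_mem_ghPart (z : Gen σ F P) (ν : Fin 4 →₀ ℕ) :
    (jet z ν : LocalFn U F P) ∈ ghPart U F P z.gh :=
  Submodule.subset_span ⟨1, [(z, ν)], by simp, by simp⟩

theorem one_mem_ghPart : (1 : LocalFn U F P) ∈ ghPart U F P 0 := by
  simpa using coeff_mem_ghPart (F := F) (P := P) (1 : Coeff U)

theorem coeff_comm_of_mem {g : ℤ} (f : Coeff U) {a : LocalFn U F P} (ha : a ∈ ghPart U F P g) :
    coeff f * a = a * coeff f := by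
  induction ha using Submodule.span_induction with
  | zero => simp
  | add x y _ _ hx hy => rw [mul_add, add_mul, hx, hy]
  | smul r x _ hx => rw [mul_smul_comm, smul_mul_assoc, hx]
  | mem x hx =>
    obtain ⟨f', l, -, rfl⟩ := hx
    rw [← mul_assoc, ← map_mul, mul_comm f f', map_mul, mul_assoc, coeff_comm_prod, mul_assoc]

theorem neg_one_zpow_add (m n : ℤ) : (-1 : ℝ) ^ (m + n) = (-1) ^ m * (-1) ^ n :=
  zpow_add₀ (by norm_num) m n

theorem neg_one_zpow_mul_self (m : ℤ) : (-1 : ℝ) ^ m * (-1) ^ m = 1 := by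
  rw [← mul_zpow]; simp

theorem jet_comm_of_mem {g : ℤ} (v : Jet σ F P) {a : LocalFn U F P} (ha : a ∈ ghPart U F P g) :
    jet v.1 v.2 * a = (-1 : ℝ) ^ (v.1.gh * g) • (a * jet v.1 v.2) := by
  induction ha using Submodule.span_induction with
  | zero => simp
  | add x y _ _ hx hy => rw [mul_add, add_mul, hx, hy, smul_add]
  | smul r x _ hx => rw [mul_smul_comm, smul_mul_assoc, hx, smul_comm]
  | mem x hx =>
    obtain ⟨f, l, hl, rfl⟩ := hx
    rw [← mul_assoc, ← coeff_comm_jet, mul_assoc, mul_assoc, ← mul_smul_comm]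
    congr 1
    clear f
    induction l generalizing g with
    | nil => subst hl; simp
    | cons w l ih =>
      simp only [List.map_cons, List.sum_cons, List.prod_cons] at hl ⊢
      subst hl
      rw [← mul_assoc, jet_comm, smul_mul_assoc, mul_assoc, ih rfl, mul_smul_comm, smul_smul,
        mul_assoc, mul_add, neg_one_zpow_add]

/-! ### Graded derivations -/

variable (U F P) in
/-- The values on generators of a graded derivation that raises the ghost number by `p`. -/
structure DerivData (p : ℤ) where
  onCoeff : Coeff U →ₗ[ℝ] LocalFn U F P
  onJet : Jet σ F P → LocalFn U F P
  leibniz : ∀ f g, onCoeff (f * g) = coeff f * onCoeff g + onCoeff f * coeff g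
  coeff_mem : ∀ f, onCoeff f ∈ ghPart U F P p
  jet_mem : ∀ v, onJet v ∈ ghPart U F P (v.1.gh + p)
  scalar_zero : ∀ i, onJet (.scalar i, 0) = onCoeff (Coeff.coord U i)

namespace DerivData

variable {p : ℤ} (D : DerivData U F P p)

/-- On generators, `a ↦ ((-1)^{p gh a} a, D a; 0, a)`. -/
def matGen : Coeff U ⊕ Jet σ F P → Matrix (Fin 2) (Fin 2) (LocalFn U F P)
  | .inl f => !![coeff f, D.onCoeff f; 0, coeff f]
  | .inr v => !![(-1 : ℝ) ^ (p * v.1.gh) • jet v.1 v.2, D.onJet v; 0, jet v.1 v.2]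

theorem onCoeff_one : D.onCoeff 1 = 0 := by
  have := D.leibniz 1 1
  simpa using this

theorem matGen_rel {x y} (h : Rel U F P x y) :
    FreeAlgebra.lift ℝ D.matGen x = FreeAlgebra.lift ℝ D.matGen y := by
  cases h with
  | coeff_add f g =>
    simp only [map_add, FreeAlgebra.lift_ι_apply, matGen]
    ext i j; fin_cases i <;> fin_cases j <;> simp
  | coeff_mul f g =>
    simp only [map_mul, FreeAlgebra.lift_ι_apply, matGen]
    ext i j; fin_cases i <;> fin_cases j <;> simp [D.leibniz]
  | coeff_const r =>
    simp only [FreeAlgebra.lift_ι_apply, matGen, AlgHom.commutes]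
    have h0 : D.onCoeff (algebraMap ℝ (Coeff U) r) = 0 := by
      rw [Algebra.algebraMap_eq_smul_one, map_smul, D.onCoeff_one, smul_zero]
    ext i j; fin_cases i <;> fin_cases j <;> simp [h0, Matrix.algebraMap_matrix_apply]
  | coeff_comm f v =>
    simp only [map_mul, FreeAlgebra.lift_ι_apply, matGen]
    have h1 := jet_comm_of_mem v (D.coeff_mem f)
    have h2 := coeff_comm_of_mem f (D.jet_mem v)
    have h3 := coeff_comm_jet f v
    ext i j; fin_cases i <;> fin_cases j
    · simp [h3]
    · simp [h2, h1, smul_smul, mul_comm p, neg_one_zpow_mul_self]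
      abel
    · simp
    · simp [h3]
  | jet_comm v w =>
    simp only [map_mul, map_smul, FreeAlgebra.lift_ι_apply, matGen]
    have h1 := jet_comm v w (U := U)
    have h2 := jet_comm_of_mem v (D.jet_mem w)
    have h3 := jet_comm_of_mem w (D.jet_mem v)
    ext i j; fin_cases i <;> fin_cases j
    · simp [h1, smul_smul]
      congr 1
      ring
    · simp [h2, h3, smul_smul, mul_add, neg_one_zpow_add]
      have e1 : (-1 : ℝ) ^ (p * v.1.gh) * ((-1) ^ (v.1.gh * w.1.gh) * (-1) ^ (v.1.gh * p))
          = (-1) ^ (v.1.gh * w.1.gh) := by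
        rw [mul_left_comm, mul_comm p, neg_one_zpow_mul_self, mul_one]
      have e2 : (-1 : ℝ) ^ (v.1.gh * w.1.gh) *
          ((-1 : ℝ) ^ (p * w.1.gh) * ((-1) ^ (w.1.gh * v.1.gh) * (-1) ^ (w.1.gh * p))) = 1 := by
        rw [mul_comm p, mul_comm w.1.gh v.1.gh, mul_left_comm ((-1 : ℝ) ^ (w.1.gh * p)),
          neg_one_zpow_mul_self, mul_one, neg_one_zpow_mul_self]
      rw [e1, e2, one_smul, add_comm]
    · simp
    · simp [h1]
  | scalar_zero i =>
    simp only [FreeAlgebra.lift_ι_apply, matGen]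
    ext k j; fin_cases k <;> fin_cases j <;> simp [D.scalar_zero, jet_scalar_zero, Gen.gh]

/-- The algebra map `a ↦ ((-1)^{p gh a} a, D a; 0, a)`. -/
def matHom : LocalFn U F P →ₐ[ℝ] Matrix (Fin 2) (Fin 2) (LocalFn U F P) :=
  RingQuot.liftAlgHom ℝ ⟨FreeAlgebra.lift ℝ D.matGen, fun _ _ h => D.matGen_rel h⟩

theorem matHom_mk (x : FreeAlgebra ℝ (Coeff U ⊕ Jet σ F P)) :
    D.matHom (LocalFn.mk x) = FreeAlgebra.lift ℝ D.matGen x :=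
  RingQuot.liftAlgHom_mkAlgHom_apply ℝ _ _ _

/-- The graded derivation with the given values on generators. -/
def toLinearMap : LocalFn U F P →ₗ[ℝ] LocalFn U F P where
  toFun a := D.matHom a 0 1
  map_add' a b := by rw [map_add]; rfl
  map_smul' r a := by rw [map_smul]; rfl

theorem toLinearMap_coeff (f : Coeff U) : D.toLinearMap (coeff f) = D.onCoeff f := by
  change D.matHom (LocalFn.mk _) 0 1 = _
  rw [matHom_mk, FreeAlgebra.lift_ι_apply]
  rfl

theorem toLinearMap_jet (v : Jet σ F P) : D.toLinearMap (jet v.1 v.2) = D.onJet v := by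
  change D.matHom (LocalFn.mk _) 0 1 = _
  rw [matHom_mk, FreeAlgebra.lift_ι_apply]
  rfl

theorem matHom_coeff (f : Coeff U) :
    D.matHom (coeff f) = !![coeff f, D.onCoeff f; 0, coeff f] := by
  change D.matHom (LocalFn.mk _) = _
  rw [matHom_mk, FreeAlgebra.lift_ι_apply]
  rfl

theorem matHom_jet (v : Jet σ F P) : D.matHom (jet v.1 v.2) =
    !![(-1 : ℝ) ^ (p * v.1.gh) • jet v.1 v.2, D.onJet v; 0, jet v.1 v.2] := by
  change D.matHom (LocalFn.mk _) = _
  rw [matHom_mk, FreeAlgebra.lift_ι_apply]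
  rfl

theorem matHom_prod (l : List (Jet σ F P)) :
    D.matHom (l.map fun v => jet v.1 v.2).prod 0 0
        = (-1 : ℝ) ^ (p * (l.map fun v => v.1.gh).sum) • (l.map fun v => jet v.1 v.2).prod ∧
      D.matHom (l.map fun v => jet v.1 v.2).prod 1 0 = 0 ∧
      D.matHom (l.map fun v => jet v.1 v.2).prod 1 1 = (l.map fun v => jet v.1 v.2).prod ∧
      D.matHom (l.map fun v => jet v.1 v.2).prod 0 1
        ∈ ghPart U F P ((l.map fun v => v.1.gh).sum + p) := by
  induction l with
  | nil => simp
  | cons v l ih =>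
    obtain ⟨h00, h10, h11, h01⟩ := ih
    simp only [List.map_cons, List.sum_cons, List.prod_cons, map_mul, matHom_jet, Matrix.mul_apply,
      Fin.sum_univ_two]
    refine ⟨?_, ?_, ?_, ?_⟩
    · rw [h00, h10]
      simp [smul_smul, mul_add, neg_one_zpow_add, mul_comm]
    · rw [h10]; simp
    · rw [h11]; simp
    · rw [h11]
      refine Submodule.add_mem _ ?_ ?_
      · have := Submodule.smul_mem _ ((-1 : ℝ) ^ (p * v.1.gh))
          (mul_mem_ghPart (jet_mem_ghPart (U := U) v.1 v.2) h01)
        rw [add_assoc]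
        simpa using this
      · have h3 : (l.map fun v => jet v.1 v.2).prod ∈ ghPart U F P (l.map fun v => v.1.gh).sum :=
          Submodule.subset_span ⟨1, l, rfl, by simp⟩
        have := mul_mem_ghPart (D.jet_mem v) h3
        rw [add_right_comm]
        simpa using this

/-- A graded derivation that raises the ghost number by `p` does so on all local functions. -/
theorem toLinearMap_mem {g : ℤ} {a : LocalFn U F P} (ha : a ∈ ghPart U F P g) :
    D.toLinearMap a ∈ ghPart U F P (g + p) := by
  induction ha using Submodule.span_induction with
  | zero => simp
  | add x y _ _ hx hy => rw [map_add]; exact Submodule.add_mem _ hx hy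
  | smul r x _ hx => rw [map_smul]; exact Submodule.smul_mem _ _ hx
  | mem x hx =>
    obtain ⟨f, l, rfl, rfl⟩ := hx
    obtain ⟨-, -, h11, h01⟩ := D.matHom_prod l
    change D.matHom _ 0 1 ∈ _
    rw [map_mul, matHom_coeff, Matrix.mul_apply, Fin.sum_univ_two, h11]
    refine Submodule.add_mem _ ?_ ?_
    · simpa using mul_mem_ghPart (coeff_mem_ghPart f) h01
    · have h3 : (l.map fun v => jet v.1 v.2).prod ∈ ghPart U F P (l.map fun v => v.1.gh).sum :=
        Submodule.subset_span ⟨1, l, rfl, by simp⟩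
      have := mul_mem_ghPart (D.coeff_mem f) h3
      rw [add_comm p] at this
      simpa using this

/-- The graded Leibniz rule `D(ab) = (Da) b + (-1)^{p gh a} a (Db)`. -/
theorem toLinearMap_mul {g : ℤ} {a : LocalFn U F P} (ha : a ∈ ghPart U F P g)
    (b : LocalFn U F P) : D.toLinearMap (a * b)
      = D.toLinearMap a * b + (-1 : ℝ) ^ (p * g) • (a * D.toLinearMap b) := by
  have key : D.matHom b 1 1 = b := by
    let e : LocalFn U F P →ₗ[ℝ] LocalFn U F P :=
      { toFun := fun a => D.matHom a 1 1
        map_add' := fun a b => by rw [map_add]; rfl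
        map_smul' := fun r a => by rw [map_smul]; rfl }
    obtain ⟨x, rfl⟩ := RingQuot.mkAlgHom_surjective ℝ (Rel U F P) b
    change D.matHom (LocalFn.mk x) 1 1 = LocalFn.mk x
    rw [matHom_mk]
    suffices h : FreeAlgebra.lift ℝ D.matGen x 1 0 = 0 ∧
        FreeAlgebra.lift ℝ D.matGen x 1 1 = LocalFn.mk x from h.2
    induction x using FreeAlgebra.induction with
    | grade0 r => simp [Matrix.algebraMap_matrix_apply]
    | grade1 v => rw [FreeAlgebra.lift_ι_apply]; cases v <;> exact ⟨rfl, rfl⟩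
    | mul x y hx hy =>
      rw [map_mul, Matrix.mul_apply, Matrix.mul_apply, Fin.sum_univ_two, Fin.sum_univ_two, hx.1,
        hx.2, hy.1, hy.2, map_mul]
      simp
    | add x y hx hy =>
      rw [map_add, Matrix.add_apply, Matrix.add_apply, hx.1, hx.2, hy.1, hy.2, map_add]
      simp
  have h00 : D.matHom a 0 0 = (-1 : ℝ) ^ (p * g) • a := by
    induction ha using Submodule.span_induction with
    | zero => simp
    | add x y _ _ hx hy => rw [map_add, Matrix.add_apply, hx, hy, smul_add]
    | smul r x _ hx => rw [map_smul, Matrix.smul_apply, hx, smul_comm]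
    | mem x hx =>
      obtain ⟨f, l, rfl, rfl⟩ := hx
      obtain ⟨h00, h10, -, -⟩ := D.matHom_prod l
      rw [map_mul, Matrix.mul_apply, Fin.sum_univ_two, h00, h10, matHom_coeff]
      simp
  change D.matHom _ 0 1 = D.matHom a 0 1 * b + _ • (a * D.matHom b 0 1)
  rw [map_mul, Matrix.mul_apply, Fin.sum_univ_two, key, h00, smul_mul_assoc, add_comm]

end DerivData

/-! ### Total derivatives and Euler-Lagrange derivatives -/

/-- `∂_μ f = ∂f/∂x^μ + ∑ᵢ (∂f/∂φ^i) ∂_μφ^i` and `∂_μ (∂^ν z) = ∂^{ν+μ} z`. -/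
def totalData (μ : Fin 4) : DerivData U F P 0 where
  onCoeff :=
    { toFun := fun f => coeff (Coeff.dx U μ f)
        + ∑ i, coeff (Coeff.dphi U i f) * jet (.scalar i) (Finsupp.single μ 1)
      map_add' := fun f g => by
        simp only [map_add, add_mul, Finset.sum_add_distrib]; abel
      map_smul' := fun r f => by
        simp only [Derivation.map_smul, map_smul, smul_mul_assoc, smul_add, Finset.smul_sum,
          RingHom.id_apply] }
  onJet v := jet v.1 (v.2 + Finsupp.single μ 1)
  leibniz f g := by
    have h : ∀ i, (coeff g * jet (.scalar i) (Finsupp.single μ 1) : LocalFn U F P)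
        = jet (.scalar i) (Finsupp.single μ 1) * coeff g := fun i =>
      coeff_comm_jet g (.scalar i, Finsupp.single μ 1)
    simp only [LinearMap.coe_mk, AddHom.coe_mk, Derivation.leibniz, smul_eq_mul, map_add, map_mul,
      add_mul, mul_add, Finset.sum_add_distrib, Finset.mul_sum, Finset.sum_mul, mul_assoc, ← h]
    have c : ∀ f' g' : Coeff U, (coeff f' * coeff g' : LocalFn U F P) = coeff g' * coeff f' :=
      fun f' g' => by rw [← map_mul, mul_comm, map_mul]
    have e : ∀ i, (coeff (Coeff.dphi U i f) *
        (coeff g * jet (.scalar i) (Finsupp.single μ 1)) : LocalFn U F P)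
        = coeff g * (coeff (Coeff.dphi U i f) * jet (.scalar i) (Finsupp.single μ 1)) :=
      fun i => by rw [← mul_assoc, c, mul_assoc]
    simp only [e, c (Coeff.dx U μ f) g]
    abel
  coeff_mem f := Submodule.add_mem _ (coeff_mem_ghPart _) (Submodule.sum_mem _ fun i _ => by
    have := mul_mem_ghPart (coeff_mem_ghPart (F := F) (P := P) (Coeff.dphi U i f))
      (jet_mem_ghPart (U := U) (F := F) (P := P) (.scalar i) (Finsupp.single μ 1))
    simpa [Gen.gh] using this)
  jet_mem v := by simpa using jet_mem_ghPart (U := U) v.1 (v.2 + Finsupp.single μ 1)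
  scalar_zero i := by
    classical
    simp [Coeff.dx_coord, Coeff.dphi_coord, apply_ite coeff]

/-- The total derivative `∂_μ`. -/
def total (μ : Fin 4) : LocalFn U F P →ₗ[ℝ] LocalFn U F P := (totalData μ).toLinearMap

/-- `∂^ν = ∂_0^{ν₀} ∂_1^{ν₁} ∂_2^{ν₂} ∂_3^{ν₃}`. -/
def totalPow (ν : Fin 4 →₀ ℕ) : LocalFn U F P →ₗ[ℝ] LocalFn U F P :=
  total 0 ^ ν 0 * total 1 ^ ν 1 * total 2 ^ ν 2 * total 3 ^ ν 3

theorem total_mem {g : ℤ} {a : LocalFn U F P} (μ : Fin 4) (ha : a ∈ ghPart U F P g) :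
    total μ a ∈ ghPart U F P g := by
  have h := (totalData μ).toLinearMap_mem ha
  rwa [add_zero] at h

theorem total_pow_mem {g : ℤ} {a : LocalFn U F P} (μ : Fin 4) (k : ℕ) (ha : a ∈ ghPart U F P g) :
    (total μ ^ k) a ∈ ghPart U F P g := by
  induction k with
  | zero => simpa using ha
  | succ k ih => rw [pow_succ', Module.End.mul_apply]; exact total_mem μ ih

theorem totalPow_mem {g : ℤ} {a : LocalFn U F P} (ν : Fin 4 →₀ ℕ) (ha : a ∈ ghPart U F P g) :
    totalPow ν a ∈ ghPart U F P g :=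
  total_pow_mem 0 _ (total_pow_mem 1 _ (total_pow_mem 2 _ (total_pow_mem 3 _ ha)))

open Classical in
/-- The left partial derivative with respect to the jet variable `w`; with respect to an
undifferentiated scalar it differentiates the coefficient functions. -/
def partialData (w : Jet σ F P) : DerivData U F P (-w.1.gh) where
  onCoeff := ∑ i, if w = (.scalar i, 0) then coeff.toLinearMap ∘ₗ (Coeff.dphi U i : _ →ₗ[ℝ] _) else 0
  onJet v := if v = w then 1 else 0
  leibniz f g := by
    simp only [LinearMap.sum_apply, Finset.mul_sum, Finset.sum_mul, ← Finset.sum_add_distrib]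
    refine Finset.sum_congr rfl fun i _ => ?_
    split_ifs
    · simp only [LinearMap.comp_apply, AlgHom.toLinearMap_apply, Derivation.coeFn_coe,
        Derivation.leibniz, smul_eq_mul, map_add, map_mul]
      rw [← map_mul coeff g, mul_comm g, map_mul]
    · simp
  coeff_mem f := by
    rw [LinearMap.sum_apply]
    refine Submodule.sum_mem _ fun i _ => ?_
    split_ifs with h
    · subst h
      exact coeff_mem_ghPart _
    · simp
  jet_mem v := by
    split_ifs with h
    · subst h
      simpa using one_mem_ghPart (U := U) (F := F) (P := P)
    · simp
  scalar_zero i := by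
    rw [LinearMap.sum_apply, Finset.sum_eq_single i]
    · by_cases h : w = (.scalar i, 0)
      · subst h
        simp [Coeff.dphi_coord]
      · simp [h, Ne.symm h]
    · intro j _ hj
      split_ifs
      · simp [Coeff.dphi_coord, Ne.symm hj]
      · simp
    · simp

/-- The partial derivative `∂/∂(∂^ν z)`. -/
def jetPartial (z : Gen σ F P) (ν : Fin 4 →₀ ℕ) : LocalFn U F P →ₗ[ℝ] LocalFn U F P :=
  (partialData (z, ν)).toLinearMap

/-- The Euler-Lagrange derivative `δL/δz = ∂L/∂z - ∂_μ (∂L/∂(∂_μ z))` of a Lagrangian that contains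
no derivatives of order higher than one, with respect to a field `z`. -/
def eulerLagrange (L : LocalFn U F P) (z : Gen σ F P) : LocalFn U F P :=
  jetPartial z 0 L - ∑ μ, total μ (jetPartial z (Finsupp.single μ 1) L)

theorem eulerLagrange_mem (L : ghPart U F P 0) (z : Gen σ F P) :
    eulerLagrange L.1 z ∈ ghPart U F P (-z.gh) := by
  have h : ∀ ν, jetPartial z ν L.1 ∈ ghPart U F P (-z.gh) := fun ν => by
    have h := (partialData (U := U) (z, ν)).toLinearMap_mem L.2
    rwa [zero_add] at h
  exact Submodule.sub_mem _ (h 0) (Submodule.sum_mem _ fun μ _ => total_mem μ (h _))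

/-! ### Gauge symmetries and the BRST differential -/

/-- Constant-coefficient differential operators, as polynomials in the `∂_μ`. -/
abbrev DiffOp : Type := MvPolynomial (Fin 4) ℝ

/-- `T(∂) a`. -/
def DiffOp.act (T : DiffOp) (a : LocalFn U F P) : LocalFn U F P :=
  ∑ ν ∈ T.support, T.coeff ν • totalPow ν a

/-- The formal adjoint `T(-∂) a`. -/
def DiffOp.actAdjoint (T : DiffOp) (a : LocalFn U F P) : LocalFn U F P :=
  ∑ ν ∈ T.support, ((-1) ^ ν.degree * T.coeff ν) • totalPow ν a

theorem DiffOp.act_mem {g : ℤ} (T : DiffOp) {a : LocalFn U F P} (ha : a ∈ ghPart U F P g) :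
    T.act a ∈ ghPart U F P g :=
  Submodule.sum_mem _ fun ν _ => Submodule.smul_mem _ _ (totalPow_mem ν ha)

theorem DiffOp.actAdjoint_mem {g : ℤ} (T : DiffOp) {a : LocalFn U F P}
    (ha : a ∈ ghPart U F P g) : T.actAdjoint a ∈ ghPart U F P g :=
  Submodule.sum_mem _ fun ν _ => Submodule.smul_mem _ _ (totalPow_mem ν ha)

variable [Fintype F]

/-- The transformation `δ_ε z^a = T^a(∂) ε`, `δ_ε φ^i = 0`, with an arbitrary function `ε(x)`, is a
gauge symmetry of the Lagrangian `L`, stated through its Noether identity. -/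
def IsGaugeSymmetry (L : LocalFn U F P) (T : F → DiffOp) : Prop :=
  ∑ a, (T a).actAdjoint (eulerLagrange L (.field a)) = 0

variable [Fintype P]

/-- `δ_ε z^a = R^a_α(∂) ε^α` is an irreducible generating set of the gauge symmetries of `L`: it
consists of gauge symmetries, no nonzero operators `c^α` satisfy `R^a_α c^α = 0`, and every gauge
symmetry is of the form `R^a_α c^α`. -/
structure IsIrreducibleGeneratingSet (L : LocalFn U F P) (R : F → P → DiffOp) : Prop where
  isGaugeSymmetry : ∀ α, IsGaugeSymmetry L fun a => R a α
  irreducible : ∀ c : P → DiffOp, (∀ a, ∑ α, R a α * c α = 0) → c = 0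
  complete : ∀ T : F → DiffOp, IsGaugeSymmetry L T → ∃ c : P → DiffOp, ∀ a, T a = ∑ α, R a α * c α

/-- The BRST differential on undifferentiated generators, read off from the master action
`S = ∫ (L + z*_a R^a_α C^α)`. -/
def brstGen (L : ghPart U F P 0) (R : F → P → DiffOp) : Gen σ F P → LocalFn U F P
  | .scalar _ => 0
  | .field a => ∑ α, (R a α).act (jet (.ghost α) 0)
  | .ghost _ => 0
  | .scalarAnti i => eulerLagrange L.1 (.scalar i)
  | .fieldAnti a => eulerLagrange L.1 (.field a)
  | .ghostAnti α => ∑ a, (R a α).actAdjoint (jet (.fieldAnti a) 0)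

theorem brstGen_mem (L : ghPart U F P 0) (R : F → P → DiffOp) (z : Gen σ F P) :
    brstGen L R z ∈ ghPart U F P (z.gh + 1) := by
  cases z with
  | scalar i => exact Submodule.zero_mem _
  | field a => exact Submodule.sum_mem _ fun α _ => DiffOp.act_mem _ (jet_mem_ghPart (.ghost α) 0)
  | ghost α => exact Submodule.zero_mem _
  | scalarAnti i => exact eulerLagrange_mem L (.scalar i)
  | fieldAnti a => exact eulerLagrange_mem L (.field a)
  | ghostAnti α =>
    exact Submodule.sum_mem _ fun a _ => DiffOp.actAdjoint_mem _ (jet_mem_ghPart (.fieldAnti a) 0)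

/-- `s f(x, φ) = 0` and `s (∂^ν z) = ∂^ν (s z)`. -/
def brstData (L : ghPart U F P 0) (R : F → P → DiffOp) : DerivData U F P 1 where
  onCoeff := 0
  onJet v := totalPow v.2 (brstGen L R v.1)
  leibniz _ _ := by simp
  coeff_mem _ := by simp
  jet_mem v := totalPow_mem _ (brstGen_mem L R v.1)
  scalar_zero i := by simp [brstGen]

/-- The BRST differential `s` of the Lagrangian `L` with gauge generators `R`. -/
def brst (L : ghPart U F P 0) (R : F → P → DiffOp) : LocalFn U F P →ₗ[ℝ] LocalFn U F P :=
  (brstData L R).toLinearMap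

theorem brst_mem (L : ghPart U F P 0) (R : F → P → DiffOp) {g : ℤ} {a : LocalFn U F P}
    (ha : a ∈ ghPart U F P g) : brst L R a ∈ ghPart U F P (g + 1) :=
  (brstData L R).toLinearMap_mem ha

/-! ### Local BRST cohomology -/

variable (U F P) in
/-- Total derivatives `∂_μ m^μ` of ghost number `g`, the coefficients of the `d`-exact 4-forms. -/
def divergences (g : ℤ) : Submodule ℝ (LocalFn U F P) :=
  ⨆ μ : Fin 4, (ghPart U F P g).map (total μ)

/-- Cocycles of `H^g(s|d)`: `a` of ghost number `g` with `s a + ∂_μ m^μ = 0`. -/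
def cocycles (L : ghPart U F P 0) (R : F → P → DiffOp) (g : ℤ) : Submodule ℝ (LocalFn U F P) :=
  ghPart U F P g ⊓ (divergences U F P (g + 1)).comap (brst L R)

/-- Coboundaries of `H^g(s|d)`: the `s b + ∂_μ n^μ` with `b` of ghost number `g - 1` and `n^μ` of
ghost number `g`. -/
def coboundaries (L : ghPart U F P 0) (R : F → P → DiffOp) (g : ℤ) :
    Submodule ℝ (LocalFn U F P) :=
  (ghPart U F P (g - 1)).map (brst L R) ⊔ divergences U F P g

/-- The local BRST cohomology `H^g(s|d)` in top form degree; the 4-form `a d⁴x` is represented by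
its coefficient `a`. -/
abbrev Cohomology (L : ghPart U F P 0) (R : F → P → DiffOp) (g : ℤ) : Type :=
  cocycles L R g ⧸ (coboundaries L R g).submoduleOf (cocycles L R g)

variable {F' P' : Type} [Fintype F'] [Fintype P']

/-- A local map between two theories with the same scalars: an algebra map of local functions that
fixes the functions of `x` and `φ`, preserves the ghost number and commutes with the total
derivatives and with the BRST differentials. -/
structure LocalMap (L : ghPart U F P 0) (R : F → P → DiffOp) (L' : ghPart U F' P' 0)
    (R' : F' → P' → DiffOp) where
  toAlgHom : LocalFn U F P →ₐ[ℝ] LocalFn U F' P'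
  map_coeff : ∀ f, toAlgHom (coeff f) = coeff f
  map_ghPart : ∀ g, ∀ a ∈ ghPart U F P g, toAlgHom a ∈ ghPart U F' P' g
  map_total : ∀ μ a, toAlgHom (total μ a) = total μ (toAlgHom a)
  map_brst : ∀ a, toAlgHom (brst L R a) = brst L' R' (toAlgHom a)

namespace LocalMap

variable {L : ghPart U F P 0} {R : F → P → DiffOp} {L' : ghPart U F' P' 0}
  {R' : F' → P' → DiffOp} (π : LocalMap L R L' R')

theorem map_divergences {g : ℤ} {a : LocalFn U F P} (ha : a ∈ divergences U F P g) :
    π.toAlgHom a ∈ divergences U F' P' g := by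
  suffices h : divergences U F P g ≤ (divergences U F' P' g).comap π.toAlgHom.toLinearMap from h ha
  refine iSup_le fun μ => ?_
  rintro _ ⟨m, hm, rfl⟩
  change π.toAlgHom (total μ m) ∈ divergences U F' P' g
  rw [π.map_total]
  exact Submodule.mem_iSup_of_mem μ ⟨_, π.map_ghPart g m hm, rfl⟩

theorem map_cocycles {g : ℤ} {a : LocalFn U F P} (ha : a ∈ cocycles L R g) :
    π.toAlgHom a ∈ cocycles L' R' g := by
  refine Submodule.mem_inf.2 ⟨π.map_ghPart g a ha.1, ?_⟩
  change brst L' R' (π.toAlgHom a) ∈ divergences U F' P' (g + 1)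
  rw [← π.map_brst]
  exact π.map_divergences ha.2

theorem map_coboundaries {g : ℤ} {a : LocalFn U F P} (ha : a ∈ coboundaries L R g) :
    π.toAlgHom a ∈ coboundaries L' R' g := by
  obtain ⟨_, ⟨b, hb, rfl⟩, n, hn, rfl⟩ := Submodule.mem_sup.1 ha
  rw [map_add, π.map_brst]
  exact Submodule.add_mem_sup ⟨_, π.map_ghPart _ b hb, rfl⟩ (π.map_divergences hn)

/-- The map induced on the local BRST cohomology, `[a] ↦ [π a]`. -/
def onCohomology (g : ℤ) : Cohomology L R g →ₗ[ℝ] Cohomology L' R' g :=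
  Submodule.mapQ _ _
    (π.toAlgHom.toLinearMap.restrict fun _ ha => π.map_cocycles ha)
    fun _ ha => π.map_coboundaries ha

end LocalMap

end LocalFunctions

/-! ### Lagrangians -/

/-- The diagonal entries of the Minkowski metric `η = diag(-1, 1, 1, 1)`. -/
def eta (μ : Fin 4) : ℝ := if μ = 0 then -1 else 1

/-- The Levi-Civita symbol `ε^{μνρσ}`, with `ε_{0123} = 1`, that is, `ε^{0123} = -1`. -/
def levi (μ ν ρ τ : Fin 4) : ℝ :=
  -Matrix.det (Matrix.of fun i j : Fin 4 => if ![μ, ν, ρ, τ] i = j then (1 : ℝ) else 0)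

section Lagrangians

variable {σ : Type} [Fintype σ] {U : Opens (σ → ℝ)} {F P : Type}

theorem mul_mem_ghPart_zero {a b : LocalFn U F P} (ha : a ∈ ghPart U F P 0)
    (hb : b ∈ ghPart U F P 0) : a * b ∈ ghPart U F P 0 := by
  simpa using mul_mem_ghPart ha hb

/-- `L_S = -½ g_ij(φ) ∂_μφ^i ∂^μφ^j`. -/
def scalarLagrangian (g : Matrix σ σ (SmoothFn U)) : ghPart U F P 0 :=
  ⟨-(1 / 2 : ℝ) • ∑ i, ∑ j, ∑ μ, eta μ • (coeff (Coeff.ofScalar (g i j)) *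
      (jet (.scalar i) (Finsupp.single μ 1) * jet (.scalar j) (Finsupp.single μ 1))),
    Submodule.smul_mem _ _ <| Submodule.sum_mem _ fun _ _ => Submodule.sum_mem _ fun _ _ =>
      Submodule.sum_mem _ fun _ _ => Submodule.smul_mem _ _ <|
        mul_mem_ghPart_zero (coeff_mem_ghPart _) <|
          mul_mem_ghPart_zero (jet_mem_ghPart (.scalar _) _) (jet_mem_ghPart (.scalar _) _)⟩

/-- `-¼ I_IJ(φ) H^I_μν H^{Jμν} + ⅛ R_IJ(φ) ε^{μνρτ} H^I_μν H^J_ρτ` for given two-forms `H^I`. -/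
def kineticLagrangian {n : Type} [Fintype n] (I R : Matrix n n (SmoothFn U))
    (H : n → Fin 4 → Fin 4 → ghPart U F P 0) : ghPart U F P 0 :=
  ⟨-(1 / 4 : ℝ) • (∑ i, ∑ j, ∑ μ, ∑ ν, (eta μ * eta ν) •
      (coeff (Coeff.ofScalar (I i j)) * ((H i μ ν).1 * (H j μ ν).1)))
    + (1 / 8 : ℝ) • (∑ i, ∑ j, ∑ μ, ∑ ν, ∑ ρ, ∑ τ, levi μ ν ρ τ •
      (coeff (Coeff.ofScalar (R i j)) * ((H i μ ν).1 * (H j ρ τ).1))),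
    Submodule.add_mem _
      (Submodule.smul_mem _ _ <| Submodule.sum_mem _ fun _ _ => Submodule.sum_mem _ fun _ _ =>
        Submodule.sum_mem _ fun _ _ => Submodule.sum_mem _ fun _ _ => Submodule.smul_mem _ _ <|
          mul_mem_ghPart_zero (coeff_mem_ghPart _) (mul_mem_ghPart_zero (H _ _ _).2 (H _ _ _).2))
      (Submodule.smul_mem _ _ <| Submodule.sum_mem _ fun _ _ => Submodule.sum_mem _ fun _ _ =>
        Submodule.sum_mem _ fun _ _ => Submodule.sum_mem _ fun _ _ => Submodule.sum_mem _ fun _ _ =>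
          Submodule.sum_mem _ fun _ _ => Submodule.smul_mem _ _ <|
            mul_mem_ghPart_zero (coeff_mem_ghPart _)
              (mul_mem_ghPart_zero (H _ _ _).2 (H _ _ _).2))⟩

/-- The abelian curvature `∂_μ A_ν - ∂_ν A_μ` of the vector potential with components `A_μ`. -/
def curvature (A : Fin 4 → F) (μ ν : Fin 4) : ghPart U F P 0 :=
  ⟨jet (.field (A ν)) (Finsupp.single μ 1) - jet (.field (A μ)) (Finsupp.single ν 1),
    Submodule.sub_mem _ (jet_mem_ghPart (.field _) _) (jet_mem_ghPart (.field _) _)⟩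

/-- The second-order Lagrangian of scalars and vectors `A^I_μ`, the component `A^I_μ` being indexed
by `(I, μ)`: `L_S - ¼ I_IJ(φ) F^I_μν F^{Jμν} + ⅛ R_IJ(φ) ε^{μνρτ} F^I_μν F^J_ρτ`. -/
def vectorLagrangian {n : Type} [Fintype n] (g : Matrix σ σ (SmoothFn U))
    (I R : Matrix n n (SmoothFn U)) : ghPart U (n × Fin 4) P 0 :=
  scalarLagrangian g + kineticLagrangian I R fun i => curvature fun μ => (i, μ)

/-- The gauge transformations `δA^I_μ = ∂_μ λ^I`. -/
def vectorGenerators {n : Type} [DecidableEq n] : n × Fin 4 → n → DiffOp :=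
  fun z j => if z.1 = j then MvPolynomial.X z.2 else 0

/-- Components of the vector and tensor fields of the embedding tensor formalism: electric vectors
`A^I_μ`, magnetic vectors `Ã_{Iμ}` and two-forms `B_{αμν}` with `μ < ν`. -/
inductive EmbField (n a : Type) : Type
  | electric (i : n) (μ : Fin 4)
  | magnetic (i : n) (μ : Fin 4)
  | twoForm (α : a) (p : {p : Fin 4 × Fin 4 // p.1 < p.2})

/-- The field components as a disjoint sum. -/
def EmbField.equivSum (n a : Type) :
    EmbField n a ≃ (n × Fin 4) ⊕ (n × Fin 4) ⊕ (a × {p : Fin 4 × Fin 4 // p.1 < p.2}) where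
  toFun
    | .electric i μ => .inl (i, μ)
    | .magnetic i μ => .inr (.inl (i, μ))
    | .twoForm α p => .inr (.inr (α, p))
  invFun
    | .inl x => .electric x.1 x.2
    | .inr (.inl x) => .magnetic x.1 x.2
    | .inr (.inr x) => .twoForm x.1 x.2
  left_inv z := by cases z <;> rfl
  right_inv z := by rcases z with z | z | z <;> rfl

instance {n a : Type} [Fintype n] [Fintype a] : Fintype (EmbField n a) :=
  Fintype.ofEquiv _ (EmbField.equivSum n a).symm

variable {n a : Type} [Fintype n] [Fintype a]

/-- The antisymmetric tensor `B_{αμν}`. -/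
def twoForm (α : a) (μ ν : Fin 4) : ghPart U (EmbField n a) P 0 :=
  if h : μ < ν then ⟨jet (.field (.twoForm α ⟨(μ, ν), h⟩)) 0, jet_mem_ghPart (.field _) _⟩
  else if h : ν < μ then
    -⟨jet (.field (.twoForm α ⟨(ν, μ), h⟩)) 0, jet_mem_ghPart (.field _) _⟩
  else 0

/-- `H^I = F^I + ½ Θ^{Iα} B_α`. -/
def embCurvature (Θmag : Matrix n a ℝ) (i : n) (μ ν : Fin 4) : ghPart U (EmbField n a) P 0 :=
  curvature (.electric i) μ ν + (1 / 2 : ℝ) • ∑ α, Θmag i α • twoForm α μ ν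

/-- `-⅛ ε^{μνρτ} Θ^{Iα} B_{αμν} (F̃_{Iρτ} - ¼ Θ_I^β B_{βρτ})`. -/
def topologicalLagrangian (Θel Θmag : Matrix n a ℝ) : ghPart U (EmbField n a) P 0 :=
  ⟨-(1 / 8 : ℝ) • ∑ μ, ∑ ν, ∑ ρ, ∑ τ, ∑ i, ∑ α, (levi μ ν ρ τ * Θmag i α) •
      ((twoForm α μ ν : ghPart U (EmbField n a) P 0).1 *
        (curvature (.magnetic i) ρ τ - (1 / 4 : ℝ) • ∑ β, Θel i β • twoForm β ρ τ :
          ghPart U (EmbField n a) P 0).1),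
    Submodule.smul_mem _ _ <| Submodule.sum_mem _ fun _ _ => Submodule.sum_mem _ fun _ _ =>
      Submodule.sum_mem _ fun _ _ => Submodule.sum_mem _ fun _ _ => Submodule.sum_mem _ fun _ _ =>
        Submodule.sum_mem _ fun _ _ => Submodule.smul_mem _ _ <|
          mul_mem_ghPart_zero (Subtype.prop _) (Subtype.prop _)⟩

/-- The zero-coupling limit of the embedding tensor Lagrangian, including the scalar part; the
electric and magnetic components of the embedding tensor are `Θel i α = Θ_I^α` and
`Θmag i α = Θ^{Iα}`. -/
def embLagrangian (g : Matrix σ σ (SmoothFn U)) (I R : Matrix n n (SmoothFn U))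
    (Θel Θmag : Matrix n a ℝ) : ghPart U (EmbField n a) P 0 :=
  scalarLagrangian g + kineticLagrangian I R (embCurvature Θmag)
    + topologicalLagrangian Θel Θmag

end Lagrangians

/-! ### The symplectic frame determined by the embedding tensor -/

/-- The values at the point `φ` of a matrix of functions of the scalars. -/
def matrixAt {σ n : Type} [Fintype σ] {U : Opens (σ → ℝ)} (A : Matrix n n (SmoothFn U)) (φ : U) :
    Matrix n n ℝ :=
  A.map fun f => f.1 φ

/-- The symplectic form `Ω = (0, 1; -1, 0)`. -/
def symplecticForm (n : Type) [DecidableEq n] : Matrix (n ⊕ n) (n ⊕ n) ℝ :=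
  Matrix.fromBlocks 0 1 (-1) 0

/-- `M(I, R) = (I + R I⁻¹ R, -R I⁻¹; -I⁻¹ R, I⁻¹)`. -/
def kineticMatrix {n : Type} [Fintype n] [DecidableEq n] (I R : Matrix n n ℝ) :
    Matrix (n ⊕ n) (n ⊕ n) ℝ :=
  Matrix.fromBlocks (I + R * I⁻¹ * R) (-(R * I⁻¹)) (-(I⁻¹ * R)) I⁻¹

/-- Changes of basis `Y`, `Z` that bring the magnetic components of the embedding tensor to the
form `Y Θmag Z = (θ, 0; 0, 0)` with `θ` an invertible `r × r` matrix. The new vector index is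
`(Î, Û)`, and the new adjoint index is `(i, m)`. -/
structure AdaptedBasis {n a : Type} [Fintype n] [Fintype a] [DecidableEq n] [DecidableEq a]
    (Θmag : Matrix n a ℝ) where
  r : ℕ
  u : ℕ
  m : ℕ
  Y : Matrix (Fin r ⊕ Fin u) n ℝ
  Yinv : Matrix n (Fin r ⊕ Fin u) ℝ
  Z : Matrix a (Fin r ⊕ Fin m) ℝ
  Zinv : Matrix (Fin r ⊕ Fin m) a ℝ
  θ : Matrix (Fin r) (Fin r) ℝ
  Y_mul_Yinv : Y * Yinv = 1
  Yinv_mul_Y : Yinv * Y = 1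
  Z_mul_Zinv : Z * Zinv = 1
  Zinv_mul_Z : Zinv * Z = 1
  isUnit_θ : IsUnit θ.det
  magnetic : Y * Θmag * Z = Matrix.fromBlocks θ 0 0 0

namespace AdaptedBasis

variable {n a : Type} [Fintype n] [Fintype a] [DecidableEq n] [DecidableEq a]
  {Θmag : Matrix n a ℝ} (b : AdaptedBasis Θmag)

/-- The vector indices `(Î, Û)` of the new frame. -/
abbrev Idx : Type := Fin b.r ⊕ Fin b.u

/-- `θ̃_Î^i`: the corresponding block of the electric components `Y^{-T} Θel Z`. -/
def θt (Θel : Matrix n a ℝ) : Matrix (Fin b.r) (Fin b.r) ℝ :=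
  (b.Yinvᵀ * Θel * b.Z).toBlocks₁₁

/-- `E₁`: `A = Y⁻¹ A'`, `Ã = Yᵀ Ã'`. -/
def E₁ : Matrix (n ⊕ n) (b.Idx ⊕ b.Idx) ℝ :=
  Matrix.fromBlocks b.Yinv 0 0 b.Yᵀ

/-- `E₂`, where `q` are the electric and `p` the magnetic potentials of the new frame:
`A'^Î = -p^Î`, `A'^Û = q^Û`, `Ã'_Î = q_Î + (θ⁻¹)_{iÎ} θ̃_Ĵ^i p^Ĵ`, `Ã'_Û = p_Û`. -/
def E₂ (Θel : Matrix n a ℝ) : Matrix (b.Idx ⊕ b.Idx) (b.Idx ⊕ b.Idx) ℝ :=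
  Matrix.fromBlocks
    (Matrix.fromBlocks 0 0 0 1) (Matrix.fromBlocks (-1) 0 0 0)
    (Matrix.fromBlocks 1 0 0 0) (Matrix.fromBlocks (b.θt Θel * b.θ⁻¹)ᵀ 0 0 1)

/-- The matrix `E(Θ) = E₁ E₂` of the frame determined by the embedding tensor, `A = E(Θ) A_new`. -/
def E (Θel : Matrix n a ℝ) : Matrix (n ⊕ n) (b.Idx ⊕ b.Idx) ℝ :=
  b.E₁ * b.E₂ Θel

end AdaptedBasis

end

end LocalBRST

namespace LocalBRST

noncomputable section

set_option linter.unusedSectionVars false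

/-! ### Generators of the algebra of local functions -/

section Generators

variable {σ : Type} [Fintype σ] {U : Opens (σ → ℝ)} {F P : Type}

/-! The magnetic embedding tensor couples two-forms whose field equations are algebraic and whose
gauge symmetries shift away half of the dualized vectors. Removing these variables leaves the
second-order theory in the frame E(Θ), and variables that can be removed locally and algebraically
do not contribute to H(s|d).

Normal form. Under A = Y⁻¹A', Ã = YᵀÃ', B = ZB', with θ absorbed into B, the magnetic components
become diag(1, 0). The electric components enter the field equations only through ΘmagᵀΘel. By
locality this product is symmetric, and in the adapted basis it reduces to the symmetric matrix N =
θ̃θ⁻¹. The choice of an irreducible generating set is immaterial: completeness expresses each of two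
sets through the other by operator matrices c, d, and irreducibility forces dc = cd = 1, so the BRST
complexes are isomorphic (`exists_ghost_change`, `exists_localMap_of_isCovariant`,
`AdaptedBasis.isCovariant`).

Duality. The Hodge star satisfies ⋆² = -1, so τ = R + I⋆ behaves like a complex symmetric matrix and
G = τH is the dual field strength. Pairs (F, τF) are the solutions of a twisted self-duality
equation for the kinetic matrix M, and this equation is covariant under symplectic frames. In the
frame E(Θ) it yields `DualFrame`: the hatted old field strengths are -G', and (τ₁₁ + N)τ'₁₁ = -1.
The operator in front of the hatted two-forms in their own field equation therefore has the local
inverse -τ'₁₁ (`DualFrame.dualField_equation`). The same relation gives HᵀdτH = dτ'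
(`DualFrame.derivation`), so the scalar equations of the two theories agree.

Generating set. In the adapted basis the generators are explicit. Completeness is tested on constant
scalars and plane waves, where the Noether identity becomes polynomial in the wave vector k. After
dualization it says that the potentials q of the new frame satisfy k²q - (k·q)k = 0. Hence k ∧ q = 0
as a polynomial identity, and q is k times a polynomial (`adaptedGenerators_complete`).

Elimination. The map `reduction` sets the shifted vectors to zero and B to -2G'. A derivation h of
ghost number -1, commuting with total derivatives, contracts its kernel: sh + hs is an even
derivation commuting with s and the ∂_μ, and the kernel of the map lies in the sum of its
eigenspaces with positive integer eigenvalues. A polynomial in this operator inverts it on any one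
element of the kernel. Being polynomial, the inverse commutes with s and the ∂_μ, so the contraction
also works modulo total derivatives (`LocalMap.bijective_onCohomology`, `reduction_bijective`). The
section used there need not commute with s. -/

theorem LocalFn.induction {motive : LocalFn U F P → Prop}
    (hcoeff : ∀ f, motive (coeff f)) (hjet : ∀ z ν, motive (jet z ν))
    (hadd : ∀ a b, motive a → motive b → motive (a + b))
    (hmul : ∀ a b, motive a → motive b → motive (a * b)) (a : LocalFn U F P) : motive a := by
  obtain ⟨x, rfl⟩ := RingQuot.mkAlgHom_surjective ℝ (Rel U F P) a
  change motive (LocalFn.mk x)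
  induction x using FreeAlgebra.induction with
  | grade0 r =>
    rw [AlgHom.commutes, ← AlgHom.commutes coeff]
    exact hcoeff _
  | grade1 v =>
    cases v with
    | inl f => exact hcoeff f
    | inr v => exact hjet v.1 v.2
  | mul x y hx hy => rw [map_mul]; exact hmul _ _ hx hy
  | add x y hx hy => rw [map_add]; exact hadd _ _ hx hy

/-- Sign rules are available only for homogeneous elements; this spanning property extends their
consequences to all local functions. Directness of the sum is not needed. -/
theorem iSup_ghPart : ⨆ g, ghPart U F P g = ⊤ := by
  refine eq_top_iff.2 fun a _ => ?_
  induction a using LocalFn.induction with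
  | hcoeff f => exact Submodule.mem_iSup_of_mem 0 (coeff_mem_ghPart f)
  | hjet z ν => exact Submodule.mem_iSup_of_mem _ (jet_mem_ghPart z ν)
  | hadd a b ha hb => exact Submodule.add_mem _ (ha trivial) (hb trivial)
  | hmul a b ha hb =>
    replace ha := ha trivial
    replace hb := hb trivial
    clear * - ha hb
    induction ha using Submodule.iSup_induction' with
    | zero => simp
    | add x y _ _ hx hy => rw [add_mul]; exact Submodule.add_mem _ hx hy
    | mem g x hx =>
      induction hb using Submodule.iSup_induction' with
      | zero => simp
      | add x y _ _ hx hy => rw [mul_add]; exact Submodule.add_mem _ hx hy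
      | mem h y hy => exact Submodule.mem_iSup_of_mem _ (mul_mem_ghPart hx hy)

theorem mem_iSup_ghPart (a : LocalFn U F P) : a ∈ ⨆ g, ghPart U F P g := by
  rw [iSup_ghPart]; trivial

theorem ghPart_comm {g h : ℤ} {a b : LocalFn U F P} (ha : a ∈ ghPart U F P g)
    (hb : b ∈ ghPart U F P h) : a * b = (-1 : ℝ) ^ (g * h) • (b * a) := by
  induction ha using Submodule.span_induction with
  | zero => simp
  | add x y _ _ hx hy => rw [mul_add, add_mul, hx, hy, smul_add]
  | smul r x _ hx => rw [mul_smul_comm, smul_mul_assoc, hx, smul_comm]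
  | mem x hx =>
    obtain ⟨f, l, hl, rfl⟩ := hx
    rw [← mul_assoc b, ← coeff_comm_of_mem f hb, mul_assoc, mul_assoc, ← mul_smul_comm]
    congr 1
    clear f
    induction l generalizing g with
    | nil => subst hl; simp
    | cons w l ih =>
      simp only [List.map_cons, List.sum_cons, List.prod_cons] at hl ⊢
      subst hl
      rw [mul_assoc, ih rfl, mul_smul_comm, ← mul_assoc, jet_comm_of_mem w hb, smul_mul_assoc,
        smul_smul, mul_assoc, add_mul, neg_one_zpow_add, mul_comm]

theorem coeff_comm (f : Coeff U) (a : LocalFn U F P) : coeff f * a = a * coeff f := by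
  induction a using LocalFn.induction with
  | hcoeff g => rw [← map_mul, mul_comm, map_mul]
  | hjet z ν => exact coeff_comm_jet f (z, ν)
  | hadd a b ha hb => rw [mul_add, add_mul, ha, hb]
  | hmul a b ha hb => rw [← mul_assoc, ha, mul_assoc, hb, mul_assoc]

end Generators

/-! ### Graded derivations along an algebra homomorphism -/

section GradedDerivations

variable {σ : Type} [Fintype σ] {U : Opens (σ → ℝ)} {F P : Type}
  {B : Type*} [Ring B] [Algebra ℝ B]

/-- `D(ab) = (Da) φ(b) + (-1)^{p gh a} φ(a) Db`. -/
def IsGradedDerivation (φ : LocalFn U F P →ₐ[ℝ] B) (p : ℤ) (D : LocalFn U F P →ₗ[ℝ] B) : Prop :=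
  ∀ ⦃g a⦄, a ∈ ghPart U F P g → ∀ b, D (a * b) = D a * φ b + (-1 : ℝ) ^ (p * g) • (φ a * D b)

theorem DerivData.isGradedDerivation {p : ℤ} (D : DerivData U F P p) :
    IsGradedDerivation (AlgHom.id ℝ _) p D.toLinearMap := fun _ _ ha b => D.toLinearMap_mul ha b

namespace IsGradedDerivation

variable {φ : LocalFn U F P →ₐ[ℝ] B} {p : ℤ} {D D' : LocalFn U F P →ₗ[ℝ] B}

theorem sub (hD : IsGradedDerivation φ p D) (hD' : IsGradedDerivation φ p D') :
    IsGradedDerivation φ p (D - D') := fun g a ha b => by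
  simp only [LinearMap.sub_apply, hD ha b, hD' ha b, sub_mul, mul_sub, smul_sub]
  abel

/-- The Leibniz rule reduces vanishing to generators. Applied to a difference or a commutator of
derivations, this proves every identity between derivations below, including the intertwining of two
BRST differentials. -/
theorem eq_zero (hD : IsGradedDerivation φ p D) (hc : ∀ f, D (coeff f) = 0)
    (hj : ∀ z ν, D (jet z ν) = 0) (a : LocalFn U F P) : D a = 0 := by
  have ha := mem_iSup_ghPart a
  induction ha using Submodule.iSup_induction' with
  | zero => simp
  | add x y _ _ hx hy => rw [map_add, hx, hy, add_zero]
  | mem g x hx =>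
    induction hx using Submodule.span_induction with
    | zero => simp
    | add x y _ _ hx hy => rw [map_add, hx, hy, add_zero]
    | smul r x _ hx => rw [map_smul, hx, smul_zero]
    | mem x hx =>
      obtain ⟨f, l, -, rfl⟩ := hx
      rw [hD (coeff_mem_ghPart f), hc, zero_mul, zero_add]
      suffices h : D (l.map fun v => jet v.1 v.2).prod = 0 by simp [h]
      induction l with
      | nil => simpa using hc 1
      | cons v l ih =>
        rw [List.map_cons, List.prod_cons, hD (jet_mem_ghPart _ _), hj, ih]
        simp

theorem algHom_comp {B' : Type*} [Ring B'] [Algebra ℝ B'] (hD : IsGradedDerivation φ p D)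
    (ψ : B →ₐ[ℝ] B') : IsGradedDerivation (ψ.comp φ) p (ψ.toLinearMap ∘ₗ D) := fun g a ha b => by
  simp [hD ha b]

theorem comp_algHom {F' P' : Type} {π : LocalFn U F P →ₐ[ℝ] LocalFn U F' P'}
    {φ' : LocalFn U F' P' →ₐ[ℝ] B} {D' : LocalFn U F' P' →ₗ[ℝ] B}
    (hD' : IsGradedDerivation φ' p D')
    (hπ : ∀ g, ∀ a ∈ ghPart U F P g, π a ∈ ghPart U F' P' g) :
    IsGradedDerivation (φ'.comp π) p (D' ∘ₗ π.toLinearMap) := fun g a ha b => by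
  simp [hD' (hπ g a ha)]

/-- The graded commutator of graded derivations is a graded derivation. -/
theorem commutator {p q : ℤ} {D D' : LocalFn U F P →ₗ[ℝ] LocalFn U F P}
    (hD : IsGradedDerivation (AlgHom.id ℝ _) p D) (hD' : IsGradedDerivation (AlgHom.id ℝ _) q D')
    (mD : ∀ g a, a ∈ ghPart U F P g → D a ∈ ghPart U F P (g + p))
    (mD' : ∀ g a, a ∈ ghPart U F P g → D' a ∈ ghPart U F P (g + q)) :
    IsGradedDerivation (AlgHom.id ℝ _) (p + q) (D ∘ₗ D' - (-1 : ℝ) ^ (p * q) • D' ∘ₗ D) := by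
  intro g a ha b
  have e (x : LocalFn U F P) : (AlgHom.id ℝ (LocalFn U F P)) x = x := rfl
  have h := neg_one_zpow_mul_self (p * q)
  simp only [LinearMap.sub_apply, LinearMap.smul_apply, LinearMap.comp_apply, hD ha, hD' ha, e,
    map_add, map_smul, hD (mD' g a ha), hD' (mD g a ha), mul_add, add_mul, neg_one_zpow_add,
    smul_add, smul_smul, sub_mul, mul_sub, smul_sub, smul_mul_assoc, mul_smul_comm, mul_comm q p]
  generalize (-1 : ℝ) ^ (p * q) = c at *
  generalize (-1 : ℝ) ^ (p * g) = d at *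
  generalize (-1 : ℝ) ^ (q * g) = f at *
  have h2 : c * (f * c) = f := by linear_combination f * h
  rw [h2]
  module

end IsGradedDerivation

/-- When p q = 0 the graded commutator is the ordinary one. This is the case whenever one of the two
derivations is a total derivative. -/
theorem DerivData.comm_toLinearMap {p q : ℤ} (D : DerivData U F P p) (D' : DerivData U F P q)
    (hpq : p * q = 0)
    (hc : ∀ f, D.toLinearMap (D'.toLinearMap (coeff f)) = D'.toLinearMap (D.toLinearMap (coeff f)))
    (hj : ∀ z ν, D.toLinearMap (D'.toLinearMap (jet z ν))
      = D'.toLinearMap (D.toLinearMap (jet z ν))) (a : LocalFn U F P) :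
    D.toLinearMap (D'.toLinearMap a) = D'.toLinearMap (D.toLinearMap a) := by
  have h := (D.isGradedDerivation.commutator D'.isGradedDerivation
    (fun g a => D.toLinearMap_mem) (fun g a => D'.toLinearMap_mem)).eq_zero
    (fun f => by simp [hpq, hc]) (fun z ν => by simp [hpq, hj]) a
  simpa [hpq, sub_eq_zero] using h

end GradedDerivations

/-! ### Total derivatives commute -/

section Total

variable {E : Type*} [NormedAddCommGroup E] [NormedSpace ℝ E]

theorem two_le_infty : (2 : WithTop ℕ∞) ≤ ∞ := by
  change ((2 : ℕ∞) : WithTop ℕ∞) ≤ _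
  exact_mod_cast le_top

theorem SmoothFn.dir_comm (Ω : Opens E) (v w : E) (f : SmoothFn Ω) :
    SmoothFn.dir Ω v (SmoothFn.dir Ω w f) = SmoothFn.dir Ω w (SmoothFn.dir Ω v f) := by
  have key (v w : E) (x : Ω) : (SmoothFn.dir Ω v (SmoothFn.dir Ω w f)).1 x
      = fderiv ℝ (fderiv ℝ (extendZero Ω f.1)) x v w := by
    rw [SmoothFn.dir_apply, fderiv_extendZero (h := fun y => fderiv ℝ (extendZero Ω f.1) y w)
      (fun y => SmoothFn.dir_apply Ω w f y)]
    have hd : DifferentiableAt ℝ (fderiv ℝ (extendZero Ω f.1)) x :=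
      (((ContDiffOn.fderiv_of_isOpen f.2 Ω.isOpen (m := 1)
        (by rw [one_add_one_eq_two]; exact two_le_infty)).contDiffAt (Ω.isOpen.mem_nhds x.2))).differentiableAt (by simp)
    rw [fderiv_clm_apply hd (by fun_prop)]
    simp
  apply Subtype.ext
  funext x
  rw [key, key]
  exact (f.2.contDiffAt (Ω.isOpen.mem_nhds x.2)).isSymmSndFDerivAt (by
    rw [minSmoothness_of_isRCLikeNormedField]; exact two_le_infty) v w

variable {σ : Type} [Fintype σ] {U : Opens (σ → ℝ)} {F P : Type}

theorem total_coeff (μ : Fin 4) (f : Coeff U) : (total μ (coeff f) : LocalFn U F P)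
    = coeff (Coeff.dx U μ f)
      + ∑ i, coeff (Coeff.dphi U i f) * jet (.scalar i) (Finsupp.single μ 1) :=
  (totalData μ).toLinearMap_coeff f

theorem total_jet (μ : Fin 4) (z : Gen σ F P) (ν : Fin 4 →₀ ℕ) :
    total μ (jet z ν : LocalFn U F P) = jet z (ν + Finsupp.single μ 1) :=
  (totalData μ).toLinearMap_jet (z, ν)

theorem isGradedDerivation_total (μ : Fin 4) :
    IsGradedDerivation (AlgHom.id ℝ (LocalFn U F P)) 0 (total μ) :=
  (totalData μ).isGradedDerivation

theorem total_mul (μ : Fin 4) (a b : LocalFn U F P) :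
    total μ (a * b) = total μ a * b + a * total μ b := by
  have ha := mem_iSup_ghPart a
  induction ha using Submodule.iSup_induction' with
  | zero => simp
  | add x y _ _ hx hy => simp only [add_mul, map_add, hx, hy]; abel
  | mem g x hx => simpa using isGradedDerivation_total μ hx b

/-- On jet variables this is addition of multi-indices. On coefficients it is symmetry of second
derivatives, together with the fact that first derivatives of scalars commute. -/
theorem total_comm (μ ν : Fin 4) (a : LocalFn U F P) :
    total μ (total ν a) = total ν (total μ a) := by
  refine (totalData μ).comm_toLinearMap (totalData ν) (by simp) (fun f => ?_) (fun z κ => ?_) a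
  · change total μ (total ν (coeff f)) = total ν (total μ (coeff f))
    have h (v w : (Fin 4 → ℝ) × (σ → ℝ)) := SmoothFn.dir_comm (baseOpen U) v w f
    simp only [total_coeff, map_add, map_sum, total_mul, total_jet, add_mul, Finset.sum_add_distrib,
      Finset.sum_mul]
    rw [Finset.sum_comm (f := fun i j => coeff (Coeff.dphi U j (Coeff.dphi U i f)) *
      jet (Gen.scalar j) (Finsupp.single μ 1) * jet (Gen.scalar i) (Finsupp.single ν 1))]
    have h1 : ∀ i j : σ, (coeff (Coeff.dphi U j (Coeff.dphi U i f)) : LocalFn U F P) *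
          jet (Gen.scalar j) (Finsupp.single μ 1) * jet (Gen.scalar i) (Finsupp.single ν 1)
        = coeff (Coeff.dphi U i (Coeff.dphi U j f)) *
          jet (Gen.scalar i) (Finsupp.single ν 1) * jet (Gen.scalar j) (Finsupp.single μ 1) := by
      intro i j
      have := jet_comm (U := U) (F := F) (P := P) (.scalar j, Finsupp.single μ 1)
        (.scalar i, Finsupp.single ν 1)
      simp only [Gen.gh, mul_zero, zpow_zero, one_smul] at this
      rw [mul_assoc, this, ← mul_assoc]
      congr 3
      exact h _ _
    simp only [h1, add_comm (Finsupp.single ν 1)]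
    have h2 : ∀ i, Coeff.dx U μ (Coeff.dphi U i f) = Coeff.dphi U i (Coeff.dx U μ f) :=
      fun i => h _ _
    have h3 : ∀ i, Coeff.dx U ν (Coeff.dphi U i f) = Coeff.dphi U i (Coeff.dx U ν f) :=
      fun i => h _ _
    have h4 : Coeff.dx U μ (Coeff.dx U ν f) = Coeff.dx U ν (Coeff.dx U μ f) := h _ _
    simp only [h2, h3, h4]
    abel
  · change total μ (total ν (jet z κ)) = total ν (total μ (jet z κ))
    simp only [total_jet]
    rw [add_right_comm]

theorem total_commute (μ ν : Fin 4) :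
    Commute (total μ : Module.End ℝ (LocalFn U F P)) (total ν) :=
  LinearMap.ext fun a => total_comm μ ν a

theorem totalPow_zero : (totalPow 0 : LocalFn U F P →ₗ[ℝ] LocalFn U F P) = LinearMap.id := by
  simp only [totalPow, Finsupp.zero_apply, pow_zero, mul_one]
  rfl

theorem totalPow_add (ν ν' : Fin 4 →₀ ℕ) :
    (totalPow (ν + ν') : Module.End ℝ (LocalFn U F P)) = totalPow ν * totalPow ν' := by
  have c (μ μ' : Fin 4) (m n : ℕ) := (total_commute (U := U) (F := F) (P := P) μ μ').pow_pow m n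
  simp only [totalPow, Finsupp.add_apply, pow_add]
  rw [(c 0 1 _ _).mul_mul_mul_comm, (((c 0 2 _ _).mul_left (c 1 2 _ _))).mul_mul_mul_comm,
    (((c 0 3 _ _).mul_left (c 1 3 _ _)).mul_left (c 2 3 _ _)).mul_mul_mul_comm]

theorem totalPow_single (μ : Fin 4) (k : ℕ) :
    (totalPow (Finsupp.single μ k) : Module.End ℝ (LocalFn U F P)) = total μ ^ k := by
  fin_cases μ <;> simp [totalPow]

theorem total_pow_jet (μ : Fin 4) (k : ℕ) (z : Gen σ F P) (ν : Fin 4 →₀ ℕ) :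
    (total μ ^ k) (jet z ν : LocalFn U F P) = jet z (ν + Finsupp.single μ k) := by
  induction k with
  | zero => simp
  | succ k ih =>
    rw [pow_succ', Module.End.mul_apply, ih, total_jet, Finsupp.single_add, add_assoc]

theorem totalPow_jet (ν κ : Fin 4 →₀ ℕ) (z : Gen σ F P) :
    totalPow ν (jet z κ : LocalFn U F P) = jet z (κ + ν) := by
  simp only [totalPow, Module.End.mul_apply, total_pow_jet, add_assoc]
  congr 2
  ext μ
  fin_cases μ <;> simp

theorem jet_eq_totalPow (z : Gen σ F P) (ν : Fin 4 →₀ ℕ) :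
    (jet z ν : LocalFn U F P) = totalPow ν (jet z 0) := by
  rw [totalPow_jet, zero_add]

/-- A linear map that commutes with the total derivatives commutes with their products. -/
theorem map_totalPow {F' P' : Type} {f : LocalFn U F P →ₗ[ℝ] LocalFn U F' P'}
    (hf : ∀ μ a, f (total μ a) = total μ (f a)) (ν : Fin 4 →₀ ℕ) (a : LocalFn U F P) :
    f (totalPow ν a) = totalPow ν (f a) := by
  have h (μ : Fin 4) (k : ℕ) (a) : f ((total μ ^ k) a) = (total μ ^ k) (f a) := by
    induction k with
    | zero => simp
    | succ k ih => rw [pow_succ', Module.End.mul_apply, hf, ih, pow_succ', Module.End.mul_apply]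
  simp only [totalPow, Module.End.mul_apply, h]

theorem total_totalPow (μ : Fin 4) (ν : Fin 4 →₀ ℕ) (a : LocalFn U F P) :
    total μ (totalPow ν a) = totalPow ν (total μ a) :=
  map_totalPow (fun κ a => total_comm μ κ a) ν a

theorem totalPow_add_single (ν : Fin 4 →₀ ℕ) (μ : Fin 4) (a : LocalFn U F P) :
    totalPow (ν + Finsupp.single μ 1) a = total μ (totalPow ν a) := by
  rw [totalPow_add, Module.End.mul_apply, totalPow_single, pow_one, total_totalPow]

end Total

/-! ### Constant-coefficient differential operators -/

section DiffOp

variable {σ : Type} [Fintype σ] {U : Opens (σ → ℝ)} {F P : Type}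

variable (U F P) in
/-- The action of constant-coefficient differential operators as an algebra homomorphism. -/
def DiffOp.actHom : DiffOp →ₐ[ℝ] Module.End ℝ (LocalFn U F P) :=
  AddMonoidAlgebra.lift ℝ (Module.End ℝ (LocalFn U F P)) (Fin 4 →₀ ℕ)
    { toFun := fun ν => totalPow ν.toAdd
      map_one' := totalPow_zero
      map_mul' := fun _ _ => totalPow_add _ _ }

theorem DiffOp.act_eq (T : DiffOp) (a : LocalFn U F P) : T.act a = DiffOp.actHom U F P T a := by
  rw [DiffOp.actHom, AddMonoidAlgebra.lift_apply]
  exact (LinearMap.sum_apply T.support (fun ν => T.coeff ν • totalPow ν) a).symm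

theorem DiffOp.actHom_X (μ : Fin 4) : DiffOp.actHom U F P (MvPolynomial.X μ) = total μ := by
  ext a
  rw [← DiffOp.act_eq, DiffOp.act, MvPolynomial.support_X, Finset.sum_singleton, totalPow_single]
  simp

theorem DiffOp.act_X (μ : Fin 4) (a : LocalFn U F P) :
    DiffOp.act (MvPolynomial.X μ) a = total μ a := by
  rw [act_eq, actHom_X]

theorem DiffOp.act_zero (a : LocalFn U F P) : DiffOp.act 0 a = 0 := by
  rw [act_eq, map_zero]; rfl

theorem DiffOp.act_one (a : LocalFn U F P) : DiffOp.act 1 a = a := by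
  rw [act_eq, map_one]; rfl

theorem DiffOp.act_C (r : ℝ) (a : LocalFn U F P) : DiffOp.act (MvPolynomial.C r) a = r • a := by
  rw [act_eq, ← MvPolynomial.algebraMap_eq, AlgHom.commutes]; rfl

theorem DiffOp.act_mul (S T : DiffOp) (a : LocalFn U F P) : (S * T).act a = S.act (T.act a) := by
  simp only [act_eq, map_mul, Module.End.mul_apply]

theorem DiffOp.act_sum {ι : Type*} (s : Finset ι) (T : ι → DiffOp) (a : LocalFn U F P) :
    (∑ i ∈ s, T i).act a = ∑ i ∈ s, (T i).act a := by
  simp only [act_eq, map_sum, LinearMap.sum_apply]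

theorem DiffOp.act_add (S T : DiffOp) (a : LocalFn U F P) : (S + T).act a = S.act a + T.act a := by
  simp only [act_eq, map_add, LinearMap.add_apply]

theorem DiffOp.act_neg (S : DiffOp) (a : LocalFn U F P) : (-S).act a = -S.act a := by
  simp only [act_eq, map_neg, LinearMap.neg_apply]

theorem DiffOp.act_sub (S T : DiffOp) (a : LocalFn U F P) : (S - T).act a = S.act a - T.act a := by
  simp only [act_eq, map_sub, LinearMap.sub_apply]

theorem DiffOp.map_act {F' P' : Type} {f : LocalFn U F P →ₗ[ℝ] LocalFn U F' P'}
    (hf : ∀ μ a, f (total μ a) = total μ (f a)) (T : DiffOp) (a : LocalFn U F P) :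
    f (T.act a) = T.act (f a) := by
  simp only [DiffOp.act, map_sum, map_smul, map_totalPow hf]

/-- The substitution `∂_μ ↦ -∂_μ`. -/
def DiffOp.adj : DiffOp →ₐ[ℝ] DiffOp := MvPolynomial.aeval fun μ => -MvPolynomial.X μ

theorem DiffOp.adj_adj (T : DiffOp) : T.adj.adj = T := by
  have : DiffOp.adj.comp DiffOp.adj = AlgHom.id ℝ DiffOp := by
    ext μ; simp [DiffOp.adj]
  exact DFunLike.congr_fun this T

theorem DiffOp.adj_X (μ : Fin 4) : DiffOp.adj (MvPolynomial.X μ) = -MvPolynomial.X μ := by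
  simp [DiffOp.adj]

theorem DiffOp.adj_C (r : ℝ) : DiffOp.adj (MvPolynomial.C r) = MvPolynomial.C r := by
  simp [DiffOp.adj]

theorem DiffOp.act_monomial (ν : Fin 4 →₀ ℕ) (r : ℝ) (a : LocalFn U F P) :
    DiffOp.act (MvPolynomial.monomial ν r) a = r • totalPow ν a := by
  classical
  rw [DiffOp.act, MvPolynomial.support_monomial]
  split_ifs with h
  · simp [h]
  · simp

theorem DiffOp.adj_monomial (ν : Fin 4 →₀ ℕ) (r : ℝ) :
    DiffOp.adj (MvPolynomial.monomial ν r) = MvPolynomial.monomial ν ((-1) ^ ν.degree * r) := by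
  rw [DiffOp.adj, MvPolynomial.aeval_monomial, MvPolynomial.monomial_eq (s := ν) (a := _ * r)]
  have h (μ : Fin 4) (k : ℕ) : (-MvPolynomial.X μ : DiffOp) ^ k
      = (-1) ^ k * MvPolynomial.X μ ^ k := neg_pow _ _
  simp only [Finsupp.prod, h, Finset.prod_mul_distrib, Finset.prod_pow_eq_pow_sum,
    MvPolynomial.algebraMap_eq, map_mul, map_pow, map_neg, map_one]
  change _ * ((-1) ^ ν.degree * _) = _
  ring

/-- The adjoint becomes the action of the image under an algebra homomorphism, so adjoints of
products and of operator matrices can be computed algebraically. -/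
theorem DiffOp.actAdjoint_eq (T : DiffOp) (a : LocalFn U F P) : T.actAdjoint a = T.adj.act a := by
  conv_rhs => rw [T.as_sum, map_sum, DiffOp.act_sum]
  simp only [adj_monomial, act_monomial]
  rfl

end DiffOp

/-! ### Homomorphisms and derivations given on generators -/

section OnGenerators

variable {σ : Type} [Fintype σ] {U : Opens (σ → ℝ)} {F P F' P' : Type}

theorem algHom_ext {B : Type*} [Ring B] [Algebra ℝ B] {f g : LocalFn U F P →ₐ[ℝ] B}
    (hc : ∀ a, f (coeff a) = g (coeff a)) (hj : ∀ z ν, f (jet z ν) = g (jet z ν))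
    (a : LocalFn U F P) : f a = g a := by
  induction a using LocalFn.induction with
  | hcoeff a => exact hc a
  | hjet z ν => exact hj z ν
  | hadd a b ha hb => rw [map_add, map_add, ha, hb]
  | hmul a b ha hb => rw [map_mul, map_mul, ha, hb]

/-- The scalars must be fixed because the total derivative of a coefficient function produces first
derivatives of scalars by the chain rule. -/
theorem algHom_map_total {f : LocalFn U F P →ₐ[ℝ] LocalFn U F' P'}
    (hc : ∀ a, f (coeff a) = coeff a)
    (hj : ∀ z ν, f (jet z ν) = totalPow ν (f (jet z 0)))
    (hs : ∀ i, f (jet (.scalar i) 0) = jet (.scalar i) 0)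
    (μ : Fin 4) (a : LocalFn U F P) : f (total μ a) = total μ (f a) := by
  induction a using LocalFn.induction with
  | hcoeff a =>
    rw [hc, total_coeff, total_coeff]
    simp [hc, hj (.scalar _) (Finsupp.single μ 1), hs, totalPow_jet]
  | hjet z ν => rw [total_jet, hj, hj z ν, totalPow_add_single]
  | hadd a b ha hb => simp only [map_add, ha, hb]
  | hmul a b ha hb => simp only [map_mul, map_add, total_mul, ha, hb]

/-- The images of the generators under a local map that fixes the functions of `(x, φ)`. -/
structure GenMap (U : Opens (σ → ℝ)) (F P F' P' : Type) where
  toFun : Gen σ F P → LocalFn U F' P'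
  mem : ∀ z, toFun z ∈ ghPart U F' P' z.gh
  scalar : ∀ i, toFun (.scalar i) = jet (.scalar i) 0

namespace GenMap

variable (G : GenMap U F P F' P')

theorem lift_rel {x y} (h : Rel U F P x y) :
    FreeAlgebra.lift ℝ (Sum.elim coeff fun v : Jet σ F P => totalPow v.2 (G.toFun v.1)) x
      = FreeAlgebra.lift ℝ (Sum.elim coeff fun v : Jet σ F P => totalPow v.2 (G.toFun v.1)) y := by
  have hm (v : Jet σ F P) := totalPow_mem v.2 (G.mem v.1)
  cases h with
  | coeff_add f g => simp
  | coeff_mul f g => simp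
  | coeff_const r => simp
  | coeff_comm f v => simpa using coeff_comm _ _
  | jet_comm v w => simpa using ghPart_comm (hm v) (hm w)
  | scalar_zero i =>
    simp [G.scalar, totalPow_zero, jet_scalar_zero]

/-- The algebra homomorphism with the given images of the generators. -/
def hom : LocalFn U F P →ₐ[ℝ] LocalFn U F' P' :=
  RingQuot.liftAlgHom ℝ ⟨FreeAlgebra.lift ℝ
    (Sum.elim coeff fun v : Jet σ F P => totalPow v.2 (G.toFun v.1)), fun _ _ h => G.lift_rel h⟩

theorem hom_mk (x) : G.hom (LocalFn.mk x) = FreeAlgebra.lift ℝ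
    (Sum.elim coeff fun v : Jet σ F P => totalPow v.2 (G.toFun v.1)) x :=
  RingQuot.liftAlgHom_mkAlgHom_apply ℝ _ _ _

theorem hom_coeff (f : Coeff U) : G.hom (coeff f) = coeff f := by
  change G.hom (LocalFn.mk _) = _
  rw [hom_mk, FreeAlgebra.lift_ι_apply]
  rfl

theorem hom_jet (z : Gen σ F P) (ν : Fin 4 →₀ ℕ) : G.hom (jet z ν) = totalPow ν (G.toFun z) := by
  change G.hom (LocalFn.mk _) = _
  rw [hom_mk, FreeAlgebra.lift_ι_apply]
  rfl

theorem hom_jet_zero (z : Gen σ F P) : G.hom (jet z 0) = G.toFun z := by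
  rw [hom_jet, totalPow_zero]; rfl

theorem hom_total (μ : Fin 4) (a : LocalFn U F P) : G.hom (total μ a) = total μ (G.hom a) :=
  algHom_map_total G.hom_coeff (fun z ν => by rw [hom_jet, hom_jet_zero])
    (fun i => by rw [hom_jet_zero, G.scalar]) μ a

theorem hom_mem (g : ℤ) (a : LocalFn U F P) (ha : a ∈ ghPart U F P g) :
    G.hom a ∈ ghPart U F' P' g := by
  induction ha using Submodule.span_induction with
  | zero => simp
  | add x y _ _ hx hy => rw [map_add]; exact Submodule.add_mem _ hx hy
  | smul r x _ hx => rw [map_smul]; exact Submodule.smul_mem _ _ hx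
  | mem x hx =>
    obtain ⟨f, l, rfl, rfl⟩ := hx
    rw [map_mul, hom_coeff, ← zero_add (List.sum _)]
    refine mul_mem_ghPart (coeff_mem_ghPart f) ?_
    induction l with
    | nil => simpa using one_mem_ghPart
    | cons v l ih =>
      rw [List.map_cons, List.map_cons, List.prod_cons, List.sum_cons, map_mul, hom_jet]
      exact mul_mem_ghPart (totalPow_mem _ (G.mem _)) ih

end GenMap

/-- The values on the generators of a derivation that annihilates the functions of `(x, φ)` and
commutes with the total derivatives. -/
structure GenDer (U : Opens (σ → ℝ)) (F P : Type) (p : ℤ) where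
  toFun : Gen σ F P → LocalFn U F P
  mem : ∀ z, toFun z ∈ ghPart U F P (z.gh + p)
  scalar : ∀ i, toFun (.scalar i) = 0

namespace GenDer

variable {p : ℤ} (D : GenDer U F P p)

/-- The graded derivation with the given values on generators. -/
def data : DerivData U F P p where
  onCoeff := 0
  onJet v := totalPow v.2 (D.toFun v.1)
  leibniz _ _ := by simp
  coeff_mem _ := by simp
  jet_mem v := totalPow_mem _ (D.mem v.1)
  scalar_zero i := by simp [D.scalar]

/-- The graded derivation with the given values on generators. -/
def der : LocalFn U F P →ₗ[ℝ] LocalFn U F P := D.data.toLinearMap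

theorem der_coeff (f : Coeff U) : D.der (coeff f) = 0 := D.data.toLinearMap_coeff f

theorem der_jet (z : Gen σ F P) (ν : Fin 4 →₀ ℕ) : D.der (jet z ν) = totalPow ν (D.toFun z) :=
  D.data.toLinearMap_jet (z, ν)

theorem der_jet_zero (z : Gen σ F P) : D.der (jet z 0) = D.toFun z := by
  rw [der_jet, totalPow_zero]; rfl

theorem der_mem {g : ℤ} {a : LocalFn U F P} (ha : a ∈ ghPart U F P g) :
    D.der a ∈ ghPart U F P (g + p) := D.data.toLinearMap_mem ha

theorem isGradedDerivation : IsGradedDerivation (AlgHom.id ℝ _) p D.der :=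
  D.data.isGradedDerivation

theorem der_total (μ : Fin 4) (a : LocalFn U F P) : D.der (total μ a) = total μ (D.der a) := by
  refine D.data.comm_toLinearMap (totalData μ) (by simp) (fun f => ?_) (fun z κ => ?_) a
  · change D.der (total μ (coeff f)) = total μ (D.der (coeff f))
    have h (f : Coeff U) (b : LocalFn U F P) : D.der (coeff f * b) = coeff f * D.der b := by
      rw [D.isGradedDerivation (coeff_mem_ghPart f)]; simp [der_coeff]
    rw [total_coeff, der_coeff, map_add, map_sum, der_coeff]
    simp [h, der_jet, D.scalar]
  · change D.der (total μ (jet z κ)) = total μ (D.der (jet z κ))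
    rw [total_jet, der_jet, der_jet, totalPow_add_single]

end GenDer

theorem IsGradedDerivation.eq_zero_of_gen {φ : LocalFn U F P →ₐ[ℝ] LocalFn U F' P'} {p : ℤ}
    {D : LocalFn U F P →ₗ[ℝ] LocalFn U F' P'} (hD : IsGradedDerivation φ p D)
    (ht : ∀ μ a, D (total μ a) = total μ (D a)) (hc : ∀ f, D (coeff f) = 0)
    (hj : ∀ z, D (jet z 0) = 0) (a : LocalFn U F P) : D a = 0 :=
  hD.eq_zero hc (fun z ν => by rw [jet_eq_totalPow, map_totalPow ht, hj, map_zero]) a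

/-- A derivation that raises the ghost number by `0` satisfies the Leibniz rule on all elements. -/
theorem IsGradedDerivation.leibniz_zero {D : LocalFn U F P →ₗ[ℝ] LocalFn U F P}
    (hD : IsGradedDerivation (AlgHom.id ℝ _) 0 D) (a b : LocalFn U F P) :
    D (a * b) = D a * b + a * D b := by
  have ha := mem_iSup_ghPart a
  induction ha using Submodule.iSup_induction' with
  | zero => simp
  | add x y _ _ hx hy => simp only [add_mul, map_add, hx, hy]; abel
  | mem g x hx => simpa using hD hx b

end OnGenerators

/-! ### The BRST differential on generators -/

section Brst

variable {σ : Type} [Fintype σ] {U : Opens (σ → ℝ)} {F P F' P' : Type} [Fintype F] [Fintype P]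
  [Fintype F'] [Fintype P']

/-- The BRST differential as a derivation given on generators. -/
def brstDer (L : ghPart U F P 0) (R : F → P → DiffOp) : GenDer U F P 1 where
  toFun := brstGen L R
  mem := brstGen_mem L R
  scalar _ := rfl

theorem brst_eq (L : ghPart U F P 0) (R : F → P → DiffOp) : brst L R = (brstDer L R).der := rfl

variable (L : ghPart U F P 0) (R : F → P → DiffOp)

theorem brst_coeff (f : Coeff U) : brst L R (coeff f) = 0 := (brstDer L R).der_coeff f

theorem brst_total (μ : Fin 4) (a : LocalFn U F P) :
    brst L R (total μ a) = total μ (brst L R a) := (brstDer L R).der_total μ a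

theorem brst_scalar (i : σ) : brst L R (jet (.scalar i) 0) = 0 :=
  (brstDer L R).der_jet_zero _

theorem brst_field (a : F) : brst L R (jet (.field a) 0) = ∑ α, (R a α).act (jet (.ghost α) 0) :=
  (brstDer L R).der_jet_zero _

theorem brst_ghost (α : P) : brst L R (jet (.ghost α) 0) = 0 :=
  (brstDer L R).der_jet_zero _

theorem brst_scalarAnti (i : σ) :
    brst L R (jet (.scalarAnti i) 0) = eulerLagrange L.1 (.scalar i) :=
  (brstDer L R).der_jet_zero _

theorem brst_fieldAnti (a : F) : brst L R (jet (.fieldAnti a) 0) = eulerLagrange L.1 (.field a) :=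
  (brstDer L R).der_jet_zero _

theorem brst_ghostAnti (α : P) : brst L R (jet (.ghostAnti α) 0)
    = ∑ a, (R a α).adj.act (jet (.fieldAnti a) 0) := by
  rw [brst_eq, GenDer.der_jet_zero]
  exact Finset.sum_congr rfl fun a _ => DiffOp.actAdjoint_eq _ _

theorem isGradedDerivation_brst : IsGradedDerivation (AlgHom.id ℝ _) 1 (brst L R) :=
  (brstDer L R).isGradedDerivation

theorem brst_coeff_mul (f : Coeff U) (a : LocalFn U F P) :
    brst L R (coeff f * a) = coeff f * brst L R a := by
  rw [isGradedDerivation_brst L R (coeff_mem_ghPart f)]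
  simp [brst_coeff]

/-- The BRST differential is nilpotent if it is so on the antifields. -/
theorem brst_brst (hs : ∀ i, brst L R (eulerLagrange L.1 (.scalar i)) = 0)
    (hf : ∀ a, brst L R (eulerLagrange L.1 (.field a)) = 0)
    (hR : ∀ α, IsGaugeSymmetry L.1 fun a => R a α) (x : LocalFn U F P) :
    brst L R (brst L R x) = 0 := by
  -- Since s is odd, its graded commutator with itself is 2s², a derivation. It is therefore enough
  -- to check s² on undifferentiated generators.
  have hder := (isGradedDerivation_brst L R).commutator (isGradedDerivation_brst L R)
    (fun g a => brst_mem L R) (fun g a => brst_mem L R)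
  have h := hder.eq_zero_of_gen (fun μ a => by simp [brst_total]) (fun f => by simp [brst_coeff])
    (fun z => ?_) x
  · simp only [mul_one, zpow_one, LinearMap.sub_apply, LinearMap.comp_apply, LinearMap.smul_apply,
      neg_smul, one_smul, sub_neg_eq_add, ← two_smul ℝ] at h
    exact (smul_eq_zero.1 h).resolve_left two_ne_zero
  · have e : brst L R (brst L R (jet z 0)) = 0 := by
      cases z with
      | scalar i => rw [brst_scalar, map_zero]
      | field a =>
        rw [brst_field, map_sum]
        refine Finset.sum_eq_zero fun α _ => ?_
        rw [DiffOp.map_act (brst_total L R), brst_ghost, DiffOp.act_eq, map_zero]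
      | ghost α => rw [brst_ghost, map_zero]
      | scalarAnti i => rw [brst_scalarAnti, hs]
      | fieldAnti a => rw [brst_fieldAnti, hf]
      | ghostAnti α =>
        -- On the antifields of the ghosts, s² = 0 is exactly the Noether identity of the generator.
        rw [brst_ghostAnti, map_sum, ← hR α]
        refine Finset.sum_congr rfl fun a _ => ?_
        rw [DiffOp.map_act (brst_total L R), brst_fieldAnti, DiffOp.actAdjoint_eq]
    simp [e]

end Brst

/-! ### Operators with positive integer eigenvalues -/

section Positive

variable {V : Type*} [AddCommGroup V] [Module ℝ V]

/-- The sum of the eigenspaces of an operator with positive integer eigenvalues. -/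
def positivePart (N : Module.End ℝ V) : Submodule ℝ V :=
  ⨆ n : ℕ, Module.End.eigenspace N ((n : ℝ) + 1)

/-- The sum of the eigenspaces of an operator with nonnegative integer eigenvalues. -/
def nonnegPart (N : Module.End ℝ V) : Submodule ℝ V := LinearMap.ker N ⊔ positivePart N

variable {N : Module.End ℝ V}

theorem positivePart_le : positivePart N ≤ nonnegPart N := le_sup_right

theorem mem_positivePart (n : ℕ) {a : V} (ha : N a = ((n : ℝ) + 1) • a) : a ∈ positivePart N :=
  Submodule.mem_iSup_of_mem n (Module.End.mem_eigenspace_iff.2 ha)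

theorem mem_positivePart_of_eq {a : V} (ha : N a = a) : a ∈ positivePart N :=
  mem_positivePart 0 (by simp [ha])

@[elab_as_elim]
theorem positivePart_induction {p : (a : V) → a ∈ positivePart N → Prop}
    (hp : ∀ (n : ℕ) a (ha : N a = ((n : ℝ) + 1) • a), p a (mem_positivePart n ha))
    (h0 : p 0 (Submodule.zero_mem _))
    (hadd : ∀ a b ha hb, p a ha → p b hb → p (a + b) (Submodule.add_mem _ ha hb)) {a : V}
    (ha : a ∈ positivePart N) : p a ha := by
  induction ha using Submodule.iSup_induction' with
  | zero => exact h0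
  | add x y h1 h2 hx hy => exact hadd x y h1 h2 hx hy
  | mem n x hx => exact hp n x (Module.End.mem_eigenspace_iff.1 hx)

theorem positivePart_map {T : Module.End ℝ V} (hT : ∀ a, N (T a) = T (N a)) {a : V}
    (ha : a ∈ positivePart N) : T a ∈ positivePart N := by
  induction ha using positivePart_induction with
  | hp n x hx => exact mem_positivePart n (by rw [hT, hx, map_smul])
  | h0 => simp
  | hadd x y _ _ hx hy => rw [map_add]; exact Submodule.add_mem _ hx hy

theorem nonnegPart_map {T : Module.End ℝ V} (hT : ∀ a, N (T a) = T (N a)) {a : V}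
    (ha : a ∈ nonnegPart N) : T a ∈ nonnegPart N := by
  obtain ⟨b, hb, c, hc, rfl⟩ := Submodule.mem_sup.1 ha
  rw [map_add]
  refine Submodule.add_mem_sup ?_ (positivePart_map hT hc)
  rw [LinearMap.mem_ker] at hb ⊢
  rw [hT, hb, map_zero]

/-- N maps its positive part onto itself, so subtracting a preimage of N a leaves an element of the
kernel. This allows generators that N annihilates only up to positive terms. -/
theorem mem_nonnegPart_of_map_mem {a : V} (ha : N a ∈ positivePart N) : a ∈ nonnegPart N := by
  have h : ∀ c ∈ positivePart N, ∃ b ∈ positivePart N, N b = c := fun c hc => by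
    induction hc using positivePart_induction with
    | hp n x hx =>
      have : (n : ℝ) + 1 ≠ 0 := by positivity
      exact ⟨((n : ℝ) + 1)⁻¹ • x, Submodule.smul_mem _ _ (mem_positivePart n hx), by
        rw [map_smul, hx, smul_smul, inv_mul_cancel₀ this, one_smul]⟩
    | h0 => exact ⟨0, Submodule.zero_mem _, by simp⟩
    | hadd x y _ _ hx hy =>
      obtain ⟨b, hb, rfl⟩ := hx
      obtain ⟨c, hc, rfl⟩ := hy
      exact ⟨b + c, Submodule.add_mem _ hb hc, map_add _ _ _⟩
  obtain ⟨b, hb, e⟩ := h _ ha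
  rw [← sub_add_cancel a b]
  exact Submodule.add_mem_sup (by rw [LinearMap.mem_ker, map_sub, e, sub_self]) hb

open Polynomial in
/-- On finitely many elements of the positive part, a polynomial in `N` inverts `N`. -/
theorem exists_polynomial_inverse {ι : Type*} [Finite ι] (a : ι → V)
    (ha : ∀ i, a i ∈ positivePart N) :
    ∃ q : ℝ[X], ∀ i, aeval N q (N (a i)) = a i := by
  -- The polynomial has constant term 1 and roots 1, ..., M. Once it kills an element, the
  -- polynomial (1 - r)/X undoes N on that element.
  let r (M : ℕ) : ℝ[X] := ∏ n ∈ Finset.range M, (1 - C ((n : ℝ) + 1)⁻¹ * X)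
  have hr (M : ℕ) : (r M).coeff 0 = 1 := by
    rw [coeff_zero_eq_eval_zero, eval_prod]
    simp
  have key : ∀ a ∈ positivePart N, ∃ M₀, ∀ M ≥ M₀, aeval N (r M) a = 0 := fun a ha => by
    induction ha using positivePart_induction with
    | hp n x hx =>
      refine ⟨n + 1, fun M hM => ?_⟩
      have hn : n ∈ Finset.range M := Finset.mem_range.2 (by omega)
      have hne : (n : ℝ) + 1 ≠ 0 := by positivity
      simp only [r]
      rw [← Finset.prod_erase_mul _ _ hn, map_mul, Module.End.mul_apply]
      have : aeval N (1 - C ((n : ℝ) + 1)⁻¹ * X : ℝ[X]) x = 0 := by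
        simp [hx, smul_smul, mul_inv_cancel₀ hne]
      rw [this, map_zero]
    | h0 => exact ⟨0, by simp⟩
    | hadd x y _ _ hx hy =>
      obtain ⟨m, hm⟩ := hx
      obtain ⟨n, hn⟩ := hy
      exact ⟨max m n, fun M hM => by
        rw [map_add, hm M (le_of_max_le_left hM), hn M (le_of_max_le_right hM), add_zero]⟩
  choose M₀ hM₀ using fun i => key (a i) (ha i)
  cases nonempty_fintype ι
  let M := Finset.univ.sup M₀
  refine ⟨(1 - r M).divX, fun i => ?_⟩
  have h0 := hM₀ i M (Finset.le_sup (Finset.mem_univ i))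
  have h1 := divX_mul_X_add (1 - r M)
  rw [coeff_sub, hr, coeff_one_zero, sub_self, map_zero, add_zero] at h1
  have h2 := congrArg (fun p => aeval N p (a i)) h1
  simpa [h0] using h2

open Polynomial in
theorem aeval_comm {V' : Type*} [AddCommGroup V'] [Module ℝ V'] {N' : Module.End ℝ V'}
    {T : V →ₗ[ℝ] V'} (hT : ∀ a, N' (T a) = T (N a)) (q : ℝ[X]) (a : V) :
    aeval N' q (T a) = T (aeval N q a) := by
  induction q using Polynomial.induction_on' generalizing a with
  | add p q hp hq => simp [hp, hq]
  | monomial n r =>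
    have h (a : V) : (N' ^ n) (T a) = T ((N ^ n) a) := by
      induction n generalizing a with
      | zero => simp
      | succ n ih => rw [pow_succ, Module.End.mul_apply, hT, ih, pow_succ, Module.End.mul_apply]
    simp [aeval_monomial, h]

open Polynomial in
theorem aeval_mem {S : Submodule ℝ V} (hS : ∀ a ∈ S, N a ∈ S) (q : ℝ[X]) {a : V} (ha : a ∈ S) :
    aeval N q a ∈ S := by
  induction q using Polynomial.induction_on' with
  | add p q hp hq => rw [map_add]; exact Submodule.add_mem _ hp hq
  | monomial n r =>
    have h : (N ^ n) a ∈ S := by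
      induction n with
      | zero => simpa
      | succ n ih => rw [pow_succ', Module.End.mul_apply]; exact hS _ ih
    rw [aeval_monomial]
    exact Submodule.smul_mem _ _ h

variable {A : Type*} [Ring A] [Algebra ℝ A] {N : Module.End ℝ A}

/-- By the Leibniz rule eigenvalues add under products, so one positive factor and one nonnegative
factor give a positive product. -/
theorem positivePart_mul_mem (hN : ∀ a b, N (a * b) = N a * b + a * N b) {a b : A}
    (ha : a ∈ nonnegPart N) (hb : b ∈ positivePart N) : a * b ∈ positivePart N := by
  induction hb using positivePart_induction with
  | hp n x hx =>
    obtain ⟨b, hb, c, hc, rfl⟩ := Submodule.mem_sup.1 ha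
    rw [add_mul]
    refine Submodule.add_mem _ (mem_positivePart n ?_) ?_
    · rw [hN, LinearMap.mem_ker.1 hb, hx]; simp
    · clear ha
      induction hc using positivePart_induction with
      | hp m y hy =>
        refine mem_positivePart (m + n + 1) ?_
        rw [hN, hy, hx, smul_mul_assoc, mul_smul_comm, ← add_smul]
        push_cast; congr 1; ring
      | h0 => simp
      | hadd x y _ _ hx hy => rw [add_mul]; exact Submodule.add_mem _ hx hy
  | h0 => simp
  | hadd x y _ _ hx hy => rw [mul_add]; exact Submodule.add_mem _ hx hy

theorem mul_positivePart_mem (hN : ∀ a b, N (a * b) = N a * b + a * N b) {a b : A}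
    (ha : a ∈ positivePart N) (hb : b ∈ nonnegPart N) : a * b ∈ positivePart N := by
  induction ha using positivePart_induction with
  | hp n x hx =>
    obtain ⟨c, hc, d, hd, rfl⟩ := Submodule.mem_sup.1 hb
    rw [mul_add]
    refine Submodule.add_mem _ (mem_positivePart n ?_) ?_
    · rw [hN, LinearMap.mem_ker.1 hc, hx]; simp
    · exact positivePart_mul_mem hN (positivePart_le (mem_positivePart n hx)) hd
  | h0 => simp
  | hadd x y _ _ hx hy => rw [add_mul]; exact Submodule.add_mem _ hx hy

theorem nonnegPart_mul_mem (hN : ∀ a b, N (a * b) = N a * b + a * N b) {a b : A}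
    (ha : a ∈ nonnegPart N) (hb : b ∈ nonnegPart N) : a * b ∈ nonnegPart N := by
  obtain ⟨c, hc, d, hd, rfl⟩ := Submodule.mem_sup.1 hb
  rw [mul_add]
  refine Submodule.add_mem _ ?_ (positivePart_le (positivePart_mul_mem hN ha hd))
  obtain ⟨x, hx, y, hy, rfl⟩ := Submodule.mem_sup.1 ha
  rw [add_mul]
  refine Submodule.add_mem_sup ?_ (mul_positivePart_mem hN hy (le_sup_left (a := LinearMap.ker N) hc))
  rw [LinearMap.mem_ker] at *
  rw [hN, hx, hc]; simp

end Positive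

/-! ### A criterion for local maps to induce isomorphisms on local BRST cohomology -/

section Criterion

variable {σ : Type} [Fintype σ] {U : Opens (σ → ℝ)} {F P F' P' : Type}

theorem mem_divergences {g : ℤ} {a : LocalFn U F P} : a ∈ divergences U F P g ↔
    ∃ m : Fin 4 → LocalFn U F P, (∀ μ, m μ ∈ ghPart U F P g) ∧ a = ∑ μ, total μ (m μ) := by
  constructor
  · intro ha
    induction ha using Submodule.iSup_induction' with
    | zero => exact ⟨0, fun μ => Submodule.zero_mem _, by simp⟩
    | add x y _ _ hx hy =>
      obtain ⟨m, hm, rfl⟩ := hx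
      obtain ⟨n, hn, rfl⟩ := hy
      exact ⟨m + n, fun μ => Submodule.add_mem _ (hm μ) (hn μ), by
        simp [Finset.sum_add_distrib]⟩
    | mem μ x hx =>
      obtain ⟨m, hm, rfl⟩ := hx
      refine ⟨Pi.single μ m, fun κ => ?_, ?_⟩
      · by_cases h : κ = μ
        · subst h; simpa using hm
        · simp [h]
      · rw [Finset.sum_eq_single μ]
        · simp
        · intro κ _ h; simp [h]
        · simp
  · rintro ⟨m, hm, rfl⟩
    exact Submodule.sum_mem _ fun μ _ => Submodule.mem_iSup_of_mem μ ⟨m μ, hm μ, rfl⟩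

variable [Fintype F] [Fintype P] [Fintype F'] [Fintype P']
  {L : ghPart U F P 0} {R : F → P → DiffOp} {L' : ghPart U F' P' 0} {R' : F' → P' → DiffOp}

/-- The graded commutator `s h + h s` of the BRST differential with a derivation `h`. -/
def homotopyCommutator (L : ghPart U F P 0) (R : F → P → DiffOp) (h : GenDer U F P (-1)) :
    Module.End ℝ (LocalFn U F P) :=
  brst L R ∘ₗ h.der + h.der ∘ₗ brst L R

theorem homotopyCommutator_apply (h : GenDer U F P (-1)) (a : LocalFn U F P) :
    homotopyCommutator L R h a = brst L R (h.der a) + h.der (brst L R a) := rfl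

theorem homotopyCommutator_mul (h : GenDer U F P (-1)) (a b : LocalFn U F P) :
    homotopyCommutator L R h (a * b)
      = homotopyCommutator L R h a * b + a * homotopyCommutator L R h b := by
  have hd := (isGradedDerivation_brst L R).commutator h.isGradedDerivation
    (fun g a => brst_mem L R) (fun g a => h.der_mem)
  have e : homotopyCommutator L R h
      = brst L R ∘ₗ h.der - (-1 : ℝ) ^ (1 * -1 : ℤ) • h.der ∘ₗ brst L R := by
    have : ((-1 : ℝ) ^ (1 * -1 : ℤ)) = -1 := by norm_num
    rw [this]
    ext a
    simp [homotopyCommutator]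
  rw [e]
  exact IsGradedDerivation.leibniz_zero (by simpa using hd) a b

theorem homotopyCommutator_total (h : GenDer U F P (-1)) (μ : Fin 4) (a : LocalFn U F P) :
    homotopyCommutator L R h (total μ a) = total μ (homotopyCommutator L R h a) := by
  simp [homotopyCommutator, brst_total, h.der_total]

theorem homotopyCommutator_coeff (h : GenDer U F P (-1)) (f : Coeff U) :
    homotopyCommutator L R h (coeff f) = 0 := by
  simp [homotopyCommutator, brst_coeff, h.der_coeff]

theorem homotopyCommutator_mem (h : GenDer U F P (-1)) {g : ℤ} {a : LocalFn U F P}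
    (ha : a ∈ ghPart U F P g) : homotopyCommutator L R h a ∈ ghPart U F P g := by
  refine Submodule.add_mem _ ?_ ?_
  · simpa using brst_mem L R (h.der_mem ha)
  · simpa using h.der_mem (brst_mem L R ha)

theorem brst_comm_homotopyCommutator (hs : ∀ a, brst L R (brst L R a) = 0) (h : GenDer U F P (-1))
    (a : LocalFn U F P) :
    homotopyCommutator L R h (brst L R a) = brst L R (homotopyCommutator L R h a) := by
  simp [homotopyCommutator, hs]

/-- A local map that has a right inverse commuting with the total derivatives, such that its kernel
is contracted by a local homotopy, induces isomorphisms on the local BRST cohomology. -/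
theorem LocalMap.bijective_onCohomology (π : LocalMap L R L' R')
    (hs : ∀ a, brst L R (brst L R a) = 0)
    (ι : GenMap U F' P' F P) (hπι : ∀ z, π.toAlgHom (ι.toFun z) = jet z 0)
    (h : GenDer U F P (-1)) (hπh : ∀ z, π.toAlgHom (h.toFun z) = 0)
    (hker : ∀ z, jet z 0 - ι.hom (π.toAlgHom (jet z 0)) ∈ positivePart (homotopyCommutator L R h))
    (hι : ∀ z, homotopyCommutator L R h (ι.toFun z) ∈ positivePart (homotopyCommutator L R h))
    (k : ℤ) : Function.Bijective (π.onCohomology k) := by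
  set N := homotopyCommutator L R h with hN
  have hNmul := homotopyCommutator_mul (L := L) (R := R) h
  have hNt := homotopyCommutator_total (L := L) (R := R) h
  have hNtp (ν : Fin 4 →₀ ℕ) (a) : N (totalPow ν a) = totalPow ν (N a) := map_totalPow hNt ν a
  have hNs := brst_comm_homotopyCommutator hs h
  have hcoeff (f : Coeff U) : (coeff f : LocalFn U F P) ∈ nonnegPart N :=
    le_sup_left (a := LinearMap.ker N) (homotopyCommutator_coeff h f)
  have πt (ν : Fin 4 →₀ ℕ) (a) : π.toAlgHom (totalPow ν a) = totalPow ν (π.toAlgHom a) :=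
    map_totalPow (f := π.toAlgHom.toLinearMap) π.map_total ν a
  have ιt (ν : Fin 4 →₀ ℕ) (a) : ι.hom (totalPow ν a) = totalPow ν (ι.hom a) :=
    map_totalPow (f := ι.hom.toLinearMap) ι.hom_total ν a
  -- The nonnegative part is closed under products and total derivatives, so membership is needed
  -- only on generators, where N (ι z) is positive by assumption.
  have hιW (a : LocalFn U F' P') : ι.hom a ∈ nonnegPart N := by
    induction a using LocalFn.induction with
    | hcoeff f => rw [ι.hom_coeff]; exact hcoeff f
    | hjet z ν =>
      rw [ι.hom_jet]
      exact nonnegPart_map (hNtp ν) (mem_nonnegPart_of_map_mem (hι z))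
    | hadd a b ha hb => rw [map_add]; exact Submodule.add_mem _ ha hb
    | hmul a b ha hb => rw [map_mul]; exact nonnegPart_mul_mem hNmul ha hb
  have hdiff (a : LocalFn U F P) : a - ι.hom (π.toAlgHom a) ∈ positivePart N := by
    induction a using LocalFn.induction with
    | hcoeff f => simp [π.map_coeff, ι.hom_coeff]
    | hjet z ν =>
      rw [jet_eq_totalPow, πt, ιt, ← map_sub]
      exact positivePart_map (hNtp ν) (hker z)
    | hadd a b ha hb =>
      rw [map_add, map_add, add_sub_add_comm]
      exact Submodule.add_mem _ ha hb
    | hmul a b ha hb =>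
      have hbW : b ∈ nonnegPart N := by
        rw [← sub_add_cancel b (ι.hom (π.toAlgHom b))]
        exact Submodule.add_mem _ (positivePart_le hb) (hιW _)
      -- Telescoping exhibits the defect of a product as a sum of products that each contain one
      -- positive factor.
      have e : a * b - ι.hom (π.toAlgHom (a * b))
          = (a - ι.hom (π.toAlgHom a)) * b
            + ι.hom (π.toAlgHom a) * (b - ι.hom (π.toAlgHom b)) := by
        rw [map_mul, map_mul]; noncomm_ring
      rw [e]
      exact Submodule.add_mem _ (mul_positivePart_mem hNmul ha hbW)
        (positivePart_mul_mem hNmul (hιW _) hb)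
  have hK (a : LocalFn U F P) (ha : π.toAlgHom a = 0) : a ∈ positivePart N := by
    simpa [ha] using hdiff a
  have πι (a : LocalFn U F' P') : π.toAlgHom (ι.hom a) = a := by
    refine algHom_ext (f := π.toAlgHom.comp ι.hom) (g := AlgHom.id ℝ _)
      (fun f => ?_) (fun z ν => ?_) a
    · simp [ι.hom_coeff, π.map_coeff]
    · simp [ι.hom_jet, πt, hπι, totalPow_jet]
  have πh (a : LocalFn U F P) : π.toAlgHom (h.der a) = 0 := by
    refine (h.isGradedDerivation.algHom_comp π.toAlgHom).eq_zero_of_gen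
      (fun μ a => ?_) (fun f => ?_) (fun z => ?_) a
    · simp [h.der_total, π.map_total]
    · simp [h.der_coeff]
    · simp [h.der_jet_zero, hπh]
  have πN (a : LocalFn U F P) (ha : π.toAlgHom a = 0) : π.toAlgHom (N a) = 0 := by
    rw [hN, homotopyCommutator_apply, map_add, π.map_brst, πh, πh]; simp
  -- A cocycle modulo d that lies in the kernel of π is a coboundary modulo d, with a primitive b
  -- again in the kernel. Injectivity and surjectivity both follow from this.
  have fill (g : ℤ) (a : LocalFn U F P) (m : Fin 4 → LocalFn U F P) (ha : a ∈ ghPart U F P g)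
      (hm : ∀ μ, m μ ∈ ghPart U F P (g + 1)) (hπ : π.toAlgHom a = 0)
      (e : brst L R a = ∑ μ, total μ (m μ)) : ∃ b ∈ ghPart U F P (g - 1),
        ∃ n : Fin 4 → LocalFn U F P, (∀ μ, n μ ∈ ghPart U F P g) ∧
          a = brst L R b + ∑ μ, total μ (n μ) ∧ π.toAlgHom b = 0 := by
    -- The projected current has zero divergence because π a = 0, and ι preserves this because it
    -- commutes with ∂_μ. The current can thus be taken in the kernel of π.
    let m' μ := m μ - ι.hom (π.toAlgHom (m μ))
    have hπm : ∑ μ, total μ (π.toAlgHom (m μ)) = 0 := by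
      have := congrArg π.toAlgHom e
      rw [π.map_brst, hπ, map_zero, map_sum] at this
      simpa [π.map_total] using this.symm
    have e' : brst L R a = ∑ μ, total μ (m' μ) := by
      simp only [m', map_sub, Finset.sum_sub_distrib, ← ι.hom_total, ← map_sum, hπm, map_zero,
        sub_zero, e]
    have hm' μ : m' μ ∈ ghPart U F P (g + 1) :=
      Submodule.sub_mem _ (hm μ) (ι.hom_mem _ _ (π.map_ghPart _ _ (hm μ)))
    obtain ⟨q, hq⟩ := exists_polynomial_inverse (N := N) (fun i : Option (Fin 4) => i.elim a m')
      (fun i => by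
        cases i with
        | none => exact hK a hπ
        | some μ => exact hdiff _)
    have hqg (g : ℤ) {a : LocalFn U F P} (ha : a ∈ ghPart U F P g) :
        Polynomial.aeval N q a ∈ ghPart U F P g :=
      aeval_mem (fun a ha => homotopyCommutator_mem h ha) q ha
    refine ⟨Polynomial.aeval N q (h.der a), hqg _ (by simpa [sub_eq_add_neg] using h.der_mem ha),
      fun μ => Polynomial.aeval N q (h.der (m' μ)),
      fun μ => hqg _ (by simpa using h.der_mem (hm' μ)), ?_, ?_⟩
    -- N a = s(h a) + ∂_μ(h m'^μ). Applying the polynomial inverse of N, which commutes with s and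
    -- ∂_μ, yields the primitive.
    · have h1 := hq none
      simp only [Option.elim] at h1
      conv_lhs => rw [← h1, hN, homotopyCommutator_apply, e', map_sum, map_add, map_sum]
      rw [← hN, aeval_comm hNs]
      congr 1
      refine Finset.sum_congr rfl fun μ _ => ?_
      rw [h.der_total, aeval_comm (hNt μ)]
    · exact aeval_mem (S := LinearMap.ker π.toAlgHom.toLinearMap) (fun a ha => πN a ha) q (πh a)
  constructor
  · rw [injective_iff_map_eq_zero]
    intro x hx
    induction x using Submodule.Quotient.induction_on with
    | H x =>
    obtain ⟨a, ha⟩ := x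
    have hx' : π.toAlgHom a ∈ coboundaries L' R' k := by
      have := (Submodule.Quotient.mk_eq_zero _).1 hx
      exact this
    refine (Submodule.Quotient.mk_eq_zero _).2 ?_
    change a ∈ coboundaries L R k
    obtain ⟨_, ⟨b', hb', rfl⟩, n', hn', e⟩ := Submodule.mem_sup.1 hx'
    obtain ⟨n, hn, rfl⟩ := mem_divergences.1 hn'
    obtain ⟨hag, has⟩ := ha
    obtain ⟨m, hm, hsa⟩ := mem_divergences.1 has
    have hιb : ι.hom b' ∈ ghPart U F P (k - 1) := ι.hom_mem _ _ hb'
    have hιn μ : ι.hom (n μ) ∈ ghPart U F P k := ι.hom_mem _ _ (hn μ)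
    have hdiv : ∑ μ, total μ (ι.hom (n μ)) ∈ divergences U F P k :=
      mem_divergences.2 ⟨_, hιn, rfl⟩
    -- If π a = s'b' + ∂n, the element a - sιb' - ∂ιn lies in the kernel of π and is still a cocycle
    -- modulo d.
    obtain ⟨b, hb, l, hl, e2, -⟩ := fill k
      (a - brst L R (ι.hom b') - ∑ μ, total μ (ι.hom (n μ)))
      (fun μ => m μ - brst L R (ι.hom (n μ)))
      (Submodule.sub_mem _ (Submodule.sub_mem _ hag (by simpa using brst_mem L R hιb))
        (Submodule.sum_mem _ fun μ _ => total_mem μ (hιn μ)))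
      (fun μ => Submodule.sub_mem _ (hm μ) (brst_mem L R (hιn μ)))
      (by simp [π.map_brst, π.map_total, πι, ← e])
      (by simp [hs, hsa, brst_total, Finset.sum_sub_distrib])
    have e3 : a = brst L R (b + ι.hom b') + ∑ μ, total μ (l μ + ι.hom (n μ)) := by
      rw [sub_sub, sub_eq_iff_eq_add] at e2
      rw [e2]
      simp only [map_add, Finset.sum_add_distrib]
      abel
    rw [e3]
    exact Submodule.add_mem_sup ⟨_, Submodule.add_mem _ hb hιb, rfl⟩
      (mem_divergences.2 ⟨_, fun μ => Submodule.add_mem _ (hl μ) (hιn μ), rfl⟩)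
  · intro y
    induction y using Submodule.Quotient.induction_on with
    | H y =>
    obtain ⟨a', ha', hsa'⟩ := y
    obtain ⟨m, hm, hsa⟩ := mem_divergences.1 hsa'
    have hιa : ι.hom a' ∈ ghPart U F P k := ι.hom_mem _ _ ha'
    have hιm μ : ι.hom (m μ) ∈ ghPart U F P (k + 1) := ι.hom_mem _ _ (hm μ)
    -- The lift ιa' fails to be a cocycle modulo d by an element of the kernel of π, because ι is
    -- not a chain map. Filling this defect corrects the lift without changing its image.
    obtain ⟨b, hb, n, hn, e, hπb⟩ := fill (k + 1)
      (brst L R (ι.hom a') - ∑ μ, total μ (ι.hom (m μ)))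
      (fun μ => - brst L R (ι.hom (m μ)))
      (Submodule.sub_mem _ (brst_mem L R hιa)
        (Submodule.sum_mem _ fun μ _ => total_mem μ (hιm μ)))
      (fun μ => Submodule.neg_mem _ (brst_mem L R (hιm μ)))
      (by simp [π.map_brst, π.map_total, πι, hsa])
      (by simp [hs, brst_total])
    rw [add_sub_cancel_right] at hb
    refine ⟨Submodule.Quotient.mk ⟨ι.hom a' - b, Submodule.sub_mem _ hιa hb, ?_⟩, ?_⟩
    · refine mem_divergences.2 ⟨fun μ => ι.hom (m μ) + n μ,
        fun μ => Submodule.add_mem _ (hιm μ) (hn μ), ?_⟩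
      rw [sub_eq_iff_eq_add] at e
      rw [map_sub, e]
      simp only [map_add, Finset.sum_add_distrib]
      abel
    · change Submodule.Quotient.mk _ = Submodule.Quotient.mk _
      congr 1
      apply Subtype.ext
      change π.toAlgHom (ι.hom a' - b) = a'
      rw [map_sub, πι, hπb, sub_zero]

end Criterion

/-! ### Two-forms in four dimensions -/

/-- Index pairs `μ < ν`, which label the components of two-forms. -/
abbrev Pair : Type := {p : Fin 4 × Fin 4 // p.1 < p.2}

namespace Pair

/-- The pair of the two remaining indices. -/
def compl (p : Pair) : Pair :=
  if p = ⟨(0, 1), by decide⟩ then ⟨(2, 3), by decide⟩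
  else if p = ⟨(0, 2), by decide⟩ then ⟨(1, 3), by decide⟩
  else if p = ⟨(0, 3), by decide⟩ then ⟨(1, 2), by decide⟩
  else if p = ⟨(1, 2), by decide⟩ then ⟨(0, 3), by decide⟩
  else if p = ⟨(1, 3), by decide⟩ then ⟨(0, 2), by decide⟩
  else ⟨(0, 1), by decide⟩

/-- The sign of the permutation `(p, compl p)`. -/
def sgn (p : Pair) : ℝ :=
  if p = ⟨(0, 2), by decide⟩ ∨ p = ⟨(1, 3), by decide⟩ then -1 else 1

theorem forall_iff {q : Pair → Prop} : (∀ p, q p) ↔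
    q ⟨(0, 1), by decide⟩ ∧ q ⟨(0, 2), by decide⟩ ∧ q ⟨(0, 3), by decide⟩ ∧
    q ⟨(1, 2), by decide⟩ ∧ q ⟨(1, 3), by decide⟩ ∧ q ⟨(2, 3), by decide⟩ := by
  refine ⟨fun h => ⟨h _, h _, h _, h _, h _, h _⟩, fun ⟨h1, h2, h3, h4, h5, h6⟩ p => ?_⟩
  obtain ⟨⟨μ, ν⟩, h⟩ := p
  fin_cases μ <;> fin_cases ν <;> first | assumption | exact absurd h (by decide)

theorem sum_eq {M : Type*} [AddCommMonoid M] (f : Pair → M) : ∑ p, f p =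
    f ⟨(0, 1), by decide⟩ + f ⟨(0, 2), by decide⟩ + f ⟨(0, 3), by decide⟩ +
    f ⟨(1, 2), by decide⟩ + f ⟨(1, 3), by decide⟩ + f ⟨(2, 3), by decide⟩ := by
  have : (Finset.univ : Finset Pair) = {⟨(0, 1), by decide⟩, ⟨(0, 2), by decide⟩,
    ⟨(0, 3), by decide⟩, ⟨(1, 2), by decide⟩, ⟨(1, 3), by decide⟩, ⟨(2, 3), by decide⟩} := by
    decide
  rw [this, Finset.sum_insert (by decide), Finset.sum_insert (by decide),
    Finset.sum_insert (by decide), Finset.sum_insert (by decide), Finset.sum_insert (by decide),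
    Finset.sum_singleton]
  simp only [add_assoc]

theorem compl_compl : ∀ p : Pair, p.compl.compl = p := by decide

theorem sgn_compl (p : Pair) : p.compl.sgn = p.sgn := by
  revert p
  rw [forall_iff]
  simp [compl, sgn]

theorem sgn_mul_self (p : Pair) : p.sgn * p.sgn = 1 := by
  unfold sgn; split_ifs <;> norm_num

/-- `η^{μμ} η^{νν}`. -/
def eta (p : Pair) : ℝ := LocalBRST.eta p.1.1 * LocalBRST.eta p.1.2

theorem eta_mul_self (p : Pair) : p.eta * p.eta = 1 := by
  unfold eta LocalBRST.eta; split_ifs <;> norm_num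

/-- Exactly one of two complementary pairs contains the time index. This Lorentzian sign is the
reason that the star squares to -1. -/
theorem eta_compl (p : Pair) : p.compl.eta = -p.eta := by
  revert p
  rw [forall_iff]
  simp [compl, eta, LocalBRST.eta]

/-- The minus sign reflects ε^{0123} = -1 for indices raised with the Minkowski metric. -/
theorem levi_compl (p : Pair) : levi p.1.1 p.1.2 p.compl.1.1 p.compl.1.2 = -p.sgn := by
  revert p
  rw [forall_iff]
  refine ⟨?_, ?_, ?_, ?_, ?_, ?_⟩ <;>
    simp [levi, Matrix.det_succ_row_zero, Fin.sum_univ_succ, compl, sgn, Fin.succAbove]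

theorem _root_.LocalBRST.levi_eq_zero {μ ν ρ τ : Fin 4} (i j : Fin 4) (hij : i ≠ j)
    (h : ![μ, ν, ρ, τ] i = ![μ, ν, ρ, τ] j) : levi μ ν ρ τ = 0 := by
  unfold levi
  rw [Matrix.det_zero_of_row_eq hij, neg_zero]
  funext k
  simp [h]

theorem levi_eq (p q : Pair) : levi p.1.1 p.1.2 q.1.1 q.1.2 = if q = p.compl then -p.sgn else 0 := by
  split_ifs with h
  · rw [h, levi_compl]
  · have : ∀ p q : Pair, q ≠ p.compl →
        p.1.1 = q.1.1 ∨ p.1.1 = q.1.2 ∨ p.1.2 = q.1.1 ∨ p.1.2 = q.1.2 := by decide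
    rcases this p q h with h | h | h | h
    · exact levi_eq_zero 0 2 (by decide) h
    · exact levi_eq_zero 0 3 (by decide) h
    · exact levi_eq_zero 1 2 (by decide) h
    · exact levi_eq_zero 1 3 (by decide) h

end Pair

section TwoForms

variable {V : Type*} [AddCommGroup V] [Module ℝ V]

/-- `½ ε^{μνρτ} X_ρτ`. -/
def wedgeDual (X : Pair → V) (p : Pair) : V := (-p.sgn) • X p.compl

/-- The Hodge dual `-½ ε_{μν}^{ρτ} X_ρτ`, which squares to `-1`. -/
def star (X : Pair → V) (p : Pair) : V := -(p.sgn * p.eta) • X p.compl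

theorem sum_levi_smul (X : Pair → V) (p : Pair) :
    ∑ q : Pair, levi p.1.1 p.1.2 q.1.1 q.1.2 • X q = wedgeDual X p := by
  simp [Pair.levi_eq, wedgeDual, ite_smul]

theorem wedgeDual_wedgeDual (X : Pair → V) : wedgeDual (wedgeDual X) = X := by
  funext p
  simp [wedgeDual, Pair.sgn_compl, Pair.compl_compl, smul_smul, Pair.sgn_mul_self]

/-- The two dualizations cancel and leave the metric contraction. This turns the I part of H ∧ G
into the Maxwell term. -/
theorem wedgeDual_star (X : Pair → V) (p : Pair) : wedgeDual (star X) p = -p.eta • X p := by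
  have := Pair.sgn_mul_self p
  simp only [wedgeDual, star, Pair.sgn_compl, Pair.compl_compl, smul_smul, Pair.eta_compl]
  congr 1
  linear_combination (-p.eta) * this

theorem star_star (X : Pair → V) : star (star X) = -X := by
  funext p
  have h1 := Pair.sgn_mul_self p
  have h2 := Pair.eta_mul_self p
  simp only [star, Pair.sgn_compl, Pair.compl_compl, smul_smul, Pair.eta_compl, Pi.neg_apply]
  rw [← neg_one_smul ℝ (X p)]
  congr 1
  linear_combination (-(p.eta * p.eta)) * h1 - h2

/-- The antisymmetric extension of a two-form. -/
def asym (X : Pair → V) (ν μ : Fin 4) : V :=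
  if h : ν < μ then X ⟨(ν, μ), h⟩ else if h : μ < ν then -X ⟨(μ, ν), h⟩ else 0

theorem sum_fin_eq_sum_pair (f : Fin 4 → Fin 4 → V) (hf : ∀ μ ν, f ν μ = f μ ν)
    (h0 : ∀ μ, f μ μ = 0) : ∑ μ, ∑ ν, f μ ν = (2 : ℝ) • ∑ p : Pair, f p.1.1 p.1.2 := by
  rw [Pair.sum_eq]
  simp only [Fin.sum_univ_four, h0, hf 0 1, hf 0 2, hf 0 3, hf 1 2, hf 1 3, hf 2 3]
  module

theorem levi_swap_left (μ ν ρ τ : Fin 4) : levi ν μ ρ τ = -levi μ ν ρ τ := by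
  have h := Matrix.det_permute (Equiv.swap (0 : Fin 4) 1)
    (Matrix.of fun i j : Fin 4 => if ![μ, ν, ρ, τ] i = j then (1 : ℝ) else 0)
  rw [Equiv.Perm.sign_swap (by decide)] at h
  unfold levi
  simp only [Units.val_neg, Units.val_one, Int.cast_neg, Int.cast_one, neg_mul, one_mul] at h
  rw [← h, neg_inj]
  congr 1
  ext i j
  fin_cases i <;> rfl

theorem levi_swap_right (μ ν ρ τ : Fin 4) : levi μ ν τ ρ = -levi μ ν ρ τ := by
  have h := Matrix.det_permute (Equiv.swap (2 : Fin 4) 3)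
    (Matrix.of fun i j : Fin 4 => if ![μ, ν, ρ, τ] i = j then (1 : ℝ) else 0)
  rw [Equiv.Perm.sign_swap (by decide)] at h
  unfold levi
  simp only [Units.val_neg, Units.val_one, Int.cast_neg, Int.cast_one, neg_mul, one_mul] at h
  rw [← h, neg_inj]
  congr 1
  ext i j
  fin_cases i <;> rfl

end TwoForms

/-! ### Exterior derivatives and divergences of local functions -/

section Forms

variable {σ : Type} [Fintype σ] {U : Opens (σ → ℝ)} {F P F' P' : Type}

/-- The curvature `∂_μ a_ν - ∂_ν a_μ` of a one-form of local functions. -/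
def extD (a : Fin 4 → LocalFn U F P) (p : Pair) : LocalFn U F P :=
  total p.1.1 (a p.1.2) - total p.1.2 (a p.1.1)

/-- The divergence `-∂_ν X^{νμ}` of an antisymmetric tensor. -/
def codiv (X : Pair → LocalFn U F P) (μ : Fin 4) : LocalFn U F P := -∑ ν, total ν (asym X ν μ)

/-- Commuting derivatives are contracted with an antisymmetric tensor; this is the Noether identity
of abelian gauge transformations. -/
theorem sum_total_codiv (X : Pair → LocalFn U F P) : ∑ μ, total μ (codiv X μ) = 0 := by
  simp only [codiv, map_neg, Fin.sum_univ_four, asym]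
  simp only [Fin.isValue, lt_self_iff_false, ↓reduceDIte, map_zero, Fin.reduceLT, map_neg, map_add,
    total_comm 1 0, total_comm 2 0, total_comm 3 0, total_comm 2 1, total_comm 3 1, total_comm 3 2]
  abel

/-- The Bianchi identity ddA = 0, written as the divergence of the dual tensor. -/
theorem codiv_wedgeDual_extD (a : Fin 4 → LocalFn U F P) (μ : Fin 4) :
    codiv (wedgeDual (extD a)) μ = 0 := by
  have h : ∀ μ, codiv (wedgeDual (extD a)) μ = 0 := by
    rw [Fin.forall_fin_succ, Fin.forall_fin_succ, Fin.forall_fin_succ, Fin.forall_fin_one]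
    simp only [codiv, Fin.sum_univ_four, asym, wedgeDual, extD, Pair.compl, Pair.sgn]
    refine ⟨?_, ?_, ?_, ?_⟩ <;>
    · simp
      simp only [total_comm 1 0, total_comm 2 0, total_comm 3 0, total_comm 2 1, total_comm 3 1,
        total_comm 3 2]
      abel
  exact h μ

theorem map_extD {f : LocalFn U F P →ₗ[ℝ] LocalFn U F' P'}
    (hf : ∀ μ a, f (total μ a) = total μ (f a)) (a : Fin 4 → LocalFn U F P) (p : Pair) :
    f (extD a p) = extD (fun μ => f (a μ)) p := by
  simp [extD, hf]

theorem map_codiv {f : LocalFn U F P →ₗ[ℝ] LocalFn U F' P'}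
    (hf : ∀ μ a, f (total μ a) = total μ (f a)) (X : Pair → LocalFn U F P) (μ : Fin 4) :
    f (codiv X μ) = codiv (fun p => f (X p)) μ := by
  have h (ν : Fin 4) : f (asym X ν μ) = asym (fun p => f (X p)) ν μ := by
    unfold asym; split_ifs <;> simp
  simp [codiv, hf, h]

theorem map_wedgeDual {V W : Type*} [AddCommGroup V] [Module ℝ V] [AddCommGroup W] [Module ℝ W]
    (f : V →ₗ[ℝ] W) (X : Pair → V) (p : Pair) :
    f (wedgeDual X p) = wedgeDual (fun p => f (X p)) p := by
  simp [wedgeDual]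

theorem map_star {V W : Type*} [AddCommGroup V] [Module ℝ V] [AddCommGroup W] [Module ℝ W]
    (f : V →ₗ[ℝ] W) (X : Pair → V) (p : Pair) :
    f (star X p) = star (fun p => f (X p)) p := by
  simp [star]

theorem codiv_congr {X Y : Pair → LocalFn U F P} (h : ∀ p, X p = Y p) (μ : Fin 4) :
    codiv X μ = codiv Y μ := by rw [funext h]

theorem codiv_add (X Y : Pair → LocalFn U F P) (μ : Fin 4) :
    codiv (fun p => X p + Y p) μ = codiv X μ + codiv Y μ := by
  have h (ν : Fin 4) : asym (fun p => X p + Y p) ν μ = asym X ν μ + asym Y ν μ := by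
    unfold asym; split_ifs <;> simp [add_comm]
  simp only [codiv, h, map_add, Finset.sum_add_distrib, neg_add]

theorem codiv_smul (r : ℝ) (X : Pair → LocalFn U F P) (μ : Fin 4) :
    codiv (fun p => r • X p) μ = r • codiv X μ := by
  have h (ν : Fin 4) : asym (fun p => r • X p) ν μ = r • asym X ν μ := by
    unfold asym; split_ifs <;> simp
  simp only [codiv, h, map_smul, ← Finset.smul_sum, smul_neg]

theorem codiv_sum {ι : Type*} (s : Finset ι) (X : ι → Pair → LocalFn U F P) (μ : Fin 4) :
    codiv (fun p => ∑ i ∈ s, X i p) μ = ∑ i ∈ s, codiv (X i) μ := by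
  classical
  induction s using Finset.induction_on with
  | empty => simpa using codiv_smul 0 (0 : Pair → LocalFn U F P) μ
  | insert i s hi ih => simp only [Finset.sum_insert hi, codiv_add, ih]

end Forms

/-! ### Quadratic Lagrangians of two-forms -/

section Quadratic

variable {σ : Type} [Fintype σ] {U : Opens (σ → ℝ)} {F P F' P' : Type}
  {n : Type} [Fintype n]

theorem wedgeDual_symm {B : Type*} [Ring B] [Algebra ℝ B] (X Y : Pair → B) :
    ∑ p, X p * wedgeDual Y p = ∑ p, wedgeDual X p * Y p := by
  simp only [Pair.sum_eq, wedgeDual, Pair.compl, Pair.sgn]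
  simp
  abel

theorem wedgeDual_symm_smul {V : Type*} [AddCommGroup V] [Module ℝ V] (d : Pair → ℝ)
    (X : Pair → V) : ∑ p, wedgeDual d p • X p = ∑ p, d p • wedgeDual X p := by
  simp only [Pair.sum_eq, wedgeDual, Pair.compl, Pair.sgn]
  simp
  abel

/-- The dual field strength `G_i = R_ij H^j + I_ij ⋆H^j`. -/
def dualField (I R : Matrix n n (Coeff U)) (H : n → Pair → LocalFn U F P) (i : n) (p : Pair) :
    LocalFn U F P :=
  ∑ j, (coeff (R i j) * H j p + coeff (I i j) * star (H j) p)

/-- The quadratic form `½ H^i ∧ G_i`. -/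
def kinQuad (I R : Matrix n n (Coeff U)) (H : n → Pair → LocalFn U F P) : LocalFn U F P :=
  (1 / 2 : ℝ) • ∑ i, ∑ p, H i p * wedgeDual (dualField I R H i) p

variable {I R : Matrix n n (Coeff U)} {H : n → Pair → LocalFn U F P}

theorem wedgeDual_dualField (i : n) (p : Pair) : wedgeDual (dualField I R H i) p
    = ∑ j, (coeff (R i j) * wedgeDual (H j) p - p.eta • (coeff (I i j) * H j p)) := by
  simp only [wedgeDual, dualField, Finset.smul_sum, smul_add, ← mul_smul_comm]
  refine Finset.sum_congr rfl fun j _ => ?_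
  have := wedgeDual_star (H j) p
  rw [wedgeDual] at this
  rw [this, neg_smul _ (H j p), mul_neg, mul_smul_comm, mul_smul_comm, sub_eq_add_neg]

theorem kinQuad_eq : kinQuad I R H = (1 / 2 : ℝ) • ∑ i, ∑ j, ∑ p,
    (coeff (R i j) * (H i p * wedgeDual (H j) p) - p.eta • (coeff (I i j) * (H i p * H j p))) := by
  simp only [kinQuad, wedgeDual_dualField, Finset.mul_sum]
  congr 1
  refine Finset.sum_congr rfl fun i _ => ?_
  rw [Finset.sum_comm]
  refine Finset.sum_congr rfl fun j _ => Finset.sum_congr rfl fun p _ => ?_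
  rw [mul_sub, mul_smul_comm, ← mul_assoc, ← mul_assoc, ← coeff_comm, ← coeff_comm]
  simp only [mul_assoc]

theorem map_dualField {f : LocalFn U F P →ₐ[ℝ] LocalFn U F' P'} (hf : ∀ a, f (coeff a) = coeff a)
    (i : n) (p : Pair) :
    f (dualField I R H i p) = dualField I R (fun j q => f (H j q)) i p := by
  have := fun j => map_star f.toLinearMap (H j) p
  simp only [AlgHom.toLinearMap_apply] at this
  simp [dualField, hf, this]

theorem map_kinQuad {f : LocalFn U F P →ₐ[ℝ] LocalFn U F' P'} (hf : ∀ a, f (coeff a) = coeff a) :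
    f (kinQuad I R H) = kinQuad I R (fun j q => f (H j q)) := by
  simp [kinQuad, wedgeDual, map_dualField hf]

theorem kinQuad_zero : kinQuad 0 0 H = 0 := by simp [kinQuad_eq]

/-- Serves the derivatives with respect to scalars, which act on the kinetic matrices only. With
zero matrices it also covers derivatives that annihilate the whole quadratic form. -/
theorem derivation_kinQuad_coeff {D : LocalFn U F P →ₗ[ℝ] LocalFn U F P}
    (hD : ∀ a b, D (a * b) = D a * b + a * D b) {I₂ R₂ : Matrix n n (Coeff U)}
    (hI : ∀ i j, D (coeff (I i j)) = coeff (I₂ i j)) (hR : ∀ i j, D (coeff (R i j)) = coeff (R₂ i j))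
    (hH : ∀ i p, D (H i p) = 0) : D (kinQuad I R H) = kinQuad I₂ R₂ H := by
  have h (j : n) (p : Pair) : D (wedgeDual (H j) p) = 0 := by simp [wedgeDual, hH]
  simp [kinQuad_eq, hD, hI, hR, hH, h]

/-- Symmetry of the kinetic matrices and of the wedge pairing makes the two variations equal, which
cancels the factor ½. Constant variations suffice since the two-forms are linear in the fields. -/
theorem derivation_kinQuad {D : LocalFn U F P →ₗ[ℝ] LocalFn U F P}
    (hD : ∀ a b, D (a * b) = D a * b + a * D b)
    (hI : ∀ i j, D (coeff (I i j)) = 0) (hR : ∀ i j, D (coeff (R i j)) = 0)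
    (sI : I.IsSymm) (sR : R.IsSymm) {d : n → Pair → ℝ}
    (hH : ∀ i p, D (H i p) = algebraMap ℝ _ (d i p)) :
    D (kinQuad I R H) = ∑ i, ∑ p, d i p • wedgeDual (dualField I R H i) p := by
  have h (j : n) (p : Pair) : D (wedgeDual (H j) p) = algebraMap ℝ _ (wedgeDual (d j) p) := by
    simp only [wedgeDual, map_smul, hH]
    rw [smul_eq_mul, map_mul, ← Algebra.smul_def]
  have rhs : ∑ i, ∑ p, d i p • wedgeDual (dualField I R H i) p = ∑ i, ∑ j, ∑ p,
      (d i p • (coeff (R i j) * wedgeDual (H j) p)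
        - d i p • (p.eta • (coeff (I i j) * H j p))) := by
    simp only [wedgeDual_dualField, Finset.smul_sum, smul_sub]
    exact Finset.sum_congr rfl fun i _ => Finset.sum_comm
  rw [rhs]
  simp only [kinQuad_eq, map_smul, map_sum, map_sub, hD, hI, hR, zero_mul, zero_add, hH, h]
  have e1 (i j : n) : ∑ p, coeff (R i j) * (algebraMap ℝ _ (d i p) * wedgeDual (H j) p
        + H i p * algebraMap ℝ _ (wedgeDual (d j) p))
      = ∑ p, d i p • (coeff (R i j) * wedgeDual (H j) p)
        + ∑ p, d j p • (coeff (R j i) * wedgeDual (H i) p) := by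
    rw [sR.apply]
    have e := wedgeDual_symm_smul (d j) (fun p => coeff (R j i) * H i p)
    simp only [mul_add, Finset.sum_add_distrib, ← Algebra.smul_def, ← Algebra.commutes,
      mul_smul_comm]
    rw [e]
    simp [wedgeDual]
  have e2 (i j : n) (p : Pair) : p.eta • (coeff (I i j) * (algebraMap ℝ _ (d i p) * H j p
        + H i p * algebraMap ℝ _ (d j p)))
      = d i p • (p.eta • (coeff (I i j) * H j p)) + d j p • (p.eta • (coeff (I j i) * H i p)) := by
    rw [sI.apply, ← Algebra.commutes, ← Algebra.smul_def, ← Algebra.smul_def, mul_add, smul_add,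
      mul_smul_comm, mul_smul_comm, smul_comm, smul_comm (p.eta) (d j p)]
  simp only [Finset.sum_sub_distrib, e1, e2, Finset.sum_add_distrib]
  rw [Finset.sum_comm (f := fun i j => ∑ p, d j p • (coeff (R j i) * wedgeDual (H i) p)),
    Finset.sum_comm (f := fun i j => ∑ p, d j p • (p.eta • (coeff (I j i) * H i p)))]
  module

end Quadratic

/-! ### The Lagrangians in terms of two-forms -/

section LagrangianForms

variable {σ : Type} [Fintype σ] {U : Opens (σ → ℝ)} {F P : Type} {n a : Type} [Fintype n]
  [Fintype a]

/-- A matrix of functions of the scalars as a matrix of functions of `(x, φ)`. -/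
def coeffMatrix {m k : Type*} (A : Matrix m k (SmoothFn U)) : Matrix m k (Coeff U) :=
  A.map Coeff.ofScalar

/-- Summation over all indices counts each pair μ < ν twice in the Maxwell term and each pair of
pairs four times in the ε term, so -¼ and ⅛ become -½ and ½. -/
theorem kineticLagrangian_eq (I R : Matrix n n (SmoothFn U))
    (H : n → Fin 4 → Fin 4 → ghPart U F P 0) (hH : ∀ i μ ν, H i ν μ = -H i μ ν) :
    (kineticLagrangian I R H).1
      = kinQuad (coeffMatrix I) (coeffMatrix R) fun i p => (H i p.1.1 p.1.2).1 := by
  have h0 (i μ) : (H i μ μ).1 = 0 := by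
    have h := congrArg Subtype.val (hH i μ μ)
    change (H i μ μ).1 = -(H i μ μ).1 at h
    have : (2 : ℝ) • (H i μ μ).1 = 0 := by rw [two_smul]; nth_rewrite 1 [h]; simp
    exact (smul_eq_zero.1 this).resolve_left two_ne_zero
  have hs (i μ ν) : (H i ν μ).1 = -(H i μ ν).1 := congrArg Subtype.val (hH i μ ν)
  have e1 (i j) : ∑ μ, ∑ ν, (eta μ * eta ν) •
        (coeff (Coeff.ofScalar (I i j)) * ((H i μ ν).1 * (H j μ ν).1))
      = (2 : ℝ) • ∑ p : Pair, p.eta • (coeff (Coeff.ofScalar (I i j)) *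
        ((H i p.1.1 p.1.2).1 * (H j p.1.1 p.1.2).1)) := by
    rw [sum_fin_eq_sum_pair]
    · rfl
    · intro μ ν; rw [hs i, hs j, neg_mul_neg, mul_comm (eta μ)]
    · intro μ; simp [h0]
  have e2 (i j) : ∑ μ, ∑ ν, ∑ ρ, ∑ τ, levi μ ν ρ τ •
        (coeff (Coeff.ofScalar (R i j)) * ((H i μ ν).1 * (H j ρ τ).1))
      = (4 : ℝ) • ∑ p : Pair, coeff (Coeff.ofScalar (R i j)) *
        ((H i p.1.1 p.1.2).1 * wedgeDual (fun q => (H j q.1.1 q.1.2).1) p) := by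
    rw [sum_fin_eq_sum_pair]
    · simp only [← sum_levi_smul, Finset.smul_sum, Finset.mul_sum]
      refine Finset.sum_congr rfl fun p _ => ?_
      rw [sum_fin_eq_sum_pair]
      · simp only [Finset.smul_sum, smul_smul, mul_smul_comm]
        refine Finset.sum_congr rfl fun q _ => ?_
        congr 1
        ring
      · intro μ ν; rw [hs j, levi_swap_right]; simp
      · intro μ; simp [h0]
    · intro μ ν
      refine Finset.sum_congr rfl fun ρ _ => Finset.sum_congr rfl fun τ _ => ?_
      rw [hs i, levi_swap_left]; simp
    · intro μ; simp [h0]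
  rw [kinQuad_eq]
  simp only [kineticLagrangian, e1, e2, Finset.sum_sub_distrib, ← Finset.smul_sum]
  simp only [coeffMatrix, Matrix.map_apply]
  module

theorem curvature_swap (A : Fin 4 → F) (μ ν : Fin 4) :
    (curvature A ν μ : ghPart U F P 0) = -curvature A μ ν := by
  apply Subtype.ext
  simp [curvature]

theorem curvature_eq (A : Fin 4 → F) (p : Pair) :
    (curvature A p.1.1 p.1.2 : ghPart U F P 0).1 = extD (fun μ => jet (.field (A μ)) 0) p := by
  simp [curvature, extD, total_jet]

omit [Fintype n] [Fintype a] in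
theorem twoForm_swap (α : a) (μ ν : Fin 4) :
    (twoForm α ν μ : ghPart U (EmbField n a) P 0) = -twoForm α μ ν := by
  unfold twoForm
  rcases lt_trichotomy μ ν with h | h | h
  · simp [h, h.not_gt]
  · simp [h]
  · simp [h, h.not_gt]

omit [Fintype n] [Fintype a] in
theorem twoForm_eq (α : a) (p : Pair) : (twoForm α p.1.1 p.1.2 : ghPart U (EmbField n a) P 0).1
    = jet (.field (.twoForm α p)) 0 := by
  unfold twoForm
  rw [dif_pos p.2]

omit [Fintype n] in
theorem embCurvature_swap (Θmag : Matrix n a ℝ) (i : n) (μ ν : Fin 4) :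
    (embCurvature Θmag i ν μ : ghPart U (EmbField n a) P 0) = -embCurvature Θmag i μ ν := by
  simp only [embCurvature, curvature_swap _ μ ν, twoForm_swap _ μ ν, smul_neg,
    Finset.sum_neg_distrib]
  abel

variable (U P n a) in
/-- The components of the two-form `B_α`. -/
def tensorForm (α : a) (p : Pair) : LocalFn U (EmbField n a) P := jet (.field (.twoForm α p)) 0

variable (U P) in
/-- The components of the two-form `H^i`. -/
def embH (Θmag : Matrix n a ℝ) (i : n) (p : Pair) : LocalFn U (EmbField n a) P :=
  extD (fun μ => jet (.field (.electric i μ)) 0) p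
    + (1 / 2 : ℝ) • ∑ α, Θmag i α • tensorForm U P n a α p

variable (U P a) in
/-- The curvature of the magnetic vectors. -/
def magF (i : n) (p : Pair) : LocalFn U (EmbField n a) P :=
  extD (fun μ => jet (.field (.magnetic i μ)) 0) p

omit [Fintype n] in
theorem embCurvature_eq (Θmag : Matrix n a ℝ) (i : n) (p : Pair) :
    (embCurvature Θmag i p.1.1 p.1.2 : ghPart U (EmbField n a) P 0).1 = embH U P Θmag i p := by
  simp [embCurvature, embH, curvature_eq, twoForm_eq, tensorForm]

theorem topologicalLagrangian_eq (Θel Θmag : Matrix n a ℝ) :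
    (topologicalLagrangian Θel Θmag : ghPart U (EmbField n a) P 0).1
      = -(1 / 2 : ℝ) • ∑ i, ∑ α, Θmag i α • ∑ p, tensorForm U P n a α p *
          wedgeDual (fun q => magF U P a i q
            - (1 / 4 : ℝ) • ∑ β, Θel i β • tensorForm U P n a β q) p := by
  have h0 (α : a) (μ) : (twoForm α μ μ : ghPart U (EmbField n a) P 0) = 0 := by simp [twoForm]
  have hs (i ρ τ) : (curvature (.magnetic i) τ ρ
        - (1 / 4 : ℝ) • ∑ β, Θel i β • twoForm β τ ρ : ghPart U (EmbField n a) P 0)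
      = -(curvature (.magnetic i) ρ τ - (1 / 4 : ℝ) • ∑ β, Θel i β • twoForm β ρ τ) := by
    simp only [curvature_swap _ ρ τ, twoForm_swap _ ρ τ, smul_neg, Finset.sum_neg_distrib]
    abel
  have hs0 (i ρ) : (curvature (.magnetic i) ρ ρ
        - (1 / 4 : ℝ) • ∑ β, Θel i β • twoForm β ρ ρ : ghPart U (EmbField n a) P 0) = 0 := by
    apply Subtype.ext; simp [h0, curvature]
  unfold topologicalLagrangian
  simp only
  rw [sum_fin_eq_sum_pair]
  · have e (p : Pair) : ∑ ρ, ∑ τ, ∑ i, ∑ α, (levi p.1.1 p.1.2 ρ τ * Θmag i α) •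
        ((twoForm α p.1.1 p.1.2 : ghPart U (EmbField n a) P 0).1 *
        (curvature (.magnetic i) ρ τ - (1 / 4 : ℝ) • ∑ β, Θel i β • twoForm β ρ τ :
          ghPart U (EmbField n a) P 0).1)
        = (2 : ℝ) • ∑ i, ∑ α, Θmag i α • (tensorForm U P n a α p *
          wedgeDual (fun q => magF U P a i q
            - (1 / 4 : ℝ) • ∑ β, Θel i β • tensorForm U P n a β q) p) := by
      rw [sum_fin_eq_sum_pair]
      · congr 1
        rw [Finset.sum_comm]
        refine Finset.sum_congr rfl fun i _ => ?_
        rw [Finset.sum_comm]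
        refine Finset.sum_congr rfl fun α _ => ?_
        rw [← sum_levi_smul, Finset.mul_sum, Finset.smul_sum]
        refine Finset.sum_congr rfl fun q _ => ?_
        rw [mul_comm (levi _ _ _ _), mul_smul, mul_smul_comm, twoForm_eq]
        congr 3
        simp [curvature_eq, twoForm_eq, magF, tensorForm]
      · intro ρ τ
        refine Finset.sum_congr rfl fun i _ => Finset.sum_congr rfl fun α _ => ?_
        rw [hs i ρ τ, levi_swap_right]
        simp only [NegMemClass.coe_neg, mul_neg, neg_mul, smul_neg, neg_smul, neg_neg]
      · intro ρ
        refine Finset.sum_eq_zero fun i _ => Finset.sum_eq_zero fun α _ => ?_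
        rw [hs0]; simp
    simp only [e, ← Finset.smul_sum, smul_smul]
    congr 1
    · norm_num
    rw [Finset.sum_comm]
    refine Finset.sum_congr rfl fun i _ => ?_
    rw [Finset.sum_comm]
    simp only [Finset.smul_sum]
  · intro μ ν
    refine Finset.sum_congr rfl fun ρ _ => Finset.sum_congr rfl fun τ _ =>
      Finset.sum_congr rfl fun i _ => Finset.sum_congr rfl fun α _ => ?_
    rw [twoForm_swap α μ ν, levi_swap_left]; simp
  · intro μ
    simp [h0]

end LagrangianForms

/-! ### Field equations -/

section JetPartial

variable {σ : Type} [Fintype σ] {U : Opens (σ → ℝ)} {F P F' P' : Type}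

open Classical in
theorem jetPartial_jet (z : Gen σ F P) (ν : Fin 4 →₀ ℕ) (w : Gen σ F P) (κ : Fin 4 →₀ ℕ) :
    jetPartial z ν (jet w κ : LocalFn U F P) = if (w, κ) = (z, ν) then 1 else 0 :=
  (partialData (z, ν)).toLinearMap_jet (w, κ)

theorem jetPartial_coeff_of_ne {z : Gen σ F P} {ν : Fin 4 →₀ ℕ} (h : ∀ i, (z, ν) ≠ (.scalar i, 0))
    (f : Coeff U) : jetPartial z ν (coeff f : LocalFn U F P) = 0 := by
  refine ((partialData (z, ν)).toLinearMap_coeff f).trans ?_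
  simp [partialData, h]

theorem jetPartial_scalar_coeff (i : σ) (f : Coeff U) :
    jetPartial (.scalar i) 0 (coeff f : LocalFn U F P) = coeff (Coeff.dphi U i f) := by
  refine ((partialData (.scalar i, 0)).toLinearMap_coeff f).trans ?_
  simp only [partialData, LinearMap.sum_apply]
  rw [Finset.sum_eq_single i]
  · simp
  · intro j _ hj; simp [hj.symm]
  · simp

theorem jetPartial_mul {z : Gen σ F P} (hz : z.gh = 0) (ν : Fin 4 →₀ ℕ) (a b : LocalFn U F P) :
    jetPartial z ν (a * b) = jetPartial z ν a * b + a * jetPartial z ν b := by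
  have h := (partialData (U := U) (z, ν)).isGradedDerivation
  have e : -(z, ν).1.gh = 0 := by simp [hz]
  have h' : IsGradedDerivation (AlgHom.id ℝ (LocalFn U F P)) 0 (jetPartial z ν) :=
    e ▸ (show IsGradedDerivation _ (-(z, ν).1.gh) (jetPartial z ν) from h)
  exact h'.leibniz_zero a b

theorem jetPartial_extD [DecidableEq F] (A : Fin 4 → F) (b : F)
    (ν : Fin 4) (p : Pair) :
    jetPartial (.field b) (Finsupp.single ν 1)
      (extD (fun μ => jet (.field (A μ)) 0) p : LocalFn U F P)
      = algebraMap ℝ _ ((if A p.1.2 = b ∧ p.1.1 = ν then 1 else 0)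
        - (if A p.1.1 = b ∧ p.1.2 = ν then 1 else 0)) := by
  simp [extD, total_jet, jetPartial_jet, Finsupp.single_left_inj, apply_ite (algebraMap ℝ _)]

theorem jetPartial_zero_extD (A : Fin 4 → F) (b : F) (p : Pair) :
    jetPartial (.field b) 0 (extD (fun μ => jet (.field (A μ)) 0) p : LocalFn U F P) = 0 := by
  simp [extD, total_jet, jetPartial_jet]

theorem jetPartial_scalar_extD (A : Fin 4 → F) (i : σ) (ν : Fin 4 →₀ ℕ) (p : Pair) :
    jetPartial (.scalar i) ν (extD (fun μ => jet (.field (A μ)) 0) p : LocalFn U F P) = 0 := by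
  simp [extD, total_jet, jetPartial_jet]

/-- The coefficients are those of ∂F_p/∂(∂_νA_μ). Contracting them with a two-form extracts the
component that enters the Euler-Lagrange equation. -/
theorem sum_ite_pair_smul {V : Type*} [AddCommGroup V] [Module ℝ V] (X : Pair → V) (μ ν : Fin 4) :
    ∑ p : Pair, ((if p.1.2 = μ ∧ p.1.1 = ν then (1 : ℝ) else 0)
        - (if p.1.1 = μ ∧ p.1.2 = ν then 1 else 0)) • X p = asym X ν μ := by
  rw [Pair.sum_eq]
  unfold asym
  fin_cases μ <;> fin_cases ν <;> simp

end JetPartial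

section EulerLagrange

variable {σ : Type} [Fintype σ] {U : Opens (σ → ℝ)} {F P : Type} {n a : Type} [Fintype n]
  [Fintype a]

/-- The scalar part of the field equation of the scalars. -/
def scalarEL (F P : Type) (g : Matrix σ σ (SmoothFn U)) (i : σ) : LocalFn U F P :=
  eulerLagrange (scalarLagrangian g).1 (.scalar i)

/-- The subalgebra of functions of the scalars and their derivatives. -/
def scalarSubalgebra (U : Opens (σ → ℝ)) (F P : Type) : Subalgebra ℝ (LocalFn U F P) :=
  Algebra.adjoin ℝ (Set.range coeff ∪ Set.range fun v : σ × (Fin 4 →₀ ℕ) => jet (.scalar v.1) v.2)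

theorem coeff_mem_scalarSubalgebra (f : Coeff U) : coeff f ∈ scalarSubalgebra U F P :=
  Algebra.subset_adjoin (.inl ⟨f, rfl⟩)

theorem jet_mem_scalarSubalgebra (i : σ) (ν) : jet (.scalar i) ν ∈ scalarSubalgebra U F P :=
  Algebra.subset_adjoin (.inr ⟨(i, ν), rfl⟩)

theorem scalarSubalgebra_le_ghPart {a : LocalFn U F P} (ha : a ∈ scalarSubalgebra U F P) :
    a ∈ ghPart U F P 0 := by
  induction ha using Algebra.adjoin_induction with
  | mem x hx =>
    rcases hx with ⟨f, rfl⟩ | ⟨v, rfl⟩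
    · exact coeff_mem_ghPart f
    · exact jet_mem_ghPart (.scalar v.1) v.2
  | algebraMap r => rw [← AlgHom.commutes coeff]; exact coeff_mem_ghPart _
  | add x y _ _ hx hy => exact Submodule.add_mem _ hx hy
  | mul x y _ _ hx hy => exact mul_mem_ghPart_zero hx hy

/-- A graded derivation that vanishes on the scalars vanishes on the functions of the scalars. -/
theorem IsGradedDerivation.eq_zero_of_mem_scalarSubalgebra {B : Type*} [Ring B] [Algebra ℝ B]
    {φ : LocalFn U F P →ₐ[ℝ] B} {p : ℤ} {D : LocalFn U F P →ₗ[ℝ] B} (hD : IsGradedDerivation φ p D)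
    (hc : ∀ f, D (coeff f) = 0) (hj : ∀ i ν, D (jet (.scalar i) ν) = 0) {a : LocalFn U F P}
    (ha : a ∈ scalarSubalgebra U F P) : D a = 0 := by
  induction ha using Algebra.adjoin_induction with
  | mem x hx =>
    rcases hx with ⟨f, rfl⟩ | ⟨v, rfl⟩
    · exact hc f
    · exact hj v.1 v.2
  | algebraMap r => rw [← AlgHom.commutes coeff]; exact hc _
  | add x y _ _ hx hy => rw [map_add, hx, hy, add_zero]
  | mul x y h1 _ hx hy => rw [hD (scalarSubalgebra_le_ghPart h1), hx, hy]; simp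

theorem map_mem_scalarSubalgebra {D : LocalFn U F P →ₗ[ℝ] LocalFn U F P}
    (hD : ∀ a b, D (a * b) = D a * b + a * D b)
    (hc : ∀ f, D (coeff f) ∈ scalarSubalgebra U F P)
    (hj : ∀ i ν, D (jet (.scalar i) ν) ∈ scalarSubalgebra U F P) {a : LocalFn U F P}
    (ha : a ∈ scalarSubalgebra U F P) : D a ∈ scalarSubalgebra U F P := by
  induction ha using Algebra.adjoin_induction with
  | mem x hx =>
    rcases hx with ⟨f, rfl⟩ | ⟨v, rfl⟩
    · exact hc f
    · exact hj v.1 v.2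
  | algebraMap r => rw [← AlgHom.commutes coeff]; exact hc _
  | add x y _ _ hx hy => rw [map_add]; exact add_mem hx hy
  | mul x y h1 h2 hx hy => rw [hD]; exact add_mem (mul_mem hx h2) (mul_mem h1 hy)

theorem jetPartial_mem_scalarSubalgebra (i : σ) (ν) {a : LocalFn U F P}
    (ha : a ∈ scalarSubalgebra U F P) : jetPartial (.scalar i) ν a ∈ scalarSubalgebra U F P := by
  refine map_mem_scalarSubalgebra (jetPartial_mul rfl ν) (fun f => ?_)
    (fun j κ => ?_) ha
  · by_cases h : ν = 0
    · rw [h, jetPartial_scalar_coeff]; exact coeff_mem_scalarSubalgebra _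
    · rw [jetPartial_coeff_of_ne (by simp [h])]; exact zero_mem _
  · rw [jetPartial_jet]
    split_ifs
    · exact one_mem _
    · exact zero_mem _

theorem total_mem_scalarSubalgebra (μ : Fin 4) {a : LocalFn U F P}
    (ha : a ∈ scalarSubalgebra U F P) : total μ a ∈ scalarSubalgebra U F P := by
  refine map_mem_scalarSubalgebra (total_mul μ) (fun f => ?_) (fun j κ => ?_) ha
  · rw [total_coeff]
    exact add_mem (coeff_mem_scalarSubalgebra _) (sum_mem fun i _ =>
      mul_mem (coeff_mem_scalarSubalgebra _) (jet_mem_scalarSubalgebra i _))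
  · rw [total_jet]; exact jet_mem_scalarSubalgebra _ _

theorem scalarLagrangian_mem (g : Matrix σ σ (SmoothFn U)) :
    (scalarLagrangian g).1 ∈ scalarSubalgebra U F P :=
  (scalarSubalgebra U F P).smul_mem (sum_mem fun _ _ => sum_mem fun _ _ => sum_mem fun _ _ =>
    (scalarSubalgebra U F P).smul_mem (mul_mem (coeff_mem_scalarSubalgebra _)
      (mul_mem (jet_mem_scalarSubalgebra _ _) (jet_mem_scalarSubalgebra _ _))) _) _

theorem scalarEL_mem (g : Matrix σ σ (SmoothFn U)) (i : σ) :
    scalarEL F P g i ∈ scalarSubalgebra U F P :=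
  sub_mem (jetPartial_mem_scalarSubalgebra _ _ (scalarLagrangian_mem g))
    (sum_mem fun μ _ => total_mem_scalarSubalgebra μ
      (jetPartial_mem_scalarSubalgebra _ _ (scalarLagrangian_mem g)))

theorem jetPartial_field_scalarLagrangian (g : Matrix σ σ (SmoothFn U)) (b : F) (ν) :
    jetPartial (.field b) ν (scalarLagrangian g : ghPart U F P 0).1 = 0 :=
  (partialData (U := U) (.field b, ν)).isGradedDerivation.eq_zero_of_mem_scalarSubalgebra
    (fun f => jetPartial_coeff_of_ne (by simp) f)
    (fun i κ => (jetPartial_jet _ _ _ _).trans (by simp)) (scalarLagrangian_mem g)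

/-- A general local map does not commute with ∂/∂φ, since it may send other fields to expressions
involving scalars. On the subalgebra of the scalars it does, and the scalar Lagrangian lies there.
-/
theorem map_scalarEL {F' P' : Type} {f : LocalFn U F P →ₐ[ℝ] LocalFn U F' P'}
    (hc : ∀ a, f (coeff a) = coeff a) (ht : ∀ μ a, f (total μ a) = total μ (f a))
    (hs : ∀ i, f (jet (.scalar i) 0) = jet (.scalar i) 0) (g : Matrix σ σ (SmoothFn U)) (i : σ) :
    f (scalarEL F P g i) = scalarEL F' P' g i := by
  have hj (i ν) : f (jet (.scalar i) ν) = jet (.scalar i) ν := by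
    rw [jet_eq_totalPow, jet_eq_totalPow _ ν, ← hs]
    exact map_totalPow (f := f.toLinearMap) ht ν _
  have hg : ∀ a ∈ scalarSubalgebra U F P, f a ∈ ghPart U F' P' 0 := fun a ha => by
    refine scalarSubalgebra_le_ghPart ?_
    induction ha using Algebra.adjoin_induction with
    | mem x hx =>
      rcases hx with ⟨f, rfl⟩ | ⟨v, rfl⟩
      · rw [hc]; exact coeff_mem_scalarSubalgebra _
      · simp only [hj]; exact jet_mem_scalarSubalgebra _ _
    | algebraMap r => rw [AlgHom.commutes]; exact Subalgebra.algebraMap_mem _ _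
    | add x y _ _ hx hy => rw [map_add]; exact add_mem hx hy
    | mul x y _ _ hx hy => rw [map_mul]; exact mul_mem hx hy
  have key (ν) : ∀ a ∈ scalarSubalgebra U F P,
      f (jetPartial (.scalar i) ν a) = jetPartial (.scalar i) ν (f a) := fun a ha => by
    induction ha using Algebra.adjoin_induction with
    | mem x hx =>
      rcases hx with ⟨f, rfl⟩ | ⟨v, rfl⟩
      · rw [hc]
        by_cases h : ν = 0
        · rw [h, jetPartial_scalar_coeff, jetPartial_scalar_coeff, hc]
        · rw [jetPartial_coeff_of_ne (by simp [h]), jetPartial_coeff_of_ne (by simp [h]), map_zero]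
      · simp only [hj, jetPartial_jet]
        by_cases h : v.1 = i ∧ v.2 = ν
        · rw [if_pos (by rw [h.1, h.2]), if_pos (by rw [h.1, h.2]), map_one]
        · rw [if_neg (by simpa using h), if_neg (by simpa using h), map_zero]
    | algebraMap r =>
      rw [AlgHom.commutes, ← AlgHom.commutes coeff, ← AlgHom.commutes coeff]
      by_cases h : ν = 0
      · rw [h, jetPartial_scalar_coeff, jetPartial_scalar_coeff, hc]
      · rw [jetPartial_coeff_of_ne (by simp [h]), jetPartial_coeff_of_ne (by simp [h]), map_zero]
    | add x y _ _ hx hy => simp only [map_add, hx, hy]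
    | mul x y _ _ hx hy =>
      rw [jetPartial_mul rfl, map_add, map_mul, map_mul, hx, hy, map_mul, jetPartial_mul rfl]
  have hL : f (scalarLagrangian g).1 = (scalarLagrangian g).1 := by
    simp [scalarLagrangian, hc, hj]
  simp only [scalarEL, eulerLagrange, map_sub, map_sum, ht, key _ _ (scalarLagrangian_mem g), hL]

/-- The matrix of the derivatives with respect to `φ^i`. -/
def dphiMatrix {m k : Type*} (i : σ) (A : Matrix m k (Coeff U)) : Matrix m k (Coeff U) :=
  A.map (Coeff.dphi U i)

variable {g : Matrix σ σ (SmoothFn U)} {I R : Matrix n n (SmoothFn U)}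

omit [Fintype n] in
theorem isSymm_coeffMatrix {A : Matrix n n (SmoothFn U)} (h : A.IsSymm) : (coeffMatrix A).IsSymm :=
  h.map _

/-! ### Field equations of the second-order vector theory -/

section Vector

variable (U P n) in
/-- The curvature of the vectors. -/
def vecF (i : n) (p : Pair) : LocalFn U (n × Fin 4) P := extD (fun μ => jet (.field (i, μ)) 0) p

theorem vectorLagrangian_eq : (vectorLagrangian g I R : ghPart U (n × Fin 4) P 0).1
    = (scalarLagrangian g).1 + kinQuad (coeffMatrix I) (coeffMatrix R) (vecF U P n) := by
  have h := kineticLagrangian_eq (P := P) I R (fun i => curvature fun μ => (i, μ))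
    (fun i => curvature_swap _)
  simp only [curvature_eq] at h
  exact congrArg (_ + ·) h

theorem eulerLagrange_vector_field (sI : I.IsSymm) (sR : R.IsSymm) (i : n) (μ : Fin 4) :
    eulerLagrange (vectorLagrangian g I R : ghPart U (n × Fin 4) P 0).1 (.field (i, μ))
      = codiv (wedgeDual (dualField (coeffMatrix I) (coeffMatrix R) (vecF U P n) i)) μ := by
  classical
  have h0 := derivation_kinQuad (H := vecF U P n) (I := coeffMatrix I) (R := coeffMatrix R)
    (D := jetPartial (.field (i, μ)) 0) (jetPartial_mul rfl 0)
    (fun _ _ => jetPartial_coeff_of_ne (by simp) _) (fun _ _ => jetPartial_coeff_of_ne (by simp) _)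
    (isSymm_coeffMatrix sI) (isSymm_coeffMatrix sR) (d := 0)
    (fun i p => by simp [vecF, jetPartial_zero_extD])
  have h1 (ν : Fin 4) := derivation_kinQuad (H := vecF U P n) (I := coeffMatrix I)
    (R := coeffMatrix R) (D := jetPartial (.field (i, μ)) (Finsupp.single ν 1))
    (jetPartial_mul rfl _)
    (fun _ _ => jetPartial_coeff_of_ne (by simp) _) (fun _ _ => jetPartial_coeff_of_ne (by simp) _)
    (isSymm_coeffMatrix sI) (isSymm_coeffMatrix sR)
    (fun j p => jetPartial_extD (fun μ => (j, μ)) (i, μ) ν p)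
  rw [eulerLagrange, vectorLagrangian_eq, map_add, h0, jetPartial_field_scalarLagrangian]
  simp only [map_add, h1, jetPartial_field_scalarLagrangian, codiv]
  simp only [Pi.zero_apply, zero_smul, Finset.sum_const_zero, add_zero, zero_sub, neg_inj]
  refine Finset.sum_congr rfl fun ν _ => ?_
  rw [Finset.sum_eq_single i]
  · rw [← sum_ite_pair_smul]; simp
  · intro j _ hj; simp [hj]
  · simp

theorem eulerLagrange_vector_scalar (i : σ) :
    eulerLagrange (vectorLagrangian g I R : ghPart U (n × Fin 4) P 0).1 (.scalar i)
      = scalarEL _ P g i + kinQuad (dphiMatrix i (coeffMatrix I)) (dphiMatrix i (coeffMatrix R))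
        (vecF U P n) := by
  have h0 := derivation_kinQuad_coeff (H := vecF U P n) (I := coeffMatrix I) (R := coeffMatrix R)
    (D := jetPartial (.scalar i) 0) (jetPartial_mul rfl 0)
    (fun _ _ => jetPartial_scalar_coeff i _) (fun _ _ => jetPartial_scalar_coeff i _)
    (fun i p => by simp [vecF, jetPartial_scalar_extD])
  have h1 (ν : Fin 4) := derivation_kinQuad_coeff (H := vecF U P n) (I := coeffMatrix I)
    (R := coeffMatrix R) (D := jetPartial (.scalar i) (Finsupp.single ν 1)) (jetPartial_mul rfl _)
    (I₂ := 0) (R₂ := 0)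
    (fun _ _ => (jetPartial_coeff_of_ne (by simp) _).trans (by simp))
    (fun _ _ => (jetPartial_coeff_of_ne (by simp) _).trans (by simp))
    (fun i p => by simp [vecF, jetPartial_scalar_extD])
  rw [eulerLagrange, vectorLagrangian_eq, scalarEL, eulerLagrange]
  simp only [map_add, h0, h1, kinQuad_zero, add_zero]
  exact add_sub_right_comm _ _ _

end Vector

/-! ### Field equations of the embedding tensor theory -/

section Embedding

variable {Θel Θmag : Matrix n a ℝ}

/-- The topological term of the embedding tensor Lagrangian. -/
def topQuad (U : Opens (σ → ℝ)) (P : Type) (Θel Θmag : Matrix n a ℝ) :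
    LocalFn U (EmbField n a) P :=
  -(1 / 2 : ℝ) • ∑ i, ∑ α, Θmag i α • ∑ p, tensorForm U P n a α p *
    wedgeDual (fun q => magF U P a i q
      - (1 / 4 : ℝ) • ∑ β, Θel i β • tensorForm U P n a β q) p

theorem embLagrangian_eq : (embLagrangian g I R Θel Θmag : ghPart U (EmbField n a) P 0).1
    = (scalarLagrangian g).1 + kinQuad (coeffMatrix I) (coeffMatrix R) (embH U P Θmag)
      + topQuad U P Θel Θmag := by
  have h := kineticLagrangian_eq (P := P) I R (embCurvature Θmag)
    (fun i => embCurvature_swap Θmag i)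
  simp only [embCurvature_eq] at h
  rw [topQuad, ← topologicalLagrangian_eq]
  exact congrArg (_ + · + _) h

theorem derivation_topQuad {D : LocalFn U (EmbField n a) P →ₗ[ℝ] LocalFn U (EmbField n a) P}
    (hD : ∀ x y, D (x * y) = D x * y + x * D y) {dB : a → Pair → ℝ} {dF : n → Pair → ℝ}
    (hB : ∀ α p, D (tensorForm U P n a α p) = algebraMap ℝ _ (dB α p))
    (hF : ∀ i p, D (magF U P a i p) = algebraMap ℝ _ (dF i p)) :
    D (topQuad U P Θel Θmag) = -(1 / 2 : ℝ) • ∑ i, ∑ α, Θmag i α • ∑ p,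
      (dB α p • wedgeDual (fun q => magF U P a i q
          - (1 / 4 : ℝ) • ∑ β, Θel i β • tensorForm U P n a β q) p
        + (dF i p - (1 / 4 : ℝ) * ∑ β, Θel i β * dB β p) • wedgeDual (tensorForm U P n a α) p) := by
  simp only [topQuad, map_smul, map_sum, hD, hB, ← Algebra.smul_def]
  congr 1
  refine Finset.sum_congr rfl fun i _ => Finset.sum_congr rfl fun α _ => ?_
  congr 1
  rw [Finset.sum_add_distrib, Finset.sum_add_distrib]
  congr 1
  rw [← wedgeDual_symm_smul]
  refine Finset.sum_congr rfl fun p _ => ?_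
  have e (q : Pair) : D (magF U P a i q - (1 / 4 : ℝ) • ∑ β, Θel i β • tensorForm U P n a β q)
      = algebraMap ℝ _ (dF i q - (1 / 4 : ℝ) * ∑ β, Θel i β * dB β q) := by
    simp only [map_sub, map_smul, map_sum, hB, hF, map_mul, ← Algebra.smul_def]
  rw [map_wedgeDual D]
  simp only [e]
  simp only [wedgeDual]
  rw [smul_eq_mul, mul_smul, mul_smul_comm, ← Algebra.commutes, ← Algebra.smul_def]

theorem eulerLagrange_emb_scalar (i : σ) :
    eulerLagrange (embLagrangian g I R Θel Θmag : ghPart U (EmbField n a) P 0).1 (.scalar i)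
      = scalarEL _ P g i + kinQuad (dphiMatrix i (coeffMatrix I)) (dphiMatrix i (coeffMatrix R))
        (embH U P Θmag) := by
  have hB (ν) (α : a) (p) : jetPartial (.scalar i) ν (tensorForm U P n a α p) = 0 := by
    simp [tensorForm, jetPartial_jet]
  have hF (ν) (j : n) (p) : jetPartial (.scalar i) ν (magF U P a j p) = 0 :=
    jetPartial_scalar_extD _ _ _ _
  have hH (ν) (j : n) (p) : jetPartial (.scalar i) ν (embH U P Θmag j p) = 0 := by
    simp [embH, hB, jetPartial_scalar_extD]
  have h0 := derivation_kinQuad_coeff (H := embH U P Θmag) (I := coeffMatrix I)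
    (R := coeffMatrix R) (D := jetPartial (.scalar i) 0) (jetPartial_mul rfl 0)
    (fun _ _ => jetPartial_scalar_coeff i _) (fun _ _ => jetPartial_scalar_coeff i _) (hH 0)
  have h1 (ν : Fin 4) := derivation_kinQuad_coeff (H := embH U P Θmag) (I := coeffMatrix I)
    (R := coeffMatrix R) (D := jetPartial (.scalar i) (Finsupp.single ν 1)) (jetPartial_mul rfl _)
    (I₂ := 0) (R₂ := 0)
    (fun _ _ => (jetPartial_coeff_of_ne (by simp) _).trans (by simp))
    (fun _ _ => (jetPartial_coeff_of_ne (by simp) _).trans (by simp)) (hH _)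
  have h2 (ν) : jetPartial (.scalar i) ν (topQuad U P Θel Θmag) = 0 :=
    (derivation_topQuad (Θel := Θel) (Θmag := Θmag)
      (D := jetPartial (.scalar i) ν) (jetPartial_mul rfl ν) (dB := 0) (dF := 0)
      (fun α p => (hB ν α p).trans (by simp)) (fun j p => (hF ν j p).trans (by simp))).trans
      (by simp)
  rw [eulerLagrange, embLagrangian_eq, scalarEL, eulerLagrange]
  simp only [map_add, h0, h1, h2, kinQuad_zero, add_zero]
  exact add_sub_right_comm _ _ _

theorem eulerLagrange_emb_electric (sI : I.IsSymm) (sR : R.IsSymm) (i : n) (μ : Fin 4) :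
    eulerLagrange (embLagrangian g I R Θel Θmag : ghPart U (EmbField n a) P 0).1
        (.field (.electric i μ))
      = codiv (wedgeDual (dualField (coeffMatrix I) (coeffMatrix R) (embH U P Θmag) i)) μ := by
  classical
  have hB (ν) (α : a) (p) : jetPartial (.field (.electric i μ)) ν (tensorForm U P n a α p) = 0 := by
    simp [tensorForm, jetPartial_jet]
  have hF (ν) (j : n) (p) : jetPartial (.field (.electric i μ)) ν (magF U P a j p) = 0 := by
    simp [magF, extD, total_jet, jetPartial_jet]
  have h0 := derivation_kinQuad (H := embH U P Θmag) (I := coeffMatrix I) (R := coeffMatrix R)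
    (D := jetPartial (.field (.electric i μ)) 0) (jetPartial_mul rfl 0)
    (fun _ _ => jetPartial_coeff_of_ne (by simp) _) (fun _ _ => jetPartial_coeff_of_ne (by simp) _)
    (isSymm_coeffMatrix sI) (isSymm_coeffMatrix sR) (d := 0)
    (fun i p => by simp [embH, hB, jetPartial_zero_extD])
  have h1 (ν : Fin 4) := derivation_kinQuad (H := embH U P Θmag) (I := coeffMatrix I)
    (R := coeffMatrix R) (D := jetPartial (.field (.electric i μ)) (Finsupp.single ν 1))
    (jetPartial_mul rfl _)
    (fun _ _ => jetPartial_coeff_of_ne (by simp) _) (fun _ _ => jetPartial_coeff_of_ne (by simp) _)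
    (isSymm_coeffMatrix sI) (isSymm_coeffMatrix sR)
    (fun j p => by
      rw [embH, map_add, jetPartial_extD]
      simp only [map_smul, map_sum, hB, smul_zero, Finset.sum_const_zero, add_zero]
      rfl)
  have h2 (ν) : jetPartial (.field (.electric i μ)) ν (topQuad U P Θel Θmag) = 0 :=
    (derivation_topQuad (Θel := Θel) (Θmag := Θmag)
      (D := jetPartial (.field (.electric i μ)) ν) (jetPartial_mul rfl ν) (dB := 0) (dF := 0)
      (fun α p => (hB ν α p).trans (by simp)) (fun j p => (hF ν j p).trans (by simp))).trans
      (by simp)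
  rw [eulerLagrange, embLagrangian_eq]
  simp only [map_add, h0, h1, h2, jetPartial_field_scalarLagrangian, codiv]
  simp only [Pi.zero_apply, zero_smul, Finset.sum_const_zero, add_zero, zero_sub, neg_inj]
  refine Finset.sum_congr rfl fun ν _ => ?_
  rw [Finset.sum_eq_single i]
  · rw [← sum_ite_pair_smul]; simp
  · intro j _ hj; simp [hj]
  · simp

theorem eulerLagrange_emb_magnetic (i : n) (μ : Fin 4) :
    eulerLagrange (embLagrangian g I R Θel Θmag : ghPart U (EmbField n a) P 0).1
        (.field (.magnetic i μ))
      = -(1 / 2 : ℝ) • ∑ α, Θmag i α • codiv (wedgeDual (tensorForm U P n a α)) μ := by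
  classical
  have hB (ν) (α : a) (p) : jetPartial (.field (.magnetic i μ)) ν (tensorForm U P n a α p) = 0 := by
    simp [tensorForm, jetPartial_jet]
  have hH (ν) (j : n) (p) : jetPartial (.field (.magnetic i μ)) ν (embH U P Θmag j p) = 0 := by
    simp [embH, hB, extD, total_jet, jetPartial_jet]
  have h1 (ν) : jetPartial (.field (.magnetic i μ)) ν
      (kinQuad (coeffMatrix I) (coeffMatrix R) (embH U P Θmag)) = 0 :=
    (derivation_kinQuad_coeff (I₂ := 0) (R₂ := 0) (jetPartial_mul rfl _)
      (fun _ _ => (jetPartial_coeff_of_ne (by simp) _).trans (by simp))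
      (fun _ _ => (jetPartial_coeff_of_ne (by simp) _).trans (by simp)) (hH ν)).trans kinQuad_zero
  have h0 : jetPartial (.field (.magnetic i μ)) 0 (topQuad U P Θel Θmag) = 0 :=
    (derivation_topQuad (Θel := Θel) (Θmag := Θmag)
      (D := jetPartial (.field (.magnetic i μ)) 0) (jetPartial_mul rfl 0) (dB := 0) (dF := 0)
      (fun α p => (hB 0 α p).trans (by simp))
      (fun j p => (jetPartial_zero_extD _ _ p).trans (by simp))).trans (by simp)
  have h2 (ν : Fin 4) := derivation_topQuad (Θel := Θel) (Θmag := Θmag)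
      (D := jetPartial (.field (.magnetic i μ)) (Finsupp.single ν 1)) (jetPartial_mul rfl _)
      (dB := 0) (fun α p => (hB _ α p).trans (by simp)) (fun j p => jetPartial_extD _ _ ν p)
  have e (ν : Fin 4) : jetPartial (.field (.magnetic i μ)) (Finsupp.single ν 1)
      (topQuad U P Θel Θmag)
      = -(1 / 2 : ℝ) • ∑ α, Θmag i α • asym (wedgeDual (tensorForm U P n a α)) ν μ := by
    rw [h2, Finset.sum_eq_single i]
    · congr 1
      refine Finset.sum_congr rfl fun α _ => ?_
      rw [← sum_ite_pair_smul]
      simp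
    · intro j _ hj
      simp [hj]
    · simp
  rw [eulerLagrange, embLagrangian_eq]
  simp only [map_add, h0, h1, e, jetPartial_field_scalarLagrangian, codiv, add_zero, zero_add,
    zero_sub, map_smul, map_sum, ← Finset.smul_sum, smul_neg, Finset.sum_neg_distrib]
  rw [Finset.sum_comm]
  simp only [Finset.smul_sum]

/-- In the term quadratic in B, the variations of the two factors coincide because locality makes
ΘmagᵀΘel symmetric. The coefficient ¼ of the Lagrangian therefore becomes ½. -/
theorem eulerLagrange_emb_twoForm (sI : I.IsSymm) (sR : R.IsSymm)
    (hΘ : ∀ α β, ∑ i, Θmag i α * Θel i β = ∑ i, Θmag i β * Θel i α) (α : a) (p : Pair) :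
    eulerLagrange (embLagrangian g I R Θel Θmag : ghPart U (EmbField n a) P 0).1
        (.field (.twoForm α p))
      = (1 / 2 : ℝ) • ∑ i, Θmag i α •
        (wedgeDual (dualField (coeffMatrix I) (coeffMatrix R) (embH U P Θmag) i) p
          - wedgeDual (fun q => magF U P a i q
            - (1 / 2 : ℝ) • ∑ β, Θel i β • tensorForm U P n a β q) p) := by
  classical
  have hB (β : a) (q) : jetPartial (.field (.twoForm α p)) 0 (tensorForm U P n a β q)
      = algebraMap ℝ _ (if β = α ∧ q = p then 1 else 0) := by
    simp [tensorForm, jetPartial_jet, apply_ite (algebraMap ℝ _)]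
  have hB' (ν : Fin 4) (β : a) (q) : jetPartial (.field (.twoForm α p)) (Finsupp.single ν 1)
      (tensorForm U P n a β q) = 0 := by
    have : (0 : Fin 4 →₀ ℕ) ≠ Finsupp.single ν 1 := (Finsupp.single_ne_zero.2 one_ne_zero).symm
    simp [tensorForm, jetPartial_jet, this]
  have hF (ν) (j : n) (q) : jetPartial (.field (.twoForm α p)) ν (magF U P a j q) = 0 := by
    simp [magF, extD, total_jet, jetPartial_jet]
  have hE (ν) (j : n) (q) : jetPartial (.field (.twoForm α p)) ν
      (extD (fun μ => jet (.field (.electric j μ)) 0) q : LocalFn U (EmbField n a) P) = 0 := by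
    simp [extD, total_jet, jetPartial_jet]
  have h0 := derivation_kinQuad (H := embH U P Θmag) (I := coeffMatrix I) (R := coeffMatrix R)
    (D := jetPartial (.field (.twoForm α p)) 0) (jetPartial_mul rfl 0)
    (fun _ _ => jetPartial_coeff_of_ne (by simp) _) (fun _ _ => jetPartial_coeff_of_ne (by simp) _)
    (isSymm_coeffMatrix sI) (isSymm_coeffMatrix sR)
    (d := fun j q => (1 / 2 : ℝ) * ∑ β, Θmag j β * if β = α ∧ q = p then 1 else 0)
    (fun j q => by
      rw [embH, map_add, hE, zero_add]
      simp only [map_smul, map_sum, hB, map_mul, ← Algebra.smul_def])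
  have h1 (ν : Fin 4) : jetPartial (.field (.twoForm α p)) (Finsupp.single ν 1)
      (kinQuad (coeffMatrix I) (coeffMatrix R) (embH U P Θmag)) = 0 :=
    (derivation_kinQuad_coeff (I₂ := 0) (R₂ := 0) (jetPartial_mul rfl _)
      (fun _ _ => (jetPartial_coeff_of_ne (by simp) _).trans (by simp))
      (fun _ _ => (jetPartial_coeff_of_ne (by simp) _).trans (by simp))
      (fun j q => by simp [embH, hE, hB'])).trans kinQuad_zero
  have h2 := derivation_topQuad (Θel := Θel) (Θmag := Θmag)
      (D := jetPartial (.field (.twoForm α p)) 0) (jetPartial_mul rfl _) (dF := 0) hB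
      (fun j q => (hF _ j q).trans (by simp))
  have h3 (ν : Fin 4) : jetPartial (.field (.twoForm α p)) (Finsupp.single ν 1)
      (topQuad U P Θel Θmag) = 0 :=
    (derivation_topQuad (Θel := Θel) (Θmag := Θmag) (jetPartial_mul rfl _) (dB := 0) (dF := 0)
      (fun α p => (hB' ν α p).trans (by simp)) (fun j p => (hF _ j p).trans (by simp))).trans
      (by simp)
  have e0 : jetPartial (.field (.twoForm α p)) 0
      (kinQuad (coeffMatrix I) (coeffMatrix R) (embH U P Θmag)) = (1 / 2 : ℝ) • ∑ i, Θmag i α •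
        wedgeDual (dualField (coeffMatrix I) (coeffMatrix R) (embH U P Θmag) i) p := by
    rw [h0, Finset.smul_sum]
    refine Finset.sum_congr rfl fun i _ => ?_
    rw [Finset.sum_eq_single p, smul_smul]
    · simp
    · intro q _ hq; simp [hq]
    · simp
  have e2 : jetPartial (.field (.twoForm α p)) 0 (topQuad U P Θel Θmag)
      = -(1 / 2 : ℝ) • ∑ i, Θmag i α • wedgeDual (fun q => magF U P a i q
            - (1 / 2 : ℝ) • ∑ β, Θel i β • tensorForm U P n a β q) p := by
    rw [h2]
    congr 1
    have w (c : ℝ) (i : n) : wedgeDual (fun q => magF U P a i q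
          - c • ∑ β, Θel i β • tensorForm U P n a β q) p = wedgeDual (magF U P a i) p
          - c • ∑ β, Θel i β • wedgeDual (tensorForm U P n a β) p := by
      simp only [wedgeDual, smul_sub, Finset.smul_sum]
      congr 1
      refine Finset.sum_congr rfl fun β _ => ?_
      module
    have s1 (i : n) (β : a) : ∑ q, ((if β = α ∧ q = p then (1 : ℝ) else 0) •
          wedgeDual (fun q => magF U P a i q
            - (1 / 4 : ℝ) • ∑ β, Θel i β • tensorForm U P n a β q) q
        + ((0 : n → Pair → ℝ) i q - (1 / 4 : ℝ) * ∑ γ, Θel i γ * if γ = α ∧ q = p then 1 else 0) •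
          wedgeDual (tensorForm U P n a β) q)
        = (if β = α then (1 : ℝ) else 0) • wedgeDual (fun q => magF U P a i q
            - (1 / 4 : ℝ) • ∑ β, Θel i β • tensorForm U P n a β q) p
          - ((1 / 4 : ℝ) * Θel i α) • wedgeDual (tensorForm U P n a β) p := by
      rw [Finset.sum_eq_single p]
      · simp [sub_eq_add_neg]
      · intro q _ hq; simp [hq]
      · simp
    simp only [s1, smul_sub, Finset.sum_sub_distrib]
    have s2 : ∑ i, ∑ β, Θmag i β • ((1 / 4 : ℝ) * Θel i α) • wedgeDual (tensorForm U P n a β) p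
        = ∑ i, Θmag i α • (1 / 4 : ℝ) • ∑ β, Θel i β • wedgeDual (tensorForm U P n a β) p := by
      simp only [Finset.smul_sum, smul_smul]
      refine Finset.sum_comm.trans (Eq.trans ?_ Finset.sum_comm)
      refine Finset.sum_congr rfl fun β _ => ?_
      rw [← Finset.sum_smul, ← Finset.sum_smul]
      congr 1
      have := hΘ β α
      calc ∑ i, Θmag i β * (1 / 4 * Θel i α) = 1 / 4 * ∑ i, Θmag i β * Θel i α := by
            rw [Finset.mul_sum]; exact Finset.sum_congr rfl fun i _ => by ring
        _ = 1 / 4 * ∑ i, Θmag i α * Θel i β := by rw [this]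
        _ = _ := by rw [Finset.mul_sum]; exact Finset.sum_congr rfl fun i _ => by ring
    rw [s2, ← Finset.sum_sub_distrib]
    refine Finset.sum_congr rfl fun i _ => ?_
    rw [Finset.sum_eq_single α]
    · rw [w, w]
      simp only [if_true]
      module
    · intro β _ hβ; simp [hβ]
    · simp
  rw [eulerLagrange, embLagrangian_eq]
  simp only [map_add, h1, h3, e0, e2, jetPartial_field_scalarLagrangian, add_zero, zero_add,
    map_zero, Finset.sum_const_zero, sub_zero, smul_sub, Finset.sum_sub_distrib, neg_smul]
  abel

end Embedding

end EulerLagrange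

/-! ### Smooth functions: evaluation and units -/

section SmoothUnits

variable {E : Type*} [NormedAddCommGroup E] [NormedSpace ℝ E] {Ω : Opens E}

/-- Evaluation at a point. -/
def SmoothFn.eval (x : Ω) : SmoothFn Ω →ₐ[ℝ] ℝ := (Pi.evalAlgHom ℝ _ x).comp (SmoothFn Ω).val

theorem SmoothFn.eval_apply (x : Ω) (f : SmoothFn Ω) : SmoothFn.eval x f = f.1 x := rfl

theorem SmoothFn.ext_eval {f g : SmoothFn Ω} (h : ∀ x, SmoothFn.eval x f = SmoothFn.eval x g) :
    f = g := Subtype.ext (funext h)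

theorem SmoothFn.isUnit_of_ne_zero {f : SmoothFn Ω} (h : ∀ x, f.1 x ≠ 0) : IsUnit f := by
  have hd : ContDiffOn ℝ ∞ (fun x => (extendZero Ω f.1 x)⁻¹) Ω :=
    ContDiffOn.inv f.2 fun x hx => by
      rw [extendZero_apply Ω f.1 ⟨x, hx⟩]; exact h _
  refine IsUnit.of_mul_eq_one (SmoothFn.ofContDiffOn Ω _ hd) (SmoothFn.ext_eval fun x => ?_)
  rw [map_mul, map_one]
  change f.1 x * (extendZero Ω f.1 x)⁻¹ = 1
  rw [extendZero_apply, mul_inv_cancel₀ (h x)]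

theorem SmoothFn.matrix_ext {m k : Type*} {A B : Matrix m k (SmoothFn Ω)}
    (h : ∀ x, A.map (SmoothFn.eval x) = B.map (SmoothFn.eval x)) : A = B :=
  Matrix.ext fun i j => SmoothFn.ext_eval fun x => congrFun (congrFun (h x) i) j

theorem SmoothFn.isUnit_det {n : Type*} [Fintype n] [DecidableEq n] {A : Matrix n n (SmoothFn Ω)}
    (h : ∀ x, (A.map (SmoothFn.eval x)).det ≠ 0) : IsUnit A.det := by
  refine SmoothFn.isUnit_of_ne_zero fun x => ?_
  have := h x
  rwa [← AlgHom.mapMatrix_apply, ← AlgHom.map_det] at this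

theorem SmoothFn.map_inv {n : Type*} [Fintype n] [DecidableEq n] {A : Matrix n n (SmoothFn Ω)}
    (h : IsUnit A.det) (x : Ω) :
    A⁻¹.map (SmoothFn.eval x) = (A.map (SmoothFn.eval x))⁻¹ := by
  refine (Matrix.inv_eq_right_inv ?_).symm
  rw [← AlgHom.mapMatrix_apply, ← AlgHom.mapMatrix_apply, ← map_mul, Matrix.mul_nonsing_inv _ h,
    map_one]

end SmoothUnits

/-! ### The kinetic matrix -/

section KineticMatrix

variable {n k : Type} [Fintype n] [DecidableEq n] [Fintype k] [DecidableEq k]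

theorem symplecticForm_mul_self : symplecticForm n * symplecticForm n = -1 := by
  rw [symplecticForm, Matrix.fromBlocks_multiply, ← Matrix.fromBlocks_one, Matrix.fromBlocks_neg]
  simp

section

variable {I R : Matrix n n ℝ}

omit [Fintype n] [DecidableEq n] in
theorem posDef_isSymm (hI : I.PosDef) : I.IsSymm := by
  have := hI.1
  rwa [Matrix.IsHermitian, Matrix.conjTranspose_eq_transpose_of_trivial] at this

/-- Equivalently (ΩM)² = -1, so that ΩM can act as the Hodge star on field strengths and their
duals. -/
theorem kineticMatrix_symplectic (hI : I.PosDef) :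
    kineticMatrix I R * symplecticForm n * kineticMatrix I R = symplecticForm n := by
  have h : IsUnit I.det := (Matrix.isUnit_iff_isUnit_det _).1 hI.isUnit
  simp only [kineticMatrix, symplecticForm, Matrix.fromBlocks_multiply, mul_zero, mul_one,
    mul_neg, neg_neg, zero_add, add_zero, add_mul, neg_mul]
  have h1 : I * I⁻¹ = 1 := Matrix.mul_nonsing_inv _ h
  have h2 : I⁻¹ * I = 1 := Matrix.nonsing_inv_mul _ h
  congr 1
  · have e1 : I * (I⁻¹ * R) = R := by rw [← mul_assoc, h1, one_mul]
    have e2 : R * I⁻¹ * I = R := by rw [mul_assoc, h2, mul_one]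
    simp only [mul_add, e1, e2, mul_assoc]
    abel
  · rw [h1]; simp only [mul_assoc]; abel
  · simp only [mul_add, h2, mul_assoc]; abel
  · simp only [mul_assoc]; abel

/-- The Schur complement of the block I⁻¹ is I, which gives semidefiniteness. Symplecticity supplies
an inverse, and an invertible semidefinite matrix is definite. -/
theorem posDef_kineticMatrix (hI : I.PosDef) (hR : R.IsSymm) : (kineticMatrix I R).PosDef := by
  have h : IsUnit I.det := (Matrix.isUnit_iff_isUnit_det _).1 hI.isUnit
  have h2 : I⁻¹ * I = 1 := Matrix.nonsing_inv_mul _ h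
  have hi := hI.inv
  have : Invertible I⁻¹ := hi.isUnit.invertible
  have hs : (I⁻¹)ᵀ = I⁻¹ := by rw [Matrix.transpose_nonsing_inv, posDef_isSymm hI]
  have e : kineticMatrix I R = Matrix.fromBlocks (I + R * I⁻¹ * R) (-(R * I⁻¹)) (-(R * I⁻¹))ᴴ I⁻¹ := by
    rw [kineticMatrix, Matrix.conjTranspose_eq_transpose_of_trivial, Matrix.transpose_neg,
      Matrix.transpose_mul, hs, hR]
  have hp : (kineticMatrix I R).PosSemidef := by
    rw [e, Matrix.PosDef.fromBlocks₂₂ _ _ hi]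
    rw [Matrix.conjTranspose_eq_transpose_of_trivial, Matrix.transpose_neg,
      Matrix.transpose_mul, hs, hR, Matrix.nonsing_inv_nonsing_inv _ h]
    have : R * I⁻¹ * I * (I⁻¹ * R) = R * I⁻¹ * R := by
      rw [mul_assoc R, h2, mul_one, mul_assoc]
    simpa [this] using hI.posSemidef
  rw [hp.posDef_iff_isUnit]
  refine IsUnit.of_mul_eq_one (-(symplecticForm n * kineticMatrix I R * symplecticForm n)) ?_
  rw [mul_neg, ← mul_assoc, ← mul_assoc, kineticMatrix_symplectic hI, symplecticForm_mul_self,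
    neg_neg]

omit [Fintype k] [DecidableEq k] in
/-- A field strength and its dual are a solution of the twisted self-duality equation. -/
theorem eq_of_twisted_selfDual (hI : I.PosDef) {x₁ y₁ x₂ y₂ : Matrix n k ℝ}
    (h₁ : symplecticForm n * kineticMatrix I R * Matrix.fromRows x₁ y₁ = -Matrix.fromRows x₂ y₂)
    (h₂ : symplecticForm n * kineticMatrix I R * Matrix.fromRows x₂ y₂ = Matrix.fromRows x₁ y₁) :
    y₁ = R * x₁ - I * x₂ ∧ y₂ = R * x₂ + I * x₁ := by
  have h : IsUnit I.det := (Matrix.isUnit_iff_isUnit_det _).1 hI.isUnit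
  have e : symplecticForm n * kineticMatrix I R
      = Matrix.fromBlocks (-(I⁻¹ * R)) I⁻¹ (-(I + R * I⁻¹ * R)) (R * I⁻¹) := by
    rw [symplecticForm, kineticMatrix, Matrix.fromBlocks_multiply]
    simp
  have hx : I * I⁻¹ = 1 := Matrix.mul_nonsing_inv _ h
  rw [e, Matrix.fromBlocks_mul_fromRows] at h₁ h₂
  rw [Matrix.fromRows_neg, Matrix.fromRows_ext_iff] at h₁
  rw [Matrix.fromRows_ext_iff] at h₂
  -- The upper rows suffice: their coefficient of y is I⁻¹, so multiplication by I solves for y.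
  have a := congrArg (I * ·) h₁.1
  have b := congrArg (I * ·) h₂.1
  simp only [← mul_assoc, hx, Matrix.mul_add, ← Matrix.mul_assoc, Matrix.neg_mul,
    Matrix.mul_neg, Matrix.one_mul] at a b
  constructor
  · rw [sub_eq_add_neg, ← a]; abel
  · rw [← b]; abel

/-- With j² = -1, these are the real and imaginary parts of the statement that ΩM acts as
multiplication by j on the columns (1; R + jI). -/
theorem twisted_selfDual (hI : I.PosDef) :
    symplecticForm n * kineticMatrix I R * Matrix.fromRows (1 : Matrix n n ℝ) R = -Matrix.fromRows (0 : Matrix n n ℝ) I ∧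
      symplecticForm n * kineticMatrix I R * Matrix.fromRows (0 : Matrix n n ℝ) I = Matrix.fromRows (1 : Matrix n n ℝ) R := by
  have h : IsUnit I.det := (Matrix.isUnit_iff_isUnit_det _).1 hI.isUnit
  have e : symplecticForm n * kineticMatrix I R
      = Matrix.fromBlocks (-(I⁻¹ * R)) I⁻¹ (-(I + R * I⁻¹ * R)) (R * I⁻¹) := by
    rw [symplecticForm, kineticMatrix, Matrix.fromBlocks_multiply]
    simp
  rw [e, Matrix.fromBlocks_mul_fromRows, Matrix.fromBlocks_mul_fromRows, Matrix.fromRows_neg,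
    Matrix.mul_assoc R I⁻¹ I, Matrix.nonsing_inv_mul _ h]
  simp

/-- The change of the kinetic matrices under a change of the symplectic frame. -/
theorem frame_duality (hI : I.PosDef) {I' R' : Matrix k k ℝ} (hI' : I'.PosDef)
    {E : Matrix (n ⊕ n) (k ⊕ k) ℝ} (hE : E * symplecticForm k * Eᵀ = symplecticForm n)
    (hM : kineticMatrix I' R' = Eᵀ * kineticMatrix I R * E) {x₁ y₁ x₂ y₂ : Matrix n k ℝ}
    (h₁ : E * Matrix.fromRows (1 : Matrix k k ℝ) R' = Matrix.fromRows x₁ y₁)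
    (h₂ : E * Matrix.fromRows (0 : Matrix k k ℝ) I' = Matrix.fromRows x₂ y₂) :
    y₁ = R * x₁ - I * x₂ ∧ y₂ = R * x₂ + I * x₁ := by
  -- Covariance of ΩM: substituting M' = EᵀME and EΩ'Eᵀ = Ω turns EΩ'M' into ΩME.
  have key (X : Matrix (k ⊕ k) k ℝ) : symplecticForm n * kineticMatrix I R * (E * X)
      = E * (symplecticForm k * kineticMatrix I' R' * X) := by
    rw [hM, ← hE]
    simp only [Matrix.mul_assoc]
  obtain ⟨t₁, t₂⟩ := twisted_selfDual (R := R') hI'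
  refine eq_of_twisted_selfDual hI ?_ ?_
  · rw [← h₁, key, t₁, Matrix.mul_neg, h₂]
  · rw [← h₂, key, t₂, h₁]

/-- A positive definite symplectic matrix is a kinetic matrix. -/
theorem eq_kineticMatrix {M : Matrix (n ⊕ n) (n ⊕ n) ℝ} (hM : M.PosDef)
    (hs : M * symplecticForm n * M = symplecticForm n) :
    (M.toBlocks₂₂).PosDef ∧ (M.toBlocks₁₂ * M.toBlocks₂₂⁻¹).IsSymm ∧
      kineticMatrix M.toBlocks₂₂⁻¹ (-(M.toBlocks₁₂ * M.toBlocks₂₂⁻¹)) = M := by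
  have hsym := posDef_isSymm hM
  have hW : M.toBlocks₂₂.PosDef := hM.submatrix Sum.inr_injective
  have hu : IsUnit M.toBlocks₂₂.det := (Matrix.isUnit_iff_isUnit_det _).1 hW.isUnit
  have e : M = Matrix.fromBlocks M.toBlocks₁₁ M.toBlocks₁₂ M.toBlocks₁₂ᵀ M.toBlocks₂₂ := by
    conv_lhs => rw [← Matrix.fromBlocks_toBlocks M]
    congr 1
    ext i j
    exact hsym.apply (.inl j) (.inr i)
  generalize M.toBlocks₁₁ = A, M.toBlocks₁₂ = B, M.toBlocks₂₂ = W at *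
  subst e
  simp only [symplecticForm, Matrix.fromBlocks_multiply, mul_zero, mul_one, mul_neg,
    zero_add, add_zero, neg_mul] at hs
  obtain ⟨-, h12, -, h22⟩ := Matrix.fromBlocks_inj.1 hs
  have hWs := posDef_isSymm hW
  have h1 : W * W⁻¹ = 1 := Matrix.mul_nonsing_inv _ hu
  have h2 : W⁻¹ * W = 1 := Matrix.nonsing_inv_mul _ hu
  -- The lower right block of MΩM = Ω makes BW⁻¹ symmetric; the upper right block, AW - BB = 1, then
  -- determines A.
  have hB : W⁻¹ * Bᵀ = B * W⁻¹ := by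
    have : Bᵀ * W = W * B := by rw [← sub_eq_zero, sub_eq_add_neg, add_comm]; exact h22
    calc W⁻¹ * Bᵀ = W⁻¹ * (Bᵀ * W) * W⁻¹ := by rw [mul_assoc, mul_assoc Bᵀ, h1, mul_one]
      _ = B * W⁻¹ := by rw [this, ← mul_assoc, h2, one_mul]
  refine ⟨hW, ?_, ?_⟩
  · rw [Matrix.IsSymm, Matrix.transpose_mul, Matrix.transpose_nonsing_inv, hWs, hB]
  · rw [kineticMatrix, Matrix.nonsing_inv_nonsing_inv _ hu]
    congr 1
    · have : A * W = 1 + B * B := by rw [← h12]; abel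
      calc _ = W⁻¹ + B * (W⁻¹ * W) * B * W⁻¹ := by simp only [neg_mul, mul_neg, neg_neg, mul_assoc]
        _ = (1 + B * B) * W⁻¹ := by rw [h2, mul_one, add_mul, one_mul]
        _ = A := by rw [← this, mul_assoc, h1, mul_one]
    · rw [neg_mul, neg_neg, mul_assoc, h2, mul_one]
    · rw [mul_neg, neg_neg, ← hB, ← mul_assoc, h1, one_mul]

end

variable {σ : Type} [Fintype σ] {U : Opens (σ → ℝ)}

/-- The smooth kinetic matrices in a new symplectic frame. -/
theorem exists_frame_matrices {I R : Matrix n n (SmoothFn U)} (hI : ∀ φ : U, (matrixAt I φ).PosDef)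
    (hR : R.IsSymm) {E : Matrix (n ⊕ n) (k ⊕ k) ℝ} (hE : E * symplecticForm k * Eᵀ = symplecticForm n)
    (hE' : Eᵀ * symplecticForm n * E = symplecticForm k) :
    ∃ I' R' : Matrix k k (SmoothFn U), (∀ φ : U, (matrixAt I' φ).PosDef) ∧ R'.IsSymm ∧
      ∀ φ : U, kineticMatrix (matrixAt I' φ) (matrixAt R' φ)
        = Eᵀ * kineticMatrix (matrixAt I φ) (matrixAt R φ) * E := by
  let C := algebraMap ℝ (SmoothFn U)
  let M : Matrix (n ⊕ n) (n ⊕ n) (SmoothFn U) :=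
    Matrix.fromBlocks (I + R * I⁻¹ * R) (-(R * I⁻¹)) (-(I⁻¹ * R)) I⁻¹
  let M' := (E.map C)ᵀ * M * E.map C
  -- The determinant vanishes nowhere, hence is a unit among smooth functions. The matrix inverse
  -- thus stays smooth and is compatible with evaluation.
  have uI : IsUnit I.det := SmoothFn.isUnit_det fun φ =>
    ((Matrix.isUnit_iff_isUnit_det _).1 (hI φ).isUnit).ne_zero
  have hM (φ : U) : M.map (SmoothFn.eval φ) = kineticMatrix (matrixAt I φ) (matrixAt R φ) := by
    have h := SmoothFn.map_inv uI φ
    simp only [M, kineticMatrix, Matrix.fromBlocks_map]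
    simp only [← AlgHom.mapMatrix_apply, map_add, map_neg, map_mul] at h ⊢
    rw [h]
    rfl
  have hC (φ : U) : (E.map C).map (SmoothFn.eval φ) = E := by
    ext i j; exact (SmoothFn.eval φ).commutes _
  have hM' (φ : U) : M'.map (SmoothFn.eval φ)
      = Eᵀ * kineticMatrix (matrixAt I φ) (matrixAt R φ) * E := by
    simp only [M']
    rw [Matrix.map_mul, Matrix.map_mul, Matrix.transpose_map, hC, hM]
  have hpos (φ : U) : (M'.map (SmoothFn.eval φ)).PosDef := by
    rw [hM', ← Matrix.conjTranspose_eq_transpose_of_trivial]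
    have hRφ : (matrixAt R φ).IsSymm := by
      ext i j; exact congrArg (SmoothFn.eval φ) (hR.apply i j)
    refine (posDef_kineticMatrix (hI φ) hRφ).conjTranspose_mul_mul_same fun x y hxy => ?_
    -- A symplectic E has the left inverse -ΩEᵀΩ, so it is injective and preserves positive
    -- definiteness.
    have h := congrArg ((-symplecticForm k * Eᵀ * symplecticForm n).mulVec) hxy
    have e : -symplecticForm k * Eᵀ * symplecticForm n * E = 1 := by
      rw [Matrix.mul_assoc, Matrix.mul_assoc, ← Matrix.mul_assoc Eᵀ, hE', neg_mul,
        symplecticForm_mul_self, neg_neg]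
    simpa only [Matrix.mulVec_mulVec, e, Matrix.one_mulVec] using h
  have hsym (φ : U) : M'.map (SmoothFn.eval φ) * symplecticForm k * M'.map (SmoothFn.eval φ)
      = symplecticForm k := by
    rw [hM']
    have := kineticMatrix_symplectic (R := matrixAt R φ) (hI φ)
    calc _ = Eᵀ * (kineticMatrix (matrixAt I φ) (matrixAt R φ) * (E * symplecticForm k * Eᵀ)
          * kineticMatrix (matrixAt I φ) (matrixAt R φ)) * E := by simp only [Matrix.mul_assoc]
      _ = _ := by rw [hE, this, hE']
  have h (φ : U) := eq_kineticMatrix (hpos φ) (hsym φ)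
  have uW : IsUnit M'.toBlocks₂₂.det := SmoothFn.isUnit_det fun φ =>
    ((Matrix.isUnit_iff_isUnit_det _).1 (h φ).1.isUnit).ne_zero
  have eI (φ : U) : M'.toBlocks₂₂⁻¹.map (SmoothFn.eval φ)
      = (M'.map (SmoothFn.eval φ)).toBlocks₂₂⁻¹ := SmoothFn.map_inv uW φ
  have eR (φ : U) : (M'.toBlocks₁₂ * M'.toBlocks₂₂⁻¹).map (SmoothFn.eval φ)
      = (M'.map (SmoothFn.eval φ)).toBlocks₁₂ * (M'.map (SmoothFn.eval φ)).toBlocks₂₂⁻¹ := by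
    rw [Matrix.map_mul, eI]; rfl
  refine ⟨M'.toBlocks₂₂⁻¹, -(M'.toBlocks₁₂ * M'.toBlocks₂₂⁻¹), fun φ => ?_, ?_, fun φ => ?_⟩
  · change (M'.toBlocks₂₂⁻¹.map (SmoothFn.eval φ)).PosDef
    rw [eI]
    exact (h φ).1.inv
  · refine Matrix.IsSymm.neg (SmoothFn.matrix_ext fun φ => ?_)
    rw [Matrix.transpose_map, eR]
    exact (h φ).2.1
  · have e : matrixAt (-(M'.toBlocks₁₂ * M'.toBlocks₂₂⁻¹)) φ
        = -(M'.toBlocks₁₂ * M'.toBlocks₂₂⁻¹).map (SmoothFn.eval φ) := by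
      ext i j; exact map_neg (SmoothFn.eval φ) _
    rw [e, eR]
    change kineticMatrix (M'.toBlocks₂₂⁻¹.map (SmoothFn.eval φ)) _ = _
    rw [eI, (h φ).2.2, hM']

end KineticMatrix

/-! ### Adapted bases and their frames -/

namespace AdaptedBasis

variable {n a : Type} [Fintype n] [Fintype a] [DecidableEq n] [DecidableEq a]

/-- Bases adapted to a complement of the kernel and a complement of the range bring the matrix to
rank normal form, with θ = 1. -/
theorem nonempty (Θmag : Matrix n a ℝ) : Nonempty (AdaptedBasis Θmag) := by
  let f := Θmag.mulVecLin
  obtain ⟨C, hC⟩ := Submodule.exists_isCompl (LinearMap.ker f)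
  obtain ⟨D, hD⟩ := Submodule.exists_isCompl (LinearMap.range f)
  let bC := Module.finBasis ℝ C
  let bK := Module.finBasis ℝ (LinearMap.ker f)
  let bD := Module.finBasis ℝ D
  let bR := bC.map (f.kerComplementEquivRange hC.symm)
  let ba := (bC.prod bK).map (Submodule.prodEquivOfIsCompl C _ hC.symm)
  let bn := (bR.prod bD).map (Submodule.prodEquivOfIsCompl _ D hD)
  let en := Pi.basisFun ℝ n
  let ea := Pi.basisFun ℝ a
  refine ⟨⟨_, _, _, bn.toMatrix en, en.toMatrix bn, ea.toMatrix ba, ba.toMatrix ea, 1,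
    bn.toMatrix_mul_toMatrix_flip en, en.toMatrix_mul_toMatrix_flip bn,
    ea.toMatrix_mul_toMatrix_flip ba, ba.toMatrix_mul_toMatrix_flip ea, by simp, ?_⟩⟩
  have h : Θmag = LinearMap.toMatrix ea en f := (LinearMap.toMatrix'_toLin' Θmag).symm
  rw [h, basis_toMatrix_mul_linearMap_toMatrix_mul_basis_toMatrix]
  have hl (j) : bn.repr (f (ba (.inl j))) = Finsupp.single (.inl j) 1 := by
    have : f (ba (.inl j)) = bn (.inl j) := by simp [ba, bn, bR]
    rw [this, Module.Basis.repr_self]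
  have hr (j) : f (ba (.inr j)) = 0 := by simp [ba]
  ext i j
  rw [LinearMap.toMatrix_apply]
  rcases j with j | j
  · rw [hl]
    rcases i with i | i <;> simp [Matrix.one_apply, Finsupp.single_apply, eq_comm]
  · rw [hr]
    rcases i with i | i <;> simp

variable {Θmag : Matrix n a ℝ} (b : AdaptedBasis Θmag) (Θel : Matrix n a ℝ)

/-- `θ̃ θ⁻¹`. -/
def shift : Matrix (Fin b.r) (Fin b.r) ℝ := b.θt Θel * b.θ⁻¹

variable {Θel} (hΘ : Θmagᵀ * Θel = Θelᵀ * Θmag)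

include hΘ in
-- Electric and magnetic components transform contragrediently under Y, so symmetry of ΘmagᵀΘel
-- survives the change of basis. The upper left block is the first claim. The upper right block is
-- killed by θᵀ, and θ is invertible.
theorem locality : b.θᵀ * b.θt Θel = (b.θt Θel)ᵀ * b.θ ∧
    (b.Yinvᵀ * Θel * b.Z).toBlocks₁₂ = 0 := by
  have h1 : (b.Y * Θmag * b.Z)ᵀ * (b.Yinvᵀ * Θel * b.Z)
      = (b.Yinvᵀ * Θel * b.Z)ᵀ * (b.Y * Θmag * b.Z) := by
    have e : b.Yᵀ * b.Yinvᵀ = 1 := by rw [← Matrix.transpose_mul, b.Yinv_mul_Y, Matrix.transpose_one]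
    calc _ = b.Zᵀ * (Θmagᵀ * ((b.Yᵀ * b.Yinvᵀ) * Θel)) * b.Z := by
          simp only [Matrix.transpose_mul, Matrix.mul_assoc]
      _ = b.Zᵀ * (Θelᵀ * ((b.Yinv * b.Y) * Θmag)) * b.Z := by
          rw [e, b.Yinv_mul_Y, Matrix.one_mul, Matrix.one_mul, hΘ]
      _ = _ := by simp only [Matrix.transpose_mul, Matrix.transpose_transpose, Matrix.mul_assoc]
  rw [b.magnetic, ← Matrix.fromBlocks_toBlocks (b.Yinvᵀ * Θel * b.Z)] at h1
  simp only [Matrix.fromBlocks_transpose, Matrix.fromBlocks_multiply, Matrix.transpose_zero,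
    Matrix.zero_mul, Matrix.mul_zero, add_zero] at h1
  obtain ⟨h11, h12, -, -⟩ := Matrix.fromBlocks_inj.1 h1
  refine ⟨h11, ?_⟩
  have hu : IsUnit b.θᵀ.det := by rw [Matrix.det_transpose]; exact b.isUnit_θ
  have := congrArg (b.θᵀ⁻¹ * ·) h12
  simpa only [← Matrix.mul_assoc, Matrix.nonsing_inv_mul _ hu, Matrix.one_mul,
    Matrix.mul_zero] using this

include hΘ in
theorem isSymm_shift : (b.shift Θel).IsSymm := by
  have h1 : b.θ * b.θ⁻¹ = 1 := Matrix.mul_nonsing_inv _ b.isUnit_θ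
  have h2 : b.θ⁻¹ᵀ * b.θᵀ = 1 := by rw [← Matrix.transpose_mul, h1, Matrix.transpose_one]
  have h := (b.locality hΘ).1
  rw [Matrix.IsSymm, shift, Matrix.transpose_mul]
  calc b.θ⁻¹ᵀ * (b.θt Θel)ᵀ = b.θ⁻¹ᵀ * ((b.θt Θel)ᵀ * b.θ) * b.θ⁻¹ := by
        rw [Matrix.mul_assoc, Matrix.mul_assoc, h1, Matrix.mul_one]
    _ = _ := by rw [← h, ← Matrix.mul_assoc, h2, Matrix.one_mul]

theorem E₁_symplectic : (b.E₁)ᵀ * symplecticForm n * b.E₁ = symplecticForm b.Idx ∧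
    b.E₁ * symplecticForm b.Idx * (b.E₁)ᵀ = symplecticForm n := by
  have e1 : b.Yᵀ * b.Yinvᵀ = 1 := by rw [← Matrix.transpose_mul, b.Yinv_mul_Y, Matrix.transpose_one]
  have e2 : b.Yinvᵀ * b.Yᵀ = 1 := by rw [← Matrix.transpose_mul, b.Y_mul_Yinv, Matrix.transpose_one]
  constructor <;>
    simp [E₁, symplecticForm, Matrix.fromBlocks_transpose, Matrix.fromBlocks_multiply, e1, e2,
      b.Y_mul_Yinv, b.Yinv_mul_Y]

include hΘ in
-- The matrix E₂ combines the exchange of electric and magnetic potentials in the hatted block with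
-- a shear by N = θ̃θ⁻¹. A shear is symplectic when its matrix is symmetric, which locality
-- guarantees.
theorem E₂_symplectic : (b.E₂ Θel)ᵀ * symplecticForm b.Idx * b.E₂ Θel = symplecticForm b.Idx ∧
    b.E₂ Θel * symplecticForm b.Idx * (b.E₂ Θel)ᵀ = symplecticForm b.Idx := by
  have h : (b.θt Θel * b.θ⁻¹)ᵀ = b.θt Θel * b.θ⁻¹ := b.isSymm_shift hΘ
  rw [E₂, h]
  generalize hN : b.θt Θel * b.θ⁻¹ = N at h
  constructor <;>
    simp [symplecticForm, Matrix.fromBlocks_transpose, Matrix.fromBlocks_multiply, h,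
      Matrix.fromBlocks_neg, Matrix.fromBlocks_add, ← Matrix.fromBlocks_one]

include hΘ in
theorem E_symplectic : (b.E Θel)ᵀ * symplecticForm n * b.E Θel = symplecticForm b.Idx ∧
    b.E Θel * symplecticForm b.Idx * (b.E Θel)ᵀ = symplecticForm n := by
  obtain ⟨h1, h1'⟩ := b.E₁_symplectic
  obtain ⟨h2, h2'⟩ := b.E₂_symplectic hΘ
  constructor
  · calc _ = (b.E₂ Θel)ᵀ * ((b.E₁)ᵀ * symplecticForm n * b.E₁) * b.E₂ Θel := by
          rw [E, Matrix.transpose_mul]; simp only [Matrix.mul_assoc]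
      _ = _ := by rw [h1, h2]
  · calc _ = b.E₁ * (b.E₂ Θel * symplecticForm b.Idx * (b.E₂ Θel)ᵀ) * (b.E₁)ᵀ := by
          rw [E, Matrix.transpose_mul]; simp only [Matrix.mul_assoc]
      _ = _ := by rw [h2', h1']

end AdaptedBasis

/-! ### Dual frames -/

section DualFrame

variable {r u : Type} [Fintype r] [Fintype u] [DecidableEq r] [DecidableEq u]
  {𝒦 : Type*} [CommRing 𝒦]

/-- The real or imaginary part of the matrix that expresses the field strengths of the old frame
through those of the new frame. -/
def frameH (e : Matrix u u 𝒦) (T : Matrix (r ⊕ u) (r ⊕ u) 𝒦) : Matrix (r ⊕ u) (r ⊕ u) 𝒦 :=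
  Matrix.fromBlocks (-T.toBlocks₁₁) (-T.toBlocks₁₂) 0 e

/-- The real or imaginary part of the matrix that expresses the dual field strengths of the old
frame through the field strengths of the new frame. -/
def frameG (e N : Matrix r r 𝒦) (T : Matrix (r ⊕ u) (r ⊕ u) 𝒦) : Matrix (r ⊕ u) (r ⊕ u) 𝒦 :=
  Matrix.fromBlocks (e + N * T.toBlocks₁₁) (N * T.toBlocks₁₂) T.toBlocks₂₁ T.toBlocks₂₂

/-- The kinetic matrices `R + I j` and `R' + I' j` are related by dualizing the first block of
vectors, after a shift by `N`. -/
structure DualFrame (N : Matrix r r 𝒦) (I R I' R' : Matrix (r ⊕ u) (r ⊕ u) 𝒦) : Prop where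
  symm_N : N.IsSymm
  symm_I : I.IsSymm
  symm_R : R.IsSymm
  symm_I' : I'.IsSymm
  symm_R' : R'.IsSymm
  re : frameG 1 N R' = R * frameH 1 R' - I * frameH 0 I'
  im : frameG 0 N I' = R * frameH 0 I' + I * frameH 1 R'

omit [Fintype r] [Fintype u] [DecidableEq r] [DecidableEq u] in
theorem frameH_map {𝒦' : Type*} [CommRing 𝒦'] (f : 𝒦 →+* 𝒦') (e : Matrix u u 𝒦)
    (T : Matrix (r ⊕ u) (r ⊕ u) 𝒦) : (frameH e T).map f = frameH (e.map f) (T.map f) := by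
  rw [frameH, Matrix.fromBlocks_map]
  ext i j
  rcases i with i | i <;> rcases j with j | j <;>
    simp [frameH, Matrix.toBlocks₁₁, Matrix.toBlocks₁₂]

omit [Fintype u] [DecidableEq r] [DecidableEq u] in
theorem frameG_map {𝒦' : Type*} [CommRing 𝒦'] (f : 𝒦 →+* 𝒦') (e N : Matrix r r 𝒦)
    (T : Matrix (r ⊕ u) (r ⊕ u) 𝒦) :
    (frameG e N T).map f = frameG (e.map f) (N.map f) (T.map f) := by
  rw [frameG, Matrix.fromBlocks_map]
  simp only [Matrix.map_mul, Matrix.map_add f (map_add f), frameG]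
  rfl

namespace DualFrame

variable {N : Matrix r r 𝒦} {I R I' R' : Matrix (r ⊕ u) (r ⊕ u) 𝒦} (h : DualFrame N I R I' R')

include h in
theorem map {𝒦' : Type*} [CommRing 𝒦'] (f : 𝒦 →+* 𝒦') :
    DualFrame (N.map f) (I.map f) (R.map f) (I'.map f) (R'.map f) where
  symm_N := h.symm_N.map f
  symm_I := h.symm_I.map f
  symm_R := h.symm_R.map f
  symm_I' := h.symm_I'.map f
  symm_R' := h.symm_R'.map f
  re := by
    have := congrArg (fun A => A.map f) h.re
    simp only [← RingHom.mapMatrix_apply, map_sub, map_mul] at this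
    simpa only [RingHom.mapMatrix_apply, frameG_map, frameH_map, Matrix.map_zero f (map_zero f),
      Matrix.map_one f (map_zero f) (map_one f)] using this
  im := by
    have := congrArg (fun A => A.map f) h.im
    simp only [← RingHom.mapMatrix_apply, map_add, map_mul] at this
    simpa only [RingHom.mapMatrix_apply, frameG_map, frameH_map, Matrix.map_zero f (map_zero f),
      Matrix.map_one f (map_zero f) (map_one f)] using this

include h in
/-- The blocks of the relation between the two frames. -/
theorem blocks :
    (R.toBlocks₁₁ + N) * R'.toBlocks₁₁ - I.toBlocks₁₁ * I'.toBlocks₁₁ = -1 ∧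
    (R.toBlocks₁₁ + N) * I'.toBlocks₁₁ + I.toBlocks₁₁ * R'.toBlocks₁₁ = 0 ∧
    R.toBlocks₁₂ = (R.toBlocks₁₁ + N) * R'.toBlocks₁₂ - I.toBlocks₁₁ * I'.toBlocks₁₂ ∧
    I.toBlocks₁₂ = (R.toBlocks₁₁ + N) * I'.toBlocks₁₂ + I.toBlocks₁₁ * R'.toBlocks₁₂ := by
  have hre := h.re
  have him := h.im
  rw [← Matrix.fromBlocks_toBlocks R, ← Matrix.fromBlocks_toBlocks I, frameH, frameH, frameG,
    Matrix.fromBlocks_multiply, Matrix.fromBlocks_multiply] at hre him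
  rw [sub_eq_add_neg, Matrix.fromBlocks_neg, Matrix.fromBlocks_add] at hre
  rw [Matrix.fromBlocks_add] at him
  -- Only the hatted rows of G = τH are used. For τ = R + jI they read (τ₁₁ + N)τ'₁₁ = -1 and τ₁₂ =
  -- (τ₁₁ + N)τ'₁₂, split into real and imaginary parts.
  obtain ⟨a, b, -, -⟩ := Matrix.fromBlocks_inj.1 hre
  obtain ⟨c, d, -, -⟩ := Matrix.fromBlocks_inj.1 him
  simp only [Matrix.mul_neg, Matrix.mul_zero, Matrix.mul_one, add_zero, neg_neg, zero_add] at a b c d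
  refine ⟨?_, ?_, ?_, ?_⟩
  · rw [Matrix.add_mul, eq_neg_iff_add_eq_zero, ← sub_eq_zero.2 a]; abel
  · rw [Matrix.add_mul, ← sub_eq_zero.2 c]; abel
  · rw [Matrix.add_mul, ← sub_eq_zero, ← neg_eq_zero, ← sub_eq_zero.2 b]; abel
  · rw [Matrix.add_mul, ← sub_eq_zero, ← neg_eq_zero, ← sub_eq_zero.2 d]; abel

include h in
/-- The first blocks in the reverse order. -/
theorem blocks_symm :
    R'.toBlocks₁₁ * (R.toBlocks₁₁ + N) - I'.toBlocks₁₁ * I.toBlocks₁₁ = -1 ∧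
    R'.toBlocks₁₁ * I.toBlocks₁₁ + I'.toBlocks₁₁ * (R.toBlocks₁₁ + N) = 0 := by
  obtain ⟨a, b, -, -⟩ := h.blocks
  have sym {A : Matrix (r ⊕ u) (r ⊕ u) 𝒦} (hA : A.IsSymm) : (A.toBlocks₁₁)ᵀ = A.toBlocks₁₁ := by
    ext i j; exact hA.apply _ _
  have a' := congrArg Matrix.transpose a
  have b' := congrArg Matrix.transpose b
  simp only [Matrix.transpose_sub, Matrix.transpose_add, Matrix.transpose_mul, sym h.symm_I,
    sym h.symm_R, sym h.symm_I', sym h.symm_R', h.symm_N.eq, Matrix.transpose_neg,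
    Matrix.transpose_one, Matrix.transpose_zero] at a' b'
  exact ⟨a', by rw [← b']; abel⟩

end DualFrame

/-! ### Derivatives of the kinetic matrices in dual frames -/

section Derivation

variable {A₀ : Type*} [CommRing A₀] [Algebra A₀ 𝒦] (d : Derivation A₀ 𝒦 𝒦)

theorem _root_.Matrix.map_derivation_mul {l m k : Type*} [Fintype m] (A : Matrix l m 𝒦)
    (B : Matrix m k 𝒦) : (A * B).map d = A.map d * B + A * B.map d := by
  ext i j
  simp [Matrix.mul_apply, Finset.sum_add_distrib, mul_comm, add_comm]

omit [Fintype r] [Fintype u] [DecidableEq r] [DecidableEq u] in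
theorem frameH_map_derivation (e : Matrix u u 𝒦) (he : e.map d = 0)
    (T : Matrix (r ⊕ u) (r ⊕ u) 𝒦) : (frameH e T).map d = frameH 0 (T.map d) := by
  rw [frameH, Matrix.fromBlocks_map, he]
  ext i j
  rcases i with i | i <;> rcases j with j | j <;>
    simp [frameH, Matrix.toBlocks₁₁, Matrix.toBlocks₁₂]

omit [Fintype u] [DecidableEq r] [DecidableEq u] in
theorem frameG_map_derivation (e N : Matrix r r 𝒦) (he : e.map d = 0) (hN : N.map d = 0)
    (T : Matrix (r ⊕ u) (r ⊕ u) 𝒦) : (frameG e N T).map d = frameG 0 N (T.map d) := by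
  have h (A : Matrix r r 𝒦) : (e + A).map d = A.map d := by
    rw [Matrix.map_add d (map_add d), he, zero_add]
  rw [frameG, Matrix.fromBlocks_map, h, Matrix.map_derivation_mul, Matrix.map_derivation_mul, hN,
    Matrix.zero_mul, Matrix.zero_mul, zero_add, zero_add, frameG, zero_add]
  rfl

omit [DecidableEq r] [DecidableEq u] in
-- This is HᵀdG - GᵀdH for the frame matrices. The terms quadratic in the kinetic matrix and those
-- containing N cancel, the latter by symmetry of N, so that the derivative itself remains.
theorem frame_derivation_aux {N : Matrix r r 𝒦} (hN : N.IsSymm) {T D : Matrix (r ⊕ u) (r ⊕ u) 𝒦}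
    {e : Matrix u u 𝒦} {f : Matrix r r 𝒦} (he : e.IsSymm) (hf : f.IsSymm) :
    (frameH e T)ᵀ * frameG 0 N D - (frameG f N T)ᵀ * frameH 0 D
      = Matrix.fromBlocks (f * D.toBlocks₁₁) (f * D.toBlocks₁₂) (e * D.toBlocks₂₁) (e * D.toBlocks₂₂) := by
  simp only [frameH, frameG, Matrix.fromBlocks_transpose, Matrix.fromBlocks_multiply]
  rw [sub_eq_add_neg, Matrix.fromBlocks_neg, Matrix.fromBlocks_add, he.eq]
  simp only [Matrix.transpose_add, Matrix.transpose_mul, hf.eq, hN.eq, Matrix.transpose_neg,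
    Matrix.transpose_zero]
  congr 1 <;>
  · simp only [Matrix.mul_add, Matrix.add_mul, Matrix.mul_neg, Matrix.neg_mul, Matrix.mul_assoc,
      Matrix.mul_zero, Matrix.zero_mul]
    abel

namespace DualFrame

variable {N : Matrix r r 𝒦} {I R I' R' : Matrix (r ⊕ u) (r ⊕ u) 𝒦} (h : DualFrame N I R I' R')

include h in
/-- The derivatives of the kinetic matrices in the two frames. -/
theorem derivation (hN : N.map d = 0) :
    (frameH 1 R')ᵀ * (R.map d * frameH 1 R' - I.map d * frameH 0 I')
        - (frameH 0 I')ᵀ * (R.map d * frameH 0 I' + I.map d * frameH 1 R') = R'.map d ∧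
      (frameH 1 R')ᵀ * (R.map d * frameH 0 I' + I.map d * frameH 1 R')
        + (frameH 0 I')ᵀ * (R.map d * frameH 1 R' - I.map d * frameH 0 I') = I'.map d := by
  have e1 {m : Type} [DecidableEq m] : (1 : Matrix m m 𝒦).map d = 0 := by
    ext i j
    by_cases hij : i = j
    · subst hij; simp
    · simp [hij]
  have e0 {m : Type} : (0 : Matrix m m 𝒦).map d = 0 := by ext i j; simp
  -- With complex notation G = τH and τ symmetric, differentiation gives HᵀdG - GᵀdH = HᵀdτH, while
  -- the left side equals dτ'. The two claims are the real and imaginary parts of dτ' = HᵀdτH.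
  have hre := congrArg (fun A => A.map d) h.re
  have him := congrArg (fun A => A.map d) h.im
  simp only [Matrix.map_sub d (map_sub d), Matrix.map_add d (map_add d), Matrix.map_derivation_mul,
    frameH_map_derivation d _ e1, frameH_map_derivation d _ e0, frameG_map_derivation d _ _ e1 hN,
    frameG_map_derivation d _ _ e0 hN] at hre him
  have tre := congrArg Matrix.transpose h.re
  have tim := congrArg Matrix.transpose h.im
  rw [Matrix.transpose_sub, Matrix.transpose_mul, Matrix.transpose_mul, h.symm_I, h.symm_R] at tre
  rw [Matrix.transpose_add, Matrix.transpose_mul, Matrix.transpose_mul, h.symm_I, h.symm_R] at tim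
  have a1 := frame_derivation_aux h.symm_N (T := R') (D := R'.map d) (e := 1) (f := 1)
    Matrix.isSymm_one Matrix.isSymm_one
  have a2 := frame_derivation_aux h.symm_N (T := I') (D := I'.map d) (e := 0) (f := 0)
    Matrix.isSymm_zero Matrix.isSymm_zero
  have a3 := frame_derivation_aux h.symm_N (T := R') (D := I'.map d) (e := 1) (f := 1)
    Matrix.isSymm_one Matrix.isSymm_one
  have a4 := frame_derivation_aux h.symm_N (T := I') (D := R'.map d) (e := 0) (f := 0)
    Matrix.isSymm_zero Matrix.isSymm_zero
  simp only [Matrix.one_mul, Matrix.zero_mul, Matrix.fromBlocks_toBlocks, Matrix.fromBlocks_zero] at a1 a2 a3 a4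
  constructor
  · refine Eq.trans ?_ ((congrArg₂ (· - ·) a1 a2).trans (sub_zero _))
    rw [hre, him, tre, tim]
    noncomm_ring
  · refine Eq.trans ?_ ((congrArg₂ (· + ·) a3 a4).trans (add_zero _))
    rw [hre, him, tre, tim]
    noncomm_ring

end DualFrame

end Derivation

end DualFrame

/-- `Yᵀ A Y` for a real matrix `Y`. -/
def congruence {n k : Type} [Fintype n] {𝒦 : Type*} [CommRing 𝒦] [Algebra ℝ 𝒦] (Y : Matrix n k ℝ)
    (A : Matrix n n 𝒦) : Matrix k k 𝒦 :=
  let Y' : Matrix n k 𝒦 := Y.map (algebraMap ℝ 𝒦)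
  Y'ᵀ * A * Y'

theorem isSymm_congruence {n k : Type} [Fintype n] {𝒦 : Type*} [CommRing 𝒦] [Algebra ℝ 𝒦]
    (Y : Matrix n k ℝ) {A : Matrix n n 𝒦} (h : A.IsSymm) : (congruence Y A).IsSymm := by
  rw [Matrix.IsSymm, congruence, Matrix.transpose_mul, Matrix.transpose_mul, h,
    Matrix.transpose_transpose, Matrix.mul_assoc]

theorem congruence_map {n k : Type} [Fintype n] {𝒦 𝒦' : Type*} [CommRing 𝒦] [Algebra ℝ 𝒦]
    [CommRing 𝒦'] [Algebra ℝ 𝒦'] (f : 𝒦 →ₐ[ℝ] 𝒦') (Y : Matrix n k ℝ) (A : Matrix n n 𝒦) :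
    (congruence Y A).map f = congruence Y (A.map f) := by
  have h : (Y.map (algebraMap ℝ 𝒦)).map f = Y.map (algebraMap ℝ 𝒦') := by
    ext i j; exact f.commutes _
  rw [congruence, congruence, Matrix.map_mul, Matrix.map_mul, Matrix.transpose_map, h]

/-- The kinetic matrices in the frame of an adapted basis. -/
theorem AdaptedBasis.dualFrame {σ n a : Type} [Fintype σ] {U : Opens (σ → ℝ)} [Fintype n]
    [Fintype a] [DecidableEq n] [DecidableEq a] {Θel Θmag : Matrix n a ℝ}
    (hΘ : Θmagᵀ * Θel = Θelᵀ * Θmag) (b : AdaptedBasis Θmag) {I R : Matrix n n (SmoothFn U)}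
    (hI : ∀ φ : U, (matrixAt I φ).PosDef) (hR : R.IsSymm) {I' R' : Matrix b.Idx b.Idx (SmoothFn U)}
    (hI' : ∀ φ : U, (matrixAt I' φ).PosDef) (hR' : R'.IsSymm)
    (hM : ∀ φ : U, kineticMatrix (matrixAt I' φ) (matrixAt R' φ)
      = (b.E Θel)ᵀ * kineticMatrix (matrixAt I φ) (matrixAt R φ) * b.E Θel) :
    DualFrame ((b.shift Θel).map (algebraMap ℝ (SmoothFn U)))
      (congruence b.Yinv I) (congruence b.Yinv R) I' R' := by
  have sym {m : Type} {A : Matrix m m (SmoothFn U)} (h : ∀ φ : U, (matrixAt A φ).PosDef) :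
      A.IsSymm := SmoothFn.matrix_ext fun φ => by
    rw [Matrix.transpose_map]; exact posDef_isSymm (h φ)
  have hN := b.isSymm_shift hΘ
  have hC {m k : Type} (A : Matrix m k ℝ) (φ : U) :
      (A.map (algebraMap ℝ (SmoothFn U))).map (SmoothFn.eval φ) = A := by
    ext i j; exact (SmoothFn.eval φ).commutes _
  have hY (A : Matrix n n (SmoothFn U)) (φ : U) :
      (congruence b.Yinv A).map (SmoothFn.eval φ) = b.Yinvᵀ * matrixAt A φ * b.Yinv :=
    congruence_map (SmoothFn.eval φ) b.Yinv A
  -- The cases e = 1, S = R' and e = 0, S = I' are the real and imaginary parts of E applied to the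
  -- column (1; τ').
  have frame (S : Matrix b.Idx b.Idx ℝ) (e : ℝ) :
      b.E Θel * Matrix.fromRows (e • (1 : Matrix b.Idx b.Idx ℝ)) S
        = Matrix.fromRows (b.Yinv * frameH (e • 1) S)
            (b.Yᵀ * frameG (e • 1) (b.shift Θel) S) := by
    have h2 : b.E₂ Θel * Matrix.fromRows (e • (1 : Matrix b.Idx b.Idx ℝ)) S
        = Matrix.fromRows (frameH (e • 1) S) (frameG (e • 1) (b.shift Θel) S) := by
      rw [AdaptedBasis.E₂, Matrix.fromBlocks_mul_fromRows]
      change _ = Matrix.fromRows (frameH (e • 1) S) (frameG (e • 1) (b.θt Θel * b.θ⁻¹) S)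
      rw [show (b.θt Θel * b.θ⁻¹)ᵀ = b.θt Θel * b.θ⁻¹ from hN, ← Matrix.fromBlocks_one,
        Matrix.fromBlocks_smul]
      nth_rewrite 1 2 [← Matrix.fromBlocks_toBlocks S]
      simp only [Matrix.fromBlocks_multiply, Matrix.fromBlocks_add, frameH, frameG]
      congr 1 <;> simp
    rw [AdaptedBasis.E, Matrix.mul_assoc, h2, AdaptedBasis.E₁, Matrix.fromBlocks_mul_fromRows,
      Matrix.zero_mul, Matrix.zero_mul, zero_add, add_zero]
  have e2 : b.Yinvᵀ * b.Yᵀ = 1 := by rw [← Matrix.transpose_mul, b.Y_mul_Yinv, Matrix.transpose_one]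
  have key (φ : U) := frame_duality (hI φ) (hI' φ) (b.E_symplectic hΘ).2 (hM φ)
    (by simpa only [one_smul] using frame (matrixAt R' φ) 1)
    (by simpa only [zero_smul] using frame (matrixAt I' φ) 0)
  have m1 {m : Type} [DecidableEq m] (φ : U) : (1 : Matrix m m (SmoothFn U)).map (SmoothFn.eval φ) = 1 :=
    Matrix.map_one _ (map_zero _) (map_one _)
  have m0 {m : Type} (φ : U) : (0 : Matrix m m (SmoothFn U)).map (SmoothFn.eval φ) = 0 :=
    Matrix.map_zero _ (map_zero _)
  have mG {e N : Matrix (Fin b.r) (Fin b.r) (SmoothFn U)} {T : Matrix b.Idx b.Idx (SmoothFn U)} (φ : U) :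
      (frameG e N T).map (SmoothFn.eval φ) = frameG (e.map (SmoothFn.eval φ)) (N.map (SmoothFn.eval φ))
        (matrixAt T φ) := frameG_map (SmoothFn.eval φ).toRingHom e N T
  have mH {e : Matrix (Fin b.u) (Fin b.u) (SmoothFn U)} {T : Matrix b.Idx b.Idx (SmoothFn U)} (φ : U) :
      (frameH e T).map (SmoothFn.eval φ) = frameH (e.map (SmoothFn.eval φ)) (matrixAt T φ) :=
    frameH_map (SmoothFn.eval φ).toRingHom e T
  refine ⟨hN.map _, isSymm_congruence _ (sym hI), isSymm_congruence _ hR, sym hI', hR', SmoothFn.matrix_ext fun φ => ?_,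
    SmoothFn.matrix_ext fun φ => ?_⟩
  · rw [Matrix.map_sub _ (map_sub _), Matrix.map_mul, Matrix.map_mul, hY, hY, mG, mH, mH, m1, m1, m0, hC]
    have := congrArg (b.Yinvᵀ * ·) (key φ).1
    simpa only [← Matrix.mul_assoc, e2, Matrix.one_mul, Matrix.mul_sub] using this
  · rw [Matrix.map_add _ (map_add _), Matrix.map_mul, Matrix.map_mul, hY, hY, mG, mH, mH, m0, m1, m0, hC]
    have := congrArg (b.Yinvᵀ * ·) (key φ).2
    simpa only [← Matrix.mul_assoc, e2, Matrix.one_mul, Matrix.mul_add] using this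

/-! ### Duality of field strengths -/

section Duality

variable {σ : Type} [Fintype σ] {U : Opens (σ → ℝ)} {F P : Type}

/-- The inclusion of the functions of the scalars into the functions of `(x, φ)`. -/
def Coeff.ofScalarHom : SmoothFn U →ₐ[ℝ] Coeff U where
  toFun := Coeff.ofScalar
  map_one' := by
    refine SmoothFn.ext_eval fun p => ?_
    exact extendZero_apply U (1 : SmoothFn U).1 ⟨p.1.2, p.2⟩
  map_mul' f g := by
    refine SmoothFn.ext_eval fun p => ?_
    have h (f : SmoothFn U) := extendZero_apply U f.1 ⟨p.1.2, p.2⟩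
    rw [map_mul]
    exact (h (f * g)).trans (congrArg₂ (· * ·) (h f) (h g)).symm
  map_zero' := by
    refine SmoothFn.ext_eval fun p => ?_
    exact extendZero_apply U (0 : SmoothFn U).1 ⟨p.1.2, p.2⟩
  map_add' f g := by
    refine SmoothFn.ext_eval fun p => ?_
    have h (f : SmoothFn U) := extendZero_apply U f.1 ⟨p.1.2, p.2⟩
    rw [map_add]
    exact (h (f + g)).trans (congrArg₂ (· + ·) (h f) (h g)).symm
  commutes' r := by
    refine SmoothFn.ext_eval fun p => ?_
    exact extendZero_apply U (algebraMap ℝ (SmoothFn U) r).1 ⟨p.1.2, p.2⟩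

variable {n : Type} [Fintype n]

theorem star_sum_coeff_mul {ι : Type*} (s : Finset ι) (f : ι → Coeff U)
    (X : ι → Pair → LocalFn U F P) (p : Pair) :
    star (fun q => ∑ i ∈ s, coeff (f i) * X i q) p = ∑ i ∈ s, coeff (f i) * star (X i) p := by
  simp [star, Finset.smul_sum]

theorem star_star_apply {V : Type*} [AddCommGroup V] [Module ℝ V] (X : Pair → V) (p : Pair) :
    star (star X) p = -X p := congrFun (star_star X) p

/-- Since ⋆² = -1, composition follows the rule (A + B⋆)(C + D⋆) = (AC - BD) + (AD + BC)⋆ of complex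
matrices. -/
theorem dualField_dualField (A B C D : Matrix n n (Coeff U)) (X : n → Pair → LocalFn U F P) (i : n)
    (p : Pair) : dualField B A (dualField D C X) i p
      = dualField (A * D + B * C) (A * C - B * D) X i p := by
  have h (j : n) : star (dualField D C X j) p
      = ∑ k, (coeff (C j k) * star (X k) p - coeff (D j k) * X k p) := by
    have e : dualField D C X j
        = fun q => ∑ k, coeff (C j k) * X k q + ∑ k, coeff (D j k) * star (X k) q := by
      funext q; rw [dualField, Finset.sum_add_distrib]
    have e' (Y Z : Pair → LocalFn U F P) : star (fun q => Y q + Z q) p = star Y p + star Z p := by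
      simp only [star, smul_add]
    have e'' := star_sum_coeff_mul Finset.univ (fun k => D j k) (fun k => star (X k)) p
    rw [e, e', star_sum_coeff_mul, e'']
    simp only [star_star_apply, mul_neg, Finset.sum_neg_distrib, Finset.sum_sub_distrib]
    abel
  rw [dualField, dualField]
  simp only [h]
  simp only [dualField, Matrix.sub_apply, Matrix.add_apply, Matrix.mul_apply, Finset.mul_sum,
    ← Finset.sum_add_distrib, ← Finset.sum_sub_distrib, map_sub, map_add, map_sum, map_mul,
    Finset.sum_mul]
  rw [Finset.sum_comm]
  refine Finset.sum_congr rfl fun k _ => Finset.sum_congr rfl fun j _ => ?_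
  noncomm_ring

theorem dualField_add (I R : Matrix n n (Coeff U)) (X Y : n → Pair → LocalFn U F P) (i : n) (p : Pair) :
    dualField I R (fun j q => X j q + Y j q) i p = dualField I R X i p + dualField I R Y i p := by
  simp only [dualField, star, smul_add, mul_add, Finset.sum_add_distrib]
  abel

theorem sum_star_mul_wedgeDual (X Y : Pair → LocalFn U F P) :
    ∑ p, star X p * wedgeDual Y p = ∑ p, X p * wedgeDual (star Y) p := by
  rw [wedgeDual_symm]
  simp only [wedgeDual_star, smul_mul_assoc, mul_smul_comm]

/-- The star is self-adjoint for the wedge pairing, so the adjoint of C + D⋆ is its plain transpose,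
without conjugation. -/
theorem sum_dualField_mul_wedgeDual (C D : Matrix n n (Coeff U)) (X Y : n → Pair → LocalFn U F P) :
    ∑ i, ∑ p, dualField D C X i p * wedgeDual (Y i) p
      = ∑ i, ∑ p, X i p * wedgeDual (dualField Dᵀ Cᵀ Y i) p := by
  have l (i : n) : ∑ p, dualField D C X i p * wedgeDual (Y i) p
      = ∑ j, (coeff (C i j) * ∑ p, X j p * wedgeDual (Y i) p
        + coeff (D i j) * ∑ p, X j p * wedgeDual (star (Y i)) p) := by
    simp only [← sum_star_mul_wedgeDual, dualField, Finset.sum_mul, Finset.mul_sum,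
      ← Finset.sum_add_distrib, add_mul, mul_assoc]
    exact Finset.sum_comm
  have w (j : n) (p : Pair) : wedgeDual (dualField Dᵀ Cᵀ Y j) p
      = ∑ i, (coeff (C i j) * wedgeDual (Y i) p + coeff (D i j) * wedgeDual (star (Y i)) p) := by
    simp only [wedgeDual, dualField, Finset.smul_sum, smul_add, mul_smul_comm,
      Matrix.transpose_apply]
  have r (j : n) : ∑ p, X j p * wedgeDual (dualField Dᵀ Cᵀ Y j) p
      = ∑ i, (coeff (C i j) * ∑ p, X j p * wedgeDual (Y i) p
        + coeff (D i j) * ∑ p, X j p * wedgeDual (star (Y i)) p) := by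
    have c (f : Coeff U) (x y : LocalFn U F P) : x * (coeff f * y) = coeff f * (x * y) := by
      rw [← mul_assoc, ← coeff_comm, mul_assoc]
    simp only [w, Finset.mul_sum, ← Finset.sum_add_distrib, mul_add, c]
    exact Finset.sum_comm
  simp only [l, r]
  exact Finset.sum_comm

/-- For T = C + D⋆ and τ = A + B⋆, this is the congruence τ ↦ TᵀτT of quadratic forms. -/
theorem kinQuad_dualField (A B C D : Matrix n n (Coeff U)) (X : n → Pair → LocalFn U F P) :
    kinQuad B A (dualField D C X)
      = kinQuad (Cᵀ * (A * D + B * C) + Dᵀ * (A * C - B * D))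
          (Cᵀ * (A * C - B * D) - Dᵀ * (A * D + B * C)) X := by
  rw [kinQuad, sum_dualField_mul_wedgeDual]
  have e : dualField B A (dualField D C X) = dualField (A * D + B * C) (A * C - B * D) X := by
    funext i p; exact dualField_dualField A B C D X i p
  rw [e, kinQuad]
  have e' : dualField Dᵀ Cᵀ (dualField (A * D + B * C) (A * C - B * D) X)
      = dualField (Cᵀ * (A * D + B * C) + Dᵀ * (A * C - B * D))
          (Cᵀ * (A * C - B * D) - Dᵀ * (A * D + B * C)) X := by
    funext i p; exact dualField_dualField _ _ _ _ X i p
  simp only [← e']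

end Duality

/-! ### Field strengths of the old frame in terms of the new frame -/

section FrameFields

variable {σ : Type} [Fintype σ] {U : Opens (σ → ℝ)} {F P : Type} {r u : Type} [Fintype r] [Fintype u]
  [DecidableEq r] [DecidableEq u]

/-- The field strengths of the old frame in terms of those of the new frame. -/
def oldField (I' R' : Matrix (r ⊕ u) (r ⊕ u) (Coeff U)) (X : r ⊕ u → Pair → LocalFn U F P) :
    r ⊕ u → Pair → LocalFn U F P
  | .inl i => fun p => -dualField I' R' X (.inl i) p
  | .inr i => X (.inr i)

omit [DecidableEq r] in
theorem dualField_frameH (I' R' : Matrix (r ⊕ u) (r ⊕ u) (Coeff U))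
    (X : r ⊕ u → Pair → LocalFn U F P) :
    dualField (frameH 0 I') (frameH 1 R') X = oldField I' R' X := by
  funext i p
  rcases i with i | i
  · simp only [dualField, frameH, oldField, Fintype.sum_sum_type, Matrix.fromBlocks_apply₁₁,
      Matrix.fromBlocks_apply₁₂, Matrix.neg_apply, map_neg, neg_mul, ← neg_add,
      Finset.sum_neg_distrib]
    rfl
  · simp [dualField, frameH, oldField, Matrix.one_apply, apply_ite coeff, ite_mul]

omit [DecidableEq u] in
theorem dualField_frameG (N : Matrix r r ℝ) (I' R' : Matrix (r ⊕ u) (r ⊕ u) (Coeff U))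
    (X : r ⊕ u → Pair → LocalFn U F P) (p : Pair) :
    (∀ i, dualField (frameG 0 (N.map (algebraMap ℝ _)) I') (frameG 1 (N.map (algebraMap ℝ _)) R') X
      (.inl i) p = X (.inl i) p + ∑ k, N i k • dualField I' R' X (.inl k) p) ∧
    ∀ i, dualField (frameG 0 (N.map (algebraMap ℝ _)) I') (frameG 1 (N.map (algebraMap ℝ _)) R') X
      (.inr i) p = dualField I' R' X (.inr i) p := by
  constructor
  · intro i
    have h (k : r) (f : Coeff U) (x : LocalFn U F P) :
        coeff (algebraMap ℝ (Coeff U) (N i k) * f) * x = N i k • (coeff f * x) := by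
      rw [map_mul, AlgHom.commutes, mul_assoc, ← Algebra.smul_def]
    have hb {l : Type} (M : Matrix r l (Coeff U)) (j : l) (x : LocalFn U F P) :
        coeff ((N.map (algebraMap ℝ (Coeff U)) * M) i j) * x
          = ∑ k, N i k • (coeff (M k j) * x) := by
      simp only [Matrix.mul_apply, Matrix.map_apply, map_sum, Finset.sum_mul, h]
    simp only [dualField, frameG, Fintype.sum_sum_type, Matrix.fromBlocks_apply₁₁, zero_add,
      Matrix.fromBlocks_apply₁₂, hb, Matrix.add_apply, map_add, add_mul, Finset.smul_sum, smul_add,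
      Finset.sum_add_distrib]
    have e1 : ∑ j, coeff ((1 : Matrix r r (Coeff U)) i j) * X (.inl j) p = X (.inl i) p := by
      simp [Matrix.one_apply, apply_ite coeff, ite_mul]
    have c {l : Type} [Fintype l] (f : r → l → LocalFn U F P) :
        ∑ j, ∑ k, N i k • f k j = ∑ k, ∑ j, N i k • f k j := Finset.sum_comm
    rw [e1]
    simp only [c, Matrix.toBlocks₁₁, Matrix.toBlocks₁₂, Matrix.of_apply]
    abel
  · intro i
    simp only [dualField, frameG, Fintype.sum_sum_type, Matrix.fromBlocks_apply₂₁,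
      Matrix.fromBlocks_apply₂₂]
    rfl

variable {N : Matrix r r ℝ} {I R I' R' : Matrix (r ⊕ u) (r ⊕ u) (Coeff U)}
  (h : DualFrame (N.map (algebraMap ℝ _)) I R I' R')

include h in
/-- The dual field strengths of the old frame in terms of the new frame. -/
theorem DualFrame.dualField_oldField (X : r ⊕ u → Pair → LocalFn U F P) (p : Pair) :
    (∀ i, dualField I R (oldField I' R' X) (.inl i) p
      = X (.inl i) p + ∑ k, N i k • dualField I' R' X (.inl k) p) ∧
    ∀ i, dualField I R (oldField I' R' X) (.inr i) p = dualField I' R' X (.inr i) p := by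
  have e (i) : dualField I R (oldField I' R' X) i p = dualField
      (frameG 0 (N.map (algebraMap ℝ _)) I') (frameG 1 (N.map (algebraMap ℝ _)) R') X i p := by
    rw [← dualField_frameH, dualField_dualField, h.re, h.im]
  simp only [e]
  exact dualField_frameG N I' R' X p

include h in
/-- The energy of the scalar equation in the two frames. -/
theorem DualFrame.kinQuad_oldField (d : Derivation ℝ (Coeff U) (Coeff U))
    (X : r ⊕ u → Pair → LocalFn U F P) :
    kinQuad (I.map d) (R.map d) (oldField I' R' X) = kinQuad (I'.map d) (R'.map d) X := by
  have hN : (N.map (algebraMap ℝ (Coeff U))).map d = 0 := by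
    ext i j; simp
  obtain ⟨h1, h2⟩ := h.derivation d hN
  rw [← dualField_frameH, kinQuad_dualField, h1, h2]

omit [DecidableEq r] [DecidableEq u] in
theorem dualField_sumElim_zero (N : Matrix r r ℝ) (V : r → Pair → LocalFn U F P) (k : r) (q : Pair) :
    dualField I R (Sum.elim V fun _ _ => 0) (.inl k) q + ∑ l, N k l • V l q
      = dualField I.toBlocks₁₁ (R.toBlocks₁₁ + N.map (algebraMap ℝ _)) V k q := by
  have hV : dualField I R (Sum.elim V fun _ _ => 0) (.inl k) q
      = dualField I.toBlocks₁₁ R.toBlocks₁₁ V k q := by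
    simp [dualField, Fintype.sum_sum_type, Matrix.toBlocks₁₁, star]
  rw [hV]
  simp only [dualField, ← Finset.sum_add_distrib, Matrix.add_apply, map_add, add_mul,
    Matrix.map_apply, AlgHom.commutes, Algebra.smul_def]
  exact Finset.sum_congr rfl fun l _ => by abel

include h in
/-- The equation that determines the two-forms. -/
theorem DualFrame.dualField_equation (X : r ⊕ u → Pair → LocalFn U F P) (Y : r → Pair → LocalFn U F P)
    (i : r) (p : Pair) :
    dualField I'.toBlocks₁₁ R'.toBlocks₁₁ (fun k q =>
      dualField I R (Sum.elim Y fun j => X (.inr j)) (.inl k) q + ∑ l, N k l • Y l q - X (.inl k) q) i p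
      = -(Y i p + dualField I' R' X (.inl i) p) := by
  let V : r → Pair → LocalFn U F P := fun k q => Y k q + dualField I' R' X (.inl k) q
  -- The given field strengths differ from those dual to X only by V in the hatted block. The
  -- expression in the equation is then (τ₁₁ + N)V, and τ'₁₁(τ₁₁ + N) = -1.
  have split : (Sum.elim Y fun j => X (.inr j))
      = fun j q => oldField I' R' X j q + Sum.elim V (fun _ _ => 0) j q := by
    funext j q
    rcases j with j | j
    · simp [oldField, V]
    · simp [oldField]
  have hNV := dualField_sumElim_zero (I := I) (R := R) N V
  have e : (fun k q => dualField I R (Sum.elim Y fun j => X (.inr j)) (.inl k) q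
      + ∑ l, N k l • Y l q - X (.inl k) q)
      = dualField I.toBlocks₁₁ (R.toBlocks₁₁ + N.map (algebraMap ℝ _)) V := by
    funext k q
    rw [split, dualField_add, (h.dualField_oldField X q).1, ← hNV]
    simp only [V, smul_add, Finset.sum_add_distrib]
    abel
  rw [e, dualField_dualField, h.blocks_symm.1, h.blocks_symm.2]
  simp [dualField, Matrix.one_apply, apply_ite coeff, V]

end FrameFields

/-! ### BRST differentials and two-forms -/

section BrstForms

variable {σ : Type} [Fintype σ] {U : Opens (σ → ℝ)} {F P : Type} {n : Type} [Fintype n]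

theorem extD_total (x : LocalFn U F P) (p : Pair) : extD (fun μ => total μ x) p = 0 := by
  rw [extD, total_comm, sub_self]

theorem extD_sub (a b : Fin 4 → LocalFn U F P) (p : Pair) :
    extD (fun μ => a μ - b μ) p = extD a p - extD b p := by
  simp only [extD, map_sub]; abel

theorem extD_add (a b : Fin 4 → LocalFn U F P) (p : Pair) :
    extD (fun μ => a μ + b μ) p = extD a p + extD b p := by
  simp only [extD, map_add]; abel

theorem extD_smul (c : ℝ) (a : Fin 4 → LocalFn U F P) (p : Pair) :
    extD (fun μ => c • a μ) p = c • extD a p := by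
  simp only [extD, map_smul, smul_sub]

theorem extD_sum {ι : Type*} (s : Finset ι) (a : ι → Fin 4 → LocalFn U F P) (p : Pair) :
    extD (fun μ => ∑ i ∈ s, a i μ) p = ∑ i ∈ s, extD (a i) p := by
  simp only [extD, map_sum, Finset.sum_sub_distrib]

theorem dualField_zero (I R : Matrix n n (Coeff U)) (i : n) (p : Pair) :
    dualField I R (fun _ _ => (0 : LocalFn U F P)) i p = 0 := by
  simp [dualField, star]

theorem dualField_mem {I R : Matrix n n (Coeff U)} {H : n → Pair → LocalFn U F P}
    (hH : ∀ j p, H j p ∈ ghPart U F P 0) (i : n) (p : Pair) :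
    dualField I R H i p ∈ ghPart U F P 0 :=
  Submodule.sum_mem _ fun _ _ => Submodule.add_mem _
    (mul_mem_ghPart_zero (coeff_mem_ghPart _) (hH _ _))
    (mul_mem_ghPart_zero (coeff_mem_ghPart _) (Submodule.smul_mem _ _ (hH _ _)))

/-- Linear maps that commute with the coefficient functions commute with the dualization. -/
theorem map_dualField_linear {F' P' : Type} {f : LocalFn U F P →ₗ[ℝ] LocalFn U F' P'}
    (hf : ∀ a x, f (coeff a * x) = coeff a * f x) (I R : Matrix n n (Coeff U))
    (H : n → Pair → LocalFn U F P) (i : n) (p : Pair) :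
    f (dualField I R H i p) = dualField I R (fun j q => f (H j q)) i p := by
  simp [dualField, hf, map_star]

/-- A derivation that annihilates the coefficients and the two-forms annihilates the quadratic
form. -/
theorem IsGradedDerivation.kinQuad_eq_zero {D : LocalFn U F P →ₗ[ℝ] LocalFn U F P} {k : ℤ}
    (hD : IsGradedDerivation (AlgHom.id ℝ _) k D) (hc : ∀ f, D (coeff f) = 0)
    {H : n → Pair → LocalFn U F P} (hH : ∀ j p, H j p ∈ ghPart U F P 0) (h0 : ∀ j p, D (H j p) = 0)
    (I R : Matrix n n (Coeff U)) : D (kinQuad I R H) = 0 := by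
  have h1 (i) (p) : D (wedgeDual (dualField I R H i) p) = 0 := by
    rw [wedgeDual, map_smul, map_dualField_linear (fun a x => by
      rw [hD (coeff_mem_ghPart a), hc]; simp)]
    simp only [h0, dualField_zero, smul_zero]
  simp only [kinQuad, map_smul, map_sum]
  simp [hD (hH _ _), h0, h1]

end BrstForms

/-! ### The vector theory -/

section VectorTheory

variable {σ : Type} [Fintype σ] {U : Opens (σ → ℝ)} {n : Type} [Fintype n] [DecidableEq n]
  {g : Matrix σ σ (SmoothFn U)} {I R : Matrix n n (SmoothFn U)}

theorem vecF_mem {P : Type} (i : n) (p : Pair) : vecF U P n i p ∈ ghPart U (n × Fin 4) P 0 :=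
  Submodule.sub_mem _ (total_mem _ (jet_mem_ghPart (.field _) _))
    (total_mem _ (jet_mem_ghPart (.field _) _))

theorem brst_vector_field (i : n) (μ : Fin 4) :
    brst (vectorLagrangian g I R) vectorGenerators (jet (.field (i, μ)) 0)
      = total μ (jet (.ghost i) 0) := by
  rw [brst_field, Finset.sum_eq_single i]
  · simp [vectorGenerators, DiffOp.act_X]
  · intro j _ hj; simp [vectorGenerators, hj.symm, DiffOp.act_zero]
  · simp

theorem brst_vector_ghostAnti (i : n) :
    brst (vectorLagrangian g I R) vectorGenerators (jet (.ghostAnti i) 0)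
      = -∑ μ, total μ (jet (.fieldAnti (i, μ)) 0) := by
  rw [brst_ghostAnti, Fintype.sum_prod_type, Finset.sum_eq_single i]
  · simp [vectorGenerators, DiffOp.adj_X, DiffOp.act_neg, DiffOp.act_X]
  · intro j _ hj
    simp [vectorGenerators, hj, map_zero, DiffOp.act_zero]
  · simp

theorem brst_vecF (i : n) (p : Pair) :
    brst (vectorLagrangian g I R) vectorGenerators (vecF U n n i p) = 0 := by
  rw [vecF, map_extD (brst_total _ _)]
  simp only [brst_vector_field, extD_total]

theorem isGaugeSymmetry_vector (sI : I.IsSymm) (sR : R.IsSymm) (j : n) :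
    IsGaugeSymmetry (vectorLagrangian g I R : ghPart U (n × Fin 4) n 0).1
      (fun z => vectorGenerators z j) := by
  rw [IsGaugeSymmetry, Fintype.sum_prod_type, Finset.sum_eq_single j]
  · simp only [vectorGenerators, DiffOp.actAdjoint_eq, if_true, DiffOp.adj_X, DiffOp.act_neg,
      DiffOp.act_X, eulerLagrange_vector_field sI sR, Finset.sum_neg_distrib, sum_total_codiv, neg_zero]
  · intro i _ hi
    simp [vectorGenerators, hi, DiffOp.actAdjoint_eq, DiffOp.act_zero]
  · simp

theorem brst_brst_vector (sI : I.IsSymm) (sR : R.IsSymm) (x : LocalFn U (n × Fin 4) n) :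
    brst (vectorLagrangian g I R) vectorGenerators
      (brst (vectorLagrangian g I R) vectorGenerators x) = 0 := by
  refine brst_brst _ _ (fun i => ?_) (fun z => ?_) (isGaugeSymmetry_vector sI sR) x
  · rw [eulerLagrange_vector_scalar, map_add,
      (isGradedDerivation_brst _ _).kinQuad_eq_zero (brst_coeff _ _) vecF_mem brst_vecF, add_zero]
    exact (isGradedDerivation_brst _ _).eq_zero_of_mem_scalarSubalgebra (brst_coeff _ _)
      (fun i ν => by
        rw [jet_eq_totalPow, map_totalPow (brst_total _ _), brst_scalar, map_zero])
      (scalarEL_mem g i)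
  · obtain ⟨i, μ⟩ := z
    rw [eulerLagrange_vector_field sI sR, map_codiv (brst_total _ _)]
    have h (p) : brst (vectorLagrangian g I R) vectorGenerators
        (wedgeDual (dualField (coeffMatrix I) (coeffMatrix R) (vecF U n n) i) p) = 0 := by
      rw [wedgeDual, map_smul, map_dualField_linear (brst_coeff_mul _ _)]
      simp only [brst_vecF, dualField_zero, smul_zero]
    simp only [h]
    simpa using codiv_smul 0 (0 : Pair → LocalFn U (n × Fin 4) n) μ

end VectorTheory

/-! ### The embedding tensor theory in an adapted basis -/

section Adapted

/-- The gauge parameters of the embedding tensor theory in an adapted basis: gauge transformations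
of the vectors, shifts of the vectors, and shifts of the decoupled two-forms. -/
inductive AdaptedParam (r u m : Type) : Type
  | gauge (j : r ⊕ u)
  | shift (j : r ⊕ u) (μ : Fin 4)
  | tensor (k : m) (p : Pair)

/-- The gauge parameters as a disjoint sum. -/
def AdaptedParam.equivSum (r u m : Type) :
    AdaptedParam r u m ≃ (r ⊕ u) ⊕ ((r ⊕ u) × Fin 4) ⊕ (m × Pair) where
  toFun
    | .gauge j => .inl j
    | .shift j μ => .inr (.inl (j, μ))
    | .tensor k p => .inr (.inr (k, p))
  invFun
    | .inl j => .gauge j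
    | .inr (.inl x) => .shift x.1 x.2
    | .inr (.inr x) => .tensor x.1 x.2
  left_inv z := by cases z <;> rfl
  right_inv z := by rcases z with z | z | z <;> rfl

variable {r u m : Type} [Fintype r] [Fintype u] [Fintype m] [DecidableEq r] [DecidableEq u]
  [DecidableEq m]

instance : Fintype (AdaptedParam r u m) := Fintype.ofEquiv _ (AdaptedParam.equivSum r u m).symm

theorem AdaptedParam.sum_eq {M : Type*} [AddCommMonoid M] (f : AdaptedParam r u m → M) :
    ∑ x, f x = ∑ j, f (.gauge j) + (∑ j, ∑ μ, f (.shift j μ) + ∑ k, ∑ p, f (.tensor k p)) := by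
  rw [← (AdaptedParam.equivSum r u m).symm.sum_comp, Fintype.sum_sum_type,
    Fintype.sum_sum_type (α₁ := (r ⊕ u) × Fin 4), Fintype.sum_prod_type, Fintype.sum_prod_type]
  rfl

theorem EmbField.sum_eq {n a : Type} [Fintype n] [Fintype a] {M : Type*} [AddCommMonoid M]
    (f : EmbField n a → M) :
    ∑ x, f x = ∑ j, ∑ μ, f (.electric j μ) + (∑ j, ∑ μ, f (.magnetic j μ)
      + ∑ k, ∑ p, f (.twoForm k p)) := by
  rw [← (EmbField.equivSum n a).symm.sum_comp, Fintype.sum_sum_type, Fintype.sum_sum_type,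
    Fintype.sum_prod_type, Fintype.sum_prod_type, Fintype.sum_prod_type]
  rfl

/-- The coefficients of `∂_μ ξ_ν - ∂_ν ξ_μ`. -/
def extDOp (p : Pair) (μ : Fin 4) : DiffOp :=
  (if p.1.2 = μ then MvPolynomial.X p.1.1 else 0) - (if p.1.1 = μ then MvPolynomial.X p.1.2 else 0)

/-- The gauge generators of the embedding tensor theory in an adapted basis. -/
def adaptedGenerators (N : Matrix r r ℝ) :
    EmbField (r ⊕ u) (r ⊕ m) → AdaptedParam r u m → DiffOp
  | .electric (.inl i) μ, .shift (.inl j) ν => if i = j ∧ μ = ν then 1 else 0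
  | .electric (.inr i) μ, .gauge (.inr j) => if i = j then MvPolynomial.X μ else 0
  | .magnetic (.inl i) μ, .gauge (.inl j) => if i = j then MvPolynomial.X μ else 0
  | .magnetic (.inl i) μ, .shift (.inl j) ν => if μ = ν then -MvPolynomial.C (N i j) else 0
  | .magnetic (.inr i) μ, .shift (.inr j) ν => if i = j ∧ μ = ν then 1 else 0
  | .twoForm (.inl i) p, .shift (.inl j) ν => if i = j then -2 * extDOp p ν else 0
  | .twoForm (.inr i) p, .tensor j q => if i = j ∧ p = q then 1 else 0
  | _, _ => 0

variable {σ : Type} [Fintype σ] {U : Opens (σ → ℝ)}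

theorem extDOp_act {F P : Type} (p : Pair) (μ : Fin 4) (x : LocalFn U F P) :
    (extDOp p μ).act x = (if p.1.2 = μ then total p.1.1 x else 0)
      - (if p.1.1 = μ then total p.1.2 x else 0) := by
  rw [extDOp, DiffOp.act_sub]
  congr 1 <;> split_ifs <;> simp [DiffOp.act_X, DiffOp.act_zero]

theorem sum_extDOp_act {F P : Type} (p : Pair) (a : Fin 4 → LocalFn U F P) :
    ∑ μ, (extDOp p μ).act (a μ) = extD a p := by
  simp [extDOp_act, extD]

theorem extDOp_adj (p : Pair) (μ : Fin 4) : (extDOp p μ).adj = -extDOp p μ := by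
  rw [extDOp, map_sub]
  split_ifs <;> simp [DiffOp.adj_X]; abel

theorem sum_extDOp_adj_act {F P : Type} (X : Pair → LocalFn U F P) (μ : Fin 4) :
    ∑ p, (extDOp p μ).adj.act (X p) = codiv X μ := by
  have h (p : Pair) : (extDOp p μ).adj.act (X p)
      = -∑ ν, total ν (((if p.1.2 = μ ∧ p.1.1 = ν then (1 : ℝ) else 0)
        - (if p.1.1 = μ ∧ p.1.2 = ν then 1 else 0)) • X p) := by
    rw [extDOp_adj, DiffOp.act_neg, extDOp_act]
    simp only [sub_smul, ite_and, ite_smul, one_smul, zero_smul]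
    have ht (q : Fin 4) : ∑ ν, total ν (if q = ν then X p else 0) = total q (X p) := by
      rw [Finset.sum_eq_single q]
      · simp
      · intro ν _ hν; simp [hν.symm]
      · simp
    simp only [map_sub, Finset.sum_sub_distrib]
    congr 2 <;> split_ifs <;> simp [ht]
  simp only [h, codiv, ← sum_ite_pair_smul, map_sum, Finset.sum_neg_distrib]
  rw [Finset.sum_comm]

/-- The magnetic components of the embedding tensor in an adapted basis. -/
def adaptedMag (r u m : Type) [DecidableEq r] : Matrix (r ⊕ u) (r ⊕ m) ℝ :=
  Matrix.fromBlocks 1 0 0 0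

/-- The relevant electric components of the embedding tensor in an adapted basis. -/
def adaptedEl (u m : Type) (N : Matrix r r ℝ) : Matrix (r ⊕ u) (r ⊕ m) ℝ :=
  Matrix.fromBlocks N 0 0 0

/-- The Lagrangian of the embedding tensor formalism in an adapted basis. -/
def adaptedLagrangian (P m : Type) [Fintype m] (g : Matrix σ σ (SmoothFn U))
    (I R : Matrix (r ⊕ u) (r ⊕ u) (SmoothFn U)) (N : Matrix r r ℝ) :
    ghPart U (EmbField (r ⊕ u) (r ⊕ m)) P 0 :=
  embLagrangian g I R (adaptedEl u m N) (adaptedMag r u m)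

/-! ### Field equations, Noether identities and nilpotency in the adapted basis -/

section FieldEquations

variable {P : Type} {g : Matrix σ σ (SmoothFn U)} {I R : Matrix (r ⊕ u) (r ⊕ u) (SmoothFn U)}
  {N : Matrix r r ℝ}

theorem embH_adapted_inl (i : r) (p : Pair) : embH U P (adaptedMag r u m) (.inl i) p
    = extD (fun μ => jet (.field (.electric (.inl i) μ)) 0) p
      + (1 / 2 : ℝ) • jet (.field (.twoForm (.inl i) p)) 0 := by
  simp [embH, adaptedMag, Fintype.sum_sum_type, Matrix.one_apply, tensorForm]

theorem embH_adapted_inr (i : u) (p : Pair) : embH U P (adaptedMag r u m) (.inr i) p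
    = extD (fun μ => jet (.field (.electric (.inr i) μ)) 0) p := by
  simp [embH, adaptedMag, Fintype.sum_sum_type]

theorem eulerLagrange_adapted_magnetic_inl (i : r) (μ : Fin 4) :
    eulerLagrange (adaptedLagrangian P m g I R N).1 (.field (.magnetic (.inl i) μ))
      = -(1 / 2 : ℝ) • codiv (wedgeDual fun p => jet (.field (.twoForm (.inl i) p)) 0) μ := by
  rw [adaptedLagrangian, eulerLagrange_emb_magnetic]
  simp [adaptedMag, Fintype.sum_sum_type, Matrix.one_apply]
  rfl

theorem eulerLagrange_adapted_magnetic_inr (i : u) (μ : Fin 4) :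
    eulerLagrange (adaptedLagrangian P m g I R N).1 (.field (.magnetic (.inr i) μ)) = 0 := by
  rw [adaptedLagrangian, eulerLagrange_emb_magnetic]
  simp [adaptedMag, Fintype.sum_sum_type]

theorem adapted_locality (hN : N.IsSymm) (α β : r ⊕ m) :
    ∑ i, adaptedMag r u m i α * adaptedEl u m N i β = ∑ i, adaptedMag r u m i β * adaptedEl u m N i α := by
  rcases α with α | α <;> rcases β with β | β <;>
    simp [adaptedMag, adaptedEl, Fintype.sum_sum_type, Matrix.one_apply]
  exact hN.apply _ _

theorem eulerLagrange_adapted_twoForm_inl (sI : I.IsSymm) (sR : R.IsSymm) (hN : N.IsSymm) (i : r)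
    (p : Pair) :
    eulerLagrange (adaptedLagrangian P m g I R N).1 (.field (.twoForm (.inl i) p))
      = (1 / 2 : ℝ) • wedgeDual (fun q =>
          dualField (coeffMatrix I) (coeffMatrix R) (embH U P (adaptedMag r u m)) (.inl i) q
          - extD (fun μ => jet (.field (.magnetic (.inl i) μ)) 0) q
          + (1 / 2 : ℝ) • ∑ j, N i j • jet (.field (.twoForm (.inl j) q)) 0) p := by
  rw [adaptedLagrangian, eulerLagrange_emb_twoForm sI sR (adapted_locality hN)]
  simp only [adaptedMag, Fintype.sum_sum_type, Matrix.fromBlocks_apply₁₁, Matrix.one_apply,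
    Matrix.fromBlocks_apply₂₁, Matrix.zero_apply, zero_smul, Finset.sum_const_zero, add_zero,
    ite_smul, one_smul, Finset.sum_ite_eq', Finset.mem_univ, if_true]
  simp only [wedgeDual, adaptedEl, Matrix.fromBlocks_apply₁₁, Matrix.fromBlocks_apply₁₂,
    Matrix.zero_apply, zero_smul, Finset.sum_const_zero, add_zero, tensorForm, magF]
  module

theorem eulerLagrange_adapted_twoForm_inr (sI : I.IsSymm) (sR : R.IsSymm) (hN : N.IsSymm) (k : m)
    (p : Pair) :
    eulerLagrange (adaptedLagrangian P m g I R N).1 (.field (.twoForm (.inr k) p)) = 0 := by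
  rw [adaptedLagrangian, eulerLagrange_emb_twoForm sI sR (adapted_locality hN)]
  simp [adaptedMag, Fintype.sum_sum_type]

theorem brst_adapted_electric_inl (i : r) (μ : Fin 4) :
    brst (adaptedLagrangian _ m g I R N) (adaptedGenerators N) (jet (.field (.electric (.inl i) μ)) 0)
      = jet (.ghost (.shift (.inl i) μ)) 0 := by
  rw [brst_field, AdaptedParam.sum_eq]
  simp [adaptedGenerators, Fintype.sum_sum_type, DiffOp.act_zero, ite_and, apply_ite DiffOp.act,
    ite_apply, DiffOp.act_one]

theorem brst_adapted_electric_inr (i : u) (μ : Fin 4) :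
    brst (adaptedLagrangian _ m g I R N) (adaptedGenerators N) (jet (.field (.electric (.inr i) μ)) 0)
      = total μ (jet (.ghost (.gauge (.inr i))) 0) := by
  rw [brst_field, AdaptedParam.sum_eq]
  simp [adaptedGenerators, Fintype.sum_sum_type, DiffOp.act_zero, apply_ite DiffOp.act,
    ite_apply, DiffOp.act_X]

theorem brst_adapted_magnetic_inl (i : r) (μ : Fin 4) :
    brst (adaptedLagrangian _ m g I R N) (adaptedGenerators N) (jet (.field (.magnetic (.inl i) μ)) 0)
      = total μ (jet (.ghost (.gauge (.inl i))) 0)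
        - ∑ j, N i j • jet (.ghost (.shift (.inl j) μ)) 0 := by
  rw [brst_field, AdaptedParam.sum_eq]
  simp [adaptedGenerators, Fintype.sum_sum_type, DiffOp.act_zero, apply_ite DiffOp.act,
    ite_apply, DiffOp.act_X, DiffOp.act_neg, DiffOp.act_C, sub_eq_add_neg]

theorem brst_adapted_magnetic_inr (i : u) (μ : Fin 4) :
    brst (adaptedLagrangian _ m g I R N) (adaptedGenerators N) (jet (.field (.magnetic (.inr i) μ)) 0)
      = jet (.ghost (.shift (.inr i) μ)) 0 := by
  rw [brst_field, AdaptedParam.sum_eq]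
  simp [adaptedGenerators, Fintype.sum_sum_type, DiffOp.act_zero, ite_and, apply_ite DiffOp.act,
    ite_apply, DiffOp.act_one]

theorem two_mul_act {F P : Type} (T : DiffOp) (x : LocalFn U F P) :
    (2 * T).act x = (2 : ℝ) • T.act x := by
  rw [DiffOp.act_mul, ← map_ofNat MvPolynomial.C 2, DiffOp.act_C]

theorem brst_adapted_twoForm_inl (i : r) (p : Pair) :
    brst (adaptedLagrangian _ m g I R N) (adaptedGenerators N) (jet (.field (.twoForm (.inl i) p)) 0)
      = -(2 : ℝ) • extD (fun μ => jet (.ghost (.shift (.inl i) μ)) 0) p := by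
  rw [brst_field, AdaptedParam.sum_eq, ← sum_extDOp_act]
  simp [adaptedGenerators, Fintype.sum_sum_type, DiffOp.act_zero, apply_ite DiffOp.act,
    ite_apply, DiffOp.act_neg, two_mul_act, Finset.smul_sum]

theorem brst_adapted_twoForm_inr (k : m) (p : Pair) :
    brst (adaptedLagrangian (r := r) (u := u) _ m g I R N) (adaptedGenerators N)
        (jet (.field (.twoForm (.inr k) p)) 0)
      = jet (.ghost (.tensor k p)) 0 := by
  rw [brst_field, AdaptedParam.sum_eq]
  simp [adaptedGenerators, DiffOp.act_zero, ite_and, apply_ite DiffOp.act,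
    ite_apply, DiffOp.act_one]

/-- The adjoint of the gauge generators. -/
theorem sum_adaptedGenerators_adj {F P : Type} (f : EmbField (r ⊕ u) (r ⊕ m) → LocalFn U F P) :
    (∀ i, ∑ z, (adaptedGenerators N z (.gauge (.inl i))).adj.act (f z)
      = -∑ μ, total μ (f (.magnetic (.inl i) μ))) ∧
    (∀ i, ∑ z, (adaptedGenerators N z (.gauge (.inr i))).adj.act (f z)
      = -∑ μ, total μ (f (.electric (.inr i) μ))) ∧
    (∀ i μ, ∑ z, (adaptedGenerators N z (.shift (.inl i) μ)).adj.act (f z)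
      = f (.electric (.inl i) μ) - ∑ j, N j i • f (.magnetic (.inl j) μ)
        - (2 : ℝ) • codiv (fun p => f (.twoForm (.inl i) p)) μ) ∧
    (∀ i μ, ∑ z, (adaptedGenerators N z (.shift (.inr i) μ)).adj.act (f z)
      = f (.magnetic (.inr i) μ)) ∧
    (∀ k p, ∑ z, (adaptedGenerators N z (.tensor k p)).adj.act (f z)
      = f (.twoForm (.inr k) p)) := by
  have c2 : DiffOp.adj (2 : DiffOp) = 2 := by
    rw [← map_ofNat MvPolynomial.C 2, DiffOp.adj_C]
  refine ⟨fun i => ?_, fun i => ?_, fun i μ => ?_, fun i μ => ?_, fun k p => ?_⟩ <;>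
    rw [EmbField.sum_eq]
  · simp [adaptedGenerators, Fintype.sum_sum_type, DiffOp.act_zero, apply_ite DiffOp.adj, apply_ite DiffOp.act,
      ite_apply, DiffOp.act_X, DiffOp.adj_X, DiffOp.act_neg]
  · simp [adaptedGenerators, Fintype.sum_sum_type, DiffOp.act_zero, apply_ite DiffOp.adj, apply_ite DiffOp.act,
      ite_apply, DiffOp.act_X, DiffOp.adj_X, DiffOp.act_neg]
  · rw [← sum_extDOp_adj_act]
    simp [adaptedGenerators, Fintype.sum_sum_type, DiffOp.act_zero, apply_ite DiffOp.adj, apply_ite DiffOp.act,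
      ite_apply, DiffOp.act_one, DiffOp.act_neg, DiffOp.act_C, two_mul_act, c2, ite_and,
      Finset.smul_sum]
    abel
  · simp [adaptedGenerators, Fintype.sum_sum_type, DiffOp.act_zero, apply_ite DiffOp.adj, apply_ite DiffOp.act,
      ite_apply, DiffOp.act_one, ite_and]
  · simp [adaptedGenerators, Fintype.sum_sum_type, DiffOp.act_zero, apply_ite DiffOp.adj, apply_ite DiffOp.act,
      ite_apply, DiffOp.act_one, ite_and]

theorem eulerLagrange_adapted_electric (sI : I.IsSymm) (sR : R.IsSymm) (i : r ⊕ u) (μ : Fin 4) :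
    eulerLagrange (adaptedLagrangian P m g I R N).1 (.field (.electric i μ))
      = codiv (wedgeDual (dualField (coeffMatrix I) (coeffMatrix R)
          (embH U P (adaptedMag r u m)) i)) μ := by
  rw [adaptedLagrangian, eulerLagrange_emb_electric sI sR]

theorem eulerLagrange_adapted_scalar (i : σ) :
    eulerLagrange (adaptedLagrangian P m g I R N).1 (.scalar i)
      = scalarEL _ P g i + kinQuad (dphiMatrix i (coeffMatrix I)) (dphiMatrix i (coeffMatrix R))
          (embH U P (adaptedMag r u m)) := by
  rw [adaptedLagrangian, eulerLagrange_emb_scalar]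

/-- For the hatted shifts, the electric equation cancels against the divergence of the two-form
equation. There dÃ drops out by the Bianchi identity, and the terms with N cancel against the
magnetic equation because N is symmetric. -/
theorem isGaugeSymmetry_adapted (sI : I.IsSymm) (sR : R.IsSymm) (hN : N.IsSymm)
    (α : AdaptedParam r u m) :
    IsGaugeSymmetry (adaptedLagrangian P m g I R N).1 (fun z => adaptedGenerators N z α) := by
  rw [IsGaugeSymmetry]
  simp only [DiffOp.actAdjoint_eq]
  obtain ⟨h1, h2, h3, h4, h5⟩ := sum_adaptedGenerators_adj (N := N)
    (fun z => eulerLagrange (adaptedLagrangian P m g I R N).1 (.field z))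
  rcases α with (j | j) | ⟨j | j, μ⟩ | ⟨k, p⟩
  · rw [h1]
    simp only [eulerLagrange_adapted_magnetic_inl, map_smul, ← Finset.smul_sum, sum_total_codiv,
      smul_zero, neg_zero]
  · rw [h2]
    simp only [eulerLagrange_adapted_electric sI sR, sum_total_codiv, neg_zero]
  · rw [h3]
    simp only [eulerLagrange_adapted_electric sI sR, eulerLagrange_adapted_magnetic_inl,
      eulerLagrange_adapted_twoForm_inl sI sR hN, codiv_smul]
    have e : (wedgeDual fun q =>
          dualField (coeffMatrix I) (coeffMatrix R) (embH U P (adaptedMag r u m)) (.inl j) q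
          - extD (fun μ => jet (.field (.magnetic (.inl j) μ)) 0) q
          + (1 / 2 : ℝ) • ∑ k, N j k • jet (.field (.twoForm (.inl k) q)) 0)
        = fun p => (wedgeDual (dualField (coeffMatrix I) (coeffMatrix R)
            (embH U P (adaptedMag r u m)) (.inl j)) p
          + (-1 : ℝ) • wedgeDual (extD fun μ => jet (.field (.magnetic (.inl j) μ)) 0) p)
          + ∑ k, ((1 / 2 : ℝ) * N j k) • wedgeDual (fun q => jet (.field (.twoForm (.inl k) q)) 0) p := by
      funext p
      simp only [wedgeDual, smul_add, smul_sub, Finset.smul_sum, smul_smul]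
      congr 1
      · module
      · exact Finset.sum_congr rfl fun k _ => by congr 1; ring
    rw [e, codiv_add, codiv_add, codiv_sum, codiv_smul, codiv_wedgeDual_extD]
    simp only [codiv_smul, smul_smul, hN.apply, Finset.smul_sum, smul_add]
    have e2 (k : r) : N j k * -(1 / 2 : ℝ) = -(N j k / 2) := by ring
    have e3 (k : r) : 2 * (1 / 2 * (1 / 2 * N j k)) = N j k / 2 := by ring
    simp only [e2, e3, neg_smul, Finset.sum_neg_distrib]
    module
  · rw [h4, eulerLagrange_adapted_magnetic_inr]
  · rw [h5, eulerLagrange_adapted_twoForm_inr sI sR hN]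

theorem embH_adapted_mem (i : r ⊕ u) (p : Pair) :
    embH U P (adaptedMag r u m) i p ∈ ghPart U (EmbField (r ⊕ u) (r ⊕ m)) P 0 := by
  rw [← embCurvature_eq]; exact Subtype.prop _

/-- The curvature dξ of a shifted vector is compensated by ½(-2dξ) from the two-form. -/
theorem brst_embH_adapted (i : r ⊕ u) (p : Pair) :
    brst (adaptedLagrangian _ m g I R N) (adaptedGenerators N) (embH U _ (adaptedMag r u m) i p)
      = 0 := by
  rcases i with i | i
  · rw [embH_adapted_inl, map_add, map_smul, brst_adapted_twoForm_inl, map_extD (brst_total _ _)]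
    simp only [brst_adapted_electric_inl]
    module
  · rw [embH_adapted_inr, map_extD (brst_total _ _)]
    simp only [brst_adapted_electric_inr, extD_total]

theorem brst_brst_adapted (sI : I.IsSymm) (sR : R.IsSymm) (hN : N.IsSymm)
    (x : LocalFn U (EmbField (r ⊕ u) (r ⊕ m)) (AdaptedParam r u m)) :
    brst (adaptedLagrangian _ m g I R N) (adaptedGenerators N)
      (brst (adaptedLagrangian _ m g I R N) (adaptedGenerators N) x) = 0 := by
  have hd (i p) : brst (adaptedLagrangian _ m g I R N) (adaptedGenerators N)
      (dualField (coeffMatrix I) (coeffMatrix R) (embH U _ (adaptedMag r u m)) i p) = 0 := by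
    rw [map_dualField_linear (brst_coeff_mul _ _)]
    simp only [brst_embH_adapted, dualField_zero]
  have hc (X : Pair → LocalFn U (EmbField (r ⊕ u) (r ⊕ m)) (AdaptedParam r u m)) (μ)
      (hX : ∀ p, brst (adaptedLagrangian _ m g I R N) (adaptedGenerators N) (X p) = 0) :
      brst (adaptedLagrangian _ m g I R N) (adaptedGenerators N) (codiv X μ) = 0 := by
    rw [map_codiv (brst_total _ _)]
    simp only [hX]
    simpa using codiv_smul 0 (0 : Pair → LocalFn U (EmbField (r ⊕ u) (r ⊕ m)) (AdaptedParam r u m)) μ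
  refine brst_brst _ _ (fun i => ?_) (fun z => ?_) (isGaugeSymmetry_adapted sI sR hN) x
  · rw [eulerLagrange_adapted_scalar, map_add,
      (isGradedDerivation_brst _ _).kinQuad_eq_zero (brst_coeff _ _) embH_adapted_mem
        brst_embH_adapted, add_zero]
    exact (isGradedDerivation_brst _ _).eq_zero_of_mem_scalarSubalgebra (brst_coeff _ _)
      (fun i ν => by
        rw [jet_eq_totalPow, map_totalPow (brst_total _ _), brst_scalar, map_zero])
      (scalarEL_mem g i)
  · rcases z with ⟨i, μ⟩ | ⟨i | i, μ⟩ | ⟨i | i, p⟩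
    · rw [eulerLagrange_adapted_electric sI sR]
      exact hc _ _ fun p => by rw [wedgeDual, map_smul, hd, smul_zero]
    · rw [eulerLagrange_adapted_magnetic_inl, map_smul, map_codiv (brst_total _ _)]
      have e (p) : brst (adaptedLagrangian _ m g I R N) (adaptedGenerators N)
          (wedgeDual (fun q => jet (.field (.twoForm (.inl i) q)) 0) p)
          = -(2 : ℝ) • wedgeDual (extD fun μ => jet (.ghost (.shift (.inl i) μ)) 0) p := by
        simp only [wedgeDual, map_smul, brst_adapted_twoForm_inl]
        module
      simp only [e, codiv_smul, codiv_wedgeDual_extD, smul_zero]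
    · rw [eulerLagrange_adapted_magnetic_inr, map_zero]
    · rw [eulerLagrange_adapted_twoForm_inl sI sR hN]
      -- G is invariant; the shift -Nξ of Ã contributes +N dξ through -dÃ, which cancels ½N(-2dξ).
      simp only [wedgeDual, map_smul, map_add, map_sub, map_sum, hd, map_extD (brst_total _ _),
        brst_adapted_magnetic_inl, brst_adapted_twoForm_inl, extD_sub, extD_total, extD_sum, extD_smul]
      simp only [Finset.smul_sum, smul_smul]
      have : ∀ j, (1 / 2 : ℝ) * (N i j * -2) = -N i j := fun j => by ring
      simp only [this, neg_smul, Finset.sum_neg_distrib]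
      simp
    · rw [eulerLagrange_adapted_twoForm_inr sI sR hN, map_zero]

end FieldEquations

end Adapted

/-! ### Evaluation of local functions on plane waves -/

section PlaneWave

/-- The function `exp(k·x)`. -/
def expFn (k : Fin 4 → ℝ) : SmoothFn (⊤ : Opens (Fin 4 → ℝ)) :=
  SmoothFn.ofContDiffOn ⊤ (fun x => Real.exp (∑ μ, k μ * x μ))
    (Real.contDiff_exp.comp (ContDiff.sum fun μ _ =>
      contDiff_const.mul (contDiff_apply ℝ ℝ μ))).contDiffOn

theorem dir_expFn (k : Fin 4 → ℝ) (μ : Fin 4) :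
    SmoothFn.dir ⊤ (Pi.single μ 1) (expFn k) = k μ • expFn k := by
  apply Subtype.ext
  funext x
  have e := fderiv_extendZero (Ω := ⊤) (f := (expFn k).1)
    (h := fun x : Fin 4 → ℝ => Real.exp (∑ μ, k μ * x μ)) (fun _ => rfl) x
  rw [SmoothFn.dir_apply, e]
  have h : HasFDerivAt (fun x : Fin 4 → ℝ => ∑ μ, k μ * x μ)
      (∑ μ, k μ • ContinuousLinearMap.proj (R := ℝ) (φ := fun _ : Fin 4 => ℝ) μ) x.1 :=
    HasFDerivAt.fun_sum fun μ _ =>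
      ((ContinuousLinearMap.proj (R := ℝ) (φ := fun _ : Fin 4 => ℝ) μ).hasFDerivAt).const_smul (k μ)
  rw [h.exp.fderiv]
  simp [expFn, SmoothFn.ofContDiffOn, Pi.single_apply, mul_comm]

variable {σ : Type} [Fintype σ] {U : Opens (σ → ℝ)} {F P : Type}

/-- The restriction of functions of `(x, φ)` to a constant scalar configuration. -/
def Coeff.atScalar (φ : U) : Coeff U →ₐ[ℝ] SmoothFn (⊤ : Opens (Fin 4 → ℝ)) where
  toFun f := SmoothFn.ofContDiffOn ⊤ (fun x => extendZero (baseOpen U) f.1 (x, φ.1))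
    (ContDiffOn.comp f.2 (contDiff_prodMk_left φ.1).contDiffOn fun _ _ => φ.2)
  map_one' := SmoothFn.ext_eval fun x =>
    extendZero_apply (baseOpen U) (1 : Coeff U).1 ⟨(x.1, φ.1), φ.2⟩
  map_mul' f g := by
    refine SmoothFn.ext_eval fun x => ?_
    have h (f : Coeff U) := extendZero_apply (baseOpen U) f.1 ⟨(x.1, φ.1), φ.2⟩
    rw [map_mul]
    exact (h (f * g)).trans (congrArg₂ (· * ·) (h f) (h g)).symm
  map_zero' := SmoothFn.ext_eval fun x =>
    extendZero_apply (baseOpen U) (0 : Coeff U).1 ⟨(x.1, φ.1), φ.2⟩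
  map_add' f g := by
    refine SmoothFn.ext_eval fun x => ?_
    have h (f : Coeff U) := extendZero_apply (baseOpen U) f.1 ⟨(x.1, φ.1), φ.2⟩
    rw [map_add]
    exact (h (f + g)).trans (congrArg₂ (· + ·) (h f) (h g)).symm
  commutes' r := SmoothFn.ext_eval fun x =>
    extendZero_apply (baseOpen U) (algebraMap ℝ (Coeff U) r).1 ⟨(x.1, φ.1), φ.2⟩

theorem Coeff.dir_atScalar (φ : U) (f : Coeff U) (μ : Fin 4) :
    SmoothFn.dir ⊤ (Pi.single μ 1) (Coeff.atScalar φ f) = Coeff.atScalar φ (Coeff.dx U μ f) := by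
  apply Subtype.ext
  funext x
  let y : baseOpen U := ⟨(x.1, φ.1), φ.2⟩
  have e := fderiv_extendZero (Ω := ⊤) (f := (Coeff.atScalar φ f).1)
    (h := fun x : Fin 4 → ℝ => extendZero (baseOpen U) f.1 (x, φ.1)) (fun _ => rfl) x
  rw [SmoothFn.dir_apply, e]
  have h := (SmoothFn.differentiableAt f y).hasFDerivAt.comp x.1
    ((hasFDerivAt_id (𝕜 := ℝ) x.1).prodMk (hasFDerivAt_const φ.1 x.1))
  refine (congrArg (fun L : (Fin 4 → ℝ) →L[ℝ] ℝ => L (Pi.single μ 1)) h.fderiv).trans ?_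
  exact (extendZero_apply (baseOpen U) (Coeff.dx U μ f).1 y).symm

theorem Coeff.atScalar_ofScalar (φ : U) (f : SmoothFn U) :
    Coeff.atScalar φ (Coeff.ofScalar f) = algebraMap ℝ _ (f.1 φ) := by
  refine SmoothFn.ext_eval fun x => ?_
  rw [AlgHom.commutes]
  exact (extendZero_apply (baseOpen U) (Coeff.ofScalar f).1 ⟨(x.1, φ.1), φ.2⟩).trans
    (extendZero_apply U f.1 φ)

theorem Coeff.atScalar_coord (φ : U) (i : σ) :
    Coeff.atScalar φ (Coeff.coord U i) = algebraMap ℝ _ (φ.1 i) := by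
  refine SmoothFn.ext_eval fun x => ?_
  rw [AlgHom.commutes]
  exact extendZero_apply (baseOpen U) (Coeff.coord U i).1 ⟨(x.1, φ.1), φ.2⟩

variable (φ : U) (k : Fin 4 → ℝ) (ζ : F → ℝ)

/-- The values of the jet variables on a plane wave `z^a = ζ^a exp(k·x)`. -/
def planeWaveJet : Jet σ F P → SmoothFn (⊤ : Opens (Fin 4 → ℝ))
  | (.scalar i, ν) => if ν = 0 then algebraMap ℝ _ (φ.1 i) else 0
  | (.field a, ν) => (ζ a * ∏ μ, k μ ^ ν μ) • expFn k
  | _ => 0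

theorem planeWave_rel {x y} (h : Rel U F P x y) :
    FreeAlgebra.lift ℝ (Sum.elim (Coeff.atScalar φ) (planeWaveJet (P := P) φ k ζ)) x
      = FreeAlgebra.lift ℝ (Sum.elim (Coeff.atScalar φ) (planeWaveJet φ k ζ)) y := by
  cases h with
  | coeff_add f g => simp
  | coeff_mul f g => simp
  | coeff_const r => simp
  | coeff_comm f v => simp [mul_comm]
  | jet_comm v w =>
    obtain ⟨v, ν⟩ := v
    obtain ⟨w, κ⟩ := w
    cases v <;> cases w <;> simp [planeWaveJet, Gen.gh, mul_comm]
  | scalar_zero i => simp [planeWaveJet, Coeff.atScalar_coord]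

/-- The values of local functions on constant scalars and a plane wave `z^a = ζ^a exp(k·x)`. -/
def planeWave : LocalFn U F P →ₐ[ℝ] SmoothFn (⊤ : Opens (Fin 4 → ℝ)) :=
  RingQuot.liftAlgHom ℝ ⟨FreeAlgebra.lift ℝ (Sum.elim (Coeff.atScalar φ) (planeWaveJet φ k ζ)),
    fun _ _ h => planeWave_rel φ k ζ h⟩

theorem planeWave_coeff (f : Coeff U) :
    planeWave φ k ζ (coeff f : LocalFn U F P) = Coeff.atScalar φ f := by
  refine (RingQuot.liftAlgHom_mkAlgHom_apply ℝ _ _ _).trans ?_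
  rw [FreeAlgebra.lift_ι_apply]; rfl

theorem planeWave_jet (z : Gen σ F P) (ν : Fin 4 →₀ ℕ) :
    planeWave φ k ζ (jet z ν : LocalFn U F P) = planeWaveJet φ k ζ (z, ν) := by
  refine (RingQuot.liftAlgHom_mkAlgHom_apply ℝ _ _ _).trans ?_
  rw [FreeAlgebra.lift_ι_apply]; rfl

/-- The scalars are constant, so the chain rule terms of the total derivative vanish and only the
explicit dependence on x and the exponential are differentiated. -/
theorem planeWave_total (μ : Fin 4) (a : LocalFn U F P) :
    planeWave φ k ζ (total μ a) = SmoothFn.dir ⊤ (Pi.single μ 1) (planeWave φ k ζ a) := by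
  have h0 (ν : Fin 4 →₀ ℕ) : ν + Finsupp.single μ 1 ≠ 0 := fun h => by
    simpa using DFunLike.congr_fun h μ
  induction a using LocalFn.induction with
  | hcoeff f =>
    have h1 : Finsupp.single μ 1 ≠ (0 : Fin 4 →₀ ℕ) := by simp
    simp only [total_coeff, map_add, map_sum, map_mul, planeWave_coeff, planeWave_jet, planeWaveJet,
      if_neg h1, mul_zero, Finset.sum_const_zero, add_zero, Coeff.dir_atScalar]
  | hjet z ν =>
    rw [total_jet, planeWave_jet, planeWave_jet]
    cases z with
    | scalar i =>
      simp only [planeWaveJet, if_neg (h0 ν)]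
      split_ifs
      · rw [Derivation.map_algebraMap]
      · rw [map_zero]
    | field a =>
      simp only [planeWaveJet, Derivation.map_smul, dir_expFn, smul_smul]
      congr 1
      simp only [Finsupp.add_apply, pow_add, Finset.prod_mul_distrib]
      rw [Finset.prod_eq_single (f := fun i => k i ^ (Finsupp.single μ 1) i) μ]
      · simp; ring
      · intro i _ hi; simp [hi.symm]
      · simp
    | _ => simp [planeWaveJet]
  | hadd a b ha hb => simp only [map_add, ha, hb]
  | hmul a b ha hb =>
    simp only [map_mul, map_add, total_mul, ha, hb, Derivation.leibniz, smul_eq_mul]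
    ring

/-- Operators act by their symbols. Real exponentials are used, so no factors of i occur, and
equality at all real k already determines a polynomial. -/
theorem planeWave_act (T : DiffOp) {a : LocalFn U F P} {c : ℝ} (h : planeWave φ k ζ a = c • expFn k) :
    planeWave φ k ζ (T.act a) = (MvPolynomial.eval k T * c) • expFn k := by
  induction T using MvPolynomial.induction_on generalizing a c with
  | C r => rw [DiffOp.act_C, map_smul, h, smul_smul, MvPolynomial.eval_C]
  | add S T hS hT => rw [DiffOp.act_add, map_add, hS h, hT h, map_add, add_mul, add_smul]
  | mul_X T μ hT =>
    have : planeWave φ k ζ (total μ a) = (k μ * c) • expFn k := by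
      rw [planeWave_total, h, Derivation.map_smul, dir_expFn, smul_smul, mul_comm]
    rw [DiffOp.act_mul, DiffOp.act_X, hT this, map_mul, MvPolynomial.eval_X, mul_assoc]

theorem smul_expFn_injective : Function.Injective fun c : ℝ => c • expFn k := by
  intro c d h
  have := congrArg (SmoothFn.eval (⟨0, trivial⟩ : (⊤ : Opens (Fin 4 → ℝ)))) h
  simpa [SmoothFn.eval_apply, expFn, SmoothFn.ofContDiffOn] using this

end PlaneWave

/-! ### Field equations on plane waves -/

section RealForms

/-- The two-form `k_μ a_ν - k_ν a_μ`. -/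
def extR (k a : Fin 4 → ℝ) (p : Pair) : ℝ := k p.1.1 * a p.1.2 - k p.1.2 * a p.1.1

/-- The vector `-k_ν X^{νμ}`. -/
def codivR (k : Fin 4 → ℝ) (X : Pair → ℝ) (μ : Fin 4) : ℝ := -∑ ν, k ν * asym X ν μ

/-- The symbol version of integration by parts between divergence and curvature. -/
theorem sum_mul_codivR (k a : Fin 4 → ℝ) (X : Pair → ℝ) :
    ∑ μ, a μ * codivR k X μ = -∑ p, extR k a p * X p := by
  simp only [Pair.sum_eq, Fin.sum_univ_four, codivR, extR, asym]
  simp only [Fin.isValue, lt_self_iff_false, ↓reduceDIte, Fin.reduceLT]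
  ring

theorem sum_mul_wedgeDual_comm (X Y : Pair → ℝ) :
    ∑ p, X p * wedgeDual Y p = ∑ p, wedgeDual X p * Y p := by
  simp [Pair.sum_eq, wedgeDual, Pair.compl, Pair.sgn]
  ring

/-- k ∧ a ∧ k ∧ c = 0; for this reason the R terms drop out of the Noether identity. -/
theorem sum_wedgeDual_extR_mul_extR (k a c : Fin 4 → ℝ) :
    ∑ p, wedgeDual (extR k a) p * extR k c p = 0 := by
  simp [Pair.sum_eq, wedgeDual, Pair.compl, Pair.sgn, extR]
  ring

/-- `k² a_μ - (k·a) k_μ`. -/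
def maxwellSymbol (k a : Fin 4 → ℝ) (μ : Fin 4) : ℝ :=
  (∑ ν, eta ν * k ν ^ 2) * a μ - (∑ ν, eta ν * (k ν * a ν)) * k μ

theorem sum_eta_extR_mul_extR (k a c : Fin 4 → ℝ) :
    ∑ p : Pair, p.eta * (extR k a p * extR k c p) = ∑ μ, eta μ * (c μ * maxwellSymbol k a μ) := by
  simp [Pair.sum_eq, Pair.eta, extR, maxwellSymbol, Fin.sum_univ_four, eta]
  ring

/-- The part of the Maxwell operator along k disappears on antisymmetrization with k, and only the
multiple k² of k ∧ a remains. -/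
theorem mul_maxwellSymbol_sub (k a : Fin 4 → ℝ) (μ ν : Fin 4) :
    k ν * maxwellSymbol k a μ - k μ * maxwellSymbol k a ν
      = (∑ ν, eta ν * k ν ^ 2) * (k ν * a μ - k μ * a ν) := by
  simp only [maxwellSymbol]; ring

theorem maxwellSymbol_sum {ι : Type*} (s : Finset ι) (f : ι → ℝ) (k : Fin 4 → ℝ)
    (a : ι → Fin 4 → ℝ) (μ : Fin 4) :
    maxwellSymbol k (fun μ => ∑ i ∈ s, f i * a i μ) μ = ∑ i ∈ s, f i * maxwellSymbol k (a i) μ := by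
  simp only [maxwellSymbol, mul_sub, Finset.sum_sub_distrib, Finset.mul_sum, Finset.sum_mul]
  congr 1
  · exact Finset.sum_congr rfl fun _ _ => Finset.sum_congr rfl fun _ _ => by ring
  · rw [Finset.sum_comm]
    exact Finset.sum_congr rfl fun _ _ => Finset.sum_congr rfl fun _ _ => by ring

variable {n : Type} [Fintype n]

/-- The dual field strengths `R H + I *H` for real kinetic matrices. -/
def dualR (I R : Matrix n n ℝ) (H : n → Pair → ℝ) (i : n) (p : Pair) : ℝ :=
  ∑ j, (R i j * H j p + I i j * star (H j) p)

end RealForms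

/-! ### Evaluation at a point and real kinetic matrices -/

section PointValue

variable {σ : Type} [Fintype σ] {U : Opens (σ → ℝ)} {F P : Type} {n : Type} [Fintype n]

/-- The point `(0, φ)`. -/
def basePoint (φ : U) : baseOpen U := ⟨(0, φ.1), φ.2⟩

variable (F P) in
/-- The values of local functions at `x = 0`, constant scalars, and vanishing other fields. -/
def pointValue (φ : U) : LocalFn U F P →ₐ[ℝ] ℝ :=
  (SmoothFn.eval (⟨0, trivial⟩ : (⊤ : Opens (Fin 4 → ℝ)))).comp (planeWave φ 0 0)

theorem pointValue_coeff (φ : U) (f : Coeff U) :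
    pointValue F P φ (coeff f) = SmoothFn.eval (basePoint φ) f := by
  rw [pointValue, AlgHom.comp_apply, planeWave_coeff]
  exact extendZero_apply (baseOpen U) f.1 (basePoint φ)

theorem pointValue_dualField (φ : U) (I R : Matrix n n (Coeff U)) (X : n → Pair → LocalFn U F P)
    (i : n) (p : Pair) : pointValue F P φ (dualField I R X i p)
      = dualR (I.map (SmoothFn.eval (basePoint φ))) (R.map (SmoothFn.eval (basePoint φ)))
          (fun j q => pointValue F P φ (X j q)) i p := by
  have h (Y : Pair → LocalFn U F P) : pointValue F P φ (star Y p)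
      = star (fun q => pointValue F P φ (Y q)) p :=
    map_star (pointValue F P φ).toLinearMap Y p
  simp [dualField, dualR, pointValue_coeff, h]

theorem coeffMatrix_map_eval (φ : U) (A : Matrix n n (SmoothFn U)) :
    (coeffMatrix A).map (SmoothFn.eval (basePoint φ)) = matrixAt A φ := by
  ext i j
  exact extendZero_apply U (A i j).1 φ

theorem sum_dualR_mul_wedgeDual {I R : Matrix n n ℝ} (hI : I.IsSymm) (hR : R.IsSymm)
    (X H : n → Pair → ℝ) :
    ∑ i, ∑ p, X i p * wedgeDual (dualR I R H i) p
      = ∑ i, ∑ p, wedgeDual (dualR I R X i) p * H i p := by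
  have h1 (X : n → Pair → ℝ) (i : n) (p : Pair) : wedgeDual (dualR I R X i) p
      = ∑ j, (R i j * wedgeDual (X j) p - I i j * (p.eta * X j p)) := by
    have h (j) := wedgeDual_star (X j) p
    simp only [wedgeDual, dualR, smul_eq_mul, Finset.mul_sum] at h ⊢
    refine Finset.sum_congr rfl fun j _ => ?_
    linear_combination I i j * h j
  have h2 (i j : n) : ∑ p, X i p * (R i j * wedgeDual (H j) p - I i j * (p.eta * H j p))
      = ∑ p, (R j i * wedgeDual (X i) p - I j i * (p.eta * X i p)) * H j p := by
    have := sum_mul_wedgeDual_comm (X i) (H j)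
    simp only [mul_sub, sub_mul, Finset.sum_sub_distrib, hI.apply i j, hR.apply i j]
    congr 1
    · simp only [mul_left_comm _ (R i j), mul_assoc (R i j), ← Finset.mul_sum, this]
    · exact Finset.sum_congr rfl fun _ _ => by ring
  simp only [h1, Finset.mul_sum, Finset.sum_mul]
  have l (i : n) := Finset.sum_comm (s := Finset.univ) (t := Finset.univ)
    (f := fun (p : Pair) j => X i p * (R i j * wedgeDual (H j) p - I i j * (p.eta * H j p)))
  have r (i : n) := Finset.sum_comm (s := Finset.univ) (t := Finset.univ)
    (f := fun (p : Pair) j => (R i j * wedgeDual (X j) p - I i j * (p.eta * X j p)) * H i p)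
  simp only [l, r, h2]
  exact Finset.sum_comm

end PointValue

/-! ### Two-forms on plane waves -/

section PlaneWaveForms

variable {σ : Type} [Fintype σ] {U : Opens (σ → ℝ)} {F P : Type} {n : Type} [Fintype n]
  {φ : U} {k : Fin 4 → ℝ} {ζ : F → ℝ}

theorem planeWave_field (a : F) :
    planeWave φ k ζ (jet (.field a) 0 : LocalFn U F P) = ζ a • expFn k := by
  rw [planeWave_jet]; simp [planeWaveJet]

theorem planeWave_total_smul {a : LocalFn U F P} {c : ℝ} (h : planeWave φ k ζ a = c • expFn k)
    (μ : Fin 4) : planeWave φ k ζ (total μ a) = (k μ * c) • expFn k := by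
  rw [planeWave_total, h, Derivation.map_smul, dir_expFn, smul_smul, mul_comm]

theorem planeWave_extD {a : Fin 4 → LocalFn U F P} {c : Fin 4 → ℝ}
    (h : ∀ μ, planeWave φ k ζ (a μ) = c μ • expFn k) (p : Pair) :
    planeWave φ k ζ (extD a p) = extR k c p • expFn k := by
  rw [extD, map_sub, planeWave_total_smul (h _), planeWave_total_smul (h _), ← sub_smul, extR]

theorem planeWave_codiv {X : Pair → LocalFn U F P} {c : Pair → ℝ}
    (h : ∀ p, planeWave φ k ζ (X p) = c p • expFn k) (μ : Fin 4) :
    planeWave φ k ζ (codiv X μ) = codivR k c μ • expFn k := by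
  have h' (ν : Fin 4) : planeWave φ k ζ (asym X ν μ) = asym c ν μ • expFn k := by
    unfold asym; split_ifs <;> simp [h]
  rw [codiv, map_neg, map_sum, codivR, neg_smul, Finset.sum_smul]
  simp only [planeWave_total_smul (h' _)]

theorem planeWave_wedgeDual {X : Pair → LocalFn U F P} {c : Pair → ℝ}
    (h : ∀ p, planeWave φ k ζ (X p) = c p • expFn k) (p : Pair) :
    planeWave φ k ζ (wedgeDual X p) = wedgeDual c p • expFn k := by
  rw [wedgeDual, map_smul, h, smul_smul]; rfl

theorem planeWave_dualField {I R : Matrix n n (SmoothFn U)} {X : n → Pair → LocalFn U F P}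
    {c : n → Pair → ℝ} (h : ∀ i p, planeWave φ k ζ (X i p) = c i p • expFn k) (i : n) (p : Pair) :
    planeWave φ k ζ (dualField (coeffMatrix I) (coeffMatrix R) X i p)
      = dualR (matrixAt I φ) (matrixAt R φ) c i p • expFn k := by
  have hs (j : n) : planeWave φ k ζ (star (X j) p) = star (c j) p • expFn k := by
    rw [star, map_smul, h, smul_smul]; rfl
  have hc (A : Matrix n n (SmoothFn U)) (i j : n) :
      planeWave φ k ζ (coeff (coeffMatrix A i j) : LocalFn U F P)
        = algebraMap ℝ _ (matrixAt A φ i j) := by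
    rw [planeWave_coeff]; exact Coeff.atScalar_ofScalar φ (A i j)
  rw [dualField, map_sum, dualR, Finset.sum_smul]
  refine Finset.sum_congr rfl fun j _ => ?_
  rw [map_add, map_mul, map_mul, hs, h, hc, hc, ← Algebra.smul_def, ← Algebra.smul_def, smul_smul,
    smul_smul, add_smul]

end PlaneWaveForms

/-! ### Gauge symmetries of the embedding tensor theory in an adapted basis -/

section Symbols

variable {r u m : Type} [Fintype r] [Fintype u] [Fintype m] [DecidableEq r] [DecidableEq u]
  [DecidableEq m] {σ : Type} [Fintype σ] {U : Opens (σ → ℝ)} {P : Type}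
  {g : Matrix σ σ (SmoothFn U)} {I R : Matrix (r ⊕ u) (r ⊕ u) (SmoothFn U)} {N : Matrix r r ℝ}

/-- The values of the field strengths `H` on plane waves. -/
def symbolH (k : Fin 4 → ℝ) (ζ : EmbField (r ⊕ u) (r ⊕ m) → ℝ) : r ⊕ u → Pair → ℝ
  | .inl i => fun p => extR k (fun μ => ζ (.electric (.inl i) μ)) p + 1 / 2 * ζ (.twoForm (.inl i) p)
  | .inr i => extR k (fun μ => ζ (.electric (.inr i) μ))

variable {φ : U} {k : Fin 4 → ℝ} {ζ : EmbField (r ⊕ u) (r ⊕ m) → ℝ}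

theorem planeWave_embH (i : r ⊕ u) (p : Pair) :
    planeWave φ k ζ (embH U P (adaptedMag r u m) i p) = symbolH k ζ i p • expFn k := by
  rcases i with i | i
  · rw [embH_adapted_inl, map_add, map_smul, planeWave_field,
      planeWave_extD (c := fun μ => ζ (.electric (.inl i) μ)) (fun μ => planeWave_field _),
      smul_smul, ← add_smul]
    rfl
  · rw [embH_adapted_inr,
      planeWave_extD (c := fun μ => ζ (.electric (.inr i) μ)) (fun μ => planeWave_field _)]
    rfl

/-- The Noether identity on plane waves. -/
theorem noether_symbol (sI : I.IsSymm) (sR : R.IsSymm) (hN : N.IsSymm)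
    {T : EmbField (r ⊕ u) (r ⊕ m) → DiffOp}
    (hT : IsGaugeSymmetry (adaptedLagrangian P m g I R N).1 T) (φ : U) (k : Fin 4 → ℝ)
    (ζ : EmbField (r ⊕ u) (r ⊕ m) → ℝ) :
    let t := fun z => MvPolynomial.eval k (DiffOp.adj (T z))
    let G := dualR (matrixAt I φ) (matrixAt R φ) (symbolH k ζ)
    ∑ i, ∑ μ, t (.electric i μ) * codivR k (wedgeDual (G i)) μ
      + (∑ i, ∑ μ, t (.magnetic (.inl i) μ)
            * (-(1 / 2) * codivR k (wedgeDual fun p => ζ (.twoForm (.inl i) p)) μ)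
        + ∑ i, ∑ p, t (.twoForm (.inl i) p) * (1 / 2 * wedgeDual (fun q =>
            G (.inl i) q - extR k (fun μ => ζ (.magnetic (.inl i) μ)) q
              + 1 / 2 * ∑ j, N i j * ζ (.twoForm (.inl j) q)) p)) = 0 := by
  intro t G
  refine smul_expFn_injective k ?_
  have h := congrArg (planeWave φ k ζ) hT
  rw [map_sum, map_zero, EmbField.sum_eq] at h
  simp only [DiffOp.actAdjoint_eq] at h
  have hG (i : r ⊕ u) (p : Pair) := planeWave_dualField (φ := φ) (I := I) (R := R)
    (planeWave_embH (φ := φ) (k := k) (ζ := ζ) (P := P)) i p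
  have hE (i : r ⊕ u) (μ : Fin 4) := planeWave_act (P := P) φ k ζ (DiffOp.adj (T (.electric i μ)))
    (planeWave_codiv (planeWave_wedgeDual (hG i)) μ)
  have hM (i : r) (μ : Fin 4) := planeWave_act (P := P) φ k ζ (DiffOp.adj (T (.magnetic (.inl i) μ)))
    (a := -(1 / 2 : ℝ) • codiv (wedgeDual fun p => jet (.field (.twoForm (.inl i) p)) 0) μ)
    (c := -(1 / 2) * codivR k (wedgeDual fun p => ζ (.twoForm (.inl i) p)) μ) (by
      rw [map_smul, planeWave_codiv (planeWave_wedgeDual fun p => planeWave_field _), smul_smul])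
  have hB (i : r) (p : Pair) := planeWave_act (P := P) φ k ζ (DiffOp.adj (T (.twoForm (.inl i) p)))
    (a := (1 / 2 : ℝ) • wedgeDual (fun q =>
          dualField (coeffMatrix I) (coeffMatrix R) (embH U P (adaptedMag r u m)) (.inl i) q
          - extD (fun μ => jet (.field (.magnetic (.inl i) μ)) 0) q
          + (1 / 2 : ℝ) • ∑ j, N i j • jet (.field (.twoForm (.inl j) q)) 0) p)
    (c := 1 / 2 * wedgeDual (fun q =>
            G (.inl i) q - extR k (fun μ => ζ (.magnetic (.inl i) μ)) q
              + 1 / 2 * ∑ j, N i j * ζ (.twoForm (.inl j) q)) p) (by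
      rw [map_smul, planeWave_wedgeDual (fun q => ?_), smul_smul]
      rw [map_add, map_sub, map_smul, map_sum, hG, planeWave_extD fun μ => planeWave_field _]
      simp only [map_smul, planeWave_field, smul_smul, ← Finset.sum_smul, ← sub_smul, ← add_smul]
      rfl)
  -- The unhatted magnetic vectors and the decoupled two-forms have vanishing field equations, so
  -- the Noether identity does not restrict their components.
  simp only [Fintype.sum_sum_type, eulerLagrange_adapted_electric sI sR,
    eulerLagrange_adapted_magnetic_inl, eulerLagrange_adapted_magnetic_inr,
    eulerLagrange_adapted_twoForm_inl sI sR hN, eulerLagrange_adapted_twoForm_inr sI sR hN,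
    DiffOp.act_eq _ (0 : LocalFn U _ P), map_zero, Finset.sum_const_zero, add_zero,
    hE, hM, hB] at h
  simp only [zero_smul, add_smul, Finset.sum_smul, Fintype.sum_sum_type]
  exact h


end Symbols

/-! ### Consequences of the Noether identity for symbols -/

section SymbolAnalysis

variable {r u m : Type} [Fintype r] [Fintype u] [Fintype m] [DecidableEq r] [DecidableEq u]
  [DecidableEq m]

theorem sum_mul_wedgeDual_symm {N : Matrix r r ℝ} (hN : N.IsSymm) (X Y : r → Pair → ℝ) :
    ∑ i, ∑ p, X i p * wedgeDual (fun q => ∑ j, N i j * Y j q) p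
      = ∑ i, ∑ p, wedgeDual (fun q => ∑ j, N i j * X j q) p * Y i p := by
  have e (Z : r → Pair → ℝ) (i : r) (p : Pair) : wedgeDual (fun q => ∑ j, N i j * Z j q) p
      = ∑ j, N i j * wedgeDual (Z j) p := by
    simp only [wedgeDual, smul_eq_mul, Finset.mul_sum]
    exact Finset.sum_congr rfl fun _ _ => by ring
  have l (i : r) : ∑ p, X i p * ∑ j, N i j * wedgeDual (Y j) p
      = ∑ j, N i j * ∑ p, X i p * wedgeDual (Y j) p := by
    simp only [Finset.mul_sum]
    rw [Finset.sum_comm]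
    exact Finset.sum_congr rfl fun _ _ => Finset.sum_congr rfl fun _ _ => by ring
  have l' (i : r) : ∑ p, (∑ j, N i j * wedgeDual (X j) p) * Y i p
      = ∑ j, N i j * ∑ p, wedgeDual (X j) p * Y i p := by
    simp only [Finset.mul_sum, Finset.sum_mul]
    rw [Finset.sum_comm]
    exact Finset.sum_congr rfl fun _ _ => Finset.sum_congr rfl fun _ _ => by ring
  simp only [e, l, l', sum_mul_wedgeDual_comm]
  rw [Finset.sum_comm]
  exact Finset.sum_congr rfl fun i _ => Finset.sum_congr rfl fun j _ => by rw [hN.apply]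

/-- The two-forms that multiply `H` in the Noether identity. -/
def symbolChi (k : Fin 4 → ℝ) (t : EmbField (r ⊕ u) (r ⊕ m) → ℝ) : r ⊕ u → Pair → ℝ
  | .inl i => fun p =>
      1 / 2 * t (.twoForm (.inl i) p) - extR k (fun μ => t (.electric (.inl i) μ)) p
  | .inr i => fun p => -extR k (fun μ => t (.electric (.inr i) μ)) p

variable {N : Matrix r r ℝ} {I R : Matrix (r ⊕ u) (r ⊕ u) ℝ} {k : Fin 4 → ℝ}
  {t : EmbField (r ⊕ u) (r ⊕ m) → ℝ}

variable (N I R k t) in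
/-- The Noether identity for the symbol `t` of a gauge transformation at the wave vector `k`. -/
def NoetherSymbol : Prop := ∀ ζ : EmbField (r ⊕ u) (r ⊕ m) → ℝ,
    let G := dualR I R (symbolH k ζ)
    ∑ i, ∑ μ, t (.electric i μ) * codivR k (wedgeDual (G i)) μ
      + (∑ i, ∑ μ, t (.magnetic (.inl i) μ)
            * (-(1 / 2) * codivR k (wedgeDual fun p => ζ (.twoForm (.inl i) p)) μ)
        + ∑ i, ∑ p, t (.twoForm (.inl i) p) * (1 / 2 * wedgeDual (fun q =>
            G (.inl i) q - extR k (fun μ => ζ (.magnetic (.inl i) μ)) q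
              + 1 / 2 * ∑ j, N i j * ζ (.twoForm (.inl j) q)) p)) = 0

/-- All operators are moved from the test amplitudes ζ to the symbol t, using symmetry of I, R, N
and of the wedge pairing. The coefficient of each amplitude can then be read off. -/
theorem NoetherSymbol.transpose (sI : I.IsSymm) (sR : R.IsSymm) (hN : N.IsSymm)
    (h : NoetherSymbol N I R k t) (ζ : EmbField (r ⊕ u) (r ⊕ m) → ℝ) :
    ∑ i, ∑ p, wedgeDual (dualR I R (symbolChi k t) i) p * symbolH k ζ i p
      + 1 / 2 * ∑ i, ∑ p, wedgeDual (extR k fun μ => t (.magnetic (.inl i) μ)) p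
          * ζ (.twoForm (.inl i) p)
      - 1 / 2 * ∑ i, ∑ p, t (.twoForm (.inl i) p)
          * wedgeDual (extR k fun μ => ζ (.magnetic (.inl i) μ)) p
      + 1 / 4 * ∑ i, ∑ p, wedgeDual (fun q => ∑ j, N i j * t (.twoForm (.inl j) q)) p
          * ζ (.twoForm (.inl i) p) = 0 := by
  have h := h ζ
  have hM (i : r) : ∑ μ, t (.magnetic (.inl i) μ)
      * (-(1 / 2) * codivR k (wedgeDual fun p => ζ (.twoForm (.inl i) p)) μ)
      = 1 / 2 * ∑ p, wedgeDual (extR k fun μ => t (.magnetic (.inl i) μ)) p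
          * ζ (.twoForm (.inl i) p) := by
    rw [← sum_mul_wedgeDual_comm]
    have e := sum_mul_codivR k (fun μ => t (.magnetic (.inl i) μ))
      (wedgeDual fun p => ζ (.twoForm (.inl i) p))
    simp only [mul_left_comm _ (-(1 / 2 : ℝ)), ← Finset.mul_sum, e]
    ring
  have hB (i : r) (G M B : Pair → ℝ) : ∑ p, t (.twoForm (.inl i) p)
        * (1 / 2 * wedgeDual (fun q => G q - M q + 1 / 2 * B q) p)
      = 1 / 2 * ∑ p, t (.twoForm (.inl i) p) * wedgeDual G p
        - 1 / 2 * ∑ p, t (.twoForm (.inl i) p) * wedgeDual M p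
        + 1 / 4 * ∑ p, t (.twoForm (.inl i) p) * wedgeDual B p := by
    simp only [Finset.mul_sum, ← Finset.sum_sub_distrib, ← Finset.sum_add_distrib, wedgeDual,
      smul_eq_mul]
    exact Finset.sum_congr rfl fun _ _ => by ring
  simp only [sum_mul_codivR, hM, hB] at h
  rw [← sum_mul_wedgeDual_symm hN, ← sum_dualR_mul_wedgeDual sI sR]
  refine Eq.trans ?_ h
  simp only [Fintype.sum_sum_type, symbolChi, sub_mul, neg_mul, mul_assoc, Finset.sum_add_distrib,
    Finset.sum_sub_distrib, Finset.sum_neg_distrib, ← Finset.mul_sum]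
  ring

/-- Testing against the wedge dual itself gives a sum of squares. -/
theorem eq_zero_of_sum_wedgeDual_mul {V : r → Pair → ℝ}
    (h : ∀ b : r → Pair → ℝ, ∑ i, ∑ p, wedgeDual (V i) p * b i p = 0) (i : r) (p : Pair) :
    V i p = 0 := by
  have h0 := h fun i => wedgeDual (V i)
  have h1 := (Finset.sum_eq_zero_iff_of_nonneg fun i _ =>
    Finset.sum_nonneg fun p _ => mul_self_nonneg _).1 h0 i (Finset.mem_univ _)
  have h2 : wedgeDual (V i) = 0 := funext fun p => mul_self_eq_zero.1
    ((Finset.sum_eq_zero_iff_of_nonneg fun p _ => mul_self_nonneg _).1 h1 p (Finset.mem_univ _))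
  rw [← wedgeDual_wedgeDual (V i), h2]
  simp [wedgeDual]

theorem extR_zero : extR k (fun _ => 0) = fun _ => 0 := by
  funext p; simp [extR]

theorem wedgeDual_zero_fun : wedgeDual (fun _ => (0 : ℝ)) = fun _ => 0 := by
  funext p; simp [wedgeDual]

/-- The consequences of the Noether identity for the symbol of a gauge transformation. -/
theorem NoetherSymbol.equations (sI : I.IsSymm) (sR : R.IsSymm) (hN : N.IsSymm)
    (h : NoetherSymbol N I R k t) :
    (∀ i p, dualR I R (symbolChi k t) (.inl i) p + extR k (fun μ => t (.magnetic (.inl i) μ)) p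
      + 1 / 2 * ∑ j, N i j * t (.twoForm (.inl j) p) = 0) ∧
    (∀ c : r → Fin 4 → ℝ, ∑ i, ∑ p, t (.twoForm (.inl i) p) * wedgeDual (extR k (c i)) p = 0) ∧
    ∀ c : u → Fin 4 → ℝ,
      ∑ i, ∑ p, wedgeDual (dualR I R (symbolChi k t) (.inr i)) p * extR k (c i) p = 0 := by
  have h := h.transpose sI sR hN
  refine ⟨eq_zero_of_sum_wedgeDual_mul fun b => ?_, fun c => ?_, fun c => ?_⟩
  · have h := h fun | .twoForm (.inl i) p => b i p | _ => 0
    have h := congrArg (2 * ·) h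
    simp only [symbolH, extR_zero, wedgeDual_zero_fun, Fintype.sum_sum_type, mul_zero, zero_add,
      Finset.sum_const_zero, add_zero, sub_zero] at h
    refine Eq.trans ?_ h
    simp only [Finset.mul_sum, mul_add, ← Finset.sum_add_distrib, wedgeDual, smul_eq_mul]
    refine Finset.sum_congr rfl fun i _ => Finset.sum_congr rfl fun p _ => ?_
    simp only [← Finset.mul_sum]
    ring
  · have h := h fun | .magnetic (.inl i) μ => c i μ | _ => 0
    simp only [symbolH, extR_zero, Fintype.sum_sum_type, mul_zero, Finset.sum_const_zero,
      add_zero] at h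
    linarith
  · have h := h fun | .electric (.inr i) μ => c i μ | _ => 0
    simpa only [symbolH, extR_zero, wedgeDual_zero_fun, Fintype.sum_sum_type, mul_zero, zero_add,
      Finset.sum_const_zero, add_zero, sub_zero] using h

end SymbolAnalysis

/-! ### From the Noether identity to Maxwell's equations in the new frame -/

section Completeness

variable {r u m : Type} [Fintype r] [Fintype u] [Fintype m] [DecidableEq r] [DecidableEq u]
  [DecidableEq m] {σ : Type} [Fintype σ] {U : Opens (σ → ℝ)} {P : Type}
  {g : Matrix σ σ (SmoothFn U)} {I R I' R' : Matrix (r ⊕ u) (r ⊕ u) (SmoothFn U)} {N : Matrix r r ℝ}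
  (h : DualFrame (N.map (algebraMap ℝ _)) (coeffMatrix I) (coeffMatrix R) (coeffMatrix I')
    (coeffMatrix R')) (φ : U)

include h in
/-- Field strengths with the dual `X₁ - N H₁` are those of the old frame. -/
theorem DualFrame.dualR_oldField (H X : r ⊕ u → Pair → ℝ) (hX : ∀ j, X (.inr j) = H (.inr j))
    (hH : ∀ k q, dualR (matrixAt I φ) (matrixAt R φ) H (.inl k) q + ∑ l, N k l * H (.inl l) q
      - X (.inl k) q = 0) :
    (∀ i p, H (.inl i) p = -dualR (matrixAt I' φ) (matrixAt R' φ) X (.inl i) p) ∧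
    ∀ i p, dualR (matrixAt I φ) (matrixAt R φ) H (.inr i) p
      = dualR (matrixAt I' φ) (matrixAt R' φ) X (.inr i) p := by
  -- Real two-forms are regarded as constant local functions of a theory without fields, so the
  -- duality identities for local functions apply and are then evaluated at φ.
  let c (x : ℝ) : LocalFn U Empty Empty := algebraMap ℝ _ x
  have hc (x : ℝ) : pointValue Empty Empty φ (c x) = x := AlgHom.commutes _ x
  have hel : (fun j q => pointValue Empty Empty φ
      ((Sum.elim (fun k q => c (H (.inl k) q)) fun j q => c (X (.inr j) q)) j q)) = H := by
    funext j q
    rcases j with j | j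
    · exact hc _
    · rw [← hX]; exact hc _
  have key (i : r) (p : Pair) : H (.inl i) p = -dualR (matrixAt I' φ) (matrixAt R' φ) X (.inl i) p := by
    have e := congrArg (pointValue Empty Empty φ)
      (h.dualField_equation (fun i p => c (X i p)) (fun k q => c (H (.inl k) q)) i p)
    rw [pointValue_dualField, map_neg, map_add, hc, pointValue_dualField] at e
    simp only [map_sub, map_add, map_sum, map_smul, hc, pointValue_dualField, coeffMatrix_map_eval,
      hel, smul_eq_mul, hH] at e
    have e0 (A B : Matrix r r ℝ) : dualR A B (fun _ _ => 0) i p = 0 := by simp [dualR, star]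
    rw [e0] at e
    linarith
  refine ⟨key, fun i p => ?_⟩
  have e := congrArg (pointValue Empty Empty φ)
      ((h.dualField_oldField (fun i p => c (X i p)) p).2 i)
  rw [pointValue_dualField, pointValue_dualField] at e
  simp only [coeffMatrix_map_eval, hc] at e
  rw [← e]
  congr 1
  funext j q
  rcases j with j | j
  · simp only [oldField, map_neg, pointValue_dualField, coeffMatrix_map_eval, hc]
    exact key j q
  · simp only [oldField, hc, hX]

/-- The vector components of the symbol of a gauge transformation in the new frame. -/
def symbolPotential (N : Matrix r r ℝ) (t : EmbField (r ⊕ u) (r ⊕ m) → ℝ) : r ⊕ u → Fin 4 → ℝ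
  | .inl i => fun μ => t (.magnetic (.inl i) μ) + ∑ j, N i j * t (.electric (.inl j) μ)
  | .inr i => fun μ => t (.electric (.inr i) μ)

variable {φ} {k : Fin 4 → ℝ} {t : EmbField (r ⊕ u) (r ⊕ m) → ℝ}

include h in
-- For the potentials q of `symbolPotential`, the equation from the two-form amplitudes is (τχ + Nχ
-- + k ∧ q) = 0 in the hatted block. This is the duality relation with χ as old and -k ∧ q as new
-- field strength.
theorem NoetherSymbol.symbolChi_eq (sI : (matrixAt I φ).IsSymm) (sR : (matrixAt R φ).IsSymm)
    (hN : N.IsSymm) (ht : NoetherSymbol N (matrixAt I φ) (matrixAt R φ) k t) :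
    (∀ i p, symbolChi k t (.inl i) p = -dualR (matrixAt I' φ) (matrixAt R' φ)
      (fun J q => -extR k (symbolPotential N t J) q) (.inl i) p) ∧
    ∀ i p, dualR (matrixAt I φ) (matrixAt R φ) (symbolChi k t) (.inr i) p
      = dualR (matrixAt I' φ) (matrixAt R' φ) (fun J q => -extR k (symbolPotential N t J) q)
        (.inr i) p := by
  obtain ⟨h1, -, -⟩ := ht.equations sI sR hN
  refine h.dualR_oldField φ _ _ (fun j => rfl) fun i p => ?_
  have e := h1 i p
  have e2 : extR k (symbolPotential N t (.inl i)) p = extR k (fun μ => t (.magnetic (.inl i) μ)) p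
      + ∑ j, N i j * extR k (fun μ => t (.electric (.inl j) μ)) p := by
    simp only [extR, symbolPotential, mul_add, mul_sub, Finset.mul_sum, Finset.sum_sub_distrib,
      mul_left_comm]
    ring
  have e3 : ∑ l, N i l * symbolChi k t (.inl l) p = 1 / 2 * ∑ j, N i j * t (.twoForm (.inl j) p)
      - ∑ j, N i j * extR k (fun μ => t (.electric (.inl j) μ)) p := by
    simp only [symbolChi, mul_sub, Finset.sum_sub_distrib, Finset.mul_sum, mul_left_comm]
  rw [e3, e2]
  linarith

include h in
-- The magnetic and the unhatted electric amplitudes together say that k ∧ q is a solution of the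
-- field equations of the new frame. R' drops out by the Bianchi identity, and I' is invertible.
theorem NoetherSymbol.maxwellSymbol_eq_zero (sI : (matrixAt I φ).IsSymm)
    (sR : (matrixAt R φ).IsSymm) (hN : N.IsSymm) (hI' : (matrixAt I' φ).PosDef)
    (ht : NoetherSymbol N (matrixAt I φ) (matrixAt R φ) k t) (J : r ⊕ u) (μ : Fin 4) :
    maxwellSymbol k (symbolPotential N t J) μ = 0 := by
  obtain ⟨-, h2, h3⟩ := ht.equations sI sR hN
  obtain ⟨h4, h5⟩ := ht.symbolChi_eq h sI sR hN
  set q := symbolPotential N t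
  set I₀ := matrixAt I' φ
  set R₀ := matrixAt R' φ
  -- Weak form of these field equations with test potential c. On hatted indices the dual field
  -- strength is -χ, whose exact part k ∧ t drops out.
  have key (c : r ⊕ u → Fin 4 → ℝ) : ∑ J, ∑ p,
      wedgeDual (dualR I₀ R₀ (fun J q' => -extR k (q J) q') J) p * extR k (c J) p = 0 := by
    rw [Fintype.sum_sum_type]
    have e1 (i : r) : ∑ p, wedgeDual (dualR I₀ R₀ (fun J q' => -extR k (q J) q') (.inl i)) p
          * extR k (c (.inl i)) p
        = -(1 / 2) * ∑ p, t (.twoForm (.inl i) p) * wedgeDual (extR k (c (.inl i))) p := by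
      have e : dualR I₀ R₀ (fun J q' => -extR k (q J) q') (.inl i)
          = fun p => extR k (fun μ => t (.electric (.inl i) μ)) p - 1 / 2 * t (.twoForm (.inl i) p) := by
        funext p
        have := h4 i p
        simp only [symbolChi] at this
        linarith
      have e' := sum_wedgeDual_extR_mul_extR k (fun μ => t (.electric (.inl i) μ)) (c (.inl i))
      rw [sum_mul_wedgeDual_comm, e, Finset.mul_sum, ← sub_eq_zero, ← e', ← sub_eq_zero,
        ← Finset.sum_sub_distrib, ← Finset.sum_sub_distrib]
      refine Finset.sum_eq_zero fun p _ => ?_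
      simp only [wedgeDual, smul_eq_mul]
      ring
    have e2 (i : u) : wedgeDual (dualR I₀ R₀ (fun J q' => -extR k (q J) q') (.inr i))
        = wedgeDual (dualR (matrixAt I φ) (matrixAt R φ) (symbolChi k t) (.inr i)) := by
      congr 1
      funext p
      exact (h5 i p).symm
    simp only [e1, e2, ← Finset.mul_sum, h2, h3, mul_zero, add_zero]
  let w : r ⊕ u → Fin 4 → ℝ := fun J μ => ∑ L, I₀ J L * q L μ
  have key2 (c : r ⊕ u → Fin 4 → ℝ) :
      ∑ J, ∑ μ, eta μ * (c J μ * maxwellSymbol k (w J) μ) = 0 := by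
    rw [← key c]
    refine Finset.sum_congr rfl fun J _ => ?_
    rw [← sum_eta_extR_mul_extR]
    have e (p : Pair) : wedgeDual (dualR I₀ R₀ (fun J q' => -extR k (q J) q') J) p
        = p.eta * extR k (w J) p - ∑ L, R₀ J L * wedgeDual (extR k (q L)) p := by
      have hs (L) := wedgeDual_star (extR k (q L)) p
      simp only [wedgeDual, smul_eq_mul] at hs
      have hw : extR k (w J) p = ∑ L, I₀ J L * extR k (q L) p := by
        simp only [extR, w, Finset.mul_sum, ← Finset.sum_sub_distrib]
        exact Finset.sum_congr rfl fun _ _ => by ring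
      rw [hw]
      simp only [wedgeDual, dualR, smul_eq_mul, Finset.mul_sum, ← Finset.sum_sub_distrib]
      refine Finset.sum_congr rfl fun L _ => ?_
      have hs := hs L
      simp only [star, smul_eq_mul] at hs ⊢
      linear_combination -I₀ J L * hs
    simp only [e, sub_mul, Finset.sum_sub_distrib, mul_assoc]
    rw [eq_comm, sub_eq_self]
    simp only [Finset.sum_mul, mul_assoc]
    rw [Finset.sum_comm]
    simp only [← Finset.mul_sum, sum_wedgeDual_extR_mul_extR, mul_zero, Finset.sum_const_zero]
  have he (μ : Fin 4) (x y : ℝ) : eta μ * (eta μ * x * y) = x * y := by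
    have : eta μ * eta μ = 1 := by unfold eta; split_ifs <;> norm_num
    linear_combination x * y * this
  have hw (J : r ⊕ u) (μ : Fin 4) : maxwellSymbol k (w J) μ = 0 := by
    -- The extra factor η in the test potential turns the Lorentzian pairing into a sum of squares.
    have h0 := key2 fun J μ => eta μ * maxwellSymbol k (w J) μ
    simp only [he] at h0
    have h1 := (Finset.sum_eq_zero_iff_of_nonneg fun i _ =>
      Finset.sum_nonneg fun p _ => mul_self_nonneg _).1 h0 J (Finset.mem_univ _)
    exact mul_self_eq_zero.1 ((Finset.sum_eq_zero_iff_of_nonneg fun p _ => mul_self_nonneg _).1 h1 μ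
      (Finset.mem_univ _))
  have hv : I₀ *ᵥ (fun L => maxwellSymbol k (q L) μ) = 0 := by
    funext J
    have := hw J μ
    rw [maxwellSymbol_sum] at this
    exact this
  exact congrFun (Matrix.eq_zero_of_mulVec_eq_zero hI'.det_pos.ne' hv) J

include h in
-- Vanishing of k ∧ q forces the hatted χ = ½t_B - k ∧ t_A to vanish.
theorem NoetherSymbol.twoForm_eq (sI : (matrixAt I φ).IsSymm)
    (sR : (matrixAt R φ).IsSymm) (hN : N.IsSymm)
    (ht : NoetherSymbol N (matrixAt I φ) (matrixAt R φ) k t)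
    (hq : ∀ J p, extR k (symbolPotential N t J) p = 0) (i : r) (p : Pair) :
    t (.twoForm (.inl i) p) = 2 * extR k (fun μ => t (.electric (.inl i) μ)) p := by
  have h4 := (ht.symbolChi_eq h sI sR hN).1 i p
  simp only [hq, symbolChi, dualR, star, neg_zero, smul_zero, mul_zero, add_zero,
    Finset.sum_const_zero] at h4
  linarith

end Completeness

/-! ### The adapted generating set is irreducible and complete -/

section GeneratingSet

/-- The variable X₀ divides X₁q₀ and is a prime not dividing X₁, hence it divides q₀. The quotient
serves all components after cancelling X₀. -/
theorem exists_eq_X_mul {q : Fin 4 → DiffOp}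
    (h : ∀ μ ν, MvPolynomial.X ν * q μ = MvPolynomial.X μ * q ν) :
    ∃ l : DiffOp, ∀ μ, q μ = MvPolynomial.X μ * l := by
  have h01 : (MvPolynomial.X 0 : DiffOp) ∣ q 0 := by
    have h0 : (MvPolynomial.X 0 : DiffOp) ∣ MvPolynomial.X 1 * q 0 := ⟨q 1, h 0 1⟩
    refine (MvPolynomial.X_prime.dvd_or_dvd h0).resolve_left fun hd => ?_
    rw [MvPolynomial.X_dvd_X] at hd
    simp at hd
  obtain ⟨l, hl⟩ := h01
  refine ⟨l, fun μ => mul_left_cancel₀ (MvPolynomial.X_ne_zero (0 : Fin 4)) ?_⟩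
  rw [h μ 0, hl]
  ring

variable {r u m : Type} [Fintype r] [Fintype u] [Fintype m] [DecidableEq r] [DecidableEq u]
  [DecidableEq m] {σ : Type} [Fintype σ] {U : Opens (σ → ℝ)} {P : Type}
  {g : Matrix σ σ (SmoothFn U)} {I R I' R' : Matrix (r ⊕ u) (r ⊕ u) (SmoothFn U)} {N : Matrix r r ℝ}

theorem sum_adaptedGenerators_mul (c : AdaptedParam r u m → DiffOp) :
    (∀ i μ, ∑ α, adaptedGenerators N (.electric (.inl i) μ) α * c α = c (.shift (.inl i) μ)) ∧
    (∀ i μ, ∑ α, adaptedGenerators N (.electric (.inr i) μ) α * c α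
      = MvPolynomial.X μ * c (.gauge (.inr i))) ∧
    (∀ i μ, ∑ α, adaptedGenerators N (.magnetic (.inl i) μ) α * c α
      = MvPolynomial.X μ * c (.gauge (.inl i))
        - ∑ j, MvPolynomial.C (N i j) * c (.shift (.inl j) μ)) ∧
    (∀ i μ, ∑ α, adaptedGenerators N (.magnetic (.inr i) μ) α * c α = c (.shift (.inr i) μ)) ∧
    (∀ i p, ∑ α, adaptedGenerators N (.twoForm (.inl i) p) α * c α
      = -2 * ∑ μ, extDOp p μ * c (.shift (.inl i) μ)) ∧
    (∀ k p, ∑ α, adaptedGenerators N (.twoForm (.inr k) p) α * c α = c (.tensor k p)) := by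
  refine ⟨fun i μ => ?_, fun i μ => ?_, fun i μ => ?_, fun i μ => ?_, fun i p => ?_, fun k p => ?_⟩ <;>
    rw [AdaptedParam.sum_eq] <;>
    simp [adaptedGenerators, Fintype.sum_sum_type, ite_and, ite_mul, Finset.mul_sum, mul_assoc,
      sub_eq_add_neg]

theorem sum_extDOp_mul (p : Pair) (c : Fin 4 → DiffOp) : ∑ μ, extDOp p μ * c μ
    = MvPolynomial.X p.1.1 * c p.1.2 - MvPolynomial.X p.1.2 * c p.1.1 := by
  simp [extDOp, sub_mul, ite_mul]

/-- Shift and tensor parameters occur algebraically in some field. Each remaining parameter then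
occurs multiplied by X₀, which is not a zero divisor. -/
theorem adaptedGenerators_irreducible (c : AdaptedParam r u m → DiffOp)
    (hc : ∀ z, ∑ α, adaptedGenerators N z α * c α = 0) : c = 0 := by
  obtain ⟨h1, h2, h3, h4, -, h6⟩ := sum_adaptedGenerators_mul (N := N) c
  have X0 : (MvPolynomial.X 0 : DiffOp) ≠ 0 := MvPolynomial.X_ne_zero _
  have s (i μ) : c (.shift (.inl i) μ) = 0 := by rw [← h1, hc]
  funext α
  rcases α with (j | j) | ⟨j | j, μ⟩ | ⟨k, p⟩
  · have := h3 j 0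
    simp only [hc, s, mul_zero, Finset.sum_const_zero, sub_zero] at this
    exact (mul_eq_zero.1 this.symm).resolve_left X0
  · have := h2 j 0
    rw [hc] at this
    exact (mul_eq_zero.1 this.symm).resolve_left X0
  · exact s j μ
  · rw [← h4, hc]; rfl
  · rw [← h6, hc]; rfl

/-- The form k² is indefinite and may vanish for particular k, but as a polynomial it is nonzero and
can be cancelled; the value at a spacelike unit vector shows this. -/
theorem eval_C_eta_ne_zero :
    (∑ ν, MvPolynomial.C (eta ν) * MvPolynomial.X ν ^ 2 : DiffOp) ≠ 0 := fun h => by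
  have := congrArg (MvPolynomial.eval (Pi.single 1 1 : Fin 4 → ℝ)) h
  simp [Fin.sum_univ_four, eta] at this

/-- The shift components of T are arbitrary and are taken as parameters. The Noether identity forces
the remaining potentials to be gradients, and then the two-form components are the curvatures of the
shifts. -/
theorem adaptedGenerators_complete
    (h : DualFrame (N.map (algebraMap ℝ _)) (coeffMatrix I) (coeffMatrix R) (coeffMatrix I')
      (coeffMatrix R')) (sI : I.IsSymm) (sR : R.IsSymm) (hN : N.IsSymm) (φ : U)
    (hI' : (matrixAt I' φ).PosDef) (T : EmbField (r ⊕ u) (r ⊕ m) → DiffOp)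
    (hT : IsGaugeSymmetry (adaptedLagrangian P m g I R N).1 T) :
    ∃ c : AdaptedParam r u m → DiffOp, ∀ z, T z = ∑ α, adaptedGenerators N z α * c α := by
  let t (k : Fin 4 → ℝ) (z) := MvPolynomial.eval k (DiffOp.adj (T z))
  have ht (k : Fin 4 → ℝ) : NoetherSymbol N (matrixAt I φ) (matrixAt R φ) k (t k) := fun ζ =>
    noether_symbol sI sR hN hT φ k ζ
  have sI₀ : (matrixAt I φ).IsSymm := sI.map _
  have sR₀ : (matrixAt R φ).IsSymm := sR.map _
  -- The operators whose symbols are the potentials of `symbolPotential`. Adjoints appear because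
  -- the Noether identity contains the adjoint of T.
  let q : r ⊕ u → Fin 4 → DiffOp := Sum.elim
    (fun i μ => DiffOp.adj (T (.magnetic (.inl i) μ))
      + ∑ j, MvPolynomial.C (N i j) * DiffOp.adj (T (.electric (.inl j) μ)))
    (fun i μ => DiffOp.adj (T (.electric (.inr i) μ)))
  have hq (k : Fin 4 → ℝ) (J : r ⊕ u) (μ : Fin 4) :
      MvPolynomial.eval k (q J μ) = symbolPotential N (t k) J μ := by
    rcases J with J | J <;> simp [q, symbolPotential, t]
  have hX (J : r ⊕ u) (μ ν : Fin 4) : MvPolynomial.X ν * q J μ = MvPolynomial.X μ * q J ν := by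
    -- Vanishing of the Maxwell symbol at every k gives k²(k_ν q_μ - k_μ q_ν) = 0 as a polynomial
    -- identity, from which k² is cancelled.
    rw [← sub_eq_zero]
    refine (mul_eq_zero.1 ?_).resolve_left eval_C_eta_ne_zero
    refine MvPolynomial.funext fun k => ?_
    have e := mul_maxwellSymbol_sub k (symbolPotential N (t k) J) μ ν
    rw [(ht k).maxwellSymbol_eq_zero h sI₀ sR₀ hN hI', (ht k).maxwellSymbol_eq_zero h sI₀ sR₀ hN hI'] at e
    simpa [hq] using e.symm
  choose l hl using fun J => exists_eq_X_mul (hX J)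
  have hB (i : r) (p : Pair) : DiffOp.adj (T (.twoForm (.inl i) p))
      = 2 * (MvPolynomial.X p.1.1 * DiffOp.adj (T (.electric (.inl i) p.1.2))
        - MvPolynomial.X p.1.2 * DiffOp.adj (T (.electric (.inl i) p.1.1))) := by
    refine MvPolynomial.funext fun k => ?_
    have e := (ht k).twoForm_eq h sI₀ sR₀ hN (fun J p => by
      simp only [extR, ← hq, hl, map_mul, MvPolynomial.eval_X]; ring) i p
    simpa [extR, t] using e
  -- Taking adjoints back in q_μ = X_μ l reverses the sign of X_μ, which accounts for the minus sign
  -- of the gauge parameter.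
  refine ⟨fun
    | .gauge J => -DiffOp.adj (l J)
    | .shift (.inl i) μ => T (.electric (.inl i) μ)
    | .shift (.inr i) μ => T (.magnetic (.inr i) μ)
    | .tensor k p => T (.twoForm (.inr k) p), fun z => ?_⟩
  have hl' (J : r ⊕ u) (μ : Fin 4) : DiffOp.adj (q J μ) = MvPolynomial.X μ * -DiffOp.adj (l J) := by
    rw [hl, map_mul, DiffOp.adj_X]; ring
  obtain ⟨h1, h2, h3, h4, h5, h6⟩ := sum_adaptedGenerators_mul (N := N) (m := m) (fun
    | .gauge J => -DiffOp.adj (l J)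
    | .shift (.inl i) μ => T (.electric (.inl i) μ)
    | .shift (.inr i) μ => T (.magnetic (.inr i) μ)
    | .tensor k p => T (.twoForm (.inr k) p))
  rcases z with ⟨i | i, μ⟩ | ⟨i | i, μ⟩ | ⟨k | k, p⟩
  · rw [h1]
  · rw [h2]
    have := hl' (.inr i) μ
    simpa [q, DiffOp.adj_adj] using this
  · rw [h3, eq_sub_iff_add_eq]
    have := hl' (.inl i) μ
    simpa only [q, Sum.elim_inl, map_add, map_sum, map_mul, DiffOp.adj_adj, DiffOp.adj_C] using this
  · rw [h4]
  · rw [h5, sum_extDOp_mul, ← DiffOp.adj_adj (T (.twoForm (.inl k) p)), hB]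
    simp only [map_mul, map_sub, DiffOp.adj_X, DiffOp.adj_adj, map_ofNat]
    ring
  · rw [h6]

theorem isIrreducibleGeneratingSet_adapted
    (h : DualFrame (N.map (algebraMap ℝ _)) (coeffMatrix I) (coeffMatrix R) (coeffMatrix I')
      (coeffMatrix R')) (sI : I.IsSymm) (sR : R.IsSymm) (hN : N.IsSymm) (φ : U)
    (hI' : (matrixAt I' φ).PosDef) :
    IsIrreducibleGeneratingSet
      (adaptedLagrangian (AdaptedParam r u m) m g I R N).1 (adaptedGenerators N) where
  isGaugeSymmetry := isGaugeSymmetry_adapted sI sR hN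
  irreducible := adaptedGenerators_irreducible
  complete := adaptedGenerators_complete h sI sR hN φ hI'

end GeneratingSet

/-! ### Elimination of the two-forms -/

/-- A map of generators compatible with the BRST differentials defines a local map. -/
def GenMap.localMap {σ : Type} [Fintype σ] {U : Opens (σ → ℝ)} {F P F' P' : Type} [Fintype F]
    [Fintype P] [Fintype F'] [Fintype P'] (G : GenMap U F P F' P') {L : ghPart U F P 0}
    {R : F → P → DiffOp} {L' : ghPart U F' P' 0} {R' : F' → P' → DiffOp}
    (hG : ∀ z, G.hom (brst L R (jet z 0)) = brst L' R' (G.toFun z)) : LocalMap L R L' R' where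
  toAlgHom := G.hom
  map_coeff := G.hom_coeff
  map_ghPart := G.hom_mem
  map_total := G.hom_total
  map_brst a := by
    have h1 := (isGradedDerivation_brst L R).algHom_comp G.hom
    have h2 := (isGradedDerivation_brst L' R').comp_algHom G.hom_mem
    have h := (h1.sub h2).eq_zero_of_gen (fun μ a => by simp [brst_total, G.hom_total])
      (fun f => by simp [brst_coeff, G.hom_coeff]) (fun z => by simp [hG, G.hom_jet_zero]) a
    simpa [sub_eq_zero] using h

section Reduction

variable {r u m : Type} [Fintype r] [Fintype u] [Fintype m] [DecidableEq r] [DecidableEq u]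
  [DecidableEq m] {σ : Type} [Fintype σ] {U : Opens (σ → ℝ)}
  {g : Matrix σ σ (SmoothFn U)} {I R I' R' : Matrix (r ⊕ u) (r ⊕ u) (SmoothFn U)} {N : Matrix r r ℝ}

variable (m I' R' N) in
/-- The images of the generators of the embedding tensor theory in the vector theory. -/
def reductionFun : Gen σ (EmbField (r ⊕ u) (r ⊕ m)) (AdaptedParam r u m) →
    LocalFn U ((r ⊕ u) × Fin 4) (r ⊕ u)
  | .scalar i => jet (.scalar i) 0
  | .field (.electric (.inl _) _) => 0
  | .field (.electric (.inr i) μ) => jet (.field (.inr i, μ)) 0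
  | .field (.magnetic (.inl i) μ) => jet (.field (.inl i, μ)) 0
  | .field (.magnetic (.inr _) _) => 0
  | .field (.twoForm (.inl i) p) => -(2 : ℝ) •
      dualField (coeffMatrix I') (coeffMatrix R') (vecF U (r ⊕ u) (r ⊕ u)) (.inl i) p
  | .field (.twoForm (.inr _) _) => 0
  | .ghost (.gauge j) => jet (.ghost j) 0
  | .ghost _ => 0
  | .scalarAnti i => jet (.scalarAnti i) 0
  | .fieldAnti (.electric (.inl i) μ) => ∑ j, N i j • jet (.fieldAnti (.inl j, μ)) 0
  | .fieldAnti (.electric (.inr i) μ) => jet (.fieldAnti (.inr i, μ)) 0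
  | .fieldAnti (.magnetic (.inl i) μ) => jet (.fieldAnti (.inl i, μ)) 0
  | .fieldAnti _ => 0
  | .ghostAnti (.gauge j) => jet (.ghostAnti j) 0
  | .ghostAnti _ => 0

theorem reductionFun_mem (z : Gen σ (EmbField (r ⊕ u) (r ⊕ m)) (AdaptedParam r u m)) :
    reductionFun m I' R' N z ∈ ghPart U ((r ⊕ u) × Fin 4) (r ⊕ u) z.gh := by
  rcases z with i | (⟨i | i, μ⟩ | ⟨i | i, μ⟩ | ⟨k | k, p⟩) | (j | ⟨j, μ⟩ | ⟨k, p⟩) | i |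
    (⟨i | i, μ⟩ | ⟨i | i, μ⟩ | ⟨k | k, p⟩) | (j | ⟨j, μ⟩ | ⟨k, p⟩)
  · exact jet_mem_ghPart (.scalar _) 0
  · exact Submodule.zero_mem _
  · exact jet_mem_ghPart (.field _) 0
  · exact jet_mem_ghPart (.field _) 0
  · exact Submodule.zero_mem _
  · exact Submodule.smul_mem _ _ (dualField_mem vecF_mem _ _)
  · exact Submodule.zero_mem _
  · exact jet_mem_ghPart (.ghost _) 0
  · exact Submodule.zero_mem _
  · exact Submodule.zero_mem _
  · exact jet_mem_ghPart (.scalarAnti _) 0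
  · exact Submodule.sum_mem _ fun j _ => Submodule.smul_mem _ _ (jet_mem_ghPart (.fieldAnti _) 0)
  · exact jet_mem_ghPart (.fieldAnti _) 0
  · exact jet_mem_ghPart (.fieldAnti _) 0
  · exact Submodule.zero_mem _
  · exact Submodule.zero_mem _
  · exact Submodule.zero_mem _
  · exact jet_mem_ghPart (.ghostAnti _) 0
  · exact Submodule.zero_mem _
  · exact Submodule.zero_mem _

variable (m I' R' N) in
/-- The local map from the embedding tensor theory to the vector theory. -/
def reduction : GenMap U (EmbField (r ⊕ u) (r ⊕ m)) (AdaptedParam r u m) ((r ⊕ u) × Fin 4) (r ⊕ u) where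
  toFun := reductionFun m I' R' N
  mem := reductionFun_mem
  scalar _ := rfl

theorem reduction_toFun (z : Gen σ (EmbField (r ⊕ u) (r ⊕ m)) (AdaptedParam r u m)) :
    (reduction m I' R' N).toFun z = reductionFun m I' R' N z := rfl

/-- The hatted vectors go to zero and B to -2G', so ½B supplies exactly the hatted old field
strength -G'. -/
theorem reduction_embH (i : r ⊕ u) (p : Pair) :
    (reduction m I' R' N).hom (embH U _ (adaptedMag r u m) i p)
      = oldField (coeffMatrix I') (coeffMatrix R') (vecF U (r ⊕ u) (r ⊕ u)) i p := by
  have hD (a) := map_extD (f := (reduction m I' R' N).hom.toLinearMap) (reduction m I' R' N).hom_total a p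
  simp only [AlgHom.toLinearMap_apply] at hD
  rcases i with i | i
  · rw [embH_adapted_inl, map_add, map_smul, hD]
    simp only [GenMap.hom_jet_zero, reduction_toFun, reductionFun, oldField]
    rw [show extD (fun _ => (0 : LocalFn U ((r ⊕ u) × Fin 4) (r ⊕ u))) p = 0 by simp [extD]]
    module
  · rw [embH_adapted_inr, hD]
    simp only [GenMap.hom_jet_zero, reduction_toFun, reductionFun, oldField]
    rfl

theorem reduction_codiv_wedgeDual (X : Pair → LocalFn U (EmbField (r ⊕ u) (r ⊕ m)) (AdaptedParam r u m))
    (μ : Fin 4) : (reduction m I' R' N).hom (codiv (wedgeDual X) μ)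
      = codiv (wedgeDual fun p => (reduction m I' R' N).hom (X p)) μ := by
  have h := map_codiv (f := (reduction m I' R' N).hom.toLinearMap) (reduction m I' R' N).hom_total
    (wedgeDual X) μ
  refine h.trans (codiv_congr (fun p => ?_) μ)
  exact map_wedgeDual (reduction m I' R' N).hom.toLinearMap X p

theorem codiv_wedgeDual_add {F P : Type} (X Y : Pair → LocalFn U F P) (μ : Fin 4) :
    codiv (wedgeDual fun p => X p + Y p) μ = codiv (wedgeDual X) μ + codiv (wedgeDual Y) μ := by
  rw [← codiv_add]
  exact codiv_congr (fun p => by simp only [wedgeDual, smul_add]) μ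

theorem codiv_wedgeDual_smul {F P : Type} (c : ℝ) (X : Pair → LocalFn U F P) (μ : Fin 4) :
    codiv (wedgeDual fun p => c • X p) μ = c • codiv (wedgeDual X) μ := by
  rw [← codiv_smul]
  exact codiv_congr (fun p => by simp only [wedgeDual]; rw [smul_comm]) μ

theorem codiv_wedgeDual_sum {ι F P : Type} (s : Finset ι) (X : ι → Pair → LocalFn U F P) (μ : Fin 4) :
    codiv (wedgeDual fun p => ∑ i ∈ s, X i p) μ = ∑ i ∈ s, codiv (wedgeDual (X i)) μ := by
  rw [← codiv_sum]
  exact codiv_congr (fun p => by simp only [wedgeDual, Finset.smul_sum]) μ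

variable (h : DualFrame (N.map (algebraMap ℝ _)) (coeffMatrix I) (coeffMatrix R) (coeffMatrix I')
    (coeffMatrix R')) (sI : I.IsSymm) (sR : R.IsSymm) (hN : N.IsSymm) (sI' : I'.IsSymm)
    (sR' : R'.IsSymm)

include h sI sR hN sI' sR' in
-- The value -2G' solves the hatted two-form equation identically, which is why the corresponding
-- antifields can be sent to zero. The hatted magnetic equation becomes the Maxwell equation of the
-- new frame.
theorem reduction_fieldEquation (z : EmbField (r ⊕ u) (r ⊕ m)) :
    (reduction m I' R' N).hom (eulerLagrange (adaptedLagrangian (AdaptedParam r u m) m g I R N).1 (.field z))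
      = brst (vectorLagrangian g I' R') vectorGenerators ((reduction m I' R' N).toFun (.fieldAnti z)) := by
  have hG (i : r ⊕ u) (p : Pair) : (reduction m I' R' N).hom (dualField (coeffMatrix I) (coeffMatrix R)
      (embH U (AdaptedParam r u m) (adaptedMag r u m)) i p) = dualField (coeffMatrix I) (coeffMatrix R)
        (oldField (coeffMatrix I') (coeffMatrix R') (vecF U (r ⊕ u) (r ⊕ u))) i p := by
    rw [map_dualField (GenMap.hom_coeff _)]
    congr 1
    funext j q
    exact reduction_embH j q
  rcases z with ⟨i | i, μ⟩ | ⟨i | i, μ⟩ | ⟨k | k, p⟩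
  · rw [eulerLagrange_adapted_electric sI sR, reduction_codiv_wedgeDual]
    simp only [hG, (h.dualField_oldField _ _).1, reduction_toFun, reductionFun, map_sum, map_smul, brst_fieldAnti,
      eulerLagrange_vector_field sI' sR', codiv_wedgeDual_add, codiv_wedgeDual_sum,
      codiv_wedgeDual_smul]
    -- G on the hatted indices is F' + NG'. The F' term is removed by the Bianchi identity, and NG'
    -- gives the combination of antifields assigned to the electric ones.
    rw [add_eq_right]
    exact codiv_wedgeDual_extD _ _
  · rw [eulerLagrange_adapted_electric sI sR, reduction_codiv_wedgeDual]
    simp only [hG, (h.dualField_oldField _ _).2, reduction_toFun, reductionFun, brst_fieldAnti,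
      eulerLagrange_vector_field sI' sR']
  · rw [eulerLagrange_adapted_magnetic_inl, map_smul, reduction_codiv_wedgeDual]
    simp only [GenMap.hom_jet_zero, reduction_toFun, reductionFun, brst_fieldAnti, eulerLagrange_vector_field sI' sR',
      codiv_wedgeDual_smul]
    module
  · rw [eulerLagrange_adapted_magnetic_inr]
    simp only [reduction_toFun, reductionFun, map_zero]
  · have hD (a) (p) := map_extD (f := (reduction m I' R' N).hom.toLinearMap)
      (reduction m I' R' N).hom_total a p
    simp only [AlgHom.toLinearMap_apply] at hD
    rw [eulerLagrange_adapted_twoForm_inl sI sR hN, wedgeDual]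
    simp only [map_smul, map_add, map_sub, map_sum, hG, (h.dualField_oldField _ _).1, hD,
      GenMap.hom_jet_zero, reduction_toFun, reductionFun, map_zero]
    simp only [smul_comm (N k _) (-(2 : ℝ)), ← Finset.smul_sum]
    have e2 (x y : LocalFn U ((r ⊕ u) × Fin 4) (r ⊕ u)) : x + y - x + (1 / 2 : ℝ) • (-2 : ℝ) • y = 0 := by
      module
    exact (congrArg _ ((congrArg _ (e2 _ _)).trans (smul_zero _))).trans (smul_zero _)
  · rw [eulerLagrange_adapted_twoForm_inr sI sR hN]
    simp only [reduction_toFun, reductionFun, map_zero]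

include h sI sR hN sI' sR' in
theorem reduction_brst (z : Gen σ (EmbField (r ⊕ u) (r ⊕ m)) (AdaptedParam r u m)) :
    (reduction m I' R' N).hom (brst (adaptedLagrangian _ m g I R N) (adaptedGenerators N) (jet z 0))
      = brst (vectorLagrangian g I' R') vectorGenerators ((reduction m I' R' N).toFun z) := by
  have hT (x) (μ) := (reduction m I' R' N).hom_total μ x
  obtain ⟨h1, h2, h3, h4, h5⟩ := sum_adaptedGenerators_adj (N := N) (u := u) (m := m)
    (fun z => (jet (.fieldAnti z) 0 : LocalFn U _ (AdaptedParam r u m)))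
  rcases z with i | z | α | i | z | α
  · rw [brst_scalar, map_zero]; exact (brst_scalar _ _ i).symm
  · rcases z with ⟨i | i, μ⟩ | ⟨i | i, μ⟩ | ⟨k | k, p⟩
    · rw [brst_adapted_electric_inl, GenMap.hom_jet_zero]
      simp only [reduction_toFun, reductionFun, map_zero]
    · rw [brst_adapted_electric_inr, hT, GenMap.hom_jet_zero]
      simp only [reduction_toFun, reductionFun, brst_vector_field]
    · rw [brst_adapted_magnetic_inl, map_sub, hT, map_sum, GenMap.hom_jet_zero]
      simp only [map_smul, GenMap.hom_jet_zero, reduction_toFun, reductionFun, brst_vector_field, smul_zero,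
        Finset.sum_const_zero, sub_zero]
    · rw [brst_adapted_magnetic_inr, GenMap.hom_jet_zero]
      simp only [reduction_toFun, reductionFun, map_zero]
    · have hD (a) (p) := map_extD (f := (reduction m I' R' N).hom.toLinearMap)
        (reduction m I' R' N).hom_total a p
      simp only [AlgHom.toLinearMap_apply] at hD
      rw [brst_adapted_twoForm_inl, map_smul, hD]
      simp only [GenMap.hom_jet_zero, reduction_toFun, reductionFun, map_smul]
      rw [map_dualField_linear (brst_coeff_mul _ _)]
      simp only [brst_vecF, dualField_zero, extD, map_zero, sub_zero, smul_zero]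
    · rw [brst_adapted_twoForm_inr, GenMap.hom_jet_zero]
      simp only [reduction_toFun, reductionFun, map_zero]
  · rw [brst_ghost, map_zero]
    rcases α with j | ⟨j, μ⟩ | ⟨k, p⟩ <;> simp only [reduction_toFun, reductionFun, brst_ghost, map_zero]
  · rw [brst_scalarAnti, eulerLagrange_adapted_scalar, map_add,
      map_scalarEL (GenMap.hom_coeff _) (GenMap.hom_total _)
        (fun i => by rw [GenMap.hom_jet_zero]; rfl), map_kinQuad (GenMap.hom_coeff _)]
    simp only [reduction_embH]
    -- The scalar equations agree because dτ' = HᵀdτH for ∂/∂φ, although the Lagrangians themselves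
    -- are different quadratic forms.
    exact (congrArg _ (h.kinQuad_oldField _ _)).trans
      ((brst_scalarAnti _ _ i).trans (eulerLagrange_vector_scalar i)).symm
  · rw [brst_fieldAnti, reduction_fieldEquation h sI sR hN sI' sR']
  · rw [brst_ghostAnti]
    have hC (X : Pair → LocalFn U (EmbField (r ⊕ u) (r ⊕ m)) (AdaptedParam r u m)) (μ)
        (hX : ∀ p, (reduction m I' R' N).hom (X p) = 0) : (reduction m I' R' N).hom (codiv X μ) = 0 := by
      refine (map_codiv (f := (reduction m I' R' N).hom.toLinearMap) (reduction m I' R' N).hom_total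
        X μ).trans ?_
      simp only [AlgHom.toLinearMap_apply, hX]
      simpa using codiv_smul 0 (0 : Pair → LocalFn U ((r ⊕ u) × Fin 4) (r ⊕ u)) μ
    rcases α with (j | j) | ⟨j | j, μ⟩ | ⟨k, p⟩
    · rw [h1]
      simp only [map_neg, map_sum, hT, GenMap.hom_jet_zero, reduction_toFun, reductionFun, brst_vector_ghostAnti]
    · rw [h2]
      simp only [map_neg, map_sum, hT, GenMap.hom_jet_zero, reduction_toFun, reductionFun, brst_vector_ghostAnti]
    · rw [h3]
      simp only [map_sub, map_sum, map_smul, GenMap.hom_jet_zero]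
      rw [hC _ _ fun p => by rw [GenMap.hom_jet_zero]; rfl]
      simp only [reduction_toFun, reductionFun, map_zero, smul_zero, hN.apply, sub_self]
    · rw [h4, GenMap.hom_jet_zero]
      simp only [reduction_toFun, reductionFun, map_zero]
    · rw [h5, GenMap.hom_jet_zero]
      simp only [reduction_toFun, reductionFun, map_zero]

end Reduction

/-! ### The section of the reduction map and the contracting homotopy -/

section Homotopy

variable {r u m : Type} [Fintype r] [Fintype u] [Fintype m] [DecidableEq r] [DecidableEq u]
  [DecidableEq m] {σ : Type} [Fintype σ] {U : Opens (σ → ℝ)}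
  {g : Matrix σ σ (SmoothFn U)} {I R I' R' : Matrix (r ⊕ u) (r ⊕ u) (SmoothFn U)} {N : Matrix r r ℝ}

variable (U m N) in
/-- A section of the local map from the embedding tensor theory to the vector theory. -/
def sectionFun : Gen σ ((r ⊕ u) × Fin 4) (r ⊕ u) →
    LocalFn U (EmbField (r ⊕ u) (r ⊕ m)) (AdaptedParam r u m)
  | .scalar i => jet (.scalar i) 0
  | .field (.inl i, μ) => jet (.field (.magnetic (.inl i) μ)) 0
      + ∑ j, N i j • jet (.field (.electric (.inl j) μ)) 0
  | .field (.inr i, μ) => jet (.field (.electric (.inr i) μ)) 0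
  | .ghost j => jet (.ghost (.gauge j)) 0
  | .scalarAnti i => jet (.scalarAnti i) 0
  | .fieldAnti (.inl i, μ) => jet (.fieldAnti (.magnetic (.inl i) μ)) 0
  | .fieldAnti (.inr i, μ) => jet (.fieldAnti (.electric (.inr i) μ)) 0
  | .ghostAnti j => jet (.ghostAnti (.gauge j)) 0

theorem sectionFun_mem (z : Gen σ ((r ⊕ u) × Fin 4) (r ⊕ u)) :
    sectionFun m U N z ∈ ghPart U (EmbField (r ⊕ u) (r ⊕ m)) (AdaptedParam r u m) z.gh := by
  rcases z with i | ⟨i | i, μ⟩ | j | i | ⟨i | i, μ⟩ | j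
  · exact jet_mem_ghPart (.scalar _) 0
  · exact Submodule.add_mem _ (jet_mem_ghPart (.field _) 0)
      (Submodule.sum_mem _ fun j _ => Submodule.smul_mem _ _ (jet_mem_ghPart (.field _) 0))
  · exact jet_mem_ghPart (.field _) 0
  · exact jet_mem_ghPart (.ghost _) 0
  · exact jet_mem_ghPart (.scalarAnti _) 0
  · exact jet_mem_ghPart (.fieldAnti _) 0
  · exact jet_mem_ghPart (.fieldAnti _) 0
  · exact jet_mem_ghPart (.ghostAnti _) 0

variable (U m N) in
/-- A section of the local map from the embedding tensor theory to the vector theory. -/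
def vectorSection : GenMap U ((r ⊕ u) × Fin 4) (r ⊕ u) (EmbField (r ⊕ u) (r ⊕ m)) (AdaptedParam r u m) where
  toFun := sectionFun m U N
  mem := sectionFun_mem
  scalar _ := rfl

theorem vectorSection_toFun (z : Gen σ ((r ⊕ u) × Fin 4) (r ⊕ u)) :
    (vectorSection m U N).toFun z = sectionFun m U N z := rfl

/-- The antifields of the two-forms. -/
def twoFormAnti (U : Opens (σ → ℝ)) (r u m : Type) (i : r) (p : Pair) :
    LocalFn U (EmbField (r ⊕ u) (r ⊕ m)) (AdaptedParam r u m) :=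
  jet (.fieldAnti (.twoForm (.inl i) p)) 0

variable (m I' R') in
/-- The contracting homotopy of the variables that do not appear in the vector theory. -/
def homotopyFun : Gen σ (EmbField (r ⊕ u) (r ⊕ m)) (AdaptedParam r u m) →
    LocalFn U (EmbField (r ⊕ u) (r ⊕ m)) (AdaptedParam r u m)
  | .field (.twoForm (.inl i) p) => -(4 : ℝ) • dualField (coeffMatrix I').toBlocks₁₁
      (coeffMatrix R').toBlocks₁₁ (fun j => wedgeDual (twoFormAnti U r u m j)) i p
  | .ghost (.shift (.inl i) μ) => jet (.field (.electric (.inl i) μ)) 0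
  | .ghost (.shift (.inr i) μ) => jet (.field (.magnetic (.inr i) μ)) 0
  | .ghost (.tensor k p) => jet (.field (.twoForm (.inr k) p)) 0
  | .fieldAnti (.electric (.inl i) μ) => jet (.ghostAnti (.shift (.inl i) μ)) 0
  | .fieldAnti (.magnetic (.inr i) μ) => jet (.ghostAnti (.shift (.inr i) μ)) 0
  | .fieldAnti (.twoForm (.inr k) p) => jet (.ghostAnti (.tensor k p)) 0
  | _ => 0

theorem homotopyFun_mem (z : Gen σ (EmbField (r ⊕ u) (r ⊕ m)) (AdaptedParam r u m)) :
    homotopyFun m I' R' z ∈ ghPart U (EmbField (r ⊕ u) (r ⊕ m)) (AdaptedParam r u m) (z.gh + -1) := by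
  rcases z with i | (⟨i | i, μ⟩ | ⟨i | i, μ⟩ | ⟨k | k, p⟩) | (j | ⟨j | j, μ⟩ | ⟨k, p⟩) | i |
    (⟨i | i, μ⟩ | ⟨i | i, μ⟩ | ⟨k | k, p⟩) | (j | ⟨j, μ⟩ | ⟨k, p⟩)
  case field.twoForm.inl =>
    refine Submodule.smul_mem _ _ (Submodule.sum_mem _ fun j _ => Submodule.add_mem _ ?_ ?_)
    · rw [← zero_add (_ + _)]
      exact mul_mem_ghPart (coeff_mem_ghPart _)
        (Submodule.smul_mem _ _ (jet_mem_ghPart (.fieldAnti _) 0))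
    · rw [← zero_add (_ + _)]
      exact mul_mem_ghPart (coeff_mem_ghPart _)
        (Submodule.smul_mem _ _ (Submodule.smul_mem _ _ (jet_mem_ghPart (.fieldAnti _) 0)))
  case ghost.shift.inl => exact jet_mem_ghPart (.field _) 0
  case ghost.shift.inr => exact jet_mem_ghPart (.field _) 0
  case ghost.tensor => exact jet_mem_ghPart (.field _) 0
  case fieldAnti.electric.inl => exact jet_mem_ghPart (.ghostAnti _) 0
  case fieldAnti.magnetic.inr => exact jet_mem_ghPart (.ghostAnti _) 0
  case fieldAnti.twoForm.inr => exact jet_mem_ghPart (.ghostAnti _) 0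
  all_goals exact Submodule.zero_mem _

variable (m I' R') in
/-- The contracting homotopy of the variables that do not appear in the vector theory. -/
def homotopy : GenDer U (EmbField (r ⊕ u) (r ⊕ m)) (AdaptedParam r u m) (-1) where
  toFun := homotopyFun m I' R'
  mem := homotopyFun_mem
  scalar _ := rfl

theorem homotopy_jet (z : Gen σ (EmbField (r ⊕ u) (r ⊕ m)) (AdaptedParam r u m)) :
    (homotopy m I' R').der (jet z 0) = homotopyFun m I' R' z := GenDer.der_jet_zero _ z

theorem reduction_vectorSection (z : Gen σ ((r ⊕ u) × Fin 4) (r ⊕ u)) :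
    (reduction m I' R' N).hom ((vectorSection m U N).toFun z) = jet z 0 := by
  rw [vectorSection_toFun]
  rcases z with i | ⟨i | i, μ⟩ | j | i | ⟨i | i, μ⟩ | j <;>
    simp only [sectionFun, map_add, map_sum, map_smul, GenMap.hom_jet_zero, reduction_toFun,
      reductionFun, smul_zero, Finset.sum_const_zero, add_zero]

theorem reduction_twoFormAnti (i : r) (p : Pair) :
    (reduction m I' R' N).hom (twoFormAnti U r u m i p) = 0 := by
  rw [twoFormAnti, GenMap.hom_jet_zero]; rfl

theorem reduction_homotopy (z : Gen σ (EmbField (r ⊕ u) (r ⊕ m)) (AdaptedParam r u m)) :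
    (reduction m I' R' N).hom ((homotopy m I' R').toFun z) = 0 := by
  change (reduction m I' R' N).hom (homotopyFun m I' R' z) = 0
  rcases z with i | (⟨i | i, μ⟩ | ⟨i | i, μ⟩ | ⟨k | k, p⟩) | (j | ⟨j | j, μ⟩ | ⟨k, p⟩) | i |
    (⟨i | i, μ⟩ | ⟨i | i, μ⟩ | ⟨k | k, p⟩) | (j | ⟨j, μ⟩ | ⟨k, p⟩)
  case field.twoForm.inl =>
    have h0 (j : r) (q : Pair) : (reduction m I' R' N).hom (wedgeDual (twoFormAnti U r u m j) q) = 0 := by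
      rw [wedgeDual, map_smul, reduction_twoFormAnti, smul_zero]
    rw [homotopyFun, map_smul, map_dualField (GenMap.hom_coeff _)]
    simp only [h0, dualField_zero, smul_zero]
  all_goals simp only [homotopyFun, GenMap.hom_jet_zero, reduction_toFun, reductionFun, map_zero]

end Homotopy

theorem GenDer.der_coeff_mul {σ : Type} [Fintype σ] {U : Opens (σ → ℝ)} {F P : Type} {p : ℤ}
    (D : GenDer U F P p) (f : Coeff U) (a : LocalFn U F P) :
    D.der (coeff f * a) = coeff f * D.der a := by
  rw [D.isGradedDerivation (coeff_mem_ghPart f), D.der_coeff]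
  simp

/-! ### The commutator of s with the homotopy on generators -/

section Contraction

variable {r u m : Type} [Fintype r] [Fintype u] [Fintype m] [DecidableEq r] [DecidableEq u]
  [DecidableEq m] {σ : Type} [Fintype σ] {U : Opens (σ → ℝ)}

variable (m) in
/-- The commutator of the BRST differential with the contracting homotopy. -/
abbrev adaptedNumber (g : Matrix σ σ (SmoothFn U)) (I R I' R' : Matrix (r ⊕ u) (r ⊕ u) (SmoothFn U))
    (N : Matrix r r ℝ) : Module.End ℝ (LocalFn U (EmbField (r ⊕ u) (r ⊕ m)) (AdaptedParam r u m)) :=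
  homotopyCommutator (adaptedLagrangian (AdaptedParam r u m) m g I R N) (adaptedGenerators N)
    (homotopy m I' R')

variable {g : Matrix σ σ (SmoothFn U)} {I R I' R' : Matrix (r ⊕ u) (r ⊕ u) (SmoothFn U)}
  {N : Matrix r r ℝ}

theorem adaptedNumber_jet (z : Gen σ (EmbField (r ⊕ u) (r ⊕ m)) (AdaptedParam r u m)) :
    adaptedNumber m g I R I' R' N (jet z 0)
      = brst (adaptedLagrangian (AdaptedParam r u m) m g I R N) (adaptedGenerators N)
          (homotopyFun m I' R' z)
        + (homotopy m I' R').der (brst (adaptedLagrangian (AdaptedParam r u m) m g I R N)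
          (adaptedGenerators N) (jet z 0)) := by
  rw [homotopyCommutator_apply, homotopy_jet]

theorem adaptedNumber_coeff_mul (f : Coeff U)
    (a : LocalFn U (EmbField (r ⊕ u) (r ⊕ m)) (AdaptedParam r u m)) :
    adaptedNumber m g I R I' R' N (coeff f * a) = coeff f * adaptedNumber m g I R I' R' N a := by
  rw [homotopyCommutator_mul, homotopyCommutator_coeff, zero_mul, zero_add]

theorem adaptedNumber_electric_inl (i : r) (μ : Fin 4) :
    adaptedNumber m g I R I' R' N (jet (.field (.electric (.inl i) μ)) 0)
      = jet (.field (.electric (.inl i) μ)) 0 := by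
  rw [adaptedNumber_jet, brst_adapted_electric_inl, homotopy_jet]
  simp only [homotopyFun, map_zero, zero_add]

theorem adaptedNumber_electric_inr (i : u) (μ : Fin 4) :
    adaptedNumber m g I R I' R' N (jet (.field (.electric (.inr i) μ)) 0) = 0 := by
  rw [adaptedNumber_jet, brst_adapted_electric_inr, GenDer.der_total, homotopy_jet]
  simp only [homotopyFun, map_zero, zero_add]

theorem adaptedNumber_magnetic_inl (i : r) (μ : Fin 4) :
    adaptedNumber m g I R I' R' N (jet (.field (.magnetic (.inl i) μ)) 0)
      = -∑ j, N i j • jet (.field (.electric (.inl j) μ)) 0 := by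
  rw [adaptedNumber_jet, brst_adapted_magnetic_inl, map_sub, GenDer.der_total, map_sum]
  simp only [map_smul, homotopy_jet, homotopyFun, map_zero, zero_add, zero_sub]

theorem adaptedNumber_magnetic_inr (i : u) (μ : Fin 4) :
    adaptedNumber m g I R I' R' N (jet (.field (.magnetic (.inr i) μ)) 0)
      = jet (.field (.magnetic (.inr i) μ)) 0 := by
  rw [adaptedNumber_jet, brst_adapted_magnetic_inr, homotopy_jet]
  simp only [homotopyFun, map_zero, zero_add]

theorem adaptedNumber_twoForm_inr (k : m) (p : Pair) :
    adaptedNumber m g I R I' R' N (jet (.field (.twoForm (.inr k) p)) 0)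
      = jet (.field (.twoForm (.inr k) p)) 0 := by
  rw [adaptedNumber_jet, brst_adapted_twoForm_inr, homotopy_jet]
  simp only [homotopyFun, map_zero, zero_add]

theorem adaptedNumber_ghost_shift (j : r ⊕ u) (μ : Fin 4) :
    adaptedNumber m g I R I' R' N (jet (.ghost (.shift j μ)) 0) = jet (.ghost (.shift j μ)) 0 := by
  rw [adaptedNumber_jet, brst_ghost, map_zero, add_zero]
  rcases j with j | j
  · rw [homotopyFun, brst_adapted_electric_inl]
  · rw [homotopyFun, brst_adapted_magnetic_inr]

theorem adaptedNumber_ghost_tensor (k : m) (p : Pair) :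
    adaptedNumber m g I R I' R' N (jet (.ghost (.tensor k p)) 0) = jet (.ghost (.tensor k p)) 0 := by
  rw [adaptedNumber_jet, brst_ghost, map_zero, add_zero, homotopyFun, brst_adapted_twoForm_inr]

/-- The field strengths of the new frame in terms of the fields of the embedding tensor theory. -/
def newF (U : Opens (σ → ℝ)) (m : Type) (N : Matrix r r ℝ) (i : r ⊕ u) (p : Pair) :
    LocalFn U (EmbField (r ⊕ u) (r ⊕ m)) (AdaptedParam r u m) :=
  extD (fun μ => sectionFun m U N (.field (i, μ))) p

theorem vectorSection_vecF (i : r ⊕ u) (p : Pair) :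
    (vectorSection m U N).hom (vecF U (r ⊕ u) (r ⊕ u) i p) = newF U m N i p := by
  have h := map_extD (f := (vectorSection m U N).hom.toLinearMap) (vectorSection m U N).hom_total
    (fun μ => jet (.field (i, μ)) 0) p
  refine h.trans ?_
  rw [newF]
  congr 1
  funext μ
  exact GenMap.hom_jet_zero _ _

theorem newF_inl (i : r) (p : Pair) : newF (u := u) U m N (.inl i) p
    = extD (fun μ => jet (.field (.magnetic (.inl i) μ)) 0) p
      + ∑ j, N i j • extD (fun μ => jet (.field (.electric (.inl j) μ)) 0) p := by
  simp only [newF, sectionFun, extD_add, extD_sum, extD_smul]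

theorem newF_inr (i : u) (p : Pair) : newF (r := r) U m N (.inr i) p
    = embH U _ (adaptedMag r u m) (.inr i) p := by
  rw [embH_adapted_inr]
  rfl

/-- The combination Ã + NA is invariant under the shift symmetry, whereas Ã alone is not an
eigenvector of the commutator unless its N term vanishes. -/
theorem adaptedNumber_section_field (i : r ⊕ u) (μ : Fin 4) :
    adaptedNumber m g I R I' R' N (sectionFun m U N (.field (i, μ))) = 0 := by
  rcases i with i | i
  · simp only [sectionFun, map_add, map_sum, map_smul, adaptedNumber_magnetic_inl,
      adaptedNumber_electric_inl, neg_add_cancel]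
  · rw [sectionFun, adaptedNumber_electric_inr]

theorem adaptedNumber_newF (i : r ⊕ u) (p : Pair) :
    adaptedNumber m g I R I' R' N (newF U m N i p) = 0 := by
  rw [newF, map_extD (homotopyCommutator_total _)]
  simp only [adaptedNumber_section_field, extD, map_zero, sub_zero]

variable (h : DualFrame (N.map (algebraMap ℝ _)) (coeffMatrix I) (coeffMatrix R) (coeffMatrix I')
    (coeffMatrix R')) (sI : I.IsSymm) (sR : R.IsSymm) (hN : N.IsSymm)

include sI sR hN in
-- Adding NH and subtracting the new field strength changes nothing: the extra N dA cancels. In this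
-- form the two-form equation is the input of `DualFrame.dualField_equation`.
theorem brst_twoFormAnti (i : r) (p : Pair) :
    brst (adaptedLagrangian (AdaptedParam r u m) m g I R N) (adaptedGenerators N)
        (twoFormAnti U r u m i p)
      = (1 / 2 : ℝ) • wedgeDual (fun q =>
          dualField (coeffMatrix I) (coeffMatrix R) (embH U _ (adaptedMag r u m)) (.inl i) q
          + ∑ j, N i j • embH U _ (adaptedMag r u m) (.inl j) q - newF U m N (.inl i) q) p := by
  rw [twoFormAnti, brst_fieldAnti, eulerLagrange_adapted_twoForm_inl sI sR hN]
  congr 2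
  funext q
  simp only [embH_adapted_inl, newF_inl, smul_add, Finset.sum_add_distrib, Finset.smul_sum,
    smul_comm (1 / 2 : ℝ)]
  abel

include h sI sR hN in
-- The factor -4 in the homotopy is fixed here: together with the ½ of the two-form equation it
-- gives -2 · (-(H + G')), that is 2dA + B + 2G'. The term 2dA is cancelled by the homotopy applied
-- to sB = -2dξ.
theorem adaptedNumber_twoForm_inl (i : r) (p : Pair) :
    adaptedNumber m g I R I' R' N (jet (.field (.twoForm (.inl i) p)) 0)
      = jet (.field (.twoForm (.inl i) p)) 0
        + (2 : ℝ) • dualField (coeffMatrix I') (coeffMatrix R') (newF U m N) (.inl i) p := by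
  have hs (j : r) (q : Pair) : brst (adaptedLagrangian (AdaptedParam r u m) m g I R N)
      (adaptedGenerators N) (wedgeDual (twoFormAnti U r u m j) q)
      = (1 / 2 : ℝ) • (dualField (coeffMatrix I) (coeffMatrix R)
          (embH U (AdaptedParam r u m) (adaptedMag r u m)) (.inl j) q
        + ∑ k, N j k • embH U (AdaptedParam r u m) (adaptedMag r u m) (.inl k) q
        - newF U m N (.inl j) q) := by
    rw [map_wedgeDual]
    simp only [brst_twoFormAnti sI sR hN]
    have e (X : Pair → LocalFn U (EmbField (r ⊕ u) (r ⊕ m)) (AdaptedParam r u m)) (q) :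
        wedgeDual (fun p => (1 / 2 : ℝ) • wedgeDual X p) q = (1 / 2 : ℝ) • X q := by
      refine Eq.trans ?_ (congrArg _ (congrFun (wedgeDual_wedgeDual X) q))
      simp only [wedgeDual]
      rw [smul_comm]
    exact e _ q
  have e := h.dualField_equation (newF U m N)
    (fun k q => embH U (AdaptedParam r u m) (adaptedMag r u m) (.inl k) q) i p
  have hel : (Sum.elim (fun k q => embH U (AdaptedParam r u m) (adaptedMag r u m) (.inl k) q)
      fun j => newF U m N (.inr j)) = embH U (AdaptedParam r u m) (adaptedMag r u m) := by
    funext j q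
    rcases j with j | j
    · rfl
    · exact newF_inr j q
  rw [hel] at e
  rw [adaptedNumber_jet, brst_adapted_twoForm_inl, map_smul, map_extD (GenDer.der_total _),
    homotopyFun, map_smul, map_dualField_linear (brst_coeff_mul _ _)]
  simp only [hs, homotopy_jet]
  have hsm (X : r → Pair → LocalFn U (EmbField (r ⊕ u) (r ⊕ m)) (AdaptedParam r u m)) :
      dualField (coeffMatrix I').toBlocks₁₁ (coeffMatrix R').toBlocks₁₁
        (fun j q => (1 / 2 : ℝ) • X j q) i p
      = (1 / 2 : ℝ) • dualField (coeffMatrix I').toBlocks₁₁ (coeffMatrix R').toBlocks₁₁ X i p := by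
    simp only [dualField, star, Finset.smul_sum, smul_add, mul_smul_comm, smul_comm (1 / 2 : ℝ)]
  rw [hsm, e, embH_adapted_inl]
  simp only [homotopyFun]
  module

theorem homotopy_embH_inl (i : r) (p : Pair) :
    (homotopy m I' R').der (embH U _ (adaptedMag r u m) (.inl i) p)
      = -(2 : ℝ) • dualField (coeffMatrix I').toBlocks₁₁
      (coeffMatrix R').toBlocks₁₁ (fun j => wedgeDual (twoFormAnti U r u m j)) i p := by
  rw [embH_adapted_inl, map_add, map_smul, map_extD (GenDer.der_total _)]
  simp only [homotopy_jet, homotopyFun, extD, map_zero, sub_zero]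
  module

theorem homotopy_embH_inr (i : u) (p : Pair) :
    (homotopy m I' R').der (embH U _ (adaptedMag r u m) (.inr i) p) = 0 := by
  rw [embH_adapted_inr, map_extD (GenDer.der_total _)]
  simp only [homotopy_jet, homotopyFun, extD, map_zero, sub_zero]

theorem homotopy_newF (i : r ⊕ u) (p : Pair) : (homotopy m I' R').der (newF U m N i p) = 0 := by
  rw [newF, map_extD (GenDer.der_total _)]
  have h0 (μ : Fin 4) : (homotopy m I' R').der (sectionFun m U N (.field (i, μ))) = 0 := by
    rcases i with i | i <;>
    simp only [sectionFun, map_add, map_sum, map_smul, homotopy_jet, homotopyFun, smul_zero,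
      Finset.sum_const_zero, add_zero]
  simp only [h0, extD, map_zero, sub_zero]

include h sI sR hN in
-- The homotopy acts on H by -2τ'₁₁ times the dual antifield, and (τ₁₁ + N)τ'₁₁ = -1 turns the
-- resulting expression into the antifield itself.
theorem adaptedNumber_twoFormAnti (i : r) (p : Pair) :
    adaptedNumber m g I R I' R' N (twoFormAnti U r u m i p) = twoFormAnti U r u m i p := by
  have h0 : (homotopy m I' R').der (twoFormAnti U r u m i p) = 0 := by
    rw [twoFormAnti, homotopy_jet]; rfl
  rw [homotopyCommutator_apply, h0, map_zero, zero_add, brst_twoFormAnti sI sR hN, map_smul,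
    map_wedgeDual]
  have hE : (fun j q => (homotopy m I' R').der (embH U _ (adaptedMag r u m) j q))
      = Sum.elim (fun j q => (homotopy m I' R').der (embH U _ (adaptedMag r u m) (.inl j) q))
        fun _ _ => 0 := by
    funext j q
    rcases j with j | j
    · rfl
    · exact homotopy_embH_inr j q
  have e (q : Pair) : (homotopy m I' R').der
      (dualField (coeffMatrix I) (coeffMatrix R) (embH U _ (adaptedMag r u m)) (.inl i) q
          + ∑ j, N i j • embH U _ (adaptedMag r u m) (.inl j) q - newF U m N (.inl i) q)
      = (2 : ℝ) • wedgeDual (twoFormAnti U r u m i) q := by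
    rw [map_sub, map_add, map_dualField_linear (GenDer.der_coeff_mul _), hE, map_sum, homotopy_newF,
      sub_zero]
    simp only [map_smul]
    refine (dualField_sumElim_zero N (fun j q => (homotopy m I' R').der
      (embH U _ (adaptedMag r u m) (.inl j) q)) i q).trans ?_
    simp only [homotopy_embH_inl]
    have hsm (A B : Matrix r r (Coeff U))
        (X : r → Pair → LocalFn U (EmbField (r ⊕ u) (r ⊕ m)) (AdaptedParam r u m)) :
        dualField A B (fun j q => -(2 : ℝ) • X j q) i q = -(2 : ℝ) • dualField A B X i q := by
      simp only [dualField, star, Finset.smul_sum, smul_add, mul_smul_comm, smul_comm (-(2 : ℝ))]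
    rw [hsm, dualField_dualField, h.blocks.1, h.blocks.2.1]
    simp [dualField, Matrix.one_apply, apply_ite coeff]
  simp only [e]
  have e2 (X : Pair → LocalFn U (EmbField (r ⊕ u) (r ⊕ m)) (AdaptedParam r u m)) (q) :
      wedgeDual (fun p => (2 : ℝ) • wedgeDual X p) q = (2 : ℝ) • X q := by
    refine Eq.trans ?_ (congrArg _ (congrFun (wedgeDual_wedgeDual X) q))
    simp only [wedgeDual]
    rw [smul_comm]
  rw [e2]
  module

end Contraction

/-! ### Submodules closed under total derivatives and coefficients -/

section Closure

variable {σ : Type} [Fintype σ] {U : Opens (σ → ℝ)} {F P : Type} {S : Submodule ℝ (LocalFn U F P)}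

theorem extD_mem_of (ht : ∀ μ, ∀ x ∈ S, total μ x ∈ S) {a : Fin 4 → LocalFn U F P}
    (ha : ∀ μ, a μ ∈ S) (p : Pair) : extD a p ∈ S :=
  Submodule.sub_mem _ (ht _ _ (ha _)) (ht _ _ (ha _))

theorem codiv_mem_of (ht : ∀ μ, ∀ x ∈ S, total μ x ∈ S) {X : Pair → LocalFn U F P}
    (hX : ∀ p, X p ∈ S) (μ : Fin 4) : codiv X μ ∈ S := by
  refine Submodule.neg_mem _ (Submodule.sum_mem _ fun ν _ => ht _ _ ?_)
  unfold asym
  split_ifs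
  · exact hX _
  · exact Submodule.neg_mem _ (hX _)
  · exact Submodule.zero_mem _

theorem wedgeDual_mem_of {X : Pair → LocalFn U F P} (hX : ∀ p, X p ∈ S) (p : Pair) :
    wedgeDual X p ∈ S := Submodule.smul_mem _ _ (hX _)

theorem dualField_mem_of {n : Type} [Fintype n] (hc : ∀ f, ∀ x ∈ S, coeff f * x ∈ S)
    {H : n → Pair → LocalFn U F P} (hH : ∀ j p, H j p ∈ S) (I R : Matrix n n (Coeff U)) (i : n)
    (p : Pair) : dualField I R H i p ∈ S :=
  Submodule.sum_mem _ fun _ _ => Submodule.add_mem _ (hc _ _ (hH _ _))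
    (hc _ _ (Submodule.smul_mem _ _ (hH _ _)))

end Closure

/-! ### Positivity of the commutator on the kernel of the reduction -/

section Contraction

variable {r u m : Type} [Fintype r] [Fintype u] [Fintype m] [DecidableEq r] [DecidableEq u]
  [DecidableEq m] {σ : Type} [Fintype σ] {U : Opens (σ → ℝ)}
  {g : Matrix σ σ (SmoothFn U)} {I R I' R' : Matrix (r ⊕ u) (r ⊕ u) (SmoothFn U)}
  {N : Matrix r r ℝ}

local notation "W" => positivePart (adaptedNumber m g I R I' R' N)

theorem total_mem_adaptedPos (μ : Fin 4) : ∀ x ∈ W, total μ x ∈ W := fun _ hx =>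
  positivePart_map (homotopyCommutator_total _ μ) hx

theorem coeff_mul_mem_adaptedPos (f : Coeff U) : ∀ x ∈ W, coeff f * x ∈ W := fun _ hx =>
  positivePart_map (T := LinearMap.mulLeft ℝ (coeff f)) (adaptedNumber_coeff_mul f) hx

theorem coeff_mul_mem_adaptedNonneg (f : Coeff U) :
    ∀ x ∈ nonnegPart (adaptedNumber m g I R I' R' N),
      coeff f * x ∈ nonnegPart (adaptedNumber m g I R I' R' N) := fun _ hx =>
  nonnegPart_map (T := LinearMap.mulLeft ℝ (coeff f)) (adaptedNumber_coeff_mul f) hx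

variable (h : DualFrame (N.map (algebraMap ℝ _)) (coeffMatrix I) (coeffMatrix R) (coeffMatrix I')
    (coeffMatrix R')) (sI : I.IsSymm) (sR : R.IsSymm) (hN : N.IsSymm)

include h sI sR hN

/-- B + 2G' is the deviation of B from its on-shell value. It has eigenvalue 1, since G' is built
from the invariant new field strengths. -/
theorem twoForm_add_dualField_mem (i : r) (p : Pair) :
    jet (.field (.twoForm (.inl i) p)) 0
      + (2 : ℝ) • dualField (coeffMatrix I') (coeffMatrix R') (newF U m N) (.inl i) p ∈ W := by
  refine mem_positivePart_of_eq ?_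
  rw [map_add, map_smul, adaptedNumber_twoForm_inl h sI sR hN,
    map_dualField_linear adaptedNumber_coeff_mul]
  simp only [adaptedNumber_newF, dualField_zero, smul_zero, add_zero]

/-- H is the sum of the positive terms dA and ½(B + 2G') and the annihilated term -G'; in the
unhatted block it is a new field strength. -/
theorem embH_mem_adaptedNonneg (i : r ⊕ u) (p : Pair) :
    embH U _ (adaptedMag r u m) i p ∈ nonnegPart (adaptedNumber m g I R I' R' N) := by
  have hF (i p) : newF U m N i p ∈ nonnegPart (adaptedNumber m g I R I' R' N) :=
    (le_sup_left : LinearMap.ker (adaptedNumber m g I R I' R' N) ≤ _)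
      (LinearMap.mem_ker.2 (adaptedNumber_newF i p))
  rcases i with i | i
  · rw [embH_adapted_inl]
    have hA (μ) : jet (.field (.electric (.inl i) μ)) 0 ∈ W :=
      mem_positivePart_of_eq (adaptedNumber_electric_inl i μ)
    refine Submodule.add_mem _ (positivePart_le (extD_mem_of total_mem_adaptedPos hA p))
      (Submodule.smul_mem _ _ ?_)
    have h1 := positivePart_le (twoForm_add_dualField_mem (m := m) (g := g) h sI sR hN i p)
    have h2 := Submodule.smul_mem _ (2 : ℝ) (dualField_mem_of coeff_mul_mem_adaptedNonneg hF
      (coeffMatrix I') (coeffMatrix R') (.inl i) p)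
    simpa using Submodule.sub_mem _ h1 h2
  · rw [← newF_inr]
    exact hF _ _

theorem homotopy_embH_mem (i : r ⊕ u) (p : Pair) :
    (homotopy m I' R').der (embH U _ (adaptedMag r u m) i p) ∈ W := by
  rcases i with i | i
  · rw [homotopy_embH_inl]
    exact Submodule.smul_mem _ _ (dualField_mem_of coeff_mul_mem_adaptedPos (fun j p =>
      wedgeDual_mem_of (fun q => mem_positivePart_of_eq (adaptedNumber_twoFormAnti h sI sR hN j q)) p)
        _ _ _ _)
  · rw [homotopy_embH_inr]
    exact Submodule.zero_mem _

/-- Each term contains one factor on which the homotopy has acted, which is positive, and one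
nonnegative factor. -/
theorem homotopy_kinQuad_mem (A B : Matrix (r ⊕ u) (r ⊕ u) (Coeff U)) :
    (homotopy m I' R').der (kinQuad A B (embH U _ (adaptedMag r u m))) ∈ W := by
  have hmul := homotopyCommutator_mul
    (L := adaptedLagrangian (AdaptedParam r u m) m g I R N) (R := adaptedGenerators N)
    (homotopy m I' R')
  rw [kinQuad, map_smul]
  simp only [map_sum]
  refine Submodule.smul_mem _ _ (Submodule.sum_mem _ fun i _ => Submodule.sum_mem _ fun p _ => ?_)
  rw [(homotopy m I' R').isGradedDerivation (embH_adapted_mem i p), map_wedgeDual]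
  refine Submodule.add_mem _ ?_ ?_
  · refine mul_positivePart_mem hmul (homotopy_embH_mem h sI sR hN i p) ?_
    exact Submodule.smul_mem _ _ (dualField_mem_of coeff_mul_mem_adaptedNonneg
      (embH_mem_adaptedNonneg h sI sR hN) _ _ _ _)
  · simp only [mul_zero, zpow_zero, one_smul, AlgHom.coe_id, id_eq]
    refine positivePart_mul_mem hmul (embH_mem_adaptedNonneg h sI sR hN i p) ?_
    refine wedgeDual_mem_of (fun q => ?_) p
    rw [map_dualField_linear (GenDer.der_coeff_mul _)]
    exact dualField_mem_of coeff_mul_mem_adaptedPos (homotopy_embH_mem h sI sR hN) _ _ _ _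

/-- The retained antifields need not be annihilated: their field equations involve B and H, on which
the homotopy yields positive terms. Membership in the positive part is all that the criterion asks.
-/
theorem adaptedNumber_section_mem (z : Gen σ ((r ⊕ u) × Fin 4) (r ⊕ u)) :
    adaptedNumber m g I R I' R' N ((vectorSection m U N).toFun z) ∈ W := by
  rw [vectorSection_toFun]
  rcases z with i | ⟨i, μ⟩ | j | i | ⟨i | i, μ⟩ | j
  · rw [sectionFun, jet_scalar_zero, homotopyCommutator_coeff]
    exact Submodule.zero_mem _
  · rw [adaptedNumber_section_field]
    exact Submodule.zero_mem _
  · rw [sectionFun, adaptedNumber_jet, brst_ghost]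
    simp only [homotopyFun, map_zero, add_zero, Submodule.zero_mem]
  · rw [sectionFun, adaptedNumber_jet, brst_scalarAnti, eulerLagrange_adapted_scalar, map_add,
      (homotopy m I' R').isGradedDerivation.eq_zero_of_mem_scalarSubalgebra (GenDer.der_coeff _)
        (fun i ν => by
          rw [jet_eq_totalPow, map_totalPow (GenDer.der_total _), homotopy_jet]
          simp only [homotopyFun, map_zero]) (scalarEL_mem g i)]
    simp only [homotopyFun, map_zero, zero_add]
    exact homotopy_kinQuad_mem h sI sR hN _ _
  · rw [sectionFun, adaptedNumber_jet, brst_fieldAnti, eulerLagrange_adapted_magnetic_inl,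
      map_smul, map_codiv (GenDer.der_total _)]
    simp only [homotopyFun, map_zero, zero_add]
    refine Submodule.smul_mem _ _ (codiv_mem_of total_mem_adaptedPos (fun p => ?_) μ)
    rw [map_wedgeDual]
    refine wedgeDual_mem_of (fun q => ?_) p
    rw [homotopy_jet, homotopyFun]
    exact Submodule.smul_mem _ _ (dualField_mem_of coeff_mul_mem_adaptedPos (fun j p =>
      wedgeDual_mem_of (fun q => mem_positivePart_of_eq (adaptedNumber_twoFormAnti h sI sR hN j q)) p)
        _ _ _ _)
  · rw [sectionFun, adaptedNumber_jet, brst_fieldAnti, eulerLagrange_adapted_electric sI sR,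
      map_codiv (GenDer.der_total _)]
    simp only [homotopyFun, map_zero, zero_add]
    refine codiv_mem_of total_mem_adaptedPos (fun p => ?_) μ
    rw [map_wedgeDual]
    refine wedgeDual_mem_of (fun q => ?_) p
    rw [map_dualField_linear (GenDer.der_coeff_mul _)]
    exact dualField_mem_of coeff_mul_mem_adaptedPos (homotopy_embH_mem h sI sR hN) _ _ _ _
  · rw [sectionFun, adaptedNumber_jet, brst_ghostAnti]
    obtain ⟨h1, h2, -⟩ := sum_adaptedGenerators_adj (N := N) (u := u) (m := m)
      (fun z => (jet (.fieldAnti z) 0 : LocalFn U _ (AdaptedParam r u m)))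
    rcases j with j | j
    · rw [h1]
      simp only [homotopyFun, map_neg, map_sum, GenDer.der_total, homotopy_jet, map_zero,
        Finset.sum_const_zero, neg_zero, add_zero, Submodule.zero_mem]
    · rw [h2]
      simp only [homotopyFun, map_neg, map_sum, GenDer.der_total, homotopy_jet, map_zero,
        Finset.sum_const_zero, neg_zero, add_zero, Submodule.zero_mem]

/-- Almost all eliminated variables are eigenvectors with eigenvalue 1. The hatted electric
antifields need a correction. -/
theorem sub_section_reduction_mem
    (z : Gen σ (EmbField (r ⊕ u) (r ⊕ m)) (AdaptedParam r u m)) :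
    jet z 0 - (vectorSection m U N).hom ((reduction m I' R' N).hom (jet z 0)) ∈ W := by
  obtain ⟨-, -, h3, h4, h5⟩ := sum_adaptedGenerators_adj (N := N) (u := u) (m := m)
    (fun z => (jet (.fieldAnti z) 0 : LocalFn U _ (AdaptedParam r u m)))
  have hb (i p) : twoFormAnti U r u m i p ∈ W :=
    mem_positivePart_of_eq (adaptedNumber_twoFormAnti h sI sR hN i p)
  rw [GenMap.hom_jet_zero, reduction_toFun]
  rcases z with i | (⟨i | i, μ⟩ | ⟨i | i, μ⟩ | ⟨k | k, p⟩) | (j | ⟨j, μ⟩ | ⟨k, p⟩) | i |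
    (⟨i | i, μ⟩ | ⟨i | i, μ⟩ | ⟨k | k, p⟩) | (j | ⟨j | j, μ⟩ | ⟨k, p⟩) <;>
    simp only [reductionFun, map_zero, sub_zero, GenMap.hom_jet_zero, vectorSection_toFun, sectionFun,
      sub_self, Submodule.zero_mem]
  · exact mem_positivePart_of_eq (adaptedNumber_electric_inl i μ)
  · rw [← sub_sub, sub_self, zero_sub]
    exact Submodule.neg_mem _ (Submodule.sum_mem _ fun j _ => Submodule.smul_mem _ _
      (mem_positivePart_of_eq (adaptedNumber_electric_inl j μ)))
  · exact mem_positivePart_of_eq (adaptedNumber_magnetic_inr i μ)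
  · rw [map_smul, map_dualField (GenMap.hom_coeff _)]
    simp only [vectorSection_vecF]
    rw [neg_smul, sub_neg_eq_add]
    exact twoForm_add_dualField_mem h sI sR hN k p
  · exact mem_positivePart_of_eq (adaptedNumber_twoForm_inr k p)
  · exact mem_positivePart_of_eq (adaptedNumber_ghost_shift j μ)
  · exact mem_positivePart_of_eq (adaptedNumber_ghost_tensor k p)
  · simp only [map_sum, map_smul, GenMap.hom_jet_zero, vectorSection_toFun, sectionFun]
    -- The difference A* - NÃ* equals s of the shift ghost antifield C* plus 2 times a divergence of
    -- B*. The commutator fixes sC*, because hsC* = C* and s² = 0, and B* is already positive.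
    have e1 := brst_ghostAnti (adaptedLagrangian (AdaptedParam r u m) m g I R N)
      (adaptedGenerators N) (.shift (.inl i) μ)
    rw [h3] at e1
    have e2 : (homotopy m I' R').der (brst (adaptedLagrangian (AdaptedParam r u m) m g I R N)
        (adaptedGenerators N) (jet (.ghostAnti (.shift (.inl i) μ)) 0))
          = jet (.ghostAnti (.shift (.inl i) μ)) 0 := by
      rw [e1]
      simp only [map_sub, map_sum, map_smul, map_codiv (GenDer.der_total _), homotopy_jet,
        homotopyFun, smul_zero, Finset.sum_const_zero, sub_zero]
      rw [show codiv (fun _ => (0 : LocalFn U (EmbField (r ⊕ u) (r ⊕ m)) (AdaptedParam r u m))) μ = 0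
        by simpa using codiv_smul 0 (0 : Pair → LocalFn U _ _) μ]
      simp
    have hs : brst (adaptedLagrangian (AdaptedParam r u m) m g I R N) (adaptedGenerators N)
        (jet (.ghostAnti (.shift (.inl i) μ)) 0) ∈ W := mem_positivePart_of_eq <| by
      rw [homotopyCommutator_apply, e2, brst_brst_adapted sI sR hN, map_zero, add_zero]
    rw [e1] at hs
    have hc := Submodule.smul_mem _ (2 : ℝ) (codiv_mem_of (total_mem_adaptedPos (g := g) (I := I)
      (R := R) (I' := I') (R' := R') (N := N))
      (X := fun p => jet (.fieldAnti (.twoForm (.inl i) p)) 0) (hb i) μ)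
    have := Submodule.add_mem _ hs hc
    simpa only [hN.apply, sub_add_cancel] using this
  · refine mem_positivePart_of_eq ?_
    rw [adaptedNumber_jet, brst_fieldAnti, eulerLagrange_adapted_magnetic_inr, homotopyFun,
      brst_ghostAnti, h4, map_zero, add_zero]
  · exact hb k p
  · refine mem_positivePart_of_eq ?_
    rw [adaptedNumber_jet, brst_fieldAnti, eulerLagrange_adapted_twoForm_inr sI sR hN, homotopyFun,
      brst_ghostAnti, h5, map_zero, add_zero]
  · refine mem_positivePart_of_eq ?_
    rw [adaptedNumber_jet, brst_ghostAnti, h3]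
    simp only [map_sub, map_sum, map_smul, map_codiv (GenDer.der_total _), homotopy_jet,
      homotopyFun, smul_zero, Finset.sum_const_zero, sub_zero, map_zero, zero_add]
    rw [show codiv (fun _ => (0 : LocalFn U (EmbField (r ⊕ u) (r ⊕ m)) (AdaptedParam r u m))) μ = 0
      by simpa using codiv_smul 0 (0 : Pair → LocalFn U _ _) μ]
    simp
  · refine mem_positivePart_of_eq ?_
    rw [adaptedNumber_jet, brst_ghostAnti, h4, homotopy_jet]
    simp only [homotopyFun, map_zero, zero_add]
  · refine mem_positivePart_of_eq ?_
    rw [adaptedNumber_jet, brst_ghostAnti, h5, homotopy_jet]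
    simp only [homotopyFun, map_zero, zero_add]

/-- The elimination of the two-forms induces isomorphisms on the local BRST cohomology. -/
theorem reduction_bijective (sI' : I'.IsSymm) (sR' : R'.IsSymm) (k : ℤ) : Function.Bijective
    (((reduction m I' R' N).localMap (L := adaptedLagrangian (AdaptedParam r u m) m g I R N)
      (reduction_brst h sI sR hN sI' sR')).onCohomology k) :=
  LocalMap.bijective_onCohomology _ (brst_brst_adapted sI sR hN) (vectorSection m U N)
    reduction_vectorSection (homotopy m I' R') reduction_homotopy
    (sub_section_reduction_mem h sI sR hN) (adaptedNumber_section_mem h sI sR hN) k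

end Contraction

/-! ### Matrices of differential operators -/

section OperatorMatrices

variable {σ : Type} [Fintype σ] {U : Opens (σ → ℝ)} {F P F' P' : Type}
variable {A B C : Type} [Fintype A] [Fintype B] [Fintype C]

/-- The action of a matrix of differential operators on a vector of local functions. -/
def opVec (M : Matrix A B DiffOp) (v : B → LocalFn U F P) (a : A) : LocalFn U F P :=
  ∑ b, (M a b).act (v b)

/-- The formal adjoint of a matrix of differential operators. -/
def opAdj (M : Matrix A B DiffOp) : Matrix B A DiffOp := (M.map DiffOp.adj)ᵀ

/-- A matrix of numbers as a matrix of differential operators. -/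
def opConst (T : Matrix A B ℝ) : Matrix A B DiffOp := T.map MvPolynomial.C

theorem opVec_mul (M : Matrix A B DiffOp) (N : Matrix B C DiffOp) (v : C → LocalFn U F P) :
    opVec (M * N) v = opVec M (opVec N v) := by
  funext a
  simp only [opVec, Matrix.mul_apply, DiffOp.act_sum, DiffOp.act_mul]
  rw [Finset.sum_comm]
  simp only [DiffOp.act_eq, map_sum]

theorem opVec_one [DecidableEq A] (v : A → LocalFn U F P) : opVec 1 v = v := by
  funext a
  simp [opVec, Matrix.one_apply, apply_ite DiffOp.act, ite_apply, DiffOp.act_one, DiffOp.act_zero]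

theorem opVec_opVec [DecidableEq A] {M : Matrix A B DiffOp} {N : Matrix B A DiffOp} (h : M * N = 1)
    (v : A → LocalFn U F P) : opVec M (opVec N v) = v := by
  rw [← opVec_mul, h, opVec_one]

theorem opVec_opConst (T : Matrix A B ℝ) (v : B → LocalFn U F P) (a : A) :
    opVec (opConst T) v a = ∑ b, T a b • v b := by
  simp [opVec, opConst, DiffOp.act_C]

theorem map_opVec {f : LocalFn U F P →ₗ[ℝ] LocalFn U F' P'}
    (hf : ∀ μ a, f (total μ a) = total μ (f a)) (M : Matrix A B DiffOp) (v : B → LocalFn U F P)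
    (a : A) : f (opVec M v a) = opVec M (fun b => f (v b)) a := by
  simp only [opVec, map_sum, DiffOp.map_act hf]

theorem opVec_mem {g : ℤ} (M : Matrix A B DiffOp) {v : B → LocalFn U F P}
    (hv : ∀ b, v b ∈ ghPart U F P g) (a : A) : opVec M v a ∈ ghPart U F P g :=
  Submodule.sum_mem _ fun b _ => DiffOp.act_mem _ (hv b)

theorem opAdj_mul (M : Matrix A B DiffOp) (N : Matrix B C DiffOp) :
    opAdj (M * N) = opAdj N * opAdj M := by
  rw [opAdj, Matrix.map_mul, Matrix.transpose_mul]
  rfl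

theorem opAdj_one [DecidableEq A] : opAdj (1 : Matrix A A DiffOp) = 1 := by
  simp [opAdj]

theorem opAdj_opConst (T : Matrix A B ℝ) : opAdj (opConst T) = opConst Tᵀ := by
  ext1 a b
  exact DiffOp.adj_C _

theorem opConst_mul (S : Matrix A B ℝ) (T : Matrix B C ℝ) :
    opConst (S * T) = opConst S * opConst T := Matrix.map_mul

theorem opConst_one [DecidableEq A] : opConst (1 : Matrix A A ℝ) = 1 :=
  Matrix.map_one _ (map_zero _) (map_one _)

end OperatorMatrices

/-! ### Linear changes of the fields -/

theorem GenMap.hom_hom_eq {σ : Type} [Fintype σ] {U : Opens (σ → ℝ)} {F P F' P' : Type}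
    (G : GenMap U F P F' P') (G' : GenMap U F' P' F P) (h : ∀ z, G'.hom (G.toFun z) = jet z 0)
    (x : LocalFn U F P) : G'.hom (G.hom x) = x := by
  refine algHom_ext (f := G'.hom.comp G.hom) (g := AlgHom.id ℝ _) (fun f => ?_) (fun z ν => ?_) x
  · simp [GenMap.hom_coeff]
  · have := map_totalPow (f := G'.hom.toLinearMap) G'.hom_total ν (G.toFun z)
    simp only [AlgHom.toLinearMap_apply, h] at this
    rw [AlgHom.comp_apply, GenMap.hom_jet, this, AlgHom.id_apply, ← jet_eq_totalPow]

section LinearChange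

variable {σ : Type} [Fintype σ] {U : Opens (σ → ℝ)} {F P F' P' : Type} [Fintype F] [Fintype P]
  [Fintype F'] [Fintype P'] [DecidableEq F] [DecidableEq F']

/-- A linear change of the fields and of the ghosts, with the dual change of the antifields. -/
def changeFun (U : Opens (σ → ℝ)) (T : Matrix F F' ℝ) (T' : Matrix F' F ℝ) (d : Matrix P P' DiffOp)
    (c : Matrix P' P DiffOp) : Gen σ F P → LocalFn U F' P'
  | .scalar i => jet (.scalar i) 0
  | .field a => opVec (opConst T) (fun b => jet (.field b) 0) a
  | .ghost α => opVec d (fun β => jet (.ghost β) 0) α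
  | .scalarAnti i => jet (.scalarAnti i) 0
  | .fieldAnti a => opVec (opConst T'ᵀ) (fun b => jet (.fieldAnti b) 0) a
  | .ghostAnti α => opVec (opAdj c) (fun β => jet (.ghostAnti β) 0) α

/-- A linear change of the fields and of the ghosts, with the dual change of the antifields. -/
def change (U : Opens (σ → ℝ)) (T : Matrix F F' ℝ) (T' : Matrix F' F ℝ) (d : Matrix P P' DiffOp)
    (c : Matrix P' P DiffOp) : GenMap U F P F' P' where
  toFun := changeFun U T T' d c
  mem z := by
    cases z with
    | scalar i => exact jet_mem_ghPart (.scalar i) 0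
    | field a => exact opVec_mem _ (fun b => jet_mem_ghPart (.field b) 0) a
    | ghost α => exact opVec_mem _ (fun b => jet_mem_ghPart (.ghost b) 0) α
    | scalarAnti i => exact jet_mem_ghPart (.scalarAnti i) 0
    | fieldAnti a => exact opVec_mem _ (fun b => jet_mem_ghPart (.fieldAnti b) 0) a
    | ghostAnti α => exact opVec_mem _ (fun b => jet_mem_ghPart (.ghostAnti b) 0) α
  scalar _ := rfl

theorem change_toFun (T : Matrix F F' ℝ) (T' : Matrix F' F ℝ) (d : Matrix P P' DiffOp)
    (c : Matrix P' P DiffOp) (z : Gen σ F P) : (change U T T' d c).toFun z = changeFun U T T' d c z :=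
  rfl

theorem change_change {T : Matrix F F' ℝ} {T' : Matrix F' F ℝ} {d : Matrix P P' DiffOp}
    {c : Matrix P' P DiffOp} [DecidableEq P] (hT : T * T' = 1) (hd : d * c = 1)
    (x : LocalFn U F P) : (change U T' T c d).hom ((change U T T' d c).hom x) = x := by
  refine GenMap.hom_hom_eq _ _ (fun z => ?_) x
  have hv {A B : Type} [Fintype A] [Fintype B] (M : Matrix A B DiffOp) (v : B → LocalFn U F' P')
      (a : A) : (change U T' T c d).hom (opVec M v a)
        = opVec M (fun b => (change U T' T c d).hom (v b)) a :=
    map_opVec (f := (change U T' T c d).hom.toLinearMap) (GenMap.hom_total _) M v a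
  rw [change_toFun]
  cases z with
  | scalar i => rw [changeFun, GenMap.hom_jet_zero, change_toFun, changeFun]
  | field a =>
    rw [changeFun, hv]
    simp only [GenMap.hom_jet_zero, change_toFun, changeFun]
    exact congrFun (opVec_opVec (by rw [← opConst_mul, hT, opConst_one]) _) a
  | ghost α =>
    rw [changeFun, hv]
    simp only [GenMap.hom_jet_zero, change_toFun, changeFun]
    exact congrFun (opVec_opVec hd _) α
  | scalarAnti i => rw [changeFun, GenMap.hom_jet_zero, change_toFun, changeFun]
  | fieldAnti a =>
    rw [changeFun, hv]
    simp only [GenMap.hom_jet_zero, change_toFun, changeFun]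
    exact congrFun (opVec_opVec (by
      rw [← opConst_mul, ← Matrix.transpose_mul, hT, Matrix.transpose_one, opConst_one]) _) a
  | ghostAnti α =>
    rw [changeFun, hv]
    simp only [GenMap.hom_jet_zero, change_toFun, changeFun]
    exact congrFun (opVec_opVec (by rw [← opAdj_mul, hd, opAdj_one]) _) α

/-- The linear change of the fields with matrix `T`, whose inverse is `T'`, maps the field equations
of `L` to those of `L'`. -/
structure IsCovariant (L : ghPart U F P 0) (L' : ghPart U F' P' 0) (T : Matrix F F' ℝ)
    (T' : Matrix F' F ℝ) : Prop where
  mul_inv : T * T' = 1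
  scalar : ∀ d c i, (change U T T' d c).hom (eulerLagrange L.1 (.scalar i))
    = eulerLagrange L'.1 (.scalar i)
  field : ∀ d c a, (change U T T' d c).hom (eulerLagrange L.1 (.field a))
    = opVec (opConst T'ᵀ) (fun b => eulerLagrange L'.1 (.field b)) a

theorem isGaugeSymmetry_iff {L : LocalFn U F P} {S : F → DiffOp} : IsGaugeSymmetry L S ↔
    opVec (opAdj (Matrix.replicateCol Unit S)) (fun a => eulerLagrange L (.field a)) = 0 := by
  rw [IsGaugeSymmetry, funext_iff]
  simp [opVec, opAdj, DiffOp.actAdjoint_eq]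

variable {L : ghPart U F P 0} {L' : ghPart U F' P' 0} {T : Matrix F F' ℝ} {T' : Matrix F' F ℝ}

theorem IsCovariant.isGaugeSymmetry (h : IsCovariant L L' T T') {S : F → DiffOp}
    (hS : IsGaugeSymmetry L.1 S) : IsGaugeSymmetry L'.1 (fun a' => (opConst T' *ᵥ S) a') := by
  rw [isGaugeSymmetry_iff] at hS ⊢
  funext x
  -- The Noether identity contains no ghosts or antifields of ghosts, so their images may be set to
  -- zero.
  have e := congrArg (change U T T' (0 : Matrix P P' DiffOp) 0).hom (congrFun hS x)
  have hv := map_opVec (f := (change U T T' (0 : Matrix P P' DiffOp) 0).hom.toLinearMap)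
    (GenMap.hom_total _) (opAdj (Matrix.replicateCol Unit S))
    (fun a => eulerLagrange L.1 (.field a)) x
  simp only [AlgHom.toLinearMap_apply] at hv
  rw [hv] at e
  simp only [h.field] at e
  have e2 : opVec (opAdj (Matrix.replicateCol Unit S)) (opVec (opConst T'ᵀ)
      fun b => eulerLagrange L'.1 (.field b)) x = 0 := by
    refine e.trans ?_
    simp
  rw [← opVec_mul, ← opAdj_opConst, ← opAdj_mul, ← Matrix.replicateCol_mulVec] at e2
  exact e2

variable {R : F → P → DiffOp} {R' : F' → P' → DiffOp}

theorem IsIrreducibleGeneratingSet.exists_mul_eq {ι : Type} (h : IsIrreducibleGeneratingSet L.1 R)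
    {S : Matrix F ι DiffOp} (hS : ∀ i, IsGaugeSymmetry L.1 fun a => S a i) :
    ∃ c : Matrix P ι DiffOp, S = Matrix.of R * c := by
  choose c hc using fun i => h.complete _ (hS i)
  exact ⟨Matrix.of fun α i => c i α, by ext1 a i; simpa [Matrix.mul_apply] using hc i a⟩

/-- Irreducibility, applied to the difference column by column. -/
theorem IsIrreducibleGeneratingSet.mul_left_cancel {ι : Type} (h : IsIrreducibleGeneratingSet L.1 R)
    {c c' : Matrix P ι DiffOp} (hc : Matrix.of R * c = Matrix.of R * c') : c = c' := by
  ext1 α i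
  have := h.irreducible (fun α => c α i - c' α i) (fun a => by
    have := congrFun (congrFun hc a) i
    simp only [Matrix.mul_apply, Matrix.of_apply] at this
    simp only [mul_sub, Finset.sum_sub_distrib, this, sub_self])
  exact sub_eq_zero.1 (congrFun this α)

/-- Generating sets of theories that are related by a linear change of the fields are related by an
invertible change of the ghosts. -/
theorem exists_ghost_change [DecidableEq P] [DecidableEq P'] (h : IsCovariant L L' T T')
    (h' : IsCovariant L' L T' T) (hR : IsIrreducibleGeneratingSet L.1 R)
    (hR' : IsIrreducibleGeneratingSet L'.1 R') :
    ∃ (d : Matrix P P' DiffOp) (c : Matrix P' P DiffOp), opConst T * Matrix.of R' = Matrix.of R * d ∧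
      opConst T' * Matrix.of R = Matrix.of R' * c ∧ d * c = 1 ∧ c * d = 1 := by
  obtain ⟨d, hd⟩ := hR.exists_mul_eq (S := opConst T * Matrix.of R') fun β =>
    h'.isGaugeSymmetry (hR'.isGaugeSymmetry β)
  obtain ⟨c, hc⟩ := hR'.exists_mul_eq (S := opConst T' * Matrix.of R) fun β =>
    h.isGaugeSymmetry (hR.isGaugeSymmetry β)
  -- Going to the other theory and back shows R(dc) = R and R'(cd) = R', and irreducibility cancels
  -- R and R'.
  refine ⟨d, c, hd, hc, hR.mul_left_cancel ?_, hR'.mul_left_cancel ?_⟩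
  · rw [← Matrix.mul_assoc, ← hd, Matrix.mul_assoc, ← hc, ← Matrix.mul_assoc, ← opConst_mul,
      h.mul_inv, opConst_one, Matrix.one_mul, Matrix.mul_one]
  · rw [← Matrix.mul_assoc, ← hc, Matrix.mul_assoc, ← hd, ← Matrix.mul_assoc, ← opConst_mul,
      h'.mul_inv, opConst_one, Matrix.one_mul, Matrix.mul_one]

/-- Antifields transform contragrediently to their fields, and ghost antifields by the adjoint of
the inverse ghost change. The relation for antifields is then the adjoint of the relation between
the generating sets. -/
theorem change_brst {d : Matrix P P' DiffOp} {c : Matrix P' P DiffOp} (h : IsCovariant L L' T T')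
    (hd : opConst T * Matrix.of R' = Matrix.of R * d)
    (hc : opConst T' * Matrix.of R = Matrix.of R' * c) (z : Gen σ F P) :
    (change U T T' d c).hom (brst L R (jet z 0)) = brst L' R' ((change U T T' d c).toFun z) := by
  have hv {A B : Type} [Fintype A] [Fintype B] (M : Matrix A B DiffOp) (v : B → LocalFn U F P)
      (a : A) : (change U T T' d c).hom (opVec M v a)
        = opVec M (fun b => (change U T T' d c).hom (v b)) a :=
    map_opVec (f := (change U T T' d c).hom.toLinearMap) (GenMap.hom_total _) M v a
  have hs {A B : Type} [Fintype A] [Fintype B] (M : Matrix A B DiffOp) (v : B → LocalFn U F' P')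
      (a : A) : brst L' R' (opVec M v a) = opVec M (fun b => brst L' R' (v b)) a :=
    map_opVec (brst_total _ _) M v a
  have e1 (a) : brst L R (jet (.field a) 0) = opVec (Matrix.of R) (fun α => jet (.ghost α) 0) a :=
    brst_field L R a
  have e1' (a) : brst L' R' (jet (.field a) 0)
      = opVec (Matrix.of R') (fun α => jet (.ghost α) 0) a := brst_field L' R' a
  have e2 (α) : brst L R (jet (.ghostAnti α) 0)
      = opVec (opAdj (Matrix.of R)) (fun a => jet (.fieldAnti a) 0) α := brst_ghostAnti L R α
  have e2' (α) : brst L' R' (jet (.ghostAnti α) 0)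
      = opVec (opAdj (Matrix.of R')) (fun a => jet (.fieldAnti a) 0) α := brst_ghostAnti L' R' α
  rw [change_toFun]
  cases z with
  | scalar i => rw [changeFun, brst_scalar, brst_scalar, map_zero]
  | field a =>
    rw [changeFun, hs, e1, hv]
    simp only [GenMap.hom_jet_zero, change_toFun, changeFun, e1']
    refine congrFun ((opVec_mul _ _ _).symm.trans (Eq.trans ?_ (opVec_mul _ _ _))) a
    rw [hd]
  | ghost α =>
    rw [changeFun, hs, brst_ghost, map_zero]
    simp only [brst_ghost]
    simp [opVec, DiffOp.act_eq]
  | scalarAnti i => rw [changeFun, brst_scalarAnti, brst_scalarAnti, h.scalar]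
  | fieldAnti a =>
    rw [changeFun, hs, brst_fieldAnti, h.field]
    simp only [brst_fieldAnti]
  | ghostAnti α =>
    rw [changeFun, hs, e2, hv]
    simp only [GenMap.hom_jet_zero, change_toFun, changeFun, e2']
    refine congrFun ((opVec_mul _ _ _).symm.trans (Eq.trans ?_ (opVec_mul _ _ _))) α
    rw [← opAdj_opConst, ← opAdj_mul, ← opAdj_mul, hc]

/-- A local map with an inverse induces isomorphisms on the local BRST cohomology. -/
theorem LocalMap.bijective_onCohomology_of_inverse (π : LocalMap L R L' R') (ρ : LocalMap L' R' L R)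
    (h : ∀ x, ρ.toAlgHom (π.toAlgHom x) = x) (h' : ∀ x, π.toAlgHom (ρ.toAlgHom x) = x) (k : ℤ) :
    Function.Bijective (π.onCohomology k) := by
  refine Function.bijective_iff_has_inverse.2 ⟨ρ.onCohomology k, fun x => ?_, fun x => ?_⟩ <;>
    induction x using Submodule.Quotient.induction_on with
    | H x =>
      refine congrArg Submodule.Quotient.mk (Subtype.ext ?_)
      first | exact h _ | exact h' _

/-- Theories that are related by a linear change of the fields have isomorphic local BRST
cohomologies. -/
theorem exists_localMap_of_isCovariant (h : IsCovariant L L' T T') (h' : IsCovariant L' L T' T)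
    (hR : IsIrreducibleGeneratingSet L.1 R) (hR' : IsIrreducibleGeneratingSet L'.1 R')
    (hs : ∀ x, brst L' R' (brst L' R' x) = 0) :
    (∀ x, brst L R (brst L R x) = 0) ∧ ∃ π : LocalMap L R L' R',
      (∀ a, π.toAlgHom (jet (.field a) 0) = ∑ b, T a b • jet (.field b) 0) ∧
      ∀ k, Function.Bijective (π.onCohomology k) := by
  classical
  obtain ⟨d, c, hd, hc, hdc, hcd⟩ := exists_ghost_change h h' hR hR'
  let π : LocalMap L R L' R' := (change U T T' d c).localMap (change_brst h hd hc)
  let ρ : LocalMap L' R' L R := (change U T' T c d).localMap (change_brst h' hc hd)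
  have h1 (x) : ρ.toAlgHom (π.toAlgHom x) = x := change_change h.mul_inv hdc x
  have h2 (x) : π.toAlgHom (ρ.toAlgHom x) = x := change_change h'.mul_inv hcd x
  refine ⟨fun x => ?_, π, fun a => ?_, π.bijective_onCohomology_of_inverse ρ h1 h2⟩
  -- Nilpotency for an arbitrary generating set is pulled back along the isomorphism.
  · rw [← h1 (brst L R (brst L R x)), π.map_brst, π.map_brst, hs, map_zero]
  · exact (GenMap.hom_jet_zero _ _).trans (opVec_opConst _ _ _)

/-- The transport of an irreducible generating set along a linear change of the fields. -/
theorem IsIrreducibleGeneratingSet.of_isCovariant (h : IsCovariant L L' T T')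
    (h' : IsCovariant L' L T' T) (hR' : IsIrreducibleGeneratingSet L'.1 R') (e : P' ≃ P) :
    IsIrreducibleGeneratingSet L.1 fun a α => (opConst T * Matrix.of R') a (e.symm α) where
  isGaugeSymmetry α := h'.isGaugeSymmetry (hR'.isGaugeSymmetry (e.symm α))
  irreducible c hc := by
    have h1 : opConst T *ᵥ (Matrix.of R' *ᵥ fun β => c (e β)) = 0 := by
      rw [Matrix.mulVec_mulVec]
      funext a
      have := hc a
      rw [← e.sum_comp] at this
      simpa [Matrix.mulVec, dotProduct] using this
    have h2 : Matrix.of R' *ᵥ (fun β => c (e β)) = 0 := by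
      have := congrArg (opConst T' *ᵥ ·) h1
      simpa only [Matrix.mulVec_mulVec, ← Matrix.mul_assoc, ← opConst_mul, h'.mul_inv, opConst_one,
        Matrix.one_mul, Matrix.one_mulVec, Matrix.mulVec_zero] using this
    have h3 := hR'.irreducible _ (congrFun h2)
    funext α
    simpa using congrFun h3 (e.symm α)
  complete S hS := by
    obtain ⟨c, hc⟩ := hR'.complete _ (h.isGaugeSymmetry hS)
    refine ⟨fun α => c (e.symm α), fun a => ?_⟩
    have h1 : opConst T' *ᵥ S = Matrix.of R' *ᵥ c := funext hc
    have h2 := congrArg (opConst T *ᵥ ·) h1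
    simp only [Matrix.mulVec_mulVec, ← opConst_mul, h.mul_inv, opConst_one, Matrix.one_mulVec] at h2
    rw [e.symm.sum_comp (fun β => (opConst T * Matrix.of R') a β * c β)]
    exact congrFun h2 a

/-- The composition of local maps. -/
def LocalMap.comp {F'' P'' : Type} [Fintype F''] [Fintype P''] {L'' : ghPart U F'' P'' 0}
    {R'' : F'' → P'' → DiffOp} (ρ : LocalMap L' R' L'' R'') (π : LocalMap L R L' R') :
    LocalMap L R L'' R'' where
  toAlgHom := ρ.toAlgHom.comp π.toAlgHom
  map_coeff f := by rw [AlgHom.comp_apply, π.map_coeff, ρ.map_coeff]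
  map_ghPart g a ha := ρ.map_ghPart g _ (π.map_ghPart g a ha)
  map_total μ a := by simp only [AlgHom.comp_apply, π.map_total, ρ.map_total]
  map_brst a := by simp only [AlgHom.comp_apply, π.map_brst, ρ.map_brst]

theorem LocalMap.comp_onCohomology {F'' P'' : Type} [Fintype F''] [Fintype P'']
    {L'' : ghPart U F'' P'' 0} {R'' : F'' → P'' → DiffOp} (ρ : LocalMap L' R' L'' R'')
    (π : LocalMap L R L' R') (k : ℤ) :
    ⇑((ρ.comp π).onCohomology k) = ρ.onCohomology k ∘ π.onCohomology k := by
  funext x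
  induction x using Submodule.Quotient.induction_on with
  | H x => rfl

end LinearChange

/-! ### Linear changes of the fields of the embedding tensor formalism -/

instance {n a : Type} [DecidableEq n] [DecidableEq a] : DecidableEq (EmbField n a) :=
  (EmbField.equivSum n a).decidableEq

section EmbChange

variable {n a k l : Type} [Fintype n] [Fintype a] [Fintype k] [Fintype l] [DecidableEq n]
  [DecidableEq a] [DecidableEq k] [DecidableEq l]

/-- The change of the fields `A = X A'`, `Ã = Yᵀ Ã'`, `B = Z B'`. -/
def embChange (X : Matrix n k ℝ) (Y : Matrix k n ℝ) (Z : Matrix a l ℝ) :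
    Matrix (EmbField n a) (EmbField k l) ℝ
  | .electric i μ, .electric j ν => if μ = ν then X i j else 0
  | .magnetic i μ, .magnetic j ν => if μ = ν then Y j i else 0
  | .twoForm α p, .twoForm β q => if p = q then Z α β else 0
  | _, _ => 0

theorem embChange_transpose (X : Matrix n k ℝ) (Y : Matrix k n ℝ) (Z : Matrix a l ℝ) :
    (embChange X Y Z)ᵀ = embChange Xᵀ Yᵀ Zᵀ := by
  ext z w
  cases z <;> cases w <;> simp [embChange, eq_comm]

variable {V : Type*} [AddCommGroup V] [Module ℝ V] (X : Matrix n k ℝ) (Y : Matrix k n ℝ)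
  (Z : Matrix a l ℝ)

theorem sum_embChange_electric (v : EmbField k l → V) (i : n) (μ : Fin 4) :
    ∑ w, embChange X Y Z (.electric i μ) w • v w = ∑ j, X i j • v (.electric j μ) := by
  rw [EmbField.sum_eq]
  simp [embChange, ite_smul]

theorem sum_embChange_magnetic (v : EmbField k l → V) (i : n) (μ : Fin 4) :
    ∑ w, embChange X Y Z (.magnetic i μ) w • v w = ∑ j, Y j i • v (.magnetic j μ) := by
  rw [EmbField.sum_eq]
  simp [embChange, ite_smul]

theorem sum_embChange_twoForm (v : EmbField k l → V) (α : a) (p : Pair) :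
    ∑ w, embChange X Y Z (.twoForm α p) w • v w = ∑ β, Z α β • v (.twoForm β p) := by
  rw [EmbField.sum_eq]
  simp [embChange, ite_smul]

variable {X Y Z}

theorem embChange_mul {Z' : Matrix l a ℝ} (hX : X * Y = 1) (hZ : Z * Z' = 1) :
    embChange X Y Z * embChange Y X Z' = 1 := by
  ext z w
  rw [Matrix.mul_apply]
  have hX' (i j) := congrFun (congrFun hX i) j
  have hZ' (i j) := congrFun (congrFun hZ i) j
  simp only [Matrix.mul_apply, Matrix.one_apply] at hX' hZ'
  simp only [← smul_eq_mul]
  rcases z with ⟨i, μ⟩ | ⟨i, μ⟩ | ⟨α, p⟩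
  · rw [sum_embChange_electric X Y Z fun x => embChange Y X Z' x w]
    rcases w with ⟨j, ν⟩ | ⟨j, ν⟩ | ⟨β, q⟩ <;> simp [embChange, Matrix.one_apply]
    split_ifs <;> simp_all
  · rw [sum_embChange_magnetic X Y Z fun x => embChange Y X Z' x w]
    rcases w with ⟨j, ν⟩ | ⟨j, ν⟩ | ⟨β, q⟩ <;> simp [embChange, Matrix.one_apply]
    simp only [mul_comm (Y _ _), hX', eq_comm (a := j)]
    split_ifs <;> simp_all
  · rw [sum_embChange_twoForm X Y Z fun x => embChange Y X Z' x w]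
    rcases w with ⟨j, ν⟩ | ⟨j, ν⟩ | ⟨β, q⟩ <;> simp [embChange, Matrix.one_apply]
    split_ifs <;> simp_all

theorem sum_smul_sum {A B C : Type} [Fintype B] [Fintype C] (M : Matrix A B ℝ) (N : Matrix B C ℝ)
    (v : C → V) (x : A) : ∑ y, M x y • ∑ z, N y z • v z = ∑ z, (M * N) x z • v z := by
  simp only [Finset.smul_sum, smul_smul, Matrix.mul_apply, Finset.sum_smul]
  exact Finset.sum_comm

/-- `Yᵀ A' = A X`, for matrices with entries in a real algebra. -/
def Intertwines {𝒦 : Type} [AddCommGroup 𝒦] [Module ℝ 𝒦] (X : Matrix n k ℝ) (Y : Matrix k n ℝ)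
    (A : Matrix n n 𝒦) (A' : Matrix k k 𝒦) : Prop :=
  ∀ i x, ∑ j, Y j i • A' j x = ∑ j, X j x • A i j

theorem Intertwines.map {𝒦 𝒦' : Type} [AddCommGroup 𝒦] [Module ℝ 𝒦] [AddCommGroup 𝒦'] [Module ℝ 𝒦']
    {A : Matrix n n 𝒦} {A' : Matrix k k 𝒦} (h : Intertwines X Y A A') (f : 𝒦 →ₗ[ℝ] 𝒦') :
    Intertwines X Y (A.map f) (A'.map f) := fun i x => by
  simpa using congrArg f (h i x)

variable {σ : Type} [Fintype σ] {U : Opens (σ → ℝ)} {F P P' : Type}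

theorem Intertwines.coeffMatrix {A : Matrix n n (SmoothFn U)} {A' : Matrix k k (SmoothFn U)}
    (h : Intertwines X Y A A') : Intertwines X Y (coeffMatrix A) (coeffMatrix A') :=
  h.map Coeff.ofScalarHom.toLinearMap

theorem Intertwines.dphiMatrix {A : Matrix n n (Coeff U)} {A' : Matrix k k (Coeff U)}
    (h : Intertwines X Y A A') (i : σ) : Intertwines X Y (dphiMatrix i A) (dphiMatrix i A') :=
  h.map (Coeff.dphi U i).toLinearMap

theorem Intertwines.sum_coeff_mul {A : Matrix n n (Coeff U)} {A' : Matrix k k (Coeff U)}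
    (h : Intertwines X Y A A') (v : k → LocalFn U F P) (i : n) :
    ∑ j, Y j i • ∑ x, coeff (A' j x) * v x = ∑ j, coeff (A i j) * ∑ x, X j x • v x := by
  have e (x : k) := congrArg (coeff (F := F) (P := P)) (h i x)
  simp only [map_sum, map_smul] at e
  calc _ = ∑ x, (∑ j, Y j i • coeff (A' j x)) * v x := by
        simp only [Finset.smul_sum, Finset.sum_mul, smul_mul_assoc]
        exact Finset.sum_comm
    _ = _ := by
        simp only [e, Finset.mul_sum, Finset.sum_mul, smul_mul_assoc, mul_smul_comm]
        exact Finset.sum_comm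

theorem dualField_linear_change {I R : Matrix n n (Coeff U)} {I' R' : Matrix k k (Coeff U)}
    (hI : Intertwines X Y I I') (hR : Intertwines X Y R R') (H : k → Pair → LocalFn U F P) (i : n)
    (p : Pair) : dualField I R (fun j q => ∑ x, X j x • H x q) i p
      = ∑ j, Y j i • dualField I' R' H j p := by
  have hs (j : n) : star (fun q => ∑ x, X j x • H x q) p = ∑ x, X j x • star (H x) p := by
    simp only [star, Finset.smul_sum]
    exact Finset.sum_congr rfl fun x _ => smul_comm _ _ _
  simp only [dualField, hs, Finset.sum_add_distrib, smul_add, hI.sum_coeff_mul, hR.sum_coeff_mul]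

theorem wedgeDual_sum_smul {ι : Type} [Fintype ι] (c : ι → ℝ) (H : ι → Pair → V) (p : Pair) :
    wedgeDual (fun q => ∑ x, c x • H x q) p = ∑ x, c x • wedgeDual (H x) p := by
  simp only [wedgeDual, Finset.smul_sum]
  exact Finset.sum_congr rfl fun x _ => smul_comm _ _ _

theorem wedgeDual_sub (H K : Pair → V) (p : Pair) :
    wedgeDual (fun q => H q - K q) p = wedgeDual H p - wedgeDual K p := smul_sub _ _ _

theorem wedgeDual_smul (c : ℝ) (H : Pair → V) (p : Pair) :
    wedgeDual (fun q => c • H q) p = c • wedgeDual H p := smul_comm _ _ _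

/-- Field strengths transform with X and their duals with Yᵀ, so YX = 1 makes the pairing H ∧ G
invariant. -/
theorem kinQuad_linear_change (hY : Y * X = 1) {I R : Matrix n n (Coeff U)}
    {I' R' : Matrix k k (Coeff U)} (hI : Intertwines X Y I I') (hR : Intertwines X Y R R')
    (H : k → Pair → LocalFn U F P) :
    kinQuad I R (fun j q => ∑ x, X j x • H x q) = kinQuad I' R' H := by
  have hd (i : n) : dualField I R (fun j q => ∑ x, X j x • H x q) i
      = fun p => ∑ j, Y j i • dualField I' R' H j p :=
    funext fun p => dualField_linear_change hI hR H i p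
  simp only [kinQuad, hd, wedgeDual_sum_smul]
  congr 1
  rw [Finset.sum_comm, Finset.sum_comm (s := (Finset.univ : Finset k))]
  refine Finset.sum_congr rfl fun p _ => ?_
  have e (i : n) : (∑ x, X i x • H x p) * ∑ j, Y j i • wedgeDual (dualField I' R' H j) p
      = ∑ j, Y j i • ∑ x, X i x • (H x p * wedgeDual (dualField I' R' H j) p) := by
    simp only [Finset.mul_sum, Finset.sum_mul, smul_mul_assoc, mul_smul_comm, Finset.smul_sum]
  simp only [e]
  rw [Finset.sum_comm]
  simp only [sum_smul_sum Y X, hY, Matrix.one_apply, ite_smul, one_smul, zero_smul,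
    Finset.sum_ite_eq, Finset.mem_univ, if_true]

variable {g : Matrix σ σ (SmoothFn U)} {I R : Matrix n n (SmoothFn U)}
  {I' R' : Matrix k k (SmoothFn U)} {Θel Θmag : Matrix n a ℝ} {Θel' Θmag' : Matrix k l ℝ}
  {Z' : Matrix l a ℝ} [Fintype P] [Fintype P']

theorem change_field (T : Matrix (EmbField n a) (EmbField k l) ℝ)
    (T' : Matrix (EmbField k l) (EmbField n a) ℝ) (d : Matrix P P' DiffOp) (c : Matrix P' P DiffOp)
    (z : EmbField n a) : (change U T T' d c).hom (jet (.field z) 0)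
      = ∑ w, T z w • jet (.field w) 0 :=
  (GenMap.hom_jet_zero _ _).trans (opVec_opConst _ _ _)

/-- The two-form equation involves Θel only after contraction with Θmag, so only the product
ΘmagᵀΘel has to match; the two matrices Θel themselves need not be related. -/
theorem isCovariant_emb (hX : X * Y = 1) (hY : Y * X = 1) (hZ : Z * Z' = 1)
    (sI : I.IsSymm) (sR : R.IsSymm) (sI' : I'.IsSymm) (sR' : R'.IsSymm)
    (hΘ : ∀ α β, ∑ i, Θmag i α * Θel i β = ∑ i, Θmag i β * Θel i α)
    (hΘ' : ∀ α β, ∑ i, Θmag' i α * Θel' i β = ∑ i, Θmag' i β * Θel' i α)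
    (hI : Intertwines X Y I I') (hR : Intertwines X Y R R')
    (hmag : Θmag * Z = X * Θmag') (hmag' : Y * Θmag = Θmag' * Z')
    (hel : Θmagᵀ * Θel * Z = Z'ᵀ * (Θmag'ᵀ * Θel')) :
    IsCovariant (embLagrangian g I R Θel Θmag : ghPart U (EmbField n a) P 0)
      (embLagrangian g I' R' Θel' Θmag' : ghPart U (EmbField k l) P' 0)
      (embChange X Y Z) (embChange Y X Z') := by
  have hB (d : Matrix P P' DiffOp) (c : Matrix P' P DiffOp) (α : a) (p : Pair) :
      (change U (embChange X Y Z) (embChange Y X Z') d c).hom (tensorForm U P n a α p)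
        = ∑ β, Z α β • tensorForm U P' k l β p := by
    rw [tensorForm, change_field, sum_embChange_twoForm]; rfl
  have hD (d : Matrix P P' DiffOp) (c : Matrix P' P DiffOp) (v) (p : Pair) :=
    map_extD (f := (change U (embChange X Y Z) (embChange Y X Z') d c).hom.toLinearMap)
      (GenMap.hom_total _) v p
  simp only [AlgHom.toLinearMap_apply] at hD
  have hF (d : Matrix P P' DiffOp) (c : Matrix P' P DiffOp) (i : n) (p : Pair) :
      (change U (embChange X Y Z) (embChange Y X Z') d c).hom (magF U P a i p)
        = ∑ j, Y j i • magF U P' l j p := by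
    rw [magF, hD]
    simp only [change_field, sum_embChange_magnetic, extD_sum, extD_smul]
    rfl
  have hH (d : Matrix P P' DiffOp) (c : Matrix P' P DiffOp) (i : n) (p : Pair) :
      (change U (embChange X Y Z) (embChange Y X Z') d c).hom (embH U P Θmag i p)
        = ∑ j, X i j • embH U P' Θmag' j p := by
    simp only [embH, map_add, map_smul, map_sum, hD, hB, change_field, sum_embChange_electric, extD_sum,
      extD_smul, sum_smul_sum, hmag, smul_add, Finset.sum_add_distrib]
    simp only [smul_comm (X _ _) (1 / 2 : ℝ), ← Finset.smul_sum, sum_smul_sum]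
  have hG (d : Matrix P P' DiffOp) (c : Matrix P' P DiffOp) (i : n) (p : Pair) :
      (change U (embChange X Y Z) (embChange Y X Z') d c).hom
          (dualField (coeffMatrix I) (coeffMatrix R) (embH U P Θmag) i p)
        = ∑ j, Y j i • dualField (coeffMatrix I') (coeffMatrix R') (embH U P' Θmag') j p := by
    rw [map_dualField (GenMap.hom_coeff _)]
    simp only [hH]
    exact dualField_linear_change hI.coeffMatrix hR.coeffMatrix _ _ _
  have hC (d : Matrix P P' DiffOp) (c : Matrix P' P DiffOp) (v) (μ) :
      (change U (embChange X Y Z) (embChange Y X Z') d c).hom (codiv (wedgeDual v) μ)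
        = codiv (wedgeDual fun p => (change U (embChange X Y Z) (embChange Y X Z') d c).hom (v p)) μ := by
    refine (map_codiv (f := (change U (embChange X Y Z) (embChange Y X Z') d c).hom.toLinearMap)
      (GenMap.hom_total _) _ μ).trans (codiv_congr (fun p => ?_) μ)
    exact map_wedgeDual (change U (embChange X Y Z) (embChange Y X Z') d c).hom.toLinearMap v p
  have hW (d : Matrix P P' DiffOp) (c : Matrix P' P DiffOp) (v) (p : Pair) :=
    map_wedgeDual (change U (embChange X Y Z) (embChange Y X Z') d c).hom.toLinearMap v p
  simp only [AlgHom.toLinearMap_apply] at hW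
  refine ⟨embChange_mul hX hZ, fun d c i => ?_, fun d c z => ?_⟩
  · rw [eulerLagrange_emb_scalar, eulerLagrange_emb_scalar, map_add,
      map_scalarEL (GenMap.hom_coeff _) (GenMap.hom_total _)
        (fun i => by rw [GenMap.hom_jet_zero]; rfl), map_kinQuad (GenMap.hom_coeff _)]
    simp only [hH]
    rw [kinQuad_linear_change hY (hI.coeffMatrix.dphiMatrix i) (hR.coeffMatrix.dphiMatrix i)]
  · rw [opVec_opConst, embChange_transpose]
    rcases z with ⟨i, μ⟩ | ⟨i, μ⟩ | ⟨α, p⟩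
    · rw [sum_embChange_electric, eulerLagrange_emb_electric sI sR, hC]
      simp only [hG, codiv_wedgeDual_sum, codiv_wedgeDual_smul, eulerLagrange_emb_electric sI' sR',
        Matrix.transpose_apply]
    · rw [sum_embChange_magnetic, eulerLagrange_emb_magnetic, map_smul, map_sum]
      simp only [map_smul, hC, hB, codiv_wedgeDual_sum, codiv_wedgeDual_smul,
        eulerLagrange_emb_magnetic, Matrix.transpose_apply, sum_smul_sum, hmag]
      simp only [smul_comm (X _ _) (-(1 / 2 : ℝ)), ← Finset.smul_sum, sum_smul_sum]
    · rw [sum_embChange_twoForm, eulerLagrange_emb_twoForm sI sR hΘ, map_smul, map_sum]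
      simp only [eulerLagrange_emb_twoForm sI' sR' hΘ', map_smul, map_sub, hW, hG, hF, map_sum, hB,
        sum_smul_sum]
      have hw (x : n) : wedgeDual (fun p => ∑ j, Y j x • magF U P' l j p
          - (1 / 2 : ℝ) • ∑ z, (Θel * Z) x z • tensorForm U P' k l z p) p
            = ∑ j, Y j x • wedgeDual (magF U P' l j) p
              - (1 / 2 : ℝ) • ∑ z, (Θel * Z) x z • wedgeDual (tensorForm U P' k l z) p := by
        rw [wedgeDual_sub, wedgeDual_sum_smul, wedgeDual_smul, wedgeDual_sum_smul]
      have hw' (i : k) : wedgeDual (fun q => magF U P' l i q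
          - (1 / 2 : ℝ) • ∑ β, Θel' i β • tensorForm U P' k l β q) p
            = wedgeDual (magF U P' l i) p
              - (1 / 2 : ℝ) • ∑ z, Θel' i z • wedgeDual (tensorForm U P' k l z) p := by
        rw [wedgeDual_sub, wedgeDual_smul, wedgeDual_sum_smul]
      simp only [hw, hw', wedgeDual_sum_smul]
      simp only [smul_comm (Z'ᵀ _ _) (1 / 2 : ℝ), ← Finset.smul_sum]
      congr 1
      have e1 := (sum_smul_sum Z'ᵀ Θmag'ᵀ (fun i => wedgeDual (dualField (coeffMatrix I')
        (coeffMatrix R') (embH U P' Θmag') i) p - (wedgeDual (magF U P' l i) p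
          - (1 / 2 : ℝ) • ∑ z, Θel' i z • wedgeDual (tensorForm U P' k l z) p)) α)
      have e2 (v : k → LocalFn U (EmbField k l) P') := sum_smul_sum Θmagᵀ Yᵀ v α
      have e3 := sum_smul_sum Θmagᵀ (Θel * Z) (fun z => wedgeDual (tensorForm U P' k l z) p) α
      have e4 := sum_smul_sum (Z'ᵀ * Θmag'ᵀ) Θel' (fun z => wedgeDual (tensorForm U P' k l z) p) α
      rw [← Matrix.mul_assoc, hel, ← Matrix.mul_assoc] at e3
      simp only [← Matrix.transpose_mul, hmag'] at e2
      simp only [Matrix.transpose_mul] at e2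
      refine Eq.trans ?_ e1.symm
      simp only [sub_sub_eq_add_sub, add_sub_right_comm _ _ (wedgeDual (magF _ _ _ _) _), smul_add,
        Finset.sum_add_distrib, smul_comm _ (1 / 2 : ℝ), ← Finset.smul_sum, e4, ← e2, ← e3,
        Matrix.transpose_apply, smul_sub, Finset.sum_sub_distrib]
      exact add_sub_right_comm _ _ _

end EmbChange

/-! ### The embedding tensor formalism in an adapted basis -/

section Congruence

variable {n k : Type} [Fintype n] [Fintype k] [DecidableEq n] [DecidableEq k] {𝒦 : Type} [CommRing 𝒦]
  [Algebra ℝ 𝒦] {X : Matrix n k ℝ} {Y : Matrix k n ℝ}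

theorem map_transpose_mul_apply (X : Matrix n k ℝ) (A : Matrix n n 𝒦) (i : k) (j : n) :
    ((X.map (algebraMap ℝ 𝒦) : Matrix n k 𝒦)ᵀ * A) i j = ∑ x, X x i • A x j := by
  simp [Matrix.mul_apply, Algebra.smul_def]

theorem mul_map_apply (X : Matrix n k ℝ) (A : Matrix n n 𝒦) (i : n) (j : k) :
    (A * (X.map (algebraMap ℝ 𝒦) : Matrix n k 𝒦)) i j = ∑ x, X x j • A i x := by
  simp [Matrix.mul_apply, Algebra.smul_def, mul_comm]

theorem map_mul_map_eq_one (h : X * Y = 1) :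
    (X.map (algebraMap ℝ 𝒦) : Matrix n k 𝒦) * (Y.map (algebraMap ℝ 𝒦) : Matrix k n 𝒦) = 1 := by
  rw [← Matrix.map_mul, h, Matrix.map_one _ (map_zero _) (map_one _)]

theorem intertwines_congruence (h : X * Y = 1) (A : Matrix n n 𝒦) :
    Intertwines X Y A (congruence X A) := fun i x => by
  rw [← map_transpose_mul_apply, ← mul_map_apply, congruence]
  simp only [← Matrix.mul_assoc]
  rw [← Matrix.transpose_mul, map_mul_map_eq_one h, Matrix.transpose_one, Matrix.one_mul]

theorem congruence_intertwines (h : X * Y = 1) (A : Matrix n n 𝒦) :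
    Intertwines Y X (congruence X A) A := fun i x => by
  rw [← map_transpose_mul_apply, ← mul_map_apply, congruence]
  simp only [Matrix.mul_assoc]
  rw [map_mul_map_eq_one h, Matrix.mul_one]

end Congruence

namespace AdaptedBasis

variable {n a : Type} [Fintype n] [Fintype a] [DecidableEq n] [DecidableEq a] {Θel Θmag : Matrix n a ℝ}
  (b : AdaptedBasis Θmag)

/-- The extension of `θ` by the identity. -/
def extθ : Matrix (Fin b.r ⊕ Fin b.m) (Fin b.r ⊕ Fin b.m) ℝ := Matrix.fromBlocks b.θ 0 0 1

/-- The extension of `θ⁻¹` by the identity. -/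
def extθInv : Matrix (Fin b.r ⊕ Fin b.m) (Fin b.r ⊕ Fin b.m) ℝ := Matrix.fromBlocks b.θ⁻¹ 0 0 1

theorem extθ_mul_inv : b.extθ * b.extθInv = 1 := by
  simp [extθ, extθInv, Matrix.fromBlocks_multiply, Matrix.mul_nonsing_inv _ b.isUnit_θ]

theorem extθ_inv_mul : b.extθInv * b.extθ = 1 := by
  simp [extθ, extθInv, Matrix.fromBlocks_multiply, Matrix.nonsing_inv_mul _ b.isUnit_θ]

/-- The change of basis of the two-forms that normalizes the magnetic components. -/
def tensorBasis : Matrix a (Fin b.r ⊕ Fin b.m) ℝ := b.Z * b.extθInv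

/-- The inverse of `tensorBasis`. -/
def tensorBasisInv : Matrix (Fin b.r ⊕ Fin b.m) a ℝ := b.extθ * b.Zinv

theorem tensorBasis_mul_inv : b.tensorBasis * b.tensorBasisInv = 1 := by
  rw [tensorBasis, tensorBasisInv, Matrix.mul_assoc, ← Matrix.mul_assoc _ _ b.Zinv, b.extθ_inv_mul,
    Matrix.one_mul, b.Z_mul_Zinv]

theorem tensorBasis_inv_mul : b.tensorBasisInv * b.tensorBasis = 1 := by
  rw [tensorBasis, tensorBasisInv, Matrix.mul_assoc, ← Matrix.mul_assoc b.Zinv, b.Zinv_mul_Z,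
    Matrix.one_mul, b.extθ_mul_inv]

theorem mag_eq : b.Y * Θmag = adaptedMag (Fin b.r) (Fin b.u) (Fin b.m) * b.tensorBasisInv := by
  have h : adaptedMag (Fin b.r) (Fin b.u) (Fin b.m) * b.extθ = b.Y * Θmag * b.Z := by
    rw [b.magnetic]
    simp [adaptedMag, extθ, Matrix.fromBlocks_multiply]
  rw [tensorBasisInv, ← Matrix.mul_assoc, h, Matrix.mul_assoc, b.Z_mul_Zinv, Matrix.mul_one]

theorem mag_mul_tensorBasis :
    Θmag * b.tensorBasis = b.Yinv * adaptedMag (Fin b.r) (Fin b.u) (Fin b.m) := by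
  have h := congrArg (fun M => b.Yinv * M * b.tensorBasis) b.mag_eq
  simpa only [← Matrix.mul_assoc, b.Yinv_mul_Y, Matrix.one_mul, Matrix.mul_assoc _ b.tensorBasisInv,
    b.tensorBasis_inv_mul, Matrix.mul_one] using h

/-- Contraction with Θmag sees only the hatted rows of Θel. Of these, locality kills the right
block, and the left block times θ⁻¹ is N. This justifies the zero blocks of `adaptedEl`. -/
theorem mag_transpose_mul_el (hΘ : Θmagᵀ * Θel = Θelᵀ * Θmag) :
    Θmagᵀ * Θel * b.tensorBasis = b.tensorBasisInvᵀ *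
      ((adaptedMag (Fin b.r) (Fin b.u) (Fin b.m))ᵀ * adaptedEl (Fin b.u) (Fin b.m) (b.shift Θel)) := by
  have h1 : Θmagᵀ = b.tensorBasisInvᵀ * (adaptedMag (Fin b.r) (Fin b.u) (Fin b.m))ᵀ * b.Yinvᵀ := by
    rw [← Matrix.transpose_mul, ← b.mag_eq, ← Matrix.transpose_mul, ← Matrix.mul_assoc, b.Yinv_mul_Y,
      Matrix.one_mul]
  have h2 : (adaptedMag (Fin b.r) (Fin b.u) (Fin b.m))ᵀ * (b.Yinvᵀ * Θel * b.Z)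
      * b.extθInv
      = (adaptedMag (Fin b.r) (Fin b.u) (Fin b.m))ᵀ * adaptedEl (Fin b.u) (Fin b.m) (b.shift Θel) := by
    rw [← Matrix.fromBlocks_toBlocks (b.Yinvᵀ * Θel * b.Z), (b.locality hΘ).2, adaptedMag, adaptedEl]
    simp only [extθInv, Matrix.fromBlocks_transpose, Matrix.fromBlocks_multiply]
    simp [shift, θt]
  rw [← h2, tensorBasis, h1]
  simp only [Matrix.mul_assoc]

theorem el_mul_tensorBasisInv (hΘ : Θmagᵀ * Θel = Θelᵀ * Θmag) :
    (adaptedMag (Fin b.r) (Fin b.u) (Fin b.m))ᵀ * adaptedEl (Fin b.u) (Fin b.m) (b.shift Θel)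
      * b.tensorBasisInv = b.tensorBasisᵀ * (Θmagᵀ * Θel) := by
  have h := congrArg (fun M => b.tensorBasisᵀ * M * b.tensorBasisInv) (b.mag_transpose_mul_el hΘ)
  have e : b.tensorBasisᵀ * b.tensorBasisInvᵀ = 1 := by
    rw [← Matrix.transpose_mul, b.tensorBasis_inv_mul, Matrix.transpose_one]
  simp only [← Matrix.mul_assoc, e, Matrix.one_mul] at h
  simp only [Matrix.mul_assoc, b.tensorBasis_mul_inv, Matrix.mul_one] at h
  simpa only [Matrix.mul_assoc] using h.symm

variable {σ : Type} [Fintype σ] {U : Opens (σ → ℝ)} {P P' : Type} [Fintype P] [Fintype P']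
  {g : Matrix σ σ (SmoothFn U)} {I R : Matrix n n (SmoothFn U)}

theorem locality_sum_iff : (∀ α β, ∑ i, Θmag i α * Θel i β = ∑ i, Θmag i β * Θel i α) ↔
    Θmagᵀ * Θel = Θelᵀ * Θmag := by
  rw [← Matrix.ext_iff]
  simp only [Matrix.mul_apply, Matrix.transpose_apply, mul_comm (Θel _ _)]

theorem isCovariant (sI : I.IsSymm) (sR : R.IsSymm) (hΘ : Θmagᵀ * Θel = Θelᵀ * Θmag) :
    IsCovariant (embLagrangian g I R Θel Θmag : ghPart U (EmbField n a) P 0)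
      (adaptedLagrangian P' (Fin b.m) g (congruence b.Yinv I) (congruence b.Yinv R) (b.shift Θel))
      (embChange b.Yinv b.Y b.tensorBasis) (embChange b.Y b.Yinv b.tensorBasisInv) :=
  isCovariant_emb b.Yinv_mul_Y b.Y_mul_Yinv b.tensorBasis_mul_inv sI sR (isSymm_congruence _ sI)
    (isSymm_congruence _ sR) (locality_sum_iff.2 hΘ) (adapted_locality (b.isSymm_shift hΘ))
    (intertwines_congruence b.Yinv_mul_Y I) (intertwines_congruence b.Yinv_mul_Y R)
    b.mag_mul_tensorBasis b.mag_eq (b.mag_transpose_mul_el hΘ)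

theorem isCovariant_symm (sI : I.IsSymm) (sR : R.IsSymm) (hΘ : Θmagᵀ * Θel = Θelᵀ * Θmag) :
    IsCovariant
      (adaptedLagrangian P' (Fin b.m) g (congruence b.Yinv I) (congruence b.Yinv R) (b.shift Θel))
      (embLagrangian g I R Θel Θmag : ghPart U (EmbField n a) P 0)
      (embChange b.Y b.Yinv b.tensorBasisInv) (embChange b.Yinv b.Y b.tensorBasis) :=
  isCovariant_emb b.Y_mul_Yinv b.Yinv_mul_Y b.tensorBasis_inv_mul (isSymm_congruence _ sI)
    (isSymm_congruence _ sR) sI sR (adapted_locality (b.isSymm_shift hΘ)) (locality_sum_iff.2 hΘ)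
    (congruence_intertwines b.Yinv_mul_Y I) (congruence_intertwines b.Yinv_mul_Y R)
    b.mag_eq.symm b.mag_mul_tensorBasis.symm (b.el_mul_tensorBasisInv hΘ)

theorem coeff_dualFrame (hΘ : Θmagᵀ * Θel = Θelᵀ * Θmag) (hI : ∀ φ : U, (matrixAt I φ).PosDef)
    (hR : R.IsSymm) {I' R' : Matrix b.Idx b.Idx (SmoothFn U)}
    (hI' : ∀ φ : U, (matrixAt I' φ).PosDef) (hR' : R'.IsSymm)
    (hM : ∀ φ : U, kineticMatrix (matrixAt I' φ) (matrixAt R' φ)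
      = (b.E Θel)ᵀ * kineticMatrix (matrixAt I φ) (matrixAt R φ) * b.E Θel) :
    DualFrame ((b.shift Θel).map (algebraMap ℝ (Coeff U))) (coeffMatrix (congruence b.Yinv I))
      (coeffMatrix (congruence b.Yinv R)) (coeffMatrix I') (coeffMatrix R') := by
  have h := (b.dualFrame hΘ hI hR hI' hR' hM).map (Coeff.ofScalarHom : SmoothFn U →ₐ[ℝ] Coeff U).toRingHom
  have e : ((b.shift Θel).map (algebraMap ℝ (SmoothFn U))).map
      (Coeff.ofScalarHom : SmoothFn U →ₐ[ℝ] Coeff U).toRingHom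
        = (b.shift Θel).map (algebraMap ℝ (Coeff U)) := by
    ext1 i j
    exact Coeff.ofScalarHom.commutes _
  rw [e] at h
  exact h

end AdaptedBasis

theorem isSymm_of_posDef {σ n : Type} [Fintype σ] [Fintype n] {U : Opens (σ → ℝ)}
    {A : Matrix n n (SmoothFn U)} (h : ∀ φ : U, (matrixAt A φ).PosDef) : A.IsSymm :=
  SmoothFn.matrix_ext fun φ => by
    rw [Matrix.transpose_map]; exact posDef_isSymm (h φ)

/-! ### The reduction to the frame determined by the embedding tensor -/

namespace AdaptedBasis

variable {n a : Type} [Fintype n] [Fintype a] [DecidableEq n] [DecidableEq a] {Θel Θmag : Matrix n a ℝ}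
  (b : AdaptedBasis Θmag)

/-- The potentials `A'` in terms of the electric potentials of the new frame. -/
def electricBlock : Matrix b.Idx b.Idx ℝ := Matrix.fromBlocks 0 0 0 1

/-- The potentials `Ã'` in terms of the electric potentials of the new frame. -/
def magneticBlock : Matrix b.Idx b.Idx ℝ := Matrix.fromBlocks 1 0 0 0

theorem E_inl_inl (i : n) (j : b.Idx) : b.E Θel (.inl i) (.inl j) = (b.Yinv * b.electricBlock) i j := by
  simp only [E, E₁, E₂, Matrix.fromBlocks_multiply, Matrix.fromBlocks_apply₁₁, electricBlock,
    Matrix.zero_mul, add_zero]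

theorem E_inr_inl (i : n) (j : b.Idx) : b.E Θel (.inr i) (.inl j) = (b.Yᵀ * b.magneticBlock) i j := by
  simp only [E, E₁, E₂, Matrix.fromBlocks_multiply, Matrix.fromBlocks_apply₂₁, magneticBlock,
    Matrix.zero_mul, zero_add]

variable {σ : Type} [Fintype σ] {U : Opens (σ → ℝ)} {I' R' : Matrix b.Idx b.Idx (SmoothFn U)}
  {N : Matrix (Fin b.r) (Fin b.r) ℝ}

theorem reduction_electric (i : b.Idx) (μ : Fin 4) :
    (reduction (Fin b.m) I' R' N).hom (jet (.field (.electric i μ)) 0)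
      = ∑ j, b.electricBlock i j • jet (.field (j, μ)) 0 := by
  rw [GenMap.hom_jet_zero, Fintype.sum_sum_type]
  rcases i with i | i <;>
    simp [reduction_toFun, reductionFun, electricBlock, Matrix.one_apply]

theorem reduction_magnetic (i : b.Idx) (μ : Fin 4) :
    (reduction (Fin b.m) I' R' N).hom (jet (.field (.magnetic i μ)) 0)
      = ∑ j, b.magneticBlock i j • jet (.field (j, μ)) 0 := by
  rw [GenMap.hom_jet_zero, Fintype.sum_sum_type]
  rcases i with i | i <;>
    simp [reduction_toFun, reductionFun, magneticBlock, Matrix.one_apply]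

variable {g : Matrix σ σ (SmoothFn U)} {I R : Matrix n n (SmoothFn U)}

/-- The adapted generators are transported along the linear change of fields. A point of U is needed
because completeness is tested on a constant scalar configuration. -/
theorem exists_isIrreducibleGeneratingSet (hU : (U : Set (σ → ℝ)).Nonempty)
    (hI : ∀ φ : U, (matrixAt I φ).PosDef) (hR : R.IsSymm) (hΘ : Θmagᵀ * Θel = Θelᵀ * Θmag) :
    ∃ (p : ℕ) (𝓡 : EmbField n a → Fin p → DiffOp),
      IsIrreducibleGeneratingSet (embLagrangian g I R Θel Θmag).1 𝓡 := by
  obtain ⟨b⟩ := AdaptedBasis.nonempty Θmag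
  obtain ⟨I', R', hI', hR', hM⟩ :=
    exists_frame_matrices hI hR (b.E_symplectic hΘ).2 (b.E_symplectic hΘ).1
  obtain ⟨φ, hφ⟩ := hU
  have sI := isSymm_of_posDef hI
  have h := isIrreducibleGeneratingSet_adapted (g := g) (u := Fin b.u) (m := Fin b.m)
    (b.coeff_dualFrame hΘ hI hR hI' hR' hM) (isSymm_congruence _ sI) (isSymm_congruence _ hR)
    (b.isSymm_shift hΘ) ⟨φ, hφ⟩ (hI' _)
  exact ⟨_, _, h.of_isCovariant (b.isCovariant sI hR hΘ) (b.isCovariant_symm sI hR hΘ)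
    (Fintype.equivFin (AdaptedParam (Fin b.r) (Fin b.u) (Fin b.m)))⟩

/-- Composes the linear isomorphism to the adapted basis with the elimination of the two-forms. The
image of the potentials is the electric half of E₁E₂. -/
theorem exists_localMap (hU : (U : Set (σ → ℝ)).Nonempty)
    (hI : ∀ φ : U, (matrixAt I φ).PosDef) (hR : R.IsSymm) (hΘ : Θmagᵀ * Θel = Θelᵀ * Θmag)
    (hI' : ∀ φ : U, (matrixAt I' φ).PosDef) (hR' : R'.IsSymm)
    (hM : ∀ φ : U, kineticMatrix (matrixAt I' φ) (matrixAt R' φ)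
      = (b.E Θel)ᵀ * kineticMatrix (matrixAt I φ) (matrixAt R φ) * b.E Θel)
    {P : Type} [Fintype P] {𝓡 : EmbField n a → P → DiffOp}
    (h𝓡 : IsIrreducibleGeneratingSet (embLagrangian g I R Θel Θmag).1 𝓡) :
    (∀ x, brst (embLagrangian g I R Θel Θmag) 𝓡 (brst (embLagrangian g I R Θel Θmag) 𝓡 x) = 0) ∧
    ∃ π : LocalMap (embLagrangian g I R Θel Θmag) 𝓡 (vectorLagrangian g I' R') vectorGenerators,
      (∀ i μ, π.toAlgHom (jet (.field (.electric i μ)) 0)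
        = ∑ j, b.E Θel (.inl i) (.inl j) • jet (.field (j, μ)) 0) ∧
      (∀ i μ, π.toAlgHom (jet (.field (.magnetic i μ)) 0)
        = ∑ j, b.E Θel (.inr i) (.inl j) • jet (.field (j, μ)) 0) ∧
      ∀ k : ℤ, Function.Bijective (π.onCohomology k) := by
  have sI := isSymm_of_posDef hI
  have sI₁ := isSymm_congruence b.Yinv sI
  have sR₁ := isSymm_congruence b.Yinv hR
  have hN := b.isSymm_shift hΘ
  have hF := b.coeff_dualFrame hΘ hI hR hI' hR' hM
  obtain ⟨φ, hφ⟩ := hU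
  have h𝓡' := isIrreducibleGeneratingSet_adapted (g := g) (u := Fin b.u) (m := Fin b.m) hF sI₁ sR₁ hN
    ⟨φ, hφ⟩ (hI' _)
  obtain ⟨hs, π, hπ, hb⟩ := exists_localMap_of_isCovariant (b.isCovariant sI hR hΘ)
    (b.isCovariant_symm sI hR hΘ) h𝓡 h𝓡' (brst_brst_adapted sI₁ sR₁ hN)
  let ρ := (reduction (Fin b.m) I' R' (b.shift Θel)).localMap
    (L := adaptedLagrangian (AdaptedParam (Fin b.r) (Fin b.u) (Fin b.m)) (Fin b.m) g
      (congruence b.Yinv I) (congruence b.Yinv R) (b.shift Θel))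
    (reduction_brst hF sI₁ sR₁ hN (isSymm_of_posDef hI') hR')
  have hρ (x) : ρ.toAlgHom x = (reduction (Fin b.m) I' R' (b.shift Θel)).hom x := rfl
  have hc (x) : (ρ.comp π).toAlgHom x = ρ.toAlgHom (π.toAlgHom x) := rfl
  refine ⟨hs, ρ.comp π, fun i μ => ?_, fun i μ => ?_, fun k => ?_⟩
  · rw [hc, hπ, sum_embChange_electric]
    simp only [map_sum, map_smul, hρ, reduction_electric, E_inl_inl, sum_smul_sum]
  · rw [hc, hπ, sum_embChange_magnetic]
    simp only [map_sum, map_smul, hρ, reduction_magnetic, E_inr_inl]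
    exact sum_smul_sum b.Yᵀ b.magneticBlock _ _
  · rw [LocalMap.comp_onCohomology]
    exact (reduction_bijective hF sI₁ sR₁ hN (isSymm_of_posDef hI') hR' k).comp (hb k)

end AdaptedBasis

end

end LocalBRST

/-! ### The main theorem -/

theorem mainTheorem1 {ns nv dG : ℕ} (U : TopologicalSpace.Opens (Fin ns → ℝ))
    (hU : (U : Set (Fin ns → ℝ)).Nonempty)
    (g : Matrix (Fin ns) (Fin ns) (LocalBRST.SmoothFn U))
    (I R : Matrix (Fin nv) (Fin nv) (LocalBRST.SmoothFn U))
    (hI : ∀ φ : U, (LocalBRST.matrixAt I φ).PosDef) (hR : R.IsSymm)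
    (Θel Θmag : Matrix (Fin nv) (Fin dG) ℝ)
    (hΘ : ∀ α β, ∑ i, Θmag i α * Θel i β = ∑ i, Θmag i β * Θel i α) :
    Nonempty (LocalBRST.AdaptedBasis Θmag) ∧
    (∃ (p : ℕ) (𝓡 : LocalBRST.EmbField (Fin nv) (Fin dG) → Fin p → LocalBRST.DiffOp),
      LocalBRST.IsIrreducibleGeneratingSet (LocalBRST.embLagrangian g I R Θel Θmag).1 𝓡) ∧
    ∀ b : LocalBRST.AdaptedBasis Θmag,
      (b.E Θel)ᵀ * LocalBRST.symplecticForm (Fin nv) * b.E Θel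
        = LocalBRST.symplecticForm b.Idx ∧
      ∃ I' R' : Matrix b.Idx b.Idx (LocalBRST.SmoothFn U),
        (∀ φ : U, (LocalBRST.matrixAt I' φ).PosDef) ∧ R'.IsSymm ∧
        (∀ φ : U, LocalBRST.kineticMatrix (LocalBRST.matrixAt I' φ) (LocalBRST.matrixAt R' φ)
          = (b.E Θel)ᵀ *
            LocalBRST.kineticMatrix (LocalBRST.matrixAt I φ) (LocalBRST.matrixAt R φ) *
            b.E Θel) ∧
        ∀ (p : ℕ) (𝓡 : LocalBRST.EmbField (Fin nv) (Fin dG) → Fin p → LocalBRST.DiffOp),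
          LocalBRST.IsIrreducibleGeneratingSet (LocalBRST.embLagrangian g I R Θel Θmag).1 𝓡 →
          (∀ x, LocalBRST.brst (LocalBRST.embLagrangian g I R Θel Θmag) 𝓡
            (LocalBRST.brst (LocalBRST.embLagrangian g I R Θel Θmag) 𝓡 x) = 0) ∧
          (∀ x, LocalBRST.brst (LocalBRST.vectorLagrangian g I' R') LocalBRST.vectorGenerators
            (LocalBRST.brst (LocalBRST.vectorLagrangian g I' R') LocalBRST.vectorGenerators x)
              = 0) ∧
          ∃ π : LocalBRST.LocalMap (LocalBRST.embLagrangian g I R Θel Θmag) 𝓡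
              (LocalBRST.vectorLagrangian g I' R') LocalBRST.vectorGenerators,
            (∀ i μ, π.toAlgHom (LocalBRST.jet (.field (.electric i μ)) 0)
              = ∑ j, b.E Θel (.inl i) (.inl j) • LocalBRST.jet (.field (j, μ)) 0) ∧
            (∀ i μ, π.toAlgHom (LocalBRST.jet (.field (.magnetic i μ)) 0)
              = ∑ j, b.E Θel (.inr i) (.inl j) • LocalBRST.jet (.field (j, μ)) 0) ∧
            ∀ k : ℤ, Function.Bijective (π.onCohomology k) := by
  have hΘ' := LocalBRST.AdaptedBasis.locality_sum_iff.1 hΘ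
  refine ⟨LocalBRST.AdaptedBasis.nonempty Θmag,
    LocalBRST.AdaptedBasis.exists_isIrreducibleGeneratingSet hU hI hR hΘ', fun b => ?_⟩
  obtain ⟨hE, hE'⟩ := b.E_symplectic hΘ'
  obtain ⟨I', R', hI', hR', hM⟩ := LocalBRST.exists_frame_matrices hI hR hE' hE
  refine ⟨hE, I', R', hI', hR', hM, fun p 𝓡 h𝓡 => ?_⟩
  obtain ⟨hs, hπ⟩ := b.exists_localMap hU hI hR hΘ' hI' hR' hM h𝓡
  exact ⟨hs, LocalBRST.brst_brst_vector (LocalBRST.isSymm_of_posDef hI') hR', hπ⟩
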